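/- **Proposition.** Let $\mathbb K\in\{\mathbb R,\mathbb C\}$. Let $M$ be a smooth, Hausdorff, second countable, orientable $d$-manifold with a Lorentzian metric $g$ of signature $(+,-,\dots,-)$, time-oriented and globally hyperbolic. Let $E\to M$ be a real smooth vector bundle of finite rank with a smooth nondegenerate bilinear fibre pairing $\langle\cdot,\cdot\rangle$, which identifies $E$ with $E^*$. Let $P$ be a Green-hyperbolic operator on $\Gamma(M,E)$, i.e. a linear differential operator with unique retarded and advanced Green operators, and suppose that the equation $P\phi=0$ is variational: $\int_M\langle f,Ph\rangle\,\mathrm{dvol}_g=\int_M\langle h,Pf\rangle\,\mathrm{dvol}_g$ for all $f,h\in\Gamma_c(M,E)$ (formal self-adjointness if the pairing is symmetric). Write $\mathcal D(U)=\Gamma_c(U,E)$. *Conventions.* Factorization algebras take values in cochain complexes of convenient vector spaces (Hausdorff, Mackey complete locally convex spaces over $\mathbb K$, with bounded linear maps as morphisms and bounded multilinear maps as maps out of tensor products); that is, they are prefactorization algebras $\mathcal F$ such that for every Weiss cover $\{U_i\}$ of an open $U$, $\mathcal F(U)$ is the coequalizer of $\coprod_{i,j}\mathcal F(U_i\cap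 U_j)\rightrightarrows\coprod_i\mathcal F(U_i)$. A $P_0$ algebra is a unital commutative dg algebra with a degree $1$ Poisson bracket, normalised by $\{a,b\}=(-1)^{|a||b|}\{b,a\}$, for which $d$ is a derivation. A BD algebra over $\mathbb K[[\hbar]]$ has instead $d(ab)=(da)b+(-1)^{|a|}a\,db+\hbar\{a,b\}$; here complexes are degreewise of the form $V[[\hbar]]$, with $\hbar$-linear maps. A $P_0$ (BD) algebra in factorization algebras is one in which all structure maps are maps of $P_0$ (BD) algebras. 1. There is a $P_0$ algebra $\mathcal P$ in factorization algebras on $M$ such that, for each open $U\subset M$, the graded commutative algebra $\mathcal P(U)$ has $$\mathcal P^{-k}(U)=\bigoplus_{n\ge0}\Big(\Gamma_c(U^n\times U^k,E^{\boxtimes(n+k)})\otimes_{\mathbb R}\mathbb K\Big)_{S_n\times S_k}\quad(k\ge0),\qquad \mathcal P^{j}(U)=0\quad(j>0),$$ where $S_k$ acts through the sign and the topology is the usual locally convex (inductive limit) one. The product is induced by the exterior product of sections and the maps for $U\subset V$ by extension by zero. $\mathcal P(U)$ is generated topologically, as a unital algebra, by the cochain complex $\mathcal D(U)[1]\xrightarrow{P}\mathcal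 D(U)$: no proper closed unital subalgebra contains all linear generators, and $d f_{-1}=(Pf)_0$ for $f\in\mathcal D(U)$. On generators the bracket is $$\{f_{-1},h_0\}=\int_U\langle f,h\rangle\,\mathrm{dvol}_g,\qquad \{f_{-1},h_{-1}\}=0=\{f_0,h_0\},$$ with subscripts denoting the degree. 2. For each $U$ there is exactly one bounded degree $1$ linear map $\triangle$ on $\mathcal P(U)$ (the BV Laplacian) with $\triangle(ab)=\triangle(a)b+(-1)^{|a|}a\triangle(b)+\{a,b\}$ that vanishes on constants and on the linear generators. There is a BD algebra $\mathcal A$ in factorization algebras on $M$ with $\mathcal A(U)=\mathcal P(U)[[\hbar]]$ degreewise, whose product, unit, bracket and structure maps are the $\hbar$-linear extensions of those of $\mathcal P$ and whose differential is $d_{\mathcal P}+\hbar\triangle$. -/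

import Mathlib

open Set Filter Topology MeasureTheory Bundle TopologicalSpace
open scoped Manifold ContDiff BigOperators DirectSum Bundle

universe uK uM uF uE

noncomputable section

/-! ## Convenient vector spaces -/

section Convenient

/-- A Mackey-Cauchy sequence: `x m - x n ∈ μ (m, n) • B` with `B` bounded and `μ → 0`. -/
def IsMackeyCauchy (𝕜 : Type*) [RCLike 𝕜] {A : Type*} [AddCommGroup A] [Module 𝕜 A]
    [TopologicalSpace A] (x : ℕ → A) : Prop :=
  ∃ B : Set A, Bornology.IsVonNBounded 𝕜 B ∧ ∃ μ : ℕ × ℕ → ℝ, Tendsto μ atTop (𝓝 0) ∧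
    ∀ m n, ∃ b ∈ B, x m - x n = ((μ (m, n) : ℝ) : 𝕜) • b

/-- Convenient vector spaces: Hausdorff locally convex spaces (topology given by seminorms)
which are Mackey complete. -/
structure IsConvenient (𝕜 : Type*) [RCLike 𝕜] (A : Type*) [AddCommGroup A] [Module 𝕜 A]
    [TopologicalSpace A] : Prop where
  locallyConvex : PolynormableSpace 𝕜 A
  hausdorff : T2Space A
  complete : ∀ x : ℕ → A, IsMackeyCauchy 𝕜 x → ∃ a, Tendsto x atTop (𝓝 a)

/-- Bounded linear maps, the morphisms of convenient vector spaces. -/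
def IsBddLinear {𝕜 : Type*} [RCLike 𝕜] {A B : Type*} [AddCommGroup A] [Module 𝕜 A]
    [TopologicalSpace A] [AddCommGroup B] [Module 𝕜 B] [TopologicalSpace B]
    (f : A →ₗ[𝕜] B) : Prop :=
  ∀ S : Set A, Bornology.IsVonNBounded 𝕜 S → Bornology.IsVonNBounded 𝕜 (f '' S)

/-- Bounded bilinear maps, the morphisms out of a tensor product of two convenient spaces. -/
def IsBddBilinear {𝕜 : Type*} [RCLike 𝕜] {A B : Type*} [AddCommGroup A] [Module 𝕜 A]
    [TopologicalSpace A] [AddCommGroup B] [Module 𝕜 B] [TopologicalSpace B]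
    (f : A →ₗ[𝕜] A →ₗ[𝕜] B) : Prop :=
  ∀ S T : Set A, Bornology.IsVonNBounded 𝕜 S → Bornology.IsVonNBounded 𝕜 T →
    Bornology.IsVonNBounded 𝕜 (Set.image2 (fun a b => f a b) S T)

/-- Bounded multilinear maps, the morphisms out of a finite tensor product. -/
def IsBddMultilinear {𝕜 : Type*} [RCLike 𝕜] {ι : Type*} {A : ι → Type*} {B : Type*}
    [∀ i, AddCommGroup (A i)] [∀ i, Module 𝕜 (A i)] [∀ i, TopologicalSpace (A i)]
    [AddCommGroup B] [Module 𝕜 B] [TopologicalSpace B] (f : MultilinearMap 𝕜 A B) : Prop :=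
  ∀ S : ∀ i, Set (A i), (∀ i, Bornology.IsVonNBounded 𝕜 (S i)) →
    Bornology.IsVonNBounded 𝕜 (f '' Set.pi Set.univ S)

universe w

/-- A cochain complex of convenient vector spaces, presented by its total space `⨁ⱼ Aʲ` (with the
locally convex direct sum topology) and its homogeneous pieces, together with a degree-zero
cochain endomorphism `hbar` (multiplication by `ħ`). Two kinds of objects are used below:
`IsClassical` (no `ħ`) and `IsFormal` (free modules over `𝕜[[ħ]]`). -/
structure ConvComplex (𝕜 : Type*) [RCLike 𝕜] where
  carrier : Type w
  [addCommGroup : AddCommGroup carrier]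
  [module : Module 𝕜 carrier]
  [topology : TopologicalSpace carrier]
  convenient : IsConvenient 𝕜 carrier
  deg : ℤ → Submodule 𝕜 carrier
  internal : DirectSum.IsInternal deg
  directSum_topology : ∀ p : Seminorm 𝕜 carrier,
    (∀ j, Continuous fun x : deg j => p (x : carrier)) → Continuous p
  d : carrier →ₗ[𝕜] carrier
  d_bdd : IsBddLinear d
  d_deg : ∀ j, ∀ a ∈ deg j, d a ∈ deg (j + 1)
  d_d : ∀ a, d (d a) = 0
  hbar : carrier →ₗ[𝕜] carrier
  hbar_bdd : IsBddLinear hbar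
  hbar_deg : ∀ j, ∀ a ∈ deg j, hbar a ∈ deg j
  hbar_d : ∀ a, hbar (d a) = d (hbar a)

instance (𝕜 : Type*) [RCLike 𝕜] : CoeSort (ConvComplex.{w} 𝕜) (Type w) := ⟨ConvComplex.carrier⟩

attribute [instance] ConvComplex.addCommGroup ConvComplex.module ConvComplex.topology

/-- Complexes of convenient vector spaces without formal parameter. -/
def ConvComplex.IsClassical {𝕜 : Type*} [RCLike 𝕜] (Z : ConvComplex.{w} 𝕜) : Prop := Z.hbar = 0

/-- The shift `(w₀, w₁, …) ↦ (0, w₀, w₁, …)`, i.e. multiplication of `∑ ħⁿ wₙ` by `ħ`. -/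
def hshift {V : Type*} [Zero V] (x : ℕ → V) : ℕ → V
  | 0 => 0
  | n + 1 => x n

/-- Complexes of `𝕜[[ħ]]`-modules all of whose homogeneous pieces are of the form
`V[[ħ]] = ∏ₙ ħⁿ V` with the product topology. -/
def ConvComplex.IsFormal {𝕜 : Type*} [RCLike 𝕜] (Z : ConvComplex.{w} 𝕜) : Prop :=
  ∀ j, ∃ (V : Submodule 𝕜 (Z.deg j)) (Φ : (ℕ → V) ≃L[𝕜] Z.deg j),
    (∀ v : V, Φ (Pi.single 0 v) = v) ∧
    ∀ x : ℕ → V, Z.hbar (Φ x : Z) = (Φ (hshift x) : Z)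

/-- Morphisms of complexes: bounded, `ħ`-linear cochain maps. -/
structure IsCochainMap {𝕜 : Type*} [RCLike 𝕜] {A B : ConvComplex.{w} 𝕜} (f : A →ₗ[𝕜] B) :
    Prop where
  bdd : IsBddLinear f
  deg : ∀ j, ∀ a ∈ A.deg j, f a ∈ B.deg j
  d : ∀ a, f (A.d a) = B.d (f a)
  hbar : ∀ a, f (A.hbar a) = B.hbar (f a)

end Convenient

/-! ## Factorization algebras and Beilinson-Drinfeld algebras in them -/

section Factorization

universe u w

/-- `(-1)ⁿ`. -/
def sgn (n : ℤ) : ℤˣ := n.negOnePow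

/-- The Koszul sign of reordering homogeneous elements of degrees `k` along `σ`. -/
def koszulSign {ι κ : Type*} [LinearOrder ι] [LinearOrder κ] [Fintype κ] (σ : κ ≃ ι)
    (k : ι → ℤ) : ℤˣ :=
  ∏ p : κ × κ, if p.1 < p.2 ∧ σ p.2 < σ p.1 then sgn (k (σ p.1) * k (σ p.2)) else 1

/-- The Koszul sign of `(a₁ ⋯ aₙ)(b₁ ⋯ bₙ) ↦ (a₁b₁) ⋯ (aₙbₙ)`. -/
def shuffleSign {ι : Type*} [LinearOrder ι] [Fintype ι] (k l : ι → ℤ) : ℤˣ :=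
  ∏ p : ι × ι, if p.1 < p.2 then sgn (k p.2 * l p.1) else 1

/-- A prefactorization algebra on `M` with values in the complexes satisfying `𝒞`. The structure
maps `F(U₁) ⊗ ⋯ ⊗ F(Uₙ) → F(V)` are bounded multilinear cochain maps of degree `0`, indexed by
finite linearly ordered sets. -/
structure PrefactorizationAlgebra (𝕜 : Type*) [RCLike 𝕜] (𝒞 : ConvComplex.{w} 𝕜 → Prop)
    (M : Type u) [TopologicalSpace M] where
  obj : Opens M → ConvComplex.{w} 𝕜
  obj_mem : ∀ U, 𝒞 (obj U)
  m : ∀ {ι : Type} [Fintype ι] [LinearOrder ι] (U : ι → Opens M) (V : Opens M),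
    Pairwise (fun i j => Disjoint (U i) (U j)) → (∀ i, U i ≤ V) →
      MultilinearMap 𝕜 (fun i => obj (U i)) (obj V)
  m_bdd : ∀ {ι : Type} [Fintype ι] [LinearOrder ι] (U : ι → Opens M) (V : Opens M)
    (hU : Pairwise (fun i j => Disjoint (U i) (U j))) (hV : ∀ i, U i ≤ V),
    IsBddMultilinear (m U V hU hV)
  m_hbar : ∀ {ι : Type} [Fintype ι] [LinearOrder ι] (U : ι → Opens M) (V : Opens M)
    (hU : Pairwise (fun i j => Disjoint (U i) (U j))) (hV : ∀ i, U i ≤ V)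
    (a : ∀ i, obj (U i)) (i : ι),
    m U V hU hV (Function.update a i ((obj (U i)).hbar (a i))) = (obj V).hbar (m U V hU hV a)
  m_deg : ∀ {ι : Type} [Fintype ι] [LinearOrder ι] (U : ι → Opens M) (V : Opens M)
    (hU : Pairwise (fun i j => Disjoint (U i) (U j))) (hV : ∀ i, U i ≤ V)
    (a : ∀ i, obj (U i)) (k : ι → ℤ), (∀ i, a i ∈ (obj (U i)).deg (k i)) →
    m U V hU hV a ∈ (obj V).deg (∑ i, k i)
  m_d : ∀ {ι : Type} [Fintype ι] [LinearOrder ι] (U : ι → Opens M) (V : Opens M)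
    (hU : Pairwise (fun i j => Disjoint (U i) (U j))) (hV : ∀ i, U i ≤ V)
    (a : ∀ i, obj (U i)) (k : ι → ℤ), (∀ i, a i ∈ (obj (U i)).deg (k i)) →
    (obj V).d (m U V hU hV a) =
      ∑ i, sgn (∑ j with j < i, k j) •
        m U V hU hV (Function.update a i ((obj (U i)).d (a i)))
  m_id : ∀ (U : Opens M) (hU : Pairwise (fun _ _ : PUnit => Disjoint U U))
    (hV : ∀ _ : PUnit, U ≤ U) (a : obj U),
    m (fun _ : PUnit => U) U hU hV (fun _ => a) = a
  m_assoc : ∀ {ι : Type} [Fintype ι] [LinearOrder ι] {κ : ι → Type} [∀ i, Fintype (κ i)]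
    [∀ i, LinearOrder (κ i)] (U : ι → Opens M) (V : Opens M) (T : ∀ i, κ i → Opens M)
    (hU : Pairwise (fun i j => Disjoint (U i) (U j))) (hV : ∀ i, U i ≤ V)
    (hT : ∀ i, Pairwise (fun j j' => Disjoint (T i j) (T i j'))) (hTU : ∀ i j, T i j ≤ U i)
    (hT' : Pairwise (fun p q : Σₗ i, κ i =>
      Disjoint (T (ofLex p).1 (ofLex p).2) (T (ofLex q).1 (ofLex q).2)))
    (hTV : ∀ p : Σₗ i, κ i, T (ofLex p).1 (ofLex p).2 ≤ V)
    (a : ∀ i j, obj (T i j)),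
    m U V hU hV (fun i => m (T i) (U i) (hT i) (hTU i) (a i)) =
      m (fun p : Σₗ i, κ i => T (ofLex p).1 (ofLex p).2) V hT' hTV
        (fun p => a (ofLex p).1 (ofLex p).2)
  m_perm : ∀ {ι κ : Type} [Fintype ι] [LinearOrder ι] [Fintype κ] [LinearOrder κ] (σ : κ ≃ ι)
    (U : ι → Opens M) (V : Opens M)
    (hU : Pairwise (fun i j => Disjoint (U i) (U j))) (hV : ∀ i, U i ≤ V)
    (hU' : Pairwise (fun i j => Disjoint (U (σ i)) (U (σ j)))) (hV' : ∀ i, U (σ i) ≤ V)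
    (a : ∀ i, obj (U i)) (k : ι → ℤ), (∀ i, a i ∈ (obj (U i)).deg (k i)) →
    m (fun c => U (σ c)) V hU' hV' (fun c => a (σ c)) = koszulSign σ k • m U V hU hV a

variable {𝕜 : Type*} [RCLike 𝕜] {𝒞 : ConvComplex.{w} 𝕜 → Prop} {M : Type u} [TopologicalSpace M]

/-- The underlying precosheaf: the structure map of a single inclusion `U ⊆ V`. -/
def PrefactorizationAlgebra.ext (𝓕 : PrefactorizationAlgebra 𝕜 𝒞 M) {U V : Opens M} (h : U ≤ V)
    (a : 𝓕.obj U) : 𝓕.obj V :=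
  𝓕.m (fun _ : PUnit => U) V (fun _ _ hne => (hne (Subsingleton.elim _ _)).elim) (fun _ => h)
    (fun _ => a)

/-- Weiss covers: every finite subset of `U` is contained in a member of the cover. -/
def IsWeissCover (𝒰 : Set (Opens M)) (U : Opens M) : Prop :=
  (∀ W ∈ 𝒰, W ≤ U) ∧ ∀ S : Finset M, (S : Set M) ⊆ U → ∃ W ∈ 𝒰, (S : Set M) ⊆ W

/-- The cosheaf condition: for every Weiss cover of `U`, the object `F(U)` is the coequalizer of
`∐ F(W ∩ W') ⇉ ∐ F(W)` in the category of complexes satisfying `𝒞`. -/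
def PrefactorizationAlgebra.IsCosheaf (𝓕 : PrefactorizationAlgebra 𝕜 𝒞 M) : Prop :=
  ∀ (U : Opens M) (𝒰 : Set (Opens M)) (h𝒰 : IsWeissCover 𝒰 U) (Z : ConvComplex.{w} 𝕜), 𝒞 Z →
    ∀ φ : ∀ W : 𝒰, 𝓕.obj W.1 →ₗ[𝕜] Z, (∀ W, IsCochainMap (φ W)) →
      (∀ (W W' : 𝒰) (a : 𝓕.obj (W.1 ⊓ W'.1)),
        φ W (𝓕.ext inf_le_left a) = φ W' (𝓕.ext inf_le_right a)) →
      ∃! ψ : 𝓕.obj U →ₗ[𝕜] Z, IsCochainMap ψ ∧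
        ∀ (W : 𝒰) (a : 𝓕.obj W.1), ψ (𝓕.ext (h𝒰.1 W.1 W.2) a) = φ W a

variable (𝕜 𝒞 M) in
/-- A Beilinson-Drinfeld algebra in factorization algebras on `M`: a factorization algebra whose
values carry a unital graded commutative product and a Poisson bracket of degree `1`, both bounded
and `ħ`-bilinear, with `d (a b) = (d a) b + (-1)^|a| a (d b) + ħ {a, b}`, such that all structure
maps are maps of such algebras. When `ħ` acts by zero this is a `1`-shifted Poisson (`P₀`) algebra.

Signs: the bracket is normalised so that `{a, b} = (-1)^{|a||b|} {b, a}`, as is forced by the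
relation above; equivalently `(-1)^|a| {a, b}` is a Lie bracket on the shifted complex. -/
structure BDFactorizationAlgebra extends PrefactorizationAlgebra 𝕜 𝒞 M where
  cosheaf : toPrefactorizationAlgebra.IsCosheaf
  mul : ∀ U, obj U →ₗ[𝕜] obj U →ₗ[𝕜] obj U
  one : ∀ U, obj U
  br : ∀ U, obj U →ₗ[𝕜] obj U →ₗ[𝕜] obj U
  mul_bdd : ∀ U, IsBddBilinear (mul U)
  br_bdd : ∀ U, IsBddBilinear (br U)
  mul_hbar : ∀ U (a b : obj U), mul U ((obj U).hbar a) b = (obj U).hbar (mul U a b)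
  br_hbar : ∀ U (a b : obj U), br U ((obj U).hbar a) b = (obj U).hbar (br U a b)
  one_deg : ∀ U, one U ∈ (obj U).deg 0
  mul_deg : ∀ U i j, ∀ a ∈ (obj U).deg i, ∀ b ∈ (obj U).deg j, mul U a b ∈ (obj U).deg (i + j)
  br_deg : ∀ U i j, ∀ a ∈ (obj U).deg i, ∀ b ∈ (obj U).deg j, br U a b ∈ (obj U).deg (i + j + 1)
  one_mul : ∀ U a, mul U (one U) a = a
  mul_assoc : ∀ U a b c, mul U (mul U a b) c = mul U a (mul U b c)
  mul_comm : ∀ U i j, ∀ a ∈ (obj U).deg i, ∀ b ∈ (obj U).deg j,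
    mul U a b = sgn (i * j) • mul U b a
  br_comm : ∀ U i j, ∀ a ∈ (obj U).deg i, ∀ b ∈ (obj U).deg j, br U a b = sgn (i * j) • br U b a
  leibniz : ∀ U i j, ∀ a ∈ (obj U).deg i, ∀ b ∈ (obj U).deg j, ∀ c,
    br U a (mul U b c) = mul U (br U a b) c + sgn ((i + 1) * j) • mul U b (br U a c)
  jacobi : ∀ U i j, ∀ a ∈ (obj U).deg i, ∀ b ∈ (obj U).deg j, ∀ c,
    br U a (br U b c) =
      sgn (i + 1) • br U (br U a b) c + sgn ((i + 1) * (j + 1)) • br U b (br U a c)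
  d_one : ∀ U, (obj U).d (one U) = 0
  d_mul : ∀ U i, ∀ a ∈ (obj U).deg i, ∀ b,
    (obj U).d (mul U a b) = mul U ((obj U).d a) b + sgn i • mul U a ((obj U).d b)
      + (obj U).hbar (br U a b)
  d_br : ∀ U i, ∀ a ∈ (obj U).deg i, ∀ b,
    (obj U).d (br U a b) = - br U ((obj U).d a) b - sgn i • br U a ((obj U).d b)
  m_one : ∀ {ι : Type} [Fintype ι] [LinearOrder ι] (U : ι → Opens M) (V : Opens M)
    (hU : Pairwise (fun i j => Disjoint (U i) (U j))) (hV : ∀ i, U i ≤ V),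
    m U V hU hV (fun i => one (U i)) = one V
  m_mul : ∀ {ι : Type} [Fintype ι] [LinearOrder ι] (U : ι → Opens M) (V : Opens M)
    (hU : Pairwise (fun i j => Disjoint (U i) (U j))) (hV : ∀ i, U i ≤ V)
    (a b : ∀ i, obj (U i)) (k l : ι → ℤ), (∀ i, a i ∈ (obj (U i)).deg (k i)) →
    (∀ i, b i ∈ (obj (U i)).deg (l i)) →
    mul V (m U V hU hV a) (m U V hU hV b) =
      shuffleSign k l • m U V hU hV (fun i => mul (U i) (a i) (b i))
  m_br : ∀ {ι : Type} [Fintype ι] [LinearOrder ι] (U : ι → Opens M) (V : Opens M)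
    (hU : Pairwise (fun i j => Disjoint (U i) (U j))) (hV : ∀ i, U i ≤ V)
    (a b : ∀ i, obj (U i)) (k l : ι → ℤ), (∀ i, a i ∈ (obj (U i)).deg (k i)) →
    (∀ i, b i ∈ (obj (U i)).deg (l i)) →
    br V (m U V hU hV a) (m U V hU hV b) =
      shuffleSign k l • ∑ i, sgn (∑ j with j < i, (k j + l j)) •
        m U V hU hV (Function.update (fun i => mul (U i) (a i) (b i)) i (br (U i) (a i) (b i)))

variable (𝕜 M) in
/-- A classical field theory model: a `P₀` algebra in factorization algebras on `M`. -/
abbrev ClassicalModel := BDFactorizationAlgebra 𝕜 (ConvComplex.IsClassical : ConvComplex.{w} 𝕜 → Prop) M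

variable (𝕜 M) in
/-- A quantum field theory model: a Beilinson-Drinfeld algebra over `𝕜[[ħ]]` in factorization
algebras on `M`, with values free over `𝕜[[ħ]]`. -/
abbrev QuantumModel := BDFactorizationAlgebra 𝕜 (ConvComplex.IsFormal : ConvComplex.{w} 𝕜 → Prop) M

/-- A BV Laplacian on `Obs(U)`: a bounded linear map of degree `1` with
`Δ (a b) = (Δ a) b + (-1)^|a| a (Δ b) + {a, b}` that vanishes on constants and on the
linear generators `L`. -/
structure IsBVLaplacian (Obs : ClassicalModel 𝕜 M) (U : Opens M) (L : Set (Obs.obj U))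
    (Δ : Obs.obj U →ₗ[𝕜] Obs.obj U) : Prop where
  bdd : IsBddLinear Δ
  deg : ∀ j, ∀ a ∈ (Obs.obj U).deg j, Δ a ∈ (Obs.obj U).deg (j + 1)
  mul : ∀ i, ∀ a ∈ (Obs.obj U).deg i, ∀ b,
    Δ (Obs.mul U a b) = Obs.mul U (Δ a) b + sgn i • Obs.mul U a (Δ b) + Obs.br U a b
  one : Δ (Obs.one U) = 0
  linear : ∀ a ∈ L, Δ a = 0

/-- `𝒜` is the BD quantization of `Obs` with differential `d + ħ Δ`: one has `𝒜(U) = Obs(U)[[ħ]]`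
(degreewise, via `Φ(a) = ∑ ħⁿ c(aₙ)`, with `c` the inclusion of the `ħ⁰` part), with product, unit, bracket and structure maps the
`ħ`-linear extensions of those of `Obs`, and with differential the `ħ`-linear extension
of `d + ħ Δ`. -/
def IsBDQuantization (Obs : ClassicalModel 𝕜 M) (𝒜 : QuantumModel 𝕜 M)
    (Δ : ∀ U, Obs.obj U →ₗ[𝕜] Obs.obj U) : Prop :=
  ∃ (c : ∀ U, Obs.obj U →ₗ[𝕜] 𝒜.obj U)
    (Φ : ∀ U j, (ℕ → (Obs.obj U).deg j) ≃L[𝕜] (𝒜.obj U).deg j),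
    (∀ U j (a : (Obs.obj U).deg j), (Φ U j (Pi.single 0 a) : 𝒜.obj U) = c U a) ∧
    (∀ U j (x : ℕ → (Obs.obj U).deg j),
      (𝒜.obj U).hbar (Φ U j x : 𝒜.obj U) = (Φ U j (hshift x) : 𝒜.obj U)) ∧
    (∀ U, 𝒜.one U = c U (Obs.one U)) ∧
    (∀ U a b, 𝒜.mul U (c U a) (c U b) = c U (Obs.mul U a b)) ∧
    (∀ U a b, 𝒜.br U (c U a) (c U b) = c U (Obs.br U a b)) ∧
    (∀ {ι : Type} [Fintype ι] [LinearOrder ι] (U : ι → Opens M) (V : Opens M)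
      (hU : Pairwise (fun i j => Disjoint (U i) (U j))) (hV : ∀ i, U i ≤ V)
      (a : ∀ i, Obs.obj (U i)),
      𝒜.m U V hU hV (fun i => c (U i) (a i)) = c V (Obs.m U V hU hV a)) ∧
    (∀ U a, (𝒜.obj U).d (c U a) = c U ((Obs.obj U).d a) + (𝒜.obj U).hbar (c U (Δ U a)))

end Factorization

/-! ## Lorentzian geometry -/

section Lorentz

variable {d : ℕ} {M : Type*} [TopologicalSpace M] [ChartedSpace (EuclideanSpace ℝ (Fin d)) M]

/-- Smoothness of a bilinear form on the fibres of a vector bundle. -/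
def IsSmoothForm (F : Type*) [NormedAddCommGroup F] [NormedSpace ℝ F] {E : M → Type*}
    [TopologicalSpace (TotalSpace F E)] [∀ x, TopologicalSpace (E x)] [∀ x, AddCommGroup (E x)]
    [∀ x, Module ℝ (E x)] [∀ x, IsTopologicalAddGroup (E x)] [∀ x, ContinuousConstSMul ℝ (E x)]
    [FiberBundle F E] [VectorBundle ℝ F E] (b : ∀ x, E x →L[ℝ] E x →L[ℝ] ℝ) : Prop :=
  ContMDiff (𝓡 d) ((𝓡 d).prod 𝓘(ℝ, F →L[ℝ] F →L[ℝ] ℝ)) ∞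
    (fun x => TotalSpace.mk' (F →L[ℝ] F →L[ℝ] ℝ) x (b x))

variable [IsManifold (𝓡 d) ∞ M]

variable (d M) in
/-- A Lorentzian metric of signature `(+, -, …, -)`. -/
structure LorentzianMetric where
  val : ∀ x : M, TangentSpace (𝓡 d) x →L[ℝ] TangentSpace (𝓡 d) x →L[ℝ] ℝ
  symm : ∀ x v w, val x v w = val x w v
  signature : ∀ x, ∃ v, 0 < val x v v ∧ ∀ w, w ≠ 0 → val x v w = 0 → val x w w < 0
  smooth : IsSmoothForm (d := d) (EuclideanSpace ℝ (Fin d)) val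

/-- The `a`-th coordinate vector field of the chart at `p`, at the point with coordinates `y`. -/
def coordVec (p : M) (y : EuclideanSpace ℝ (Fin d)) (a : Fin d) :
    TangentSpace (𝓡 d) ((extChartAt (𝓡 d) p).symm y) :=
  mfderiv (𝓡 d) (𝓡 d) (extChartAt (𝓡 d) p).symm y (EuclideanSpace.single a (1 : ℝ))

/-- The measure `√|det g| dy` of the chart at `p`, as a measure on `M`. -/
def LorentzianMetric.chartVolume [MeasurableSpace M] (g : LorentzianMetric d M) (p : M) :
    Measure M :=
  Measure.map (extChartAt (𝓡 d) p).symm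
    ((volume.restrict (extChartAt (𝓡 d) p).target).withDensity fun y =>
      ENNReal.ofReal (Real.sqrt |(Matrix.of fun a b =>
        g.val ((extChartAt (𝓡 d) p).symm y) (coordVec p y a) (coordVec p y b)).det|))

/-- The volume measure `dvol_g`: the least measure that dominates all its chart expressions. (On
each chart domain it is the chart expression, by the change of variables formula.) -/
def LorentzianMetric.dvol [MeasurableSpace M] (g : LorentzianMetric d M) : Measure M :=
  ⨆ p : M, g.chartVolume p

variable (d M) in
/-- Orientability: existence of a continuous nowhere vanishing form of top degree. -/
def IsOrientableManifold : Prop :=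
  ∃ η : ∀ x : M, TangentSpace (𝓡 d) x [⋀^Fin d]→ₗ[ℝ] ℝ, (∀ x, η x ≠ 0) ∧
    ∀ p : M, ContinuousOn (fun y => η ((extChartAt (𝓡 d) p).symm y) (coordVec p y))
      (extChartAt (𝓡 d) p).target

/-- The velocity vector of a curve. -/
def velocity (γ : ℝ → M) (t : ℝ) : TangentSpace (𝓡 d) (γ t) := mfderiv 𝓘(ℝ, ℝ) (𝓡 d) γ t (1 : ℝ)

/-- The (regular) curve `γ` is causal at the parameter `t`. -/
def LorentzianMetric.IsCausalAt (g : LorentzianMetric d M) (γ : ℝ → M) (t : ℝ) : Prop :=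
  velocity (d := d) γ t ≠ 0 ∧ 0 ≤ g.val (γ t) (velocity γ t) (velocity γ t)

/-- Inextendible causal curves, parametrised by the real line. -/
def LorentzianMetric.IsInextendibleCausal (g : LorentzianMetric d M) (γ : ℝ → M) : Prop :=
  ContMDiff 𝓘(ℝ, ℝ) (𝓡 d) ∞ γ ∧ (∀ t, g.IsCausalAt γ t) ∧
    (¬ ∃ p, Tendsto γ atTop (𝓝 p)) ∧ ¬ ∃ p, Tendsto γ atBot (𝓝 p)

/-- Global hyperbolicity: `M` is foliated by the level sets of a smooth submersion `τ : M → ℝ`,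
each of which is met exactly once by every inextendible causal curve. -/
def LorentzianMetric.IsGloballyHyperbolic (g : LorentzianMetric d M) : Prop :=
  ∃ τ : M → ℝ, ContMDiff (𝓡 d) 𝓘(ℝ, ℝ) ∞ τ ∧ (∀ x, mfderiv (𝓡 d) 𝓘(ℝ, ℝ) τ x ≠ 0) ∧
    ∀ c : ℝ, ∀ γ : ℝ → M, g.IsInextendibleCausal γ → ∃! t, τ (γ t) = c

variable (d M) in
/-- Smooth vector fields. -/
abbrev SmoothVectorField :=
  Cₛ^∞⟮𝓡 d; EuclideanSpace ℝ (Fin d), (TangentSpace (𝓡 d) : M → Type _)⟯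

/-- A time orientation: an everywhere timelike vector field. -/
def LorentzianMetric.IsTimeOrientation (g : LorentzianMetric d M) (T : SmoothVectorField d M) :
    Prop :=
  ∀ x, 0 < g.val x (T x) (T x)

/-- There is a future-directed causal curve from `p` to `q`, or `p = q`. -/
def LorentzianMetric.CausallyPrecedes (g : LorentzianMetric d M) (T : SmoothVectorField d M)
    (p q : M) : Prop :=
  p = q ∨ ∃ (γ : ℝ → M) (a b : ℝ), ContMDiff 𝓘(ℝ, ℝ) (𝓡 d) ∞ γ ∧ a < b ∧ γ a = p ∧ γ b = q ∧
    ∀ t ∈ Icc a b, g.IsCausalAt γ t ∧ 0 < g.val (γ t) (T (γ t)) (velocity γ t)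

/-- The causal future `J⁺(A)`. -/
def LorentzianMetric.causalFuture (g : LorentzianMetric d M) (T : SmoothVectorField d M)
    (A : Set M) : Set M := {q | ∃ p ∈ A, g.CausallyPrecedes T p q}

/-- The causal past `J⁻(A)`. -/
def LorentzianMetric.causalPast (g : LorentzianMetric d M) (T : SmoothVectorField d M)
    (A : Set M) : Set M := {q | ∃ p ∈ A, g.CausallyPrecedes T q p}

end Lorentz

/-! ## Sections, differential operators, Green hyperbolicity -/

section Operators

variable {d : ℕ} {M : Type*} [TopologicalSpace M] [ChartedSpace (EuclideanSpace ℝ (Fin d)) M]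
  (F : Type*) [NormedAddCommGroup F] [NormedSpace ℝ F] (E : M → Type*)
  [TopologicalSpace (TotalSpace F E)] [∀ x, TopologicalSpace (E x)] [∀ x, AddCommGroup (E x)]
  [∀ x, Module ℝ (E x)] [FiberBundle F E] [VectorBundle ℝ F E]

variable (d) in
/-- `Γ_c(U, E)`: smooth sections with compact support contained in `U` (extended by zero). -/
def TestSections (U : Opens M) : Submodule ℝ Cₛ^∞⟮𝓡 d; F, E⟯ where
  carrier := {s | ∃ K : Set M, IsCompact K ∧ K ⊆ U ∧ ∀ x ∉ K, s x = 0}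
  zero_mem' := ⟨∅, isCompact_empty, empty_subset _, fun _ _ => rfl⟩
  add_mem' := by
    rintro s t ⟨K, hK, hKU, hs⟩ ⟨L, hL, hLU, ht⟩
    refine ⟨K ∪ L, hK.union hL, union_subset hKU hLU, fun x hx => ?_⟩
    rw [mem_union, not_or] at hx
    simp [hs x hx.1, ht x hx.2]
  smul_mem' := by
    rintro c s ⟨K, hK, hKU, hs⟩
    exact ⟨K, hK, hKU, fun x hx => by simp [hs x hx]⟩

/-- The domain, in the coordinates of the chart at `p`, over which both this chart and the
preferred local trivialisation of `E` at `p` are defined. -/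
def localDomain (p : M) : Set (EuclideanSpace ℝ (Fin d)) :=
  (extChartAt (𝓡 d) p).target ∩ (extChartAt (𝓡 d) p).symm ⁻¹' (trivializationAt F E p).baseSet

/-- The coordinate expression of a section near `p`. -/
def localSection (p : M) (s : ∀ x, E x) (y : EuclideanSpace ℝ (Fin d)) : F :=
  (trivializationAt F E p
    (⟨(extChartAt (𝓡 d) p).symm y, s ((extChartAt (𝓡 d) p).symm y)⟩ : TotalSpace F E)).2

/-- Linear differential operators of finite order with smooth coefficients. -/
def IsDifferentialOperator (P : Cₛ^∞⟮𝓡 d; F, E⟯ →ₗ[ℝ] Cₛ^∞⟮𝓡 d; F, E⟯) : Prop :=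
  ∃ r : ℕ, ∀ p : M, ∃ a : ∀ j : ℕ, EuclideanSpace ℝ (Fin d) →
      ((EuclideanSpace ℝ (Fin d) [×j]→L[ℝ] F) →L[ℝ] F),
    (∀ j, ContDiffOn ℝ ∞ (a j) (localDomain F E p)) ∧
    ∀ s : Cₛ^∞⟮𝓡 d; F, E⟯, ∀ y ∈ localDomain F E p,
      localSection F E p (P s) y =
        ∑ j ∈ Finset.range (r + 1), a j y (iteratedFDeriv ℝ j (localSection F E p s) y)

variable {F E}

/-- `G` is a Green operator for `P` whose supports are controlled by `J`. -/
structure IsGreenOperator (P : Cₛ^∞⟮𝓡 d; F, E⟯ →ₗ[ℝ] Cₛ^∞⟮𝓡 d; F, E⟯) (J : Set M → Set M)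
    (G : TestSections d F E ⊤ →ₗ[ℝ] Cₛ^∞⟮𝓡 d; F, E⟯) : Prop where
  right_inv : ∀ f : TestSections d F E ⊤, P (G f) = f
  left_inv : ∀ f f' : TestSections d F E ⊤,
    (f' : Cₛ^∞⟮𝓡 d; F, E⟯) = P (f : Cₛ^∞⟮𝓡 d; F, E⟯) → G f' = f
  supp : ∀ (f : TestSections d F E ⊤) (x : M), G f x ≠ 0 →
    x ∈ J (closure {y | (f : Cₛ^∞⟮𝓡 d; F, E⟯) y ≠ 0})

/-- Green-hyperbolic operators: linear differential operators with unique retarded and advanced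
Green operators. -/
def IsGreenHyperbolic [IsManifold (𝓡 d) ∞ M] (g : LorentzianMetric d M)
    (T : SmoothVectorField d M) (P : Cₛ^∞⟮𝓡 d; F, E⟯ →ₗ[ℝ] Cₛ^∞⟮𝓡 d; F, E⟯) : Prop :=
  IsDifferentialOperator F E P ∧ (∃! G, IsGreenOperator P (g.causalFuture T) G) ∧
    ∃! G, IsGreenOperator P (g.causalPast T) G

end Operators

/-! ## The spaces `⨁ₙ Γ_c(Uⁿ × Uᵏ, E^{⊠(n+k)})_{Sₙ × S_k}` -/

section Polyvectors

variable {d : ℕ} {M : Type*} [TopologicalSpace M] [ChartedSpace (EuclideanSpace ℝ (Fin d)) M]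
  (𝕜 : Type*) [RCLike 𝕜]
  (F : Type*) [NormedAddCommGroup F] [NormedSpace ℝ F] (E : M → Type*)
  [TopologicalSpace (TotalSpace F E)] [∀ x, TopologicalSpace (E x)] [∀ x, AddCommGroup (E x)]
  [∀ x, Module ℝ (E x)] [FiberBundle F E]

variable {𝕜 F E}

/-- `f` is linear over `ℝ` in each variable along the fibres of `E`. -/
def IsFiberwiseMultilinear {ι : Type*} [DecidableEq ι] (f : (ι → TotalSpace F E) → 𝕜) : Prop :=
  ∀ (v : ι → TotalSpace F E) (i : ι) (x : M) (a b : E x) (c : ℝ),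
    f (Function.update v i ⟨x, a + c • b⟩) =
      f (Function.update v i ⟨x, a⟩) + c • f (Function.update v i ⟨x, b⟩)

/-- `f` vanishes outside of `K^ι`. -/
def IsSupportedIn {ι : Type*} (K : Set M) (f : (ι → TotalSpace F E) → 𝕜) : Prop :=
  ∀ v, (∃ i, (v i).proj ∉ K) → f v = 0

variable (d) in
/-- The expression of `f` in the product of the bundle charts at the points `c i`. -/
def localRep {ι : Type*} (c : ι → TotalSpace F E) (f : (ι → TotalSpace F E) → 𝕜)
    (z : ι → EuclideanSpace ℝ (Fin d) × F) : 𝕜 :=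
  f fun i => (extChartAt ((𝓡 d).prod 𝓘(ℝ, F)) (c i)).symm (z i)

variable (d) in
/-- The domain of the product of the bundle charts at the points `c i`. -/
def repDomain {ι : Type*} (c : ι → TotalSpace F E) : Set (ι → EuclideanSpace ℝ (Fin d) × F) :=
  Set.pi Set.univ fun i => (extChartAt ((𝓡 d).prod 𝓘(ℝ, F)) (c i)).target

variable (d 𝕜 F E) in
/-- Smooth compactly supported sections over `U^ι` of the exterior tensor power of (the
`𝕜`-extension of) the bundle. A section is written as a smooth function of `ι` points of the total
space of `E`, linear along the fibres: this is a section of `(E^*)^{⊠ι}`, which is identified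
with `E^{⊠ι}` by the fibre pairing (see `generatorFun`). -/
def TestTensors (ι : Type) [Fintype ι] [DecidableEq ι] (U : Opens M) :
    Submodule 𝕜 ((ι → TotalSpace F E) → 𝕜) where
  carrier := {f | (∀ c, ContDiffOn ℝ ∞ (localRep d c f) (repDomain d c)) ∧
    IsFiberwiseMultilinear f ∧ ∃ K : Set M, IsCompact K ∧ K ⊆ U ∧ IsSupportedIn K f}
  zero_mem' := ⟨fun _ => contDiffOn_const, fun _ _ _ _ _ _ => by simp,
    ∅, isCompact_empty, empty_subset _, fun _ _ => rfl⟩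
  add_mem' := by
    rintro f g ⟨hf, hf', K, hK, hKU, hfK⟩ ⟨hg, hg', L, hL, hLU, hgL⟩
    refine ⟨fun c => (hf c).add (hg c), fun v i x a b c => ?_, K ∪ L, hK.union hL,
      union_subset hKU hLU, fun v hv => ?_⟩
    · simp only [Pi.add_apply, hf' v i x a b c, hg' v i x a b c, smul_add]
      abel
    · obtain ⟨i, hi⟩ := hv
      rw [mem_union, not_or] at hi
      simp [hfK v ⟨i, hi.1⟩, hgL v ⟨i, hi.2⟩]
  smul_mem' := by
    rintro c f ⟨hf, hf', K, hK, hKU, hfK⟩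
    refine ⟨fun e => contDiffOn_const.smul (hf e), fun v i x a b r => ?_, K, hK, hKU,
      fun v hv => by simp [hfK v hv]⟩
    simp only [Pi.smul_apply, hf' v i x a b r, smul_add, smul_comm c r]

variable (d 𝕜 F E) in
/-- The relations `f ∘ (σ, τ) = sgn(τ) f` for `(σ, τ) ∈ Sₙ × S_k`. -/
def coinvariantRelations (n k : ℕ) (U : Opens M) :
    Submodule 𝕜 (TestTensors d 𝕜 F E (Fin n ⊕ Fin k) U) :=
  Submodule.span 𝕜 {h | ∃ (f f' : TestTensors d 𝕜 F E (Fin n ⊕ Fin k) U)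
    (σ : Equiv.Perm (Fin n)) (τ : Equiv.Perm (Fin k)),
    (∀ v, f'.1 v = f.1 (v ∘ Sum.map σ τ)) ∧ h = f' - Equiv.Perm.sign τ • f}

variable (d 𝕜 F E) in
/-- The coinvariants `Γ_c(Uⁿ × Uᵏ)_{Sₙ × S_k}`, where `S_k` acts through the sign. -/
def Coinvariants (n k : ℕ) (U : Opens M) : Type _ :=
  TestTensors d 𝕜 F E (Fin n ⊕ Fin k) U ⧸ coinvariantRelations d 𝕜 F E n k U

instance (n k : ℕ) (U : Opens M) : AddCommGroup (Coinvariants d 𝕜 F E n k U) :=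
  Submodule.Quotient.addCommGroup (coinvariantRelations d 𝕜 F E n k U)

instance (n k : ℕ) (U : Opens M) : Module 𝕜 (Coinvariants d 𝕜 F E n k U) :=
  Submodule.Quotient.module (coinvariantRelations d 𝕜 F E n k U)

variable (d 𝕜 F E) in
/-- `PV^{-k}(U) = ⨁ₙ Γ_c(Uⁿ × Uᵏ)_{Sₙ × S_k}`. -/
def PV (k : ℕ) (U : Opens M) : Type _ := ⨁ n : ℕ, Coinvariants d 𝕜 F E n k U

instance (k : ℕ) (U : Opens M) : AddCommGroup (PV d 𝕜 F E k U) :=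
  inferInstanceAs (AddCommGroup (⨁ n : ℕ, Coinvariants d 𝕜 F E n k U))

instance (k : ℕ) (U : Opens M) : Module 𝕜 (PV d 𝕜 F E k U) :=
  inferInstanceAs (Module 𝕜 (⨁ n : ℕ, Coinvariants d 𝕜 F E n k U))

/-- The class in `PV^{-k}(U)` of a section over `Uⁿ × Uᵏ`. -/
def PV.mk {n k : ℕ} {U : Opens M} :
    TestTensors d 𝕜 F E (Fin n ⊕ Fin k) U →ₗ[𝕜] PV d 𝕜 F E k U :=
  (DirectSum.lof 𝕜 ℕ (fun n : ℕ => Coinvariants d 𝕜 F E n k U) n).comp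
    (coinvariantRelations d 𝕜 F E n k U).mkQ

/-- Bounded subsets of `Γ_c(U^ι)`: the supports lie in a common compact set, and in all charts all
derivatives are uniformly bounded on compact sets. -/
def IsBddFamily {ι : Type} [Fintype ι] [DecidableEq ι] {U : Opens M}
    (S : Set (TestTensors d 𝕜 F E ι U)) : Prop :=
  (∃ K : Set M, IsCompact K ∧ K ⊆ U ∧ ∀ f ∈ S, IsSupportedIn K f.1) ∧
  ∀ (c : ι → TotalSpace F E) (C : Set (ι → EuclideanSpace ℝ (Fin d) × F)), IsCompact C →
    C ⊆ repDomain d c → ∀ j : ℕ, ∃ R : ℝ, ∀ f ∈ S, ∀ z ∈ C,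
      ‖iteratedFDeriv ℝ j (localRep d c f.1) z‖ ≤ R

variable (d 𝕜 F E) in
/-- Seminorms on `PV^{-k}(U)` that are bounded on the bounded subsets of all `Γ_c(Uⁿ × Uᵏ)`. As
the spaces of sections supported in a fixed compact set are Fréchet, these are the seminorms whose
restrictions to these Fréchet spaces are continuous. -/
def IsLFSeminorm (k : ℕ) (U : Opens M) (p : Seminorm 𝕜 (PV d 𝕜 F E k U)) : Prop :=
  ∀ (n : ℕ) (S : Set (TestTensors d 𝕜 F E (Fin n ⊕ Fin k) U)), IsBddFamily S →
    ∃ R : ℝ, ∀ f ∈ S, p (PV.mk f) ≤ R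

instance (k : ℕ) (U : Opens M) : Nonempty {p // IsLFSeminorm d 𝕜 F E k U p} :=
  ⟨⟨0, fun _ _ _ => ⟨0, fun _ _ => le_rfl⟩⟩⟩

/-- The locally convex (inductive limit) topology on `PV^{-k}(U)`. -/
instance (k : ℕ) (U : Opens M) : TopologicalSpace (PV d 𝕜 F E k U) :=
  (SeminormFamily.moduleFilterBasis
    (fun p : {p // IsLFSeminorm d 𝕜 F E k U p} => p.1)).topology

variable (𝕜) in
/-- The section `s` as a function linear along the fibres, by the fibre pairing `b`. -/
def generatorFun {ι : Type} [Unique ι] (b : ∀ x, E x →L[ℝ] E x →L[ℝ] ℝ) (s : ∀ x, E x)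
    (v : ι → TotalSpace F E) : 𝕜 :=
  ((b (v default).proj (v default).2 (s (v default).proj) : ℝ) : 𝕜)

instance : Unique (Fin 1 ⊕ Fin 0) := Equiv.unique (Equiv.sumEmpty (Fin 1) (Fin 0))
instance : Unique (Fin 0 ⊕ Fin 1) := Equiv.unique (Equiv.emptySum (Fin 0) (Fin 1))

end Polyvectors

/-! ## The free classical model -/

section Free

universe u w

variable {d : ℕ} {M : Type u} [TopologicalSpace M] [ChartedSpace (EuclideanSpace ℝ (Fin d)) M]
  {𝕜 : Type*} [RCLike 𝕜]
  {F : Type*} [NormedAddCommGroup F] [NormedSpace ℝ F] {E : M → Type*}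
  [TopologicalSpace (TotalSpace F E)] [∀ x, TopologicalSpace (E x)] [∀ x, AddCommGroup (E x)]
  [∀ x, Module ℝ (E x)] [FiberBundle F E] [VectorBundle ℝ F E]

/-- The underlying precosheaf of graded commutative algebras of `Obs` is `U ↦ PV(U)`: its degree
`-k` part is `PV^{-k}(U)`, its positive degrees vanish, the product is induced by the exterior
product of sections, and the extension maps are extension by zero. -/
structure IsPolyvectorAlgebra (Obs : ClassicalModel 𝕜 M)
    (e : ∀ (U : Opens M) (k : ℕ), PV d 𝕜 F E k U ≃L[𝕜] (Obs.obj U).deg (-(k : ℤ))) : Prop where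
  pos : ∀ (U : Opens M) (j : ℤ), 0 < j → (Obs.obj U).deg j = ⊥
  one : ∀ U : Opens M, ∃ f : TestTensors d 𝕜 F E (Fin 0 ⊕ Fin 0) U, (∀ v, f.1 v = 1) ∧
    (e U 0 (PV.mk f) : Obs.obj U) = Obs.one U
  mul : ∀ (U : Opens M) (n k n' k' : ℕ) (f : TestTensors d 𝕜 F E (Fin n ⊕ Fin k) U)
    (f' : TestTensors d 𝕜 F E (Fin n' ⊕ Fin k') U),
    ∃ h : TestTensors d 𝕜 F E (Fin (n + n') ⊕ Fin (k + k')) U,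
      (∀ v, h.1 v = f.1 (v ∘ Sum.map (Fin.castAdd n') (Fin.castAdd k')) *
        f'.1 (v ∘ Sum.map (Fin.natAdd n) (Fin.natAdd k))) ∧
      Obs.mul U (e U k (PV.mk f)) (e U k' (PV.mk f')) = e U (k + k') (PV.mk h)
  ext : ∀ (U V : Opens M) (hUV : U ≤ V) (n k : ℕ)
    (f : TestTensors d 𝕜 F E (Fin n ⊕ Fin k) U),
    ∃ h : TestTensors d 𝕜 F E (Fin n ⊕ Fin k) V, h.1 = f.1 ∧
      Obs.ext hUV (e U k (PV.mk f) : Obs.obj U) = e V k (PV.mk h)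

/-- `γ₀, γ₁` are the inclusions of `Γ_c(U, E)` and `Γ_c(U, E)[1]` as linear generators of `Obs(U)`:
on these the differential is `P` and the bracket is the pairing, and they generate `Obs(U)`
topologically. -/
structure IsFreeModel [IsManifold (𝓡 d) ∞ M] [MeasurableSpace M] (g : LorentzianMetric d M)
    (b : ∀ x, E x →L[ℝ] E x →L[ℝ] ℝ)
    (P : Cₛ^∞⟮𝓡 d; F, E⟯ →ₗ[ℝ] Cₛ^∞⟮𝓡 d; F, E⟯) (Obs : ClassicalModel 𝕜 M)
    (e : ∀ (U : Opens M) (k : ℕ), PV d 𝕜 F E k U ≃L[𝕜] (Obs.obj U).deg (-(k : ℤ)))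
    (γ₀ γ₁ : ∀ U : Opens M, TestSections d F E U → Obs.obj U) : Prop where
  gen₀ : ∀ U s, ∃ f : TestTensors d 𝕜 F E (Fin 1 ⊕ Fin 0) U,
    f.1 = generatorFun 𝕜 b s.1 ∧ γ₀ U s = e U 0 (PV.mk f)
  gen₁ : ∀ U s, ∃ f : TestTensors d 𝕜 F E (Fin 0 ⊕ Fin 1) U,
    f.1 = generatorFun 𝕜 b s.1 ∧ γ₁ U s = e U 1 (PV.mk f)
  d_gen₁ : ∀ U (s : TestSections d F E U), ∃ s' : TestSections d F E U,
    (s' : Cₛ^∞⟮𝓡 d; F, E⟯) = P (s : Cₛ^∞⟮𝓡 d; F, E⟯) ∧ (Obs.obj U).d (γ₁ U s) = γ₀ U s'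
  br_gen : ∀ U (s t : TestSections d F E U), Obs.br U (γ₁ U s) (γ₀ U t) =
    (((∫ x in (U : Set M), b x (s.1 x) (t.1 x) ∂g.dvol : ℝ) : ℝ) : 𝕜) • Obs.one U
  br_gen₁ : ∀ U (s t : TestSections d F E U), Obs.br U (γ₁ U s) (γ₁ U t) = 0
  generates : ∀ U (A : Submodule 𝕜 (Obs.obj U)), IsClosed (A : Set (Obs.obj U)) → Obs.one U ∈ A →
    (∀ x ∈ A, ∀ y ∈ A, Obs.mul U x y ∈ A) → (∀ s, γ₀ U s ∈ A) → (∀ s, γ₁ U s ∈ A) → A = ⊤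

end Free

end

set_option linter.unusedSectionVars false
set_option linter.unusedVariables false
set_option linter.unusedSimpArgs false

noncomputable section

/-! ## Functions on words in even and odd letters -/

section Words

/-- Functions of a word of even letters and a word of odd letters. -/
def WordFun (X : Type*) (K : Type*) : Type _ := List X → List X → K

namespace WordFun

variable {X K : Type*} [CommRing K]

instance : AddCommGroup (WordFun X K) := inferInstanceAs (AddCommGroup (List X → List X → K))

@[simp] lemma add_apply (F G : WordFun X K) (v w) : (F + G) v w = F v w + G v w := rfl
@[simp] lemma sub_apply (F G : WordFun X K) (v w) : (F - G) v w = F v w - G v w := rfl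
@[simp] lemma neg_apply (F : WordFun X K) (v w) : (-F) v w = -F v w := rfl
@[simp] lemma zero_apply (v w) : (0 : WordFun X K) v w = 0 := rfl

@[ext] lemma ext {F G : WordFun X K} (h : ∀ v w, F v w = G v w) : F = G := funext₂ h

instance {R : Type*} [Semiring R] [Module R K] : Module R (WordFun X K) :=
  inferInstanceAs (Module R (List X → List X → K))

@[simp] lemma smul_apply {R : Type*} [Semiring R] [Module R K] (c : R) (F : WordFun X K) (v w) :
    (c • F) v w = c • F v w := rfl

/-- Partial evaluation at an even letter. -/
def dE (x : X) : WordFun X K →+ WordFun X K where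
  toFun F := fun v w => F (x :: v) w
  map_zero' := rfl
  map_add' _ _ := rfl

/-- Partial evaluation at an odd letter. -/
def dO (x : X) : WordFun X K →+ WordFun X K where
  toFun F := fun v w => F v (x :: w)
  map_zero' := rfl
  map_add' _ _ := rfl

/-- The parity involution. -/
def par : WordFun X K →+ WordFun X K where
  toFun F := fun v w => (-1) ^ w.length * F v w
  map_zero' := by ext; simp
  map_add' _ _ := by ext v w; exact mul_add _ _ _

@[simp] lemma dE_apply (x : X) (F : WordFun X K) (v w) : dE x F v w = F (x :: v) w := rfl
@[simp] lemma dO_apply (x : X) (F : WordFun X K) (v w) : dO x F v w = F v (x :: w) := rfl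
lemma par_apply (F : WordFun X K) (v w) : par F v w = (-1) ^ w.length * F v w := rfl

@[simp] lemma dE_par (x : X) (F : WordFun X K) : dE x (par F) = par (dE x F) := rfl
@[simp] lemma dO_par (x : X) (F : WordFun X K) : dO x (par F) = -par (dO x F) := by
  ext v w; simp [par_apply, pow_succ]
lemma dE_dO (x y : X) (F : WordFun X K) : dE x (dO y F) = dO y (dE x F) := rfl
@[simp] lemma par_par (F : WordFun X K) : par (par F) = F := by
  ext v w; simp only [par_apply, ← mul_assoc, ← pow_add, ← two_mul]; simp

/-- The product, determined by `F G [] [] = F [] [] * G [] []` and the Leibniz rules for partial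
evaluations. -/
def mulAux : List X → List X → WordFun X K → WordFun X K → K
  | [], [], F, G => F [] [] * G [] []
  | [], x :: w, F, G => mulAux [] w (dO x F) G + mulAux [] w (par F) (dO x G)
  | x :: v, w, F, G => mulAux v w (dE x F) G + mulAux v w F (dE x G)

instance : Mul (WordFun X K) := ⟨fun F G v w => mulAux v w F G⟩

lemma mul_nil (F G : WordFun X K) : (F * G) [] [] = F [] [] * G [] [] := by
  change mulAux _ _ _ _ = _; simp [mulAux]

lemma mul_nil_cons (F G : WordFun X K) (x w) :
    (F * G) [] (x :: w) = (dO x F * G) [] w + (par F * dO x G) [] w := by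
  change mulAux _ _ _ _ = _; simp only [mulAux]; rfl

@[simp] lemma dE_mul (x : X) (F G : WordFun X K) : dE x (F * G) = dE x F * G + F * dE x G := by
  ext v w
  change mulAux _ _ _ _ = _; simp only [mulAux]; rfl

lemma mul_cons (F G : WordFun X K) (x v w) :
    (F * G) (x :: v) w = (dE x F * G) v w + (F * dE x G) v w := by
  exact congrFun (congrFun (dE_mul x F G) v) w

@[simp] lemma dO_mul (x : X) (F G : WordFun X K) :
    dO x (F * G) = dO x F * G + par F * dO x G := by
  ext v w
  induction v generalizing F G with
  | nil => exact mul_nil_cons F G x w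
  | cons y v ih =>
    have h1 := ih (dE y F) G
    have h2 := ih F (dE y G)
    simp only [dO_apply, add_apply, mul_cons, dE_par, dE_dO] at h1 h2 ⊢
    rw [h1, h2]; ring

lemma eq_of_parts {P : WordFun X K → WordFun X K → Prop}
    (h0 : ∀ F G, P F G → F [] [] = G [] []) (hE : ∀ F G x, P F G → P (dE x F) (dE x G))
    (hO : ∀ F G x, P F G → P (dO x F) (dO x G)) {F G : WordFun X K} (h : P F G) : F = G := by
  ext v w
  induction v generalizing F G with
  | nil =>
    induction w generalizing F G with
    | nil => exact h0 _ _ h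
    | cons x w ih => exact ih (hO _ _ x h)
  | cons x v ih => exact ih (hE _ _ x h)

lemma apply_induction {p : List X → List X → Prop} (h0 : p [] [])
    (hO : ∀ x w, p [] w → p [] (x :: w)) (hE : ∀ x v w, p v w → p (x :: v) w) (v w) : p v w := by
  induction v with
  | nil => induction w with
    | nil => exact h0
    | cons x w ih => exact hO x w ih
  | cons x v ih => exact hE x v w ih

protected lemma add_mul' (F F' G : WordFun X K) : (F + F') * G = F * G + F' * G := by
  ext v w
  induction v generalizing F F' G with
  | nil => induction w generalizing F F' G with
    | nil => simp [mul_nil, add_mul]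
    | cons x w ih =>
      simp only [add_apply, mul_nil_cons, map_add, ih]; ring
  | cons x v ih => simp only [add_apply, mul_cons, map_add, ih]; ring

protected lemma mul_add' (F G G' : WordFun X K) : F * (G + G') = F * G + F * G' := by
  ext v w
  induction v generalizing F G G' with
  | nil => induction w generalizing F G G' with
    | nil => simp [mul_nil, mul_add]
    | cons x w ih =>
      simp only [add_apply, mul_nil_cons, map_add, ih]; ring
  | cons x v ih => simp only [add_apply, mul_cons, map_add, ih]; ring

protected lemma zero_mul' (G : WordFun X K) : 0 * G = 0 := by
  have := WordFun.add_mul' 0 0 G; simpa using this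

protected lemma mul_zero' (G : WordFun X K) : G * 0 = 0 := by
  have := WordFun.mul_add' G 0 0; simpa using this

protected lemma neg_mul' (F G : WordFun X K) : (-F) * G = -(F * G) := by
  have := WordFun.add_mul' F (-F) G
  rw [add_neg_cancel, WordFun.zero_mul'] at this
  exact (neg_eq_of_add_eq_zero_right this.symm).symm

@[simp] lemma par_mul (F G : WordFun X K) : par (F * G) = par F * par G := by
  ext v w
  induction v generalizing F G with
  | nil => induction w generalizing F G with
    | nil => simp [par_apply, mul_nil]
    | cons x w ih =>
      have h1 := ih (dO x F) G
      have h2 := ih (par F) (dO x G)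
      simp only [par_apply, mul_nil_cons, dO_par, List.length_cons, pow_succ] at h1 h2 ⊢
      rw [WordFun.neg_mul', neg_apply, ← h1]
      have : (par (par F) * -par (dO x G)) = -(par (par F) * par (dO x G)) := by
        have := WordFun.mul_add' (par (par F)) (par (dO x G)) (-par (dO x G))
        rw [add_neg_cancel, WordFun.mul_zero'] at this
        exact (neg_eq_of_add_eq_zero_right this.symm).symm
      rw [this, neg_apply, ← h2]; ring
  | cons x v ih =>
    have h1 := ih (dE x F) G
    have h2 := ih F (dE x G)
    simp only [par_apply, mul_cons, dE_par] at h1 h2 ⊢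
    rw [← h1, ← h2]; ring

protected lemma mul_assoc' (F G H : WordFun X K) : F * G * H = F * (G * H) := by
  ext v w
  induction v generalizing F G H with
  | nil => induction w generalizing F G H with
    | nil => simp [mul_nil, mul_assoc]
    | cons x w ih =>
      simp only [mul_nil_cons, dO_mul, par_mul, WordFun.add_mul', WordFun.mul_add', add_apply, ih]
      ring
  | cons x v ih =>
    simp only [mul_cons, dE_mul, WordFun.add_mul', WordFun.mul_add', add_apply, ih]
    ring

instance : One (WordFun X K) := ⟨fun v w => if v = [] ∧ w = [] then 1 else 0⟩

lemma one_apply (v w : List X) : (1 : WordFun X K) v w = if v = [] ∧ w = [] then 1 else 0 := rfl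
@[simp] lemma one_nil : (1 : WordFun X K) [] [] = 1 := by simp [one_apply]
@[simp] lemma dE_one (x : X) : dE x (1 : WordFun X K) = 0 := by ext; simp [one_apply]
@[simp] lemma dO_one (x : X) : dO x (1 : WordFun X K) = 0 := by ext; simp [one_apply]
@[simp] lemma par_one : par (1 : WordFun X K) = 1 := by
  ext v w; rcases w with _ | ⟨x, w⟩ <;> simp [par_apply, one_apply]

protected lemma one_mul' (F : WordFun X K) : 1 * F = F := by
  ext v w
  induction v generalizing F with
  | nil => induction w generalizing F with
    | nil => simp [mul_nil]
    | cons x w ih => simp [mul_nil_cons, WordFun.zero_mul', ih]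
  | cons x v ih => simp [mul_cons, WordFun.zero_mul', ih]

protected lemma mul_one' (F : WordFun X K) : F * 1 = F := by
  ext v w
  induction v generalizing F with
  | nil => induction w generalizing F with
    | nil => simp [mul_nil]
    | cons x w ih => simp [mul_nil_cons, WordFun.mul_zero', ih]
  | cons x v ih => simp [mul_cons, WordFun.mul_zero', ih]

instance : Ring (WordFun X K) :=
  { (inferInstance : AddCommGroup (WordFun X K)), (inferInstance : Mul (WordFun X K)),
    (inferInstance : One (WordFun X K)) with
    left_distrib := WordFun.mul_add'
    right_distrib := WordFun.add_mul'
    zero_mul := WordFun.zero_mul'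
    mul_zero := WordFun.mul_zero'
    mul_assoc := WordFun.mul_assoc'
    one_mul := WordFun.one_mul'
    mul_one := WordFun.mul_one' }

section Scalars

variable {R : Type*} [Semiring R] [Module R K]

@[simp] lemma dE_smul (x : X) (c : R) (F : WordFun X K) : dE x (c • F) = c • dE x F := rfl
@[simp] lemma dO_smul (x : X) (c : R) (F : WordFun X K) : dO x (c • F) = c • dO x F := rfl
@[simp] lemma par_smul [SMulCommClass R K K] (c : R) (F : WordFun X K) :
    par (c • F) = c • par F := by
  ext v w; simp only [par_apply, smul_apply, mul_smul_comm]

instance [SMulCommClass R K K] [IsScalarTower R K K] :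
    IsScalarTower R (WordFun X K) (WordFun X K) where
  smul_assoc c F G := by
    ext v w
    change (c • F * G) v w = c • (F * G) v w
    induction v generalizing F G with
    | nil => induction w generalizing F G with
      | nil => simp [mul_nil, smul_mul_assoc]
      | cons x w ih => simp only [mul_nil_cons, dO_smul, par_smul, ih, smul_add]
    | cons x v ih => simp only [mul_cons, dE_smul, ih, smul_add]

instance [SMulCommClass R K K] [IsScalarTower R K K] :
    SMulCommClass R (WordFun X K) (WordFun X K) where
  smul_comm c F G := by
    ext v w
    change c • (F * G) v w = (F * c • G) v w
    induction v generalizing F G with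
    | nil => induction w generalizing F G with
      | nil => simp [mul_nil, mul_smul_comm]
      | cons x w ih => simp only [mul_nil_cons, dO_smul, ← ih, smul_add]
    | cons x v ih => simp only [mul_cons, dE_smul, ← ih, smul_add]

end Scalars

/-! ### Degrees -/

/-- Word functions of degree `j`: these live on words with `-j` odd letters. -/
def HasDeg (j : ℤ) (F : WordFun X K) : Prop := ∀ v w, (w.length : ℤ) + j ≠ 0 → F v w = 0

lemma HasDeg.dE {j : ℤ} {F : WordFun X K} (h : HasDeg j F) (x : X) : HasDeg j (dE x F) :=
  fun v w hw => h _ _ hw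

lemma HasDeg.dO {j : ℤ} {F : WordFun X K} (h : HasDeg j F) (x : X) : HasDeg (j + 1) (dO x F) :=
  fun v w hw => h _ _ (by simp only [List.length_cons, Nat.cast_add, Nat.cast_one]; omega)

lemma HasDeg.par {j : ℤ} {F : WordFun X K} (h : HasDeg j F) : HasDeg j (par F) :=
  fun v w hw => by rw [par_apply, h v w hw, mul_zero]

lemma HasDeg.add {j : ℤ} {F G : WordFun X K} (h : HasDeg j F) (h' : HasDeg j G) :
    HasDeg j (F + G) := fun v w hw => by rw [add_apply, h v w hw, h' v w hw, add_zero]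

lemma HasDeg.congr {i j : ℤ} {F : WordFun X K} (h : HasDeg i F) (e : i = j) : HasDeg j F := e ▸ h

lemma hasDeg_zero (j : ℤ) : HasDeg j (0 : WordFun X K) := fun _ _ _ => rfl

lemma hasDeg_one : HasDeg 0 (1 : WordFun X K) := fun v w hw => by
  rw [one_apply, if_neg]; rintro ⟨-, rfl⟩; simp at hw

lemma HasDeg.par_eq {j : ℤ} {F : WordFun X K} (h : HasDeg j F) : WordFun.par F = sgn j • F := by
  ext v w
  rw [par_apply]
  by_cases hw : (w.length : ℤ) + j = 0
  · have : sgn j = (-1 : ℤˣ) ^ w.length := by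
      rw [sgn, show j = -(w.length : ℤ) by omega, Int.negOnePow_neg, Int.negOnePow_def]
      simp
    rw [this]
    rcases Nat.even_or_odd w.length with e | e <;>
      simp [e.neg_one_pow, Units.smul_def, show (((1:ℤˣ) • F) : WordFun X K) = F from one_smul _ _]
  · rw [h v w hw]
    change _ = ((sgn j : ℤˣ) : ℤ) • F v w
    rw [h v w hw]; simp

lemma HasDeg.mul {i j : ℤ} {F G : WordFun X K} (h : HasDeg i F) (h' : HasDeg j G) :
    HasDeg (i + j) (F * G) := by
  intro v w hw
  induction v generalizing F G i j with
  | nil => induction w generalizing F G i j with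
    | nil =>
      rw [mul_nil]
      by_cases hi : i = 0
      · rw [h' [] [] (by simp at hw ⊢; omega), mul_zero]
      · rw [h [] [] (by simpa using hi), zero_mul]
    | cons x w ih =>
      simp only [List.length_cons, Nat.cast_add, Nat.cast_one] at hw
      rw [mul_nil_cons, ih (h.dO x) h' (by omega), ih h.par (h'.dO x) (by omega), add_zero]
  | cons x v ih => rw [mul_cons, ih (h.dE x) h' hw, ih h (h'.dE x) hw, add_zero]

lemma units_smul_apply (s : ℤˣ) (F : WordFun X K) (v w) : (s • F) v w = ((s : ℤ) : K) * F v w := by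
  change (s : ℤ) • F v w = _
  rw [zsmul_eq_mul]

lemma sgn_add (i j : ℤ) : sgn (i + j) = sgn i * sgn j := Int.negOnePow_add i j

@[simp] lemma sgn_mul_self (i : ℤ) : sgn i * sgn i = 1 := by
  rw [← sgn_add]; exact Int.negOnePow_even _ ⟨i, rfl⟩

@[simp] lemma sgn_zero : sgn 0 = 1 := Int.negOnePow_zero
@[simp] lemma sgn_one : sgn 1 = -1 := Int.negOnePow_one

lemma HasDeg.mul_comm {i j : ℤ} {F G : WordFun X K} (h : HasDeg i F) (h' : HasDeg j G) :
    F * G = sgn (i * j) • (G * F) := by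
  ext v w
  rw [units_smul_apply]
  induction v generalizing F G i j with
  | nil => induction w generalizing F G i j with
    | nil =>
      rw [mul_nil, mul_nil]
      by_cases hi : i = 0
      · subst hi; simp [_root_.mul_comm]
      · rw [h [] [] (by simpa using hi)]; simp
    | cons x w ih =>
      have h1 := ih (h.dO x) h'
      have h2 := ih h (h'.dO x)
      rw [mul_nil_cons, mul_nil_cons, h.par_eq, h'.par_eq, smul_mul_assoc, smul_mul_assoc,
        units_smul_apply, units_smul_apply, h1, h2, add_mul, mul_add, one_mul, mul_one, sgn_add,
        sgn_add]
      have hi : ((sgn i : ℤ) : K) * ((sgn i : ℤ) : K) = 1 := by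
        exact_mod_cast congrArg (fun u : ℤˣ => (((u : ℤ)) : K)) (sgn_mul_self i)
      push_cast
      linear_combination ((sgn (i * j) : ℤ) : K) * (WordFun.dO x G * F) [] w * hi
  | cons x v ih =>
    rw [mul_cons, mul_cons, ih (h.dE x) h', ih h (h'.dE x)]; ring

/-! ### Derivations and second order operators -/

section Operators

variable {Y : Type*}

/-- Application of a linear functional to a family of word functions. -/
def intW (ℓ : (Y → K) →ₗ[K] K) (A : Y → WordFun X K) : WordFun X K :=
  fun v w => ℓ fun y => A y v w

variable (ℓ : (Y → K) →ₗ[K] K)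

lemma intW_apply (A : Y → WordFun X K) (v w) : intW ℓ A v w = ℓ fun y => A y v w := rfl

lemma intW_add (A B : Y → WordFun X K) :
    intW ℓ (fun y => A y + B y) = intW ℓ A + intW ℓ B := by
  ext v w
  exact map_add ℓ (fun y => A y v w) (fun y => B y v w)

lemma intW_smul (c : K) (A : Y → WordFun X K) :
    intW ℓ (fun y => c • A y) = c • intW ℓ A := by
  ext v w
  exact map_smul ℓ c (fun y => A y v w)

lemma intW_zero : intW ℓ (fun _ => (0 : WordFun X K)) = 0 := by
  ext v w
  exact map_zero ℓ

lemma intW_neg (A : Y → WordFun X K) : intW ℓ (fun y => -A y) = -intW ℓ A := by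
  ext v w
  exact map_neg ℓ (fun y => A y v w)

lemma intW_units_smul (s : ℤˣ) (A : Y → WordFun X K) :
    intW ℓ (fun y => s • A y) = s • intW ℓ A := by
  rcases Int.units_eq_one_or s with rfl | rfl
  · simp
  · simp only [Units.neg_smul, one_smul, intW_neg]

@[simp] lemma dE_intW (x : X) (A : Y → WordFun X K) :
    dE x (intW ℓ A) = intW ℓ fun y => dE x (A y) := rfl
@[simp] lemma dO_intW (x : X) (A : Y → WordFun X K) :
    dO x (intW ℓ A) = intW ℓ fun y => dO x (A y) := rfl

lemma par_intW (A : Y → WordFun X K) : par (intW ℓ A) = intW ℓ fun y => par (A y) := by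
  ext v w
  exact (map_smul ℓ ((-1 : K) ^ w.length) (fun y => A y v w)).symm

lemma intW_mul (A : Y → WordFun X K) (G : WordFun X K) :
    intW ℓ (fun y => A y * G) = intW ℓ A * G := by
  ext v w
  induction v generalizing A G with
  | nil => induction w generalizing A G with
    | nil =>
      simp only [intW_apply, mul_nil]
      have := map_smul ℓ (G [] []) (fun y => A y [] [])
      rw [_root_.mul_comm, ← smul_eq_mul, ← this]
      congr 1; funext y; simp [_root_.mul_comm]
    | cons x w ih =>
      have h1 := ih (fun y => dO x (A y)) G
      have h2 := ih (fun y => par (A y)) (dO x G)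
      rw [mul_nil_cons, par_intW, dO_intW, ← h1, ← h2]
      simp only [intW_apply, mul_nil_cons]
      exact map_add ℓ _ _
  | cons x v ih =>
    have h1 := ih (fun y => dE x (A y)) G
    have h2 := ih A (dE x G)
    rw [mul_cons, dE_intW, ← h1, ← h2]
    simp only [intW_apply, mul_cons]
    exact map_add ℓ _ _

lemma mul_intW (F : WordFun X K) (A : Y → WordFun X K) :
    intW ℓ (fun y => F * A y) = F * intW ℓ A := by
  ext v w
  induction v generalizing A F with
  | nil => induction w generalizing A F with
    | nil =>
      simp only [intW_apply, mul_nil]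
      exact map_smul ℓ (F [] []) (fun y => A y [] [])
    | cons x w ih =>
      have h1 := ih (dO x F) A
      have h2 := ih (par F) (fun y => dO x (A y))
      rw [mul_nil_cons, dO_intW, ← h1, ← h2]
      simp only [intW_apply, mul_nil_cons]
      exact map_add ℓ _ _
  | cons x v ih =>
    have h1 := ih (dE x F) A
    have h2 := ih F (fun y => dE x (A y))
    rw [mul_cons, dE_intW, ← h1, ← h2]
    simp only [intW_apply, mul_cons]
    exact map_add ℓ _ _

lemma intW_mul_eq_zero (A B : Y → WordFun X K)
    (h : ∀ v w v' w', ℓ (fun y => A y v w * B y v' w') = 0) :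
    intW ℓ (fun y => A y * B y) = 0 := by
  ext v w
  induction v generalizing A B with
  | nil => induction w generalizing A B with
    | nil => rw [intW_apply]; simp only [mul_nil]; exact h [] [] [] []
    | cons x w ih =>
      have h1 := ih (fun y => dO x (A y)) B fun v w v' w' => h _ _ _ _
      have h2 := ih (fun y => par (A y)) (fun y => dO x (B y)) fun v w v' w' => by
        have := map_smul ℓ ((-1 : K) ^ w.length) (fun y => A y v w * B y v' (x :: w'))
        rw [h, smul_zero] at this
        rw [← this]
        congr 1; funext y; simp [par_apply, mul_assoc]
      simp only [intW_apply, zero_apply, mul_nil_cons] at h1 h2 ⊢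
      rw [← add_zero (0 : K)]; nth_rewrite 1 [← h1]; rw [← h2]
      exact map_add ℓ _ _
  | cons x v ih =>
    have h1 := ih (fun y => dE x (A y)) B fun v w v' w' => h _ _ _ _
    have h2 := ih A (fun y => dE x (B y)) fun v w v' w' => h _ _ _ _
    simp only [intW_apply, zero_apply, mul_cons] at h1 h2 ⊢
    rw [← add_zero (0 : K)]; nth_rewrite 1 [← h1]; rw [← h2]
    exact map_add ℓ _ _

lemma hasDeg_intW {j : ℤ} {A : Y → WordFun X K} (h : ∀ y, HasDeg j (A y)) :
    HasDeg j (intW ℓ A) := fun v w hw => by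
  rw [intW_apply, show (fun y => A y v w) = 0 from funext fun y => h y v w hw, map_zero]

variable (L : (X → K) →ₗ[K] (X → K))

/-- Evaluation of `L` at a point. -/
def evalAt (x : X) : (X → K) →ₗ[K] K := (LinearMap.proj x).comp L

lemma evalAt_apply (x : X) (u : X → K) : evalAt L x u = L u x := rfl

/-- The odd derivation that turns one odd letter into an even letter and applies `L` to it. -/
def derAux : List X → List X → WordFun X K → K
  | [], _, _ => 0
  | x :: v, w, F => derAux v w (dE x F) + L (fun y => F v (y :: w)) x

/-- The odd derivation that turns one odd letter into an even letter and applies `L` to it. -/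
def der (F : WordFun X K) : WordFun X K := fun v w => derAux L v w F

@[simp] lemma der_nil (F : WordFun X K) (w) : der L F [] w = 0 := rfl

lemma dE_der (x : X) (F : WordFun X K) :
    dE x (der L F) = der L (dE x F) + intW (evalAt L x) fun y => dO y F := rfl

lemma der_cons (F : WordFun X K) (x v w) :
    der L F (x :: v) w = der L (dE x F) v w + L (fun y => F v (y :: w)) x := rfl

lemma der_add (F G : WordFun X K) : der L (F + G) = der L F + der L G := by
  ext v w
  induction v generalizing F G with
  | nil => simp
  | cons x v ih =>
    have : L (fun y => (F + G) v (y :: w)) x =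
        L (fun y => F v (y :: w)) x + L (fun y => G v (y :: w)) x :=
      congrFun (map_add L (fun y => F v (y :: w)) (fun y => G v (y :: w))) x
    simp only [add_apply, der_cons, map_add, ih] at this ⊢
    rw [this]; ring

lemma der_smul (c : K) (F : WordFun X K) : der L (c • F) = c • der L F := by
  ext v w
  induction v generalizing F with
  | nil => simp
  | cons x v ih =>
    have : L (fun y => (c • F) v (y :: w)) x = c • L (fun y => F v (y :: w)) x :=
      congrFun (map_smul L c (fun y => F v (y :: w))) x
    simp only [smul_apply, der_cons, dE_smul, ih] at this ⊢
    rw [this, smul_add]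

lemma nil_mul_apply (F G : WordFun X K) (h : ∀ w, F [] w = 0) (w) : (F * G) [] w = 0 := by
  induction w generalizing F G with
  | nil => simp [mul_nil, h]
  | cons x w ih =>
    rw [mul_nil_cons, ih (dO x F) G fun w => h _, ih (par F) (dO x G) fun w => by simp [par_apply, h],
      add_zero]

lemma mul_nil_apply (F G : WordFun X K) (h : ∀ w, G [] w = 0) (w) : (F * G) [] w = 0 := by
  induction w generalizing F G with
  | nil => simp [mul_nil, h]
  | cons x w ih => rw [mul_nil_cons, ih (dO x F) G h, ih (par F) (dO x G) fun w => h _, add_zero]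

lemma der_par (F : WordFun X K) : der L (par F) = -par (der L F) := by
  ext v w
  induction v generalizing F with
  | nil => simp [par_apply]
  | cons x v ih =>
    have : L (fun y => par F v (y :: w)) x = -((-1) ^ w.length * L (fun y => F v (y :: w)) x) := by
      have := congrFun (map_smul L (-(-1 : K) ^ w.length) (fun y => F v (y :: w))) x
      simp only [Pi.smul_apply, smul_eq_mul, neg_mul] at this
      rw [← this]
      refine congrArg (fun u => L u x) (funext fun y => ?_)
      simp [par_apply, pow_succ]
    have h := ih (dE x F)
    simp only [neg_apply, par_apply, der_cons, dE_par] at this h ⊢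
    rw [h, this]; ring

lemma der_mul (F G : WordFun X K) : der L (F * G) = der L F * G + par F * der L G := by
  ext v w
  induction v generalizing F G with
  | nil =>
    rw [add_apply, nil_mul_apply (der L F) G (fun _ => rfl),
      mul_nil_apply (par F) (der L G) (fun _ => rfl), der_nil, add_zero]
  | cons x v ih =>
    have h : ∀ v w, L (fun y => (F * G) v (y :: w)) x =
        (intW (evalAt L x) (fun y => dO y F) * G + par F * intW (evalAt L x) fun y => dO y G) v w := by
      intro v w
      rw [← intW_mul, ← mul_intW, ← intW_add]
      simp only [← dO_mul]; rfl
    rw [der_cons, h, dE_mul, der_add, add_apply, ih, ih]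
    simp only [add_apply]
    rw [mul_cons (der L F), mul_cons (par F)]
    simp only [dE_der, dE_par, add_mul, mul_add, add_apply]
    ring

lemma HasDeg.der {j : ℤ} {F : WordFun X K} (h : HasDeg j F) : HasDeg (j + 1) (der L F) := by
  intro v w hw
  induction v generalizing F with
  | nil => rfl
  | cons x v ih =>
    rw [der_cons, ih (h.dE x), show (fun y => F v (y :: w)) = 0 from funext fun y => h _ _ (by
      simp only [List.length_cons, Nat.cast_add, Nat.cast_one]; omega)]
    simp

variable (I : (X × X → K) →ₗ[K] K)

/-- The second order operator contracting an odd with an even letter. -/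
def lap (F : WordFun X K) : WordFun X K := intW I fun p => dO p.1 (dE p.2 F)

/-- The bracket of the contraction `I`. -/
def bra (F G : WordFun X K) : WordFun X K :=
  intW I fun p => dO p.1 F * dE p.2 G + par (dE p.2 F) * dO p.1 G

lemma lap_add (F G : WordFun X K) : lap I (F + G) = lap I F + lap I G := by
  simp only [lap, map_add, intW_add]

lemma lap_smul (c : K) (F : WordFun X K) : lap I (c • F) = c • lap I F := by
  simp only [lap, dE_smul, dO_smul, intW_smul]

lemma lap_units_smul (c : ℤˣ) (F : WordFun X K) : lap I (c • F) = c • lap I F := by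
  rcases Int.units_eq_one_or c with rfl | rfl
  · simp
  · simp only [Units.neg_smul, one_smul, lap, map_neg, intW_neg]

lemma bra_add (F G H : WordFun X K) : bra I F (G + H) = bra I F G + bra I F H := by
  simp only [bra, map_add, mul_add]
  rw [← intW_add]
  congr 1; funext p; abel

lemma add_bra (F G H : WordFun X K) : bra I (F + G) H = bra I F H + bra I G H := by
  simp only [bra, map_add, add_mul]
  rw [← intW_add]
  congr 1; funext p; abel

lemma bra_smul (c : K) (F G : WordFun X K) : bra I F (c • G) = c • bra I F G := by
  simp only [bra, dE_smul, dO_smul, mul_smul_comm, ← smul_add, intW_smul]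

lemma smul_bra (c : K) (F G : WordFun X K) : bra I (c • F) G = c • bra I F G := by
  simp only [bra, dE_smul, dO_smul, par_smul, smul_mul_assoc, ← smul_add, intW_smul]

lemma bra_zero (F : WordFun X K) : bra I F 0 = 0 := by
  simpa using bra_smul I (0 : K) F 0

lemma bra_units_smul (c : ℤˣ) (F G : WordFun X K) : bra I F (c • G) = c • bra I F G := by
  rcases Int.units_eq_one_or c with rfl | rfl
  · simp
  · simpa using bra_smul I (-1) F G

lemma lap_mul (F G : WordFun X K) :
    lap I (F * G) = lap I F * G + par F * lap I G + bra I F G := by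
  simp only [lap, bra, dE_mul, dO_mul, map_add]
  rw [← intW_mul, ← mul_intW, ← intW_add, ← intW_add]
  congr 1; funext p; abel

lemma HasDeg.lap {j : ℤ} {F : WordFun X K} (h : HasDeg j F) : HasDeg (j + 1) (lap I F) :=
  hasDeg_intW _ fun p => (h.dE p.2).dO p.1

lemma HasDeg.bra {i j : ℤ} {F G : WordFun X K} (h : HasDeg i F) (h' : HasDeg j G) :
    HasDeg (i + j + 1) (bra I F G) :=
  hasDeg_intW _ fun p => ((h.dO p.1).mul (h'.dE p.2) |>.congr (by ring)).add
    ((h.dE p.2).par.mul (h'.dO p.1) |>.congr (by ring))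

lemma HasDeg.bra_comm {i j : ℤ} {F G : WordFun X K} (h : HasDeg i F) (h' : HasDeg j G) :
    WordFun.bra I F G = sgn (i * j) • WordFun.bra I G F := by
  rw [WordFun.bra, WordFun.bra, ← intW_units_smul]
  congr 1; funext p
  rw [(h.dE p.2).par_eq, (h'.dE p.2).par_eq, (h.dO p.1).mul_comm (h'.dE p.2), smul_mul_assoc,
    (h.dE p.2).mul_comm (h'.dO p.1), smul_mul_assoc, smul_add, add_comm, smul_smul, smul_smul]
  congr 2
  · rw [mul_add, mul_one, sgn_add, _root_.mul_comm, mul_assoc, sgn_mul_self, mul_one]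
  · rw [add_mul, one_mul, sgn_add]

lemma HasDeg.bra_mul {i j : ℤ} {F G : WordFun X K} (h : HasDeg i F) (h' : HasDeg j G)
    (H : WordFun X K) : WordFun.bra I F (G * H) =
      WordFun.bra I F G * H + sgn ((i + 1) * j) • (G * WordFun.bra I F H) := by
  simp only [WordFun.bra, dE_mul, dO_mul]
  rw [← intW_mul, ← mul_intW, ← intW_units_smul, ← intW_add]
  congr 1; funext p
  rw [mul_add, mul_add, mul_add, add_mul, ← mul_assoc, ← mul_assoc, ← mul_assoc, ← mul_assoc,
    ← mul_assoc, ← mul_assoc, (h.dO p.1).mul_comm h', (h.dE p.2).par.mul_comm h'.par,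
    h'.par_eq, smul_add]
  simp only [smul_mul_assoc]
  rw [smul_smul (sgn (i * j))]
  rw [show sgn (i * j) * sgn j = sgn ((i + 1) * j) by rw [add_mul, one_mul, sgn_add]]
  abel

section Formal

variable {I} {i j : ℤ} {F G : WordFun X K} (H : WordFun X K)

lemma HasDeg.lap_mul (h : HasDeg i F) (G : WordFun X K) : WordFun.lap I (F * G) =
    WordFun.lap I F * G + sgn i • (F * WordFun.lap I G) + WordFun.bra I F G := by
  rw [WordFun.lap_mul, h.par_eq, smul_mul_assoc]

lemma lap_bra (h : HasDeg i F) (hF : lap I (lap I F) = 0) (hG : lap I (lap I G) = 0)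
    (hFG : lap I (lap I (F * G)) = 0) :
    lap I (bra I F G) = -bra I (lap I F) G - sgn i • bra I F (lap I G) := by
  rw [h.lap_mul, lap_add, lap_add, lap_units_smul, h.lap_mul, (h.lap I).lap_mul, hF, hG,
    sgn_add] at hFG
  simp only [zero_mul, mul_zero, smul_zero, smul_add, smul_smul, sgn_one, mul_neg, mul_one,
    Units.neg_smul, zero_add, add_zero] at hFG
  rw [← sub_eq_zero]
  exact Eq.trans (by abel1) hFG

lemma jacobi_of_lap (h : HasDeg i F) (h' : HasDeg j G) (hF : lap I (lap I F) = 0)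
    (hG : lap I (lap I G) = 0) (hH : lap I (lap I H) = 0) (hFG : lap I (lap I (F * G)) = 0)
    (hFH : lap I (lap I (F * H)) = 0) (hGH : lap I (lap I (G * H)) = 0)
    (hFGH : lap I (lap I (F * (G * H))) = 0) :
    bra I F (bra I G H) = sgn (i + 1) • bra I (bra I F G) H
      + sgn ((i + 1) * (j + 1)) • bra I G (bra I F H) := by
  have key := lap_bra h hF hGH hFGH
  rw [h.bra_mul I h', lap_add, lap_units_smul, (h.bra I h').lap_mul, h'.lap_mul,
    (h.lap I).bra_mul I h', h'.lap_mul, bra_add, bra_add, h.bra_mul I (h'.lap I),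
    lap_bra h hF hG hFG, lap_bra h hF hH hFH, bra_units_smul, h.bra_mul I h'] at key
  have e1 : sgn (i + 1) = -sgn i := by rw [sgn_add]; simp
  have e2 : sgn ((i + 1) * j) = sgn (i * j) * sgn j := by rw [add_mul, one_mul, sgn_add]
  have e3 : sgn ((i + 1) * (j + 1)) = -(sgn (i * j) * sgn j * sgn i) := by
    rw [mul_add, mul_one, sgn_add, e2, e1]; simp
  have e4 : sgn ((i + 1 + 1) * j) = sgn (i * j) := by
    rw [add_mul, one_mul, sgn_add, e2, mul_assoc, sgn_mul_self, mul_one]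
  have e5 : sgn (i + j + 1) = -(sgn i * sgn j) := by rw [sgn_add, sgn_add]; simp
  rw [e2, e3, e4, e5] at key
  rw [e1, e3]
  generalize sgn (i * j) = a at *
  generalize sgn i = b at *
  generalize sgn j = c at *
  rcases Int.units_eq_one_or a with rfl | rfl <;> rcases Int.units_eq_one_or b with rfl | rfl <;>
    rcases Int.units_eq_one_or c with rfl | rfl <;>
    simp only [one_smul, neg_smul, one_mul, mul_one, neg_neg, mul_neg, neg_mul, Units.neg_smul,
      sub_mul, mul_sub, smul_add, smul_sub, smul_neg] at key ⊢ <;>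
    (rw [← sub_eq_zero] at key ⊢
     first
      | exact Eq.trans (by abel1) key
      | exact Eq.trans (by abel1) (neg_eq_zero.2 key))

lemma der_bra (h : HasDeg i F) {L : (X → K) →ₗ[K] (X → K)}
    (hF : der L (lap I F) = -lap I (der L F)) (hG : der L (lap I G) = -lap I (der L G))
    (hFG : der L (lap I (F * G)) = -lap I (der L (F * G))) :
    der L (bra I F G) = -bra I (der L F) G - sgn i • bra I F (der L G) := by
  have hd : ∀ (s : ℤˣ) (A : WordFun X K), der L (s • A) = s • der L A := by
    intro s A
    rcases Int.units_eq_one_or s with rfl | rfl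
    · simp
    · simpa using der_smul L (-1) A
  rw [h.lap_mul, der_add, der_add, hd, der_mul, der_mul, der_mul, h.par_eq, lap_add,
    smul_mul_assoc, smul_mul_assoc, lap_units_smul, h.lap_mul, (h.der L).lap_mul, hF, hG, (h.lap I).par_eq, sgn_add] at hFG
  generalize sgn i = b at *
  rcases Int.units_eq_one_or b with rfl | rfl <;>
    simp only [one_smul, sgn_one, one_mul, mul_one, neg_neg, mul_neg, neg_mul, Units.neg_smul, smul_mul_assoc,
      smul_add, smul_neg] at hFG ⊢ <;>
    (rw [← sub_eq_zero] at hFG ⊢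
     exact Eq.trans (by abel1) hFG)

end Formal

lemma bra_eq_zero {F G : WordFun X K}
    (h : ∀ v w v' w', I (fun p => F v (p.1 :: w) * G (p.2 :: v') w') = 0)
    (h' : ∀ v w v' w', I (fun p => F (p.2 :: v) w * G v' (p.1 :: w')) = 0) :
    bra I F G = 0 := by
  have h1 := intW_mul_eq_zero I (fun p => dO p.1 F) (fun p => dE p.2 G) h
  rw [bra, intW_add, h1, intW_mul_eq_zero I (fun p => par (dE p.2 F)) (fun p => dO p.1 G), add_zero]
  intro v w v' w'
  have := map_smul I ((-1 : K) ^ w.length) (fun p => F (p.2 :: v) w * G v' (p.1 :: w'))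
  rw [h', smul_zero] at this
  rw [← this]
  congr 1; funext y; simp [par_apply, mul_assoc]

end Operators

/-! ### Linear generators -/

/-- The even linear generator. -/
def genE (u : X → K) : WordFun X K
  | [x], [] => u x
  | _, _ => 0

/-- The odd linear generator. -/
def genO (u : X → K) : WordFun X K
  | [], [x] => u x
  | _, _ => 0

@[simp] lemma genE_nil (u : X → K) (w) : genE u [] w = 0 := rfl
@[simp] lemma genO_nil (u : X → K) : genO u [] [] = 0 := rfl

@[simp] lemma dE_genE (u : X → K) (x) : dE x (genE u) = u x • 1 := by
  ext v w
  rcases v with _ | ⟨y, v⟩ <;> rcases w with _ | ⟨z, w⟩ <;> simp [genE, one_apply]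

@[simp] lemma dO_genE (u : X → K) (x) : dO x (genE u) = 0 := by
  ext v w
  rcases v with _ | ⟨y, _ | ⟨y', v⟩⟩ <;> simp [genE]

@[simp] lemma dO_genO (u : X → K) (x) : dO x (genO u) = u x • 1 := by
  ext v w
  rcases v with _ | ⟨y, v⟩ <;> rcases w with _ | ⟨z, w⟩ <;> simp [genO, one_apply]

@[simp] lemma dE_genO (u : X → K) (x) : dE x (genO u) = 0 := by
  ext v w
  simp [genO]

@[simp] lemma par_genE (u : X → K) : par (genE u) = genE u := by
  ext v w
  rcases v with _ | ⟨y, _ | ⟨y', v⟩⟩ <;> rcases w with _ | ⟨z, w⟩ <;> simp [genE, par_apply]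

@[simp] lemma par_genO (u : X → K) : par (genO u) = -genO u := by
  ext v w
  rcases v with _ | ⟨y, v⟩ <;> rcases w with _ | ⟨z, _ | ⟨z', w⟩⟩ <;> simp [genO, par_apply]

lemma der_genO (L : (X → K) →ₗ[K] (X → K)) (u : X → K) : der L (genO u) = genE (L u) := by
  ext v w
  rcases v with _ | ⟨x, v⟩
  · rfl
  · rw [der_cons, dE_genO, show der L (0 : WordFun X K) = 0 by simpa using der_smul L 0 0]
    rcases v with _ | ⟨y, v⟩
    · rcases w with _ | ⟨z, w⟩
      · simp [genO, genE]
      · rw [show (fun y => genO u [] (y :: z :: w)) = 0 from rfl]; simp [genE]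
    · rw [show (fun z => genO u (y :: v) (z :: w)) = 0 from rfl]; simp [genE]

lemma der_genE (L : (X → K) →ₗ[K] (X → K)) (u : X → K) : der L (genE u) = 0 := by
  ext v w
  induction v with
  | nil => rfl
  | cons x v ih =>
    rw [der_cons, dE_genE, der_smul]
    have h1 : der L (1 : WordFun X K) = 0 := by
      have := der_mul L (1 : WordFun X K) 1
      simpa using this
    have : (fun y => genE u v (y :: w)) = 0 := by
      funext y; exact congrFun (congrFun (dO_genE u y) v) w
    rw [h1, this]; simp

lemma lap_genE (I : (X × X → K) →ₗ[K] K) (u : X → K) : lap I (genE u) = 0 := by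
  rw [lap, ← intW_zero (X := X) I]; congr 1; funext p; simp

lemma lap_genO (I : (X × X → K) →ₗ[K] K) (u : X → K) : lap I (genO u) = 0 := by
  rw [lap, ← intW_zero (X := X) I]
  exact congrArg (intW I) (funext fun p => by simp)

lemma lap_one (I : (X × X → K) →ₗ[K] K) : lap I (1 : WordFun X K) = 0 := by
  rw [lap, ← intW_zero (X := X) I]
  exact congrArg (intW I) (funext fun p => by simp)

lemma der_one (L : (X → K) →ₗ[K] (X → K)) : der L (1 : WordFun X K) = 0 := by
  simpa using der_mul L (1 : WordFun X K) 1

lemma bra_genO_genE (I : (X × X → K) →ₗ[K] K) (u t : X → K) :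
    bra I (genO u) (genE t) = I (fun p => u p.1 * t p.2) • 1 := by
  ext v w
  simp only [bra, dO_genO, dE_genE, dE_genO, map_zero, zero_mul, add_zero, intW_apply, smul_apply,
    smul_mul_smul_comm, one_mul, smul_eq_mul]
  rw [_root_.mul_comm, ← smul_eq_mul, ← map_smul]
  congr 1; funext p; simp [_root_.mul_comm]

lemma bra_genO_genO (I : (X × X → K) →ₗ[K] K) (u t : X → K) : bra I (genO u) (genO t) = 0 := by
  rw [bra, ← intW_zero (X := X) I]; congr 1; funext p; simp

lemma bra_genE_genE (I : (X × X → K) →ₗ[K] K) (u t : X → K) : bra I (genE u) (genE t) = 0 := by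
  rw [bra, ← intW_zero (X := X) I]; congr 1; funext p; simp

end WordFun
end Words

/-! ## Ordered products -/

section OrderedProducts

variable {ι κ : Type*} [LinearOrder ι] [LinearOrder κ]

/-- The product of a finite family, in increasing order. -/
def oprod {R : Type*} [Monoid R] (s : Finset ι) (a : ι → R) : R := (s.sort.map a).prod

section Monoid

variable {R : Type*} [Monoid R]

@[simp] lemma oprod_empty (a : ι → R) : oprod ∅ a = 1 := by simp [oprod]

lemma notMem_of_lt {s : Finset ι} {m : ι} (h : ∀ x ∈ s, m < x) : m ∉ s :=
  fun hm => lt_irrefl _ (h m hm)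

lemma oprod_insert_min {s : Finset ι} {m : ι} (h : ∀ x ∈ s, m < x) (a : ι → R) :
    oprod (insert m s) a = a m * oprod s a := by
  rw [oprod, Finset.sort_insert _ (fun b hb => (h b hb).le) (notMem_of_lt h), List.map_cons,
    List.prod_cons, oprod]

lemma oprod_congr {s : Finset ι} {a b : ι → R} (h : ∀ i ∈ s, a i = b i) : oprod s a = oprod s b := by
  rw [oprod, oprod, List.map_congr_left fun i hi => h i ((Finset.mem_sort _).1 hi)]

lemma oprod_one (s : Finset ι) : oprod s (fun _ => (1 : R)) = 1 := by
  induction s using Finset.induction_on_min with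
  | empty => simp
  | insert m s hm ih => rw [oprod_insert_min hm, ih, one_mul]

lemma oprod_map {s : Finset ι} (e : ι ↪ κ) (he : StrictMono e) (a : κ → R) :
    oprod (s.map e) a = oprod s (a ∘ e) := by
  induction s using Finset.induction_on_min with
  | empty => simp
  | insert m s hm ih =>
    rw [Finset.map_insert, oprod_insert_min, oprod_insert_min hm, ih]; rfl
    intro x hx
    obtain ⟨y, hy, rfl⟩ := Finset.mem_map.1 hx
    exact he (hm y hy)

lemma oprod_union {s t : Finset ι} (h : ∀ x ∈ s, ∀ y ∈ t, x < y) (a : ι → R) :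
    oprod (s ∪ t) a = oprod s a * oprod t a := by
  induction s using Finset.induction_on_min with
  | empty => simp
  | insert m s hm ih =>
    rw [Finset.insert_union, oprod_insert_min, oprod_insert_min hm, mul_assoc,
      ih fun x hx => h x (Finset.mem_insert_of_mem hx)]
    intro x hx
    rcases Finset.mem_union.1 hx with hx | hx
    · exact hm x hx
    · exact h m (Finset.mem_insert_self _ _) x hx

lemma oprod_update_of_notMem {s : Finset ι} {i : ι} (hi : i ∉ s) (a : ι → R) (x : R) :
    oprod s (Function.update a i x) = oprod s a :=
  oprod_congr fun j hj => Function.update_of_ne (by rintro rfl; exact hi hj) _ _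

lemma exists_oprod_update (s : Finset ι) {i : ι} (hi : i ∈ s) (a : ι → R) :
    ∃ A B, ∀ x, oprod s (Function.update a i x) = A * x * B := by
  induction s using Finset.induction_on_min with
  | empty => simp at hi
  | insert m s hm ih =>
    rcases Finset.mem_insert.1 hi with rfl | hi
    · refine ⟨1, oprod s a, fun x => ?_⟩
      rw [oprod_insert_min hm, Function.update_self, oprod_update_of_notMem (notMem_of_lt hm),
        one_mul]
    · obtain ⟨A, B, h⟩ := ih hi
      refine ⟨a m * A, B, fun x => ?_⟩
      rw [oprod_insert_min hm, h, Function.update_of_ne (hm i hi).ne]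
      simp only [mul_assoc]

lemma oprod_sigma {ι : Type*} [LinearOrder ι] [Fintype ι] {κ : ι → Type*} [∀ i, Fintype (κ i)]
    [∀ i, LinearOrder (κ i)] (a : (Σₗ i, κ i) → R) :
    oprod Finset.univ (fun i => oprod Finset.univ fun j => a (toLex ⟨i, j⟩)) =
      oprod Finset.univ a := by
  have key : ∀ s : Finset ι, oprod s (fun i => oprod Finset.univ fun j => a (toLex ⟨i, j⟩)) =
      oprod (Finset.univ.filter fun p : Σₗ i, κ i => (ofLex p).1 ∈ s) a := by
    intro s
    induction s using Finset.induction_on_min with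
    | empty => simp
    | insert m s hm ih =>
      let e : κ m ↪ Σₗ i, κ i :=
        ⟨fun j => toLex ⟨m, j⟩, fun j j' h => by simpa using congrArg ofLex h⟩
      have he : StrictMono e := fun j j' h => Sigma.Lex.right _ _ h
      have hs : (Finset.univ.filter fun p : Σₗ i, κ i => (ofLex p).1 ∈ insert m s) =
          Finset.univ.map e ∪ Finset.univ.filter fun p : Σₗ i, κ i => (ofLex p).1 ∈ s := by
        ext p
        rw [Finset.mem_union, Finset.mem_filter, Finset.mem_filter, Finset.mem_insert,
          Finset.mem_map]
        constructor
        · rintro ⟨hu, h | h⟩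
          · obtain ⟨i, j⟩ := p
            obtain rfl : i = m := h
            exact Or.inl ⟨j, Finset.mem_univ _, rfl⟩
          · exact Or.inr ⟨hu, h⟩
        · rintro (⟨j, -, rfl⟩ | ⟨hu, h⟩)
          · exact ⟨Finset.mem_univ _, Or.inl rfl⟩
          · exact ⟨hu, Or.inr h⟩
      have hlt : ∀ x ∈ Finset.univ.map e,
          ∀ y ∈ Finset.univ.filter fun p : Σₗ i, κ i => (ofLex p).1 ∈ s, x < y := by
        intro x hx y hy
        obtain ⟨j, -, rfl⟩ := Finset.mem_map.1 hx
        exact Sigma.Lex.left _ _ (hm _ (Finset.mem_filter.1 hy).2)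
      have hu := oprod_union hlt a
      rw [oprod_insert_min hm, ih, hs]
      refine Eq.trans ?_ (Eq.trans hu.symm (by congr!))
      rw [oprod_map e he]; rfl
  simpa using key Finset.univ

end Monoid

lemma sgn_sum (s : Finset ι) (k : ι → ℤ) : sgn (∑ i ∈ s, k i) = ∏ i ∈ s, sgn (k i) := by
  induction s using Finset.induction_on_min with
  | empty => simp
  | insert m s hm ih =>
    rw [Finset.sum_insert (notMem_of_lt hm), Finset.prod_insert (notMem_of_lt hm),
      WordFun.sgn_add, ih]

lemma prod_pairs_insert {s : Finset ι} {m : ι} (h : ∀ x ∈ s, m < x) (g : ι × ι → ℤˣ)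
    (hg : ∀ p, ¬ p.1 < p.2 → g p = 1) :
    ∏ p ∈ insert m s ×ˢ insert m s, g p = (∏ q ∈ s, g (m, q)) * ∏ p ∈ s ×ˢ s, g p := by
  have hm := notMem_of_lt h
  rw [Finset.prod_product, Finset.prod_product, Finset.prod_insert hm, Finset.prod_insert hm,
    hg (m, m) (lt_irrefl _), one_mul]
  congr 1
  refine Finset.prod_congr rfl fun x hx => ?_
  rw [Finset.prod_insert hm, hg (x, m) (h x hx).not_gt, one_mul]

namespace WordFun

variable {X K : Type*} [CommRing K] {a b : ι → WordFun X K} {k l : ι → ℤ}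

lemma hasDeg_oprod (s : Finset ι) (ha : ∀ i ∈ s, HasDeg (k i) (a i)) :
    HasDeg (∑ i ∈ s, k i) (oprod s a) := by
  induction s using Finset.induction_on_min with
  | empty => simpa using hasDeg_one
  | insert m s hm ih =>
    rw [oprod_insert_min hm, Finset.sum_insert (notMem_of_lt hm)]
    exact (ha m (Finset.mem_insert_self _ _)).mul
      (ih fun i hi => ha i (Finset.mem_insert_of_mem hi))

lemma mul_units_smul (s : ℤˣ) (F G : WordFun X K) : F * (s • G) = s • (F * G) := by
  rcases Int.units_eq_one_or s with rfl | rfl <;> simp [Units.neg_smul]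

lemma oprod_insert (s : Finset ι) {i : ι} (hi : i ∉ s) (ha : ∀ j, HasDeg (k j) (a j)) :
    oprod (insert i s) a = sgn (k i * ∑ j ∈ s with j < i, k j) • (a i * oprod s a) := by
  induction s using Finset.induction_on_min with
  | empty => simpa using oprod_insert_min (s := ∅) (m := i) (by simp) a
  | insert m s hm ih =>
    have him : i ≠ m := by rintro rfl; exact hi (Finset.mem_insert_self _ _)
    have his : i ∉ s := fun h => hi (Finset.mem_insert_of_mem h)
    rcases lt_or_gt_of_ne him with h | h
    · rw [oprod_insert_min, Finset.filter_false_of_mem]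
      · simp
      · intro x hx
        rcases Finset.mem_insert.1 hx with rfl | hx
        · exact h.not_gt
        · exact (h.trans (hm x hx)).not_gt
      · intro x hx
        rcases Finset.mem_insert.1 hx with rfl | hx
        · exact h
        · exact h.trans (hm x hx)
    · rw [Finset.insert_comm, oprod_insert_min, ih his, oprod_insert_min hm, mul_units_smul,
        ← mul_assoc, (ha m).mul_comm (ha i), smul_mul_assoc, smul_smul, Finset.filter_insert,
        if_pos h, Finset.sum_insert, mul_assoc, mul_add, sgn_add, mul_comm (k m), mul_comm (sgn _)]
      · intro hm'; exact notMem_of_lt hm (Finset.mem_filter.1 hm').1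
      · intro x hx
        rcases Finset.mem_insert.1 hx with rfl | hx
        · exact h
        · exact hm x hx

lemma oprod_reorder [Fintype κ] (σ : κ ≃ ι) (s : Finset κ) (ha : ∀ j, HasDeg (k j) (a j)) :
    oprod s (fun c => a (σ c)) = (∏ p ∈ s ×ˢ s,
      if p.1 < p.2 ∧ σ p.2 < σ p.1 then sgn (k (σ p.1) * k (σ p.2)) else 1) •
        oprod (s.map σ.toEmbedding) a := by
  induction s using Finset.induction_on_min with
  | empty => simp
  | insert m s hm ih =>
    rw [prod_pairs_insert hm _ (fun p hp => if_neg fun h => hp h.1), oprod_insert_min hm, ih,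
      Finset.map_insert, oprod_insert _ _ ha, mul_units_smul, smul_smul]
    · congr 1
      rw [mul_right_comm]
      refine (mul_eq_right.2 ?_).symm
      rw [Finset.mul_sum, sgn_sum, Finset.prod_filter, Finset.prod_map, ← Finset.prod_mul_distrib]
      refine Finset.prod_eq_one fun x hx => ?_
      by_cases h : σ x < σ m
      · simp [h, hm x hx]
      · simp [h]
    · intro h
      obtain ⟨x, hx, h⟩ := Finset.mem_map.1 h
      rw [σ.toEmbedding.injective h] at hx
      exact notMem_of_lt hm hx

section Operators

variable {L : (X → K) →ₗ[K] (X → K)} {I : (X × X → K) →ₗ[K] K} (h : K)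

/-- The total differential. -/
def dW (L : (X → K) →ₗ[K] (X → K)) (I : (X × X → K) →ₗ[K] K) (h : K) (F : WordFun X K) :
    WordFun X K := der L F + h • lap I F

lemma HasDeg.dW {j : ℤ} {F : WordFun X K} (hF : HasDeg j F) : HasDeg (j + 1) (dW L I h F) :=
  (hF.der L).add fun v w hw => by rw [smul_apply, hF.lap I v w hw, smul_zero]

lemma HasDeg.dW_mul {j : ℤ} {F : WordFun X K} (hF : HasDeg j F) (G : WordFun X K) :
    WordFun.dW L I h (F * G) = WordFun.dW L I h F * G + sgn j • (F * WordFun.dW L I h G)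
      + h • WordFun.bra I F G := by
  have e : ∀ (s : ℤˣ) (c : K) (A : WordFun X K), s • c • A = c • s • A := by
    intro s c A; rcases Int.units_eq_one_or s with rfl | rfl <;> simp [Units.neg_smul]
  simp only [WordFun.dW]
  rw [der_mul, hF.lap_mul, hF.par_eq, smul_mul_assoc]
  simp only [add_mul, mul_add, smul_add, smul_mul_assoc, mul_smul_comm, e]
  abel

lemma bra_oprod_eq_zero (s : Finset ι) {x : WordFun X K} {j : ℤ} (hx : HasDeg j x)
    (ha : ∀ i, HasDeg (k i) (a i)) (h : ∀ i ∈ s, bra I x (a i) = 0) : bra I x (oprod s a) = 0 := by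
  induction s using Finset.induction_on_min with
  | empty =>
    have := hx.bra_mul I hasDeg_one 1
    simpa using this
  | insert m s hm ih =>
    rw [oprod_insert_min hm, hx.bra_mul I (ha m), h m (Finset.mem_insert_self _ _),
      ih fun i hi => h i (Finset.mem_insert_of_mem hi)]
    simp

lemma sum_oprod_update_insert {s : Finset ι} {m : ι} (hm : ∀ x ∈ s, m < x) (k : ι → ℤ)
    (a c : ι → WordFun X K) :
    ∑ i ∈ insert m s, sgn (∑ j ∈ insert m s with j < i, k j) •
      oprod (insert m s) (Function.update a i (c i)) = c m * oprod s a + sgn (k m) • (a m *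
        ∑ i ∈ s, sgn (∑ j ∈ s with j < i, k j) • oprod s (Function.update a i (c i))) := by
  have hm' := notMem_of_lt hm
  rw [Finset.sum_insert hm', Finset.mul_sum, Finset.smul_sum]
  congr 1
  · rw [oprod_insert_min hm, Function.update_self, oprod_update_of_notMem hm',
      Finset.filter_false_of_mem, Finset.sum_empty, sgn_zero, one_smul]
    intro x hx
    rcases Finset.mem_insert.1 hx with rfl | hx
    · exact lt_irrefl _
    · exact (hm x hx).not_gt
  · refine Finset.sum_congr rfl fun i hi => ?_
    rw [oprod_insert_min hm, Function.update_of_ne (hm i hi).ne, mul_units_smul, smul_smul,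
      Finset.filter_insert, if_pos (hm i hi), Finset.sum_insert, sgn_add]
    exact fun h => hm' (Finset.mem_filter.1 h).1

lemma dW_oprod (s : Finset ι) (ha : ∀ i, HasDeg (k i) (a i))
    (hbr : ∀ i j, i ≠ j → bra I (a i) (a j) = 0) :
    dW L I h (oprod s a) = ∑ i ∈ s, sgn (∑ j ∈ s with j < i, k j) •
      oprod s (Function.update a i (dW L I h (a i))) := by
  induction s using Finset.induction_on_min with
  | empty => simp [dW, der_one, lap_one]
  | insert m s hm ih =>
    rw [oprod_insert_min hm, (ha m).dW_mul, bra_oprod_eq_zero s (ha m) ha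
      fun i hi => hbr _ _ (hm i hi).ne, smul_zero, add_zero, ih, sum_oprod_update_insert hm]

lemma oprod_mul_oprod (s : Finset ι) (ha : ∀ i, HasDeg (k i) (a i)) (hb : ∀ i, HasDeg (l i) (b i)) :
    oprod s a * oprod s b = (∏ p ∈ s ×ˢ s, if p.1 < p.2 then sgn (k p.2 * l p.1) else 1) •
      oprod s (fun i => a i * b i) := by
  induction s using Finset.induction_on_min with
  | empty => simp
  | insert m s hm ih =>
    rw [prod_pairs_insert hm _ (fun p hp => if_neg hp), oprod_insert_min hm, oprod_insert_min hm,
      oprod_insert_min hm, mul_assoc, ← mul_assoc (oprod s a),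
      (hasDeg_oprod s fun i _ => ha i).mul_comm (hb m), smul_mul_assoc, mul_assoc, ih,
      mul_units_smul, mul_units_smul, mul_units_smul, smul_smul, mul_assoc, Finset.sum_mul, sgn_sum]
    congr 2
    exact Finset.prod_congr rfl fun i hi => by rw [if_pos (hm i hi)]

lemma bra_comm_eq_zero {F G : WordFun X K} {i j : ℤ} (hF : HasDeg i F) (hG : HasDeg j G)
    (h : bra I F G = 0) : bra I G F = 0 := by
  rw [hG.bra_comm I hF, h, smul_zero]

lemma bra_mul_mul {x y A B : WordFun X K} {kx ky kA kB : ℤ} (hx : HasDeg kx x) (hy : HasDeg ky y)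
    (hA : HasDeg kA A) (hB : HasDeg kB B) (h1 : bra I x B = 0) (h2 : bra I A y = 0) :
    bra I (x * A) (y * B) = sgn (kA * ky) • (bra I x y * (A * B) +
      sgn (kx + ky) • (x * y * bra I A B)) := by
  have e1 : bra I (x * A) y = sgn (kA * ky) • (bra I x y * A) := by
    rw [(hx.mul hA).bra_comm I hy, hy.bra_mul I hx, bra_comm_eq_zero hA hy h2, mul_zero, smul_zero,
      add_zero, hy.bra_comm I hx, smul_mul_assoc, smul_smul, ← sgn_add,
      show (kx + kA) * ky + ky * kx = kA * ky + (kx * ky + kx * ky) by ring, sgn_add, sgn_add (kx * ky),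
      sgn_mul_self, mul_one]
  have e2 : bra I (x * A) B = sgn kx • (x * bra I A B) := by
    rw [(hx.mul hA).bra_comm I hB, hB.bra_mul I hx, bra_comm_eq_zero hx hB h1, zero_mul, zero_add,
      hB.bra_comm I hA, mul_units_smul, smul_smul, smul_smul, ← sgn_add, ← sgn_add,
      show (kx + kA) * kB + (kB + 1) * kx + kB * kA = kx + ((kx * kB + kA * kB) + (kx * kB + kA * kB)) by
        ring, sgn_add, sgn_add (kx * kB + kA * kB), sgn_mul_self, mul_one]
  rw [(hx.mul hA).bra_mul I hy, e1, e2, smul_mul_assoc, mul_assoc, mul_units_smul, ← mul_assoc y,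
    hy.mul_comm hx, smul_mul_assoc, smul_smul, smul_smul, smul_add, smul_smul, ← sgn_add, ← sgn_add,
    ← sgn_add]
  congr 2
  rw [show (kx + kA + 1) * ky + kx + ky * kx = kA * ky + (kx + ky) + (kx * ky + kx * ky) by ring,
    sgn_add _ (kx * ky + kx * ky), sgn_add (kx * ky), sgn_mul_self, mul_one]

lemma bra_oprod_oprod (s : Finset ι) (ha : ∀ i, HasDeg (k i) (a i)) (hb : ∀ i, HasDeg (l i) (b i))
    (h : ∀ i j, i ≠ j → bra I (a i) (b j) = 0) :
    bra I (oprod s a) (oprod s b) =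
      (∏ p ∈ s ×ˢ s, if p.1 < p.2 then sgn (k p.2 * l p.1) else 1) •
        ∑ i ∈ s, sgn (∑ j ∈ s with j < i, (k j + l j)) •
          oprod s (Function.update (fun i => a i * b i) i (bra I (a i) (b i))) := by
  induction s using Finset.induction_on_min with
  | empty =>
    have := (hasDeg_one (X := X) (K := K)).bra_mul I hasDeg_one 1
    simpa using this
  | insert m s hm ih =>
    rw [prod_pairs_insert hm _ (fun p hp => if_neg hp), oprod_insert_min hm, oprod_insert_min hm,
      bra_mul_mul (ha m) (hb m) (hasDeg_oprod s fun i _ => ha i) (hasDeg_oprod s fun i _ => hb i)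
        (bra_oprod_eq_zero s (ha m) hb fun i hi => h _ _ (hm i hi).ne)
        (bra_comm_eq_zero (hb m) (hasDeg_oprod s fun i _ => ha i)
          (bra_oprod_eq_zero s (hb m) ha fun i hi =>
            bra_comm_eq_zero (ha i) (hb m) (h _ _ (hm i hi).ne'))),
      ih, oprod_mul_oprod s ha hb, sum_oprod_update_insert hm (fun j => k j + l j), Finset.sum_mul,
      sgn_sum, mul_units_smul, mul_units_smul, smul_comm (sgn (k m + l m)), ← smul_add, smul_smul]
    congr 2
    exact Finset.prod_congr rfl fun i hi => by rw [if_pos (hm i hi)]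

end Operators
end WordFun
end OrderedProducts

/-! ## Beilinson-Drinfeld algebras from word functions -/

section WordModels

universe u w

section Bounded

variable {𝕜 : Type*} [RCLike 𝕜] {A B C : Type*} [AddCommGroup A] [Module 𝕜 A]
  [TopologicalSpace A] [AddCommGroup B] [Module 𝕜 B] [TopologicalSpace B] [AddCommGroup C]
  [Module 𝕜 C] [TopologicalSpace C]

lemma IsBddLinear.comp {g : B →ₗ[𝕜] C} {f : A →ₗ[𝕜] B} (hg : IsBddLinear g) (hf : IsBddLinear f) :
    IsBddLinear (g.comp f) := fun S hS => by
  rw [LinearMap.coe_comp, image_comp]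
  exact hg _ (hf _ hS)

lemma isBddLinear_of_continuous {f : A →ₗ[𝕜] B} (hf : Continuous f) : IsBddLinear f :=
  fun S hS => hS.image (⟨f, hf⟩ : A →L[𝕜] B)

end Bounded

/-- Data realising the values of a Beilinson-Drinfeld algebra in factorization algebras as spaces
of word functions, compatibly with all structures. -/
structure WordModel (𝕜 : Type*) [RCLike 𝕜] (𝒞 : ConvComplex.{w} 𝕜 → Prop) (M : Type u)
    [TopologicalSpace M] (X K : Type*) [CommRing K] [Algebra 𝕜 K] where
  h : K
  L : (X → K) →ₗ[K] (X → K)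
  I : (X × X → K) →ₗ[K] K
  obj : Opens M → ConvComplex.{w} 𝕜
  obj_mem : ∀ U, 𝒞 (obj U)
  J : ∀ U, obj U →ₗ[𝕜] WordFun X K
  J_inj : ∀ U, Function.Injective (J U)
  mem_deg : ∀ U j a, a ∈ (obj U).deg j ↔ WordFun.HasDeg j (J U a)
  J_hbar : ∀ U a, J U ((obj U).hbar a) = h • J U a
  J_d : ∀ U a, J U ((obj U).d a) = WordFun.dW L I h (J U a)
  ext : ∀ {U V : Opens M}, U ≤ V → obj U →ₗ[𝕜] obj V
  ext_bdd : ∀ {U V : Opens M} (hUV : U ≤ V), IsBddLinear (ext hUV)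
  J_ext : ∀ {U V : Opens M} (hUV : U ≤ V) a, J V (ext hUV a) = J U a
  mul : ∀ U, obj U →ₗ[𝕜] obj U →ₗ[𝕜] obj U
  mul_bdd : ∀ U, IsBddBilinear (mul U)
  J_mul : ∀ U a b, J U (mul U a b) = J U a * J U b
  one : ∀ U, obj U
  J_one : ∀ U, J U (one U) = 1
  br : ∀ U, obj U →ₗ[𝕜] obj U →ₗ[𝕜] obj U
  br_bdd : ∀ U, IsBddBilinear (br U)
  J_br : ∀ U a b, J U (br U a b) = WordFun.bra I (J U a) (J U b)
  disjoint : ∀ {U V : Opens M}, Disjoint U V → ∀ (a : obj U) (b : obj V),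
    WordFun.bra I (J U a) (J V b) = 0
  lap_lap : ∀ U a, WordFun.lap I (WordFun.lap I (J U a)) = 0
  der_lap : ∀ U a, WordFun.der L (WordFun.lap I (J U a)) = -WordFun.lap I (WordFun.der L (J U a))
  cosheaf : ∀ (U : Opens M) (𝒰 : Set (Opens M)) (h𝒰 : IsWeissCover 𝒰 U) (Z : ConvComplex.{w} 𝕜),
    𝒞 Z → ∀ φ : ∀ W : 𝒰, obj W.1 →ₗ[𝕜] Z, (∀ W, IsCochainMap (φ W)) →
      (∀ (W W' : 𝒰) (a : obj (W.1 ⊓ W'.1)),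
        φ W (ext inf_le_left a) = φ W' (ext inf_le_right a)) →
      ∃! ψ : obj U →ₗ[𝕜] Z, IsCochainMap ψ ∧
        ∀ (W : 𝒰) (a : obj W.1), ψ (ext (h𝒰.1 W.1 W.2) a) = φ W a

namespace WordModel

variable {𝕜 : Type*} [RCLike 𝕜] {𝒞 : ConvComplex.{w} 𝕜 → Prop} {M : Type u} [TopologicalSpace M]
  {X K : Type*} [CommRing K] [Algebra 𝕜 K] (Q : WordModel 𝕜 𝒞 M X K)

variable {ι : Type} [Fintype ι] [LinearOrder ι] {U : ι → Opens M} {V : Opens M}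
  (hV : ∀ i, U i ≤ V)

lemma hasDeg {U : Opens M} {j : ℤ} {a : Q.obj U} (h : a ∈ (Q.obj U).deg j) :
    WordFun.HasDeg j (Q.J U a) := (Q.mem_deg _ _ _).1 h

/-- The underlying function of a structure map. -/
def mFun (a : ∀ i, Q.obj (U i)) : Q.obj V :=
  (Finset.univ.sort.map fun i => Q.ext (hV i) (a i)).foldr (fun x y => Q.mul V x y) (Q.one V)

lemma J_mFun (a : ∀ i, Q.obj (U i)) :
    Q.J V (Q.mFun hV a) = oprod Finset.univ fun i => Q.J (U i) (a i) := by
  rw [mFun, oprod]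
  induction (Finset.univ : Finset ι).sort with
  | nil => exact Q.J_one V
  | cons i l ih => rw [List.map_cons, List.foldr_cons, Q.J_mul, ih, Q.J_ext, List.map_cons,
      List.prod_cons]

lemma J_update {ι : Type} [DecidableEq ι] {U : ι → Opens M} (a : ∀ i, Q.obj (U i)) (i : ι)
    (x : Q.obj (U i)) : (fun j => Q.J (U j) (Function.update a i x j)) =
      Function.update (fun j => Q.J (U j) (a j)) i (Q.J (U i) x) := by
  funext j
  rcases eq_or_ne j i with rfl | h
  · simp
  · simp [Function.update_of_ne h]

lemma exists_J_mFun_update (a : ∀ i, Q.obj (U i)) (i : ι) : ∃ A B, ∀ x,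
      Q.J V (Q.mFun hV (Function.update a i x)) = A * Q.J (U i) x * B := by
  obtain ⟨A, B, h⟩ := exists_oprod_update Finset.univ (Finset.mem_univ i)
    (fun j => Q.J (U j) (a j))
  exact ⟨A, B, fun x => by rw [J_mFun, J_update, h]⟩

/-- The structure maps. -/
def m : MultilinearMap 𝕜 (fun i => Q.obj (U i)) (Q.obj V) where
  toFun := Q.mFun hV
  map_update_add' {dec} a i x y := by
    obtain rfl : dec = LinearOrder.toDecidableEq := Subsingleton.elim _ _
    obtain ⟨A, B, h⟩ := Q.exists_J_mFun_update hV a i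
    apply Q.J_inj
    rw [map_add, h, h, h, map_add, mul_add, add_mul]
  map_update_smul' {dec} a i c x := by
    obtain rfl : dec = LinearOrder.toDecidableEq := Subsingleton.elim _ _
    obtain ⟨A, B, h⟩ := Q.exists_J_mFun_update hV a i
    apply Q.J_inj
    rw [map_smul, h, h, map_smul, mul_smul_comm, smul_mul_assoc]

lemma J_m (a : ∀ i, Q.obj (U i)) :
    Q.J V (Q.m hV a) = oprod Finset.univ fun i => Q.J (U i) (a i) := Q.J_mFun hV a

lemma m_unique {U V : Opens M} (hV : ∀ _ : PUnit, U ≤ V) (a : Q.obj U) :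
    Q.m hV (fun _ => a) = Q.ext (hV ⟨⟩) a := by
  apply Q.J_inj
  rw [J_m, Q.J_ext, oprod]
  simp

lemma m_bdd : IsBddMultilinear (Q.m hV) := by
  intro S hS
  have key : ∀ l : List ι, Bornology.IsVonNBounded 𝕜 ((fun a : ∀ i, Q.obj (U i) =>
      (l.map fun i => Q.ext (hV i) (a i)).foldr (fun x y => Q.mul V x y) (Q.one V)) ''
        Set.pi Set.univ S) := by
    intro l
    have := (Q.obj V).convenient.locallyConvex
    have := (PolynormableSpace.withSeminorms 𝕜 (Q.obj V)).continuousSMul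
    induction l with
    | nil =>
      refine (Bornology.isVonNBounded_singleton (𝕜 := 𝕜) (Q.one V)).subset ?_
      rintro _ ⟨a, -, rfl⟩; rfl
    | cons i l ih =>
      refine (Q.mul_bdd V _ _ (Q.ext_bdd (hV i) _ (hS i)) ih).subset ?_
      rintro _ ⟨a, ha, rfl⟩
      exact ⟨_, ⟨a i, ha i (mem_univ i), rfl⟩, _, ⟨a, ha, rfl⟩, rfl⟩
  exact key _

lemma mem_deg_m (a : ∀ i, Q.obj (U i)) (k : ι → ℤ)
    (ha : ∀ i, a i ∈ (Q.obj (U i)).deg (k i)) : Q.m hV a ∈ (Q.obj V).deg (∑ i, k i) := by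
  rw [Q.mem_deg, J_m]
  exact WordFun.hasDeg_oprod _ fun i _ => Q.hasDeg (ha i)

lemma J_units_smul (U : Opens M) (s : ℤˣ) (a : Q.obj U) : Q.J U (s • a) = s • Q.J U a := by
  rcases Int.units_eq_one_or s with rfl | rfl <;> simp [Units.neg_smul]

/-- The underlying prefactorization algebra. -/
abbrev toPrefactorizationAlgebra : PrefactorizationAlgebra 𝕜 𝒞 M where
  obj := Q.obj
  obj_mem := Q.obj_mem
  m U V _ hV := Q.m hV
  m_bdd U V _ hV := Q.m_bdd hV
  m_hbar U V hU hV a i := by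
    obtain ⟨A, B, h⟩ := Q.exists_J_mFun_update hV a i
    apply Q.J_inj
    have h1 := h (a i)
    rw [Function.update_eq_self] at h1
    rw [Q.J_hbar]
    refine (h _).trans (Eq.trans ?_ (congrArg _ h1.symm))
    rw [Q.J_hbar, mul_smul_comm, smul_mul_assoc]
  m_deg U V _ hV a k ha := Q.mem_deg_m hV a k ha
  m_d U V hU hV a k ha := by
    apply Q.J_inj
    rw [Q.J_d, J_m, WordFun.dW_oprod (k := k) Q.h Finset.univ
      (fun i => Q.hasDeg (ha i)) fun i j hij => Q.disjoint (hU hij) _ _, map_sum]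
    refine Finset.sum_congr rfl fun i _ => ?_
    rw [J_units_smul, J_m, J_update, Q.J_d]
  m_id U hU hV a := by
    apply Q.J_inj
    rw [m_unique, Q.J_ext]
  m_assoc U V T hU hV hT hTU hT' hTV a := by
    apply Q.J_inj
    rw [J_m, J_m, ← oprod_sigma]
    exact oprod_congr fun i _ => Q.J_m _ _
  m_perm σ U V hU hV hU' hV' a k ha := by
    apply Q.J_inj
    rw [J_units_smul, J_m, J_m, WordFun.oprod_reorder (k := k) (a := fun i => Q.J (U i) (a i)) σ
      Finset.univ (fun i => Q.hasDeg (ha i)), Finset.map_univ_equiv]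
    rfl

lemma ext_eq {U V : Opens M} (hUV : U ≤ V) (a : Q.obj U) :
    Q.toPrefactorizationAlgebra.ext hUV a = Q.ext hUV a := Q.m_unique (fun _ => hUV) a

lemma isCosheaf : Q.toPrefactorizationAlgebra.IsCosheaf := by
  intro U 𝒰 h𝒰 Z hZ φ hφ hφ'
  obtain ⟨ψ, ⟨h1, h2⟩, h3⟩ := Q.cosheaf U 𝒰 h𝒰 Z hZ φ hφ fun W W' a => by
    have := hφ' W W' a
    rwa [ext_eq, ext_eq] at this
  exact ⟨ψ, ⟨h1, fun W a => (congrArg ψ (Q.ext_eq _ a)).trans (h2 W a)⟩,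
    fun ψ' h' => h3 ψ' ⟨h'.1, fun W a => (congrArg ψ' (Q.ext_eq _ a)).symm.trans (h'.2 W a)⟩⟩

/-- The Beilinson-Drinfeld algebra in factorization algebras presented by word functions. -/
def toBD : BDFactorizationAlgebra 𝕜 𝒞 M where
  toPrefactorizationAlgebra := Q.toPrefactorizationAlgebra
  cosheaf := Q.isCosheaf
  mul := Q.mul
  one := Q.one
  br := Q.br
  mul_bdd := Q.mul_bdd
  br_bdd := Q.br_bdd
  mul_hbar U a b := Q.J_inj U <| by
    rw [Q.J_hbar, Q.J_mul, Q.J_mul, Q.J_hbar, smul_mul_assoc]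
  br_hbar U a b := Q.J_inj U <| by
    rw [Q.J_hbar, Q.J_br, Q.J_br, Q.J_hbar, WordFun.smul_bra]
  one_deg U := (Q.mem_deg _ _ _).2 (by rw [Q.J_one]; exact WordFun.hasDeg_one)
  mul_deg U _ _ _ ha _ hb := (Q.mem_deg _ _ _).2 (by rw [Q.J_mul]; exact (Q.hasDeg ha).mul (Q.hasDeg hb))
  br_deg U _ _ _ ha _ hb := (Q.mem_deg _ _ _).2 (by rw [Q.J_br]; exact (Q.hasDeg ha).bra _ (Q.hasDeg hb))
  one_mul U a := Q.J_inj U <| by rw [Q.J_mul, Q.J_one, _root_.one_mul]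
  mul_assoc U a b c := Q.J_inj U <| by simp only [Q.J_mul, _root_.mul_assoc]
  mul_comm U _ _ _ ha _ hb := Q.J_inj U <| by
    rw [J_units_smul, Q.J_mul, Q.J_mul]; exact (Q.hasDeg ha).mul_comm (Q.hasDeg hb)
  br_comm U _ _ _ ha _ hb := Q.J_inj U <| by
    rw [J_units_smul, Q.J_br, Q.J_br]; exact (Q.hasDeg ha).bra_comm _ (Q.hasDeg hb)
  leibniz U _ _ _ ha _ hb c := Q.J_inj U <| by
    rw [map_add, J_units_smul, Q.J_mul, Q.J_mul, Q.J_br, Q.J_br, Q.J_br, Q.J_mul]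
    exact (Q.hasDeg ha).bra_mul _ (Q.hasDeg hb) _
  jacobi U _ _ _ ha _ hb c := Q.J_inj U <| by
    rw [map_add, J_units_smul, J_units_smul]
    simp only [Q.J_br]
    refine WordFun.jacobi_of_lap _ (Q.hasDeg ha) (Q.hasDeg hb)
      (Q.lap_lap _ _) (Q.lap_lap _ _) (Q.lap_lap _ _) ?_ ?_ ?_ ?_ <;>
    · simp only [← Q.J_mul]
      exact Q.lap_lap _ _
  d_one U := Q.J_inj U <| by
    rw [Q.J_d, Q.J_one, map_zero, WordFun.dW, WordFun.der_one, WordFun.lap_one, smul_zero, add_zero]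
  d_mul U _ _ ha b := Q.J_inj U <| by
    rw [map_add, map_add, J_units_smul, Q.J_d, Q.J_hbar, Q.J_mul, Q.J_mul, Q.J_mul, Q.J_br, Q.J_d,
      Q.J_d]
    exact (Q.hasDeg ha).dW_mul _ _
  d_br U i _ ha b := Q.J_inj U <| by
    rw [map_sub, map_neg, J_units_smul, Q.J_d, Q.J_br, Q.J_br, Q.J_br, Q.J_d, Q.J_d, WordFun.dW,
      WordFun.dW, WordFun.dW, WordFun.lap_bra (Q.hasDeg ha) (Q.lap_lap _ _) (Q.lap_lap _ _)
        (by rw [← Q.J_mul]; exact Q.lap_lap _ _),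
      WordFun.der_bra (Q.hasDeg ha) (Q.der_lap _ _) (Q.der_lap _ _)
        (by rw [← Q.J_mul]; exact Q.der_lap _ _),
      WordFun.add_bra, WordFun.bra_add, WordFun.smul_bra, WordFun.bra_smul]
    rcases Int.units_eq_one_or (sgn i) with h | h <;> rw [h] <;>
    · simp only [one_smul, Units.neg_smul, smul_sub, smul_neg, smul_add]
      abel
  m_one U V _ hV := Q.J_inj V <| by
    refine (Q.J_m _ _).trans ?_
    simp only [Q.J_one]
    exact oprod_one _
  m_mul U V _ hV a b k l ha hb := Q.J_inj V <| by
    refine Eq.trans (Q.J_mul _ _ _) ?_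
    rw [J_units_smul]
    refine (congrArg₂ (· * ·) (Q.J_m _ _) (Q.J_m _ _)).trans
      (Eq.trans ?_ (congrArg _ (Q.J_m _ _).symm))
    simp only [Q.J_mul]
    exact WordFun.oprod_mul_oprod _ (fun i => Q.hasDeg (ha i)) fun i => Q.hasDeg (hb i)
  m_br U V hU hV a b k l ha hb := Q.J_inj V <| by
    change Q.J V (Q.br V (Q.m hV a) (Q.m hV b)) =
      Q.J V (_ • ∑ i, _ • Q.m hV (Function.update _ i _))
    rw [J_units_smul, Q.J_br, J_m, J_m, map_sum]
    refine (WordFun.bra_oprod_oprod (k := k) (l := l) Finset.univ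
      (fun i => Q.hasDeg (ha i)) (fun i => Q.hasDeg (hb i))
      fun i j hij => Q.disjoint (hU hij) _ _).trans (congrArg _ (Finset.sum_congr rfl fun i _ => ?_))
    rw [J_units_smul, J_m, J_update, Q.J_br]
    simp only [Q.J_mul]

end WordModel
end WordModels

section Alternation

/-- Symmetrisation in the even and antisymmetrisation in the odd variables. -/
def altFun {X K : Type*} [CommRing K] {n k : ℕ} (f : (Fin n ⊕ Fin k → X) → K)
    (v : Fin n ⊕ Fin k → X) : K :=
  ∑ σ : Equiv.Perm (Fin n), ∑ τ : Equiv.Perm (Fin k),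
    ((Equiv.Perm.sign τ : ℤ) : K) * f (v ∘ Sum.map σ τ)

variable {X K : Type*} [CommRing K] {n k : ℕ}

lemma sign_mul_self_cast (τ : Equiv.Perm (Fin k)) :
    ((Equiv.Perm.sign τ : ℤ) : K) * ((Equiv.Perm.sign τ : ℤ) : K) = 1 := by
  rw [← Int.cast_mul, ← Units.val_mul, Int.units_mul_self, Units.val_one, Int.cast_one]

lemma altFun_comp (f : (Fin n ⊕ Fin k → X) → K) (v : Fin n ⊕ Fin k → X) (σ : Equiv.Perm (Fin n))
    (τ : Equiv.Perm (Fin k)) :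
    altFun f (v ∘ Sum.map σ τ) = ((Equiv.Perm.sign τ : ℤ) : K) * altFun f v := by
  simp only [altFun, Function.comp_assoc, Sum.map_comp_map, Finset.mul_sum]
  refine Fintype.sum_equiv (Equiv.mulLeft σ) _ _ fun σ' => Fintype.sum_equiv (Equiv.mulLeft τ) _ _
    fun τ' => ?_
  simp only [Equiv.coe_mulLeft, Equiv.Perm.coe_mul, Equiv.Perm.sign_mul, Units.val_mul,
    Int.cast_mul]
  rw [← mul_assoc, ← mul_assoc, sign_mul_self_cast, one_mul]

lemma altFun_of_comp (f : (Fin n ⊕ Fin k → X) → K) (σ : Equiv.Perm (Fin n))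
    (τ : Equiv.Perm (Fin k)) (v : Fin n ⊕ Fin k → X) :
    altFun (fun v => f (v ∘ Sum.map σ τ)) v = ((Equiv.Perm.sign τ : ℤ) : K) * altFun f v := by
  simp only [altFun, Function.comp_assoc, Sum.map_comp_map, Finset.mul_sum]
  refine Fintype.sum_equiv (Equiv.mulRight σ) _ _ fun σ' => Fintype.sum_equiv (Equiv.mulRight τ) _ _
    fun τ' => ?_
  simp only [Equiv.coe_mulRight, Equiv.Perm.coe_mul, Equiv.Perm.sign_mul, Units.val_mul,
    Int.cast_mul]
  rw [← mul_assoc, mul_left_comm, sign_mul_self_cast, mul_one]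

lemma altFun_of_alternating {f : (Fin n ⊕ Fin k → X) → K} (hf : ∀ v
    (σ : Equiv.Perm (Fin n)) (τ : Equiv.Perm (Fin k)), f (v ∘ Sum.map σ τ) = ((Equiv.Perm.sign τ : ℤ) : K) * f v) (v : Fin n ⊕ Fin k → X) :
    altFun f v = (n.factorial * k.factorial : ℕ) * f v := by
  simp only [altFun, hf, ← mul_assoc, sign_mul_self_cast, one_mul, Finset.sum_const,
    Finset.card_univ, Fintype.card_perm, Fintype.card_fin, nsmul_eq_mul, Nat.cast_mul]

lemma altFun_add (f g : (Fin n ⊕ Fin k → X) → K) : altFun (f + g) = altFun f + altFun g := by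
  funext v; simp only [altFun, Pi.add_apply, mul_add, Finset.sum_add_distrib]

lemma altFun_smul (c : K) (f : (Fin n ⊕ Fin k → X) → K) : altFun (c • f) = c • altFun f := by
  funext v
  simp only [altFun, Pi.smul_apply, smul_eq_mul, Finset.mul_sum, mul_left_comm]

end Alternation

/-! ## Components of word functions and products of generators -/

section WordComponents

lemma sum_perm_prod_succ {R : Type*} [CommRing R] {n : ℕ} (A : Fin (n + 1) → Fin (n + 1) → R) :
    ∑ σ : Equiv.Perm (Fin (n + 1)), ∏ i, A i (σ i) =
      ∑ j, A 0 j * ∑ σ : Equiv.Perm (Fin n), ∏ i, A i.succ (j.succAbove (σ i)) := by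
  rw [Finset.univ_perm_fin_succ, ← Finset.univ_product_univ]
  simp only [Finset.sum_map, Equiv.toEmbedding_apply, Finset.sum_product, Finset.mul_sum,
    Fin.prod_univ_succ, Equiv.Perm.decomposeFin_symm_apply_zero,
    Equiv.Perm.decomposeFin_symm_apply_succ]
  refine Finset.sum_congr rfl fun p _ => ?_
  have h : ∀ i : Fin n, ∃ j, p.succAbove j = Equiv.swap 0 p i.succ := fun i =>
    Fin.exists_succAbove_eq (by
      intro h
      have := (Equiv.swap_apply_eq_iff.1 h)
      rw [Equiv.swap_apply_right] at this
      exact Fin.succ_ne_zero i this)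
  choose q hq using h
  have hinj : Function.Injective q := fun i j hij => by
    have := hq i
    rw [hij, hq j] at this
    exact Fin.succ_injective _ ((Equiv.swap 0 p).injective this.symm)
  let e : Equiv.Perm (Fin n) := Equiv.ofBijective q (Finite.injective_iff_bijective.1 hinj)
  refine Fintype.sum_equiv (Equiv.mulLeft e) _ _ fun σ => ?_
  congr 1
  refine Finset.prod_congr rfl fun i _ => ?_
  rw [← hq]; rfl

namespace WordFun

variable {X Y K : Type*} [CommRing K] {n k n' k' : ℕ}

/-- The component of a word function on words of given lengths. -/
def wcomp (n k : ℕ) (F : WordFun X K) (v : Fin n ⊕ Fin k → X) : K :=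
  F (List.ofFn fun i => v (.inl i)) (List.ofFn fun i => v (.inr i))

lemma apply_eq_wcomp (F : WordFun X K) (v w : List X) :
    F v w = wcomp v.length w.length F (Sum.elim v.get w.get) := by
  simp only [wcomp, Sum.elim_inl, Sum.elim_inr]
  rw [show (List.ofFn fun i => v.get i) = v from List.ofFn_get v,
    show (List.ofFn fun i => w.get i) = w from List.ofFn_get w]

lemma ext_wcomp {F G : WordFun X K} (h : ∀ n k, wcomp n k F = wcomp n k G) : F = G := by
  refine WordFun.ext fun v w => ?_
  exact (apply_eq_wcomp F v w).trans ((congrFun (h _ _) _).trans (apply_eq_wcomp G v w).symm)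

/-- The word function with given components. -/
def ofComp (g : ∀ n k, (Fin n ⊕ Fin k → X) → K) : WordFun X K :=
  fun v w => g v.length w.length (Sum.elim v.get w.get)

lemma wcomp_ofComp (g : ∀ n k, (Fin n ⊕ Fin k → X) → K) : wcomp n k (ofComp g) = g n k := by
  funext v
  have key : ∀ (p p' : Σ n, Fin n → X) (q q' : Σ n, Fin n → X), p = p' → q = q' →
      g p.1 q.1 (Sum.elim p.2 q.2) = g p'.1 q'.1 (Sum.elim p'.2 q'.2) := by
    rintro p _ q _ rfl rfl; rfl
  have h := key ⟨_, (List.ofFn fun i => v (.inl i)).get⟩ ⟨n, fun i => v (.inl i)⟩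
    ⟨_, (List.ofFn fun i => v (.inr i)).get⟩ ⟨k, fun i => v (.inr i)⟩
    (List.equivSigmaTuple.right_inv ⟨n, fun i => v (.inl i)⟩)
    (List.equivSigmaTuple.right_inv ⟨k, fun i => v (.inr i)⟩)
  refine h.trans (congrArg _ (funext fun i => ?_))
  rcases i with i | i <;> rfl

/-- The word function of a function of `n` even and `k` odd variables. -/
def word (n k : ℕ) (f : (Fin n ⊕ Fin k → X) → K) : WordFun X K :=
  ofComp fun m l => if h : m = n ∧ l = k then
    fun v => altFun f (v ∘ Sum.map (Fin.cast h.1.symm) (Fin.cast h.2.symm)) else 0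

lemma wcomp_word (f : (Fin n ⊕ Fin k → X) → K) : wcomp n k (word n k f) = altFun f := by
  rw [word, wcomp_ofComp, dif_pos ⟨rfl, rfl⟩]
  funext v
  simp

lemma wcomp_word_of_ne {m l : ℕ} (h : ¬(m = n ∧ l = k)) (f : (Fin n ⊕ Fin k → X) → K) :
    wcomp m l (word n k f) = 0 := by
  rw [word, wcomp_ofComp, dif_neg h]

lemma word_apply_of_ne {v w : List X} (h : ¬(v.length = n ∧ w.length = k))
    (f : (Fin n ⊕ Fin k → X) → K) : word n k f v w = 0 := by
  exact (apply_eq_wcomp _ v w).trans (congrFun (wcomp_word_of_ne h f) _)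

lemma word_add (f g : (Fin n ⊕ Fin k → X) → K) : word n k (f + g) = word n k f + word n k g := by
  refine ext_wcomp fun m l => ?_
  by_cases h : m = n ∧ l = k
  · obtain ⟨rfl, rfl⟩ := h
    change _ = wcomp m l (word m l f) + wcomp m l (word m l g)
    rw [wcomp_word, wcomp_word, wcomp_word, altFun_add]
  · change _ = wcomp m l (word n k f) + wcomp m l (word n k g)
    rw [wcomp_word_of_ne h, wcomp_word_of_ne h, wcomp_word_of_ne h, add_zero]

lemma word_smul (c : K) (f : (Fin n ⊕ Fin k → X) → K) : word n k (c • f) = c • word n k f := by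
  refine ext_wcomp fun m l => ?_
  by_cases h : m = n ∧ l = k
  · obtain ⟨rfl, rfl⟩ := h
    change _ = c • wcomp m l (word m l f)
    rw [wcomp_word, wcomp_word, altFun_smul]
  · change _ = c • wcomp m l (word n k f)
    rw [wcomp_word_of_ne h, wcomp_word_of_ne h, smul_zero]

lemma hasDeg_word (f : (Fin n ⊕ Fin k → X) → K) : HasDeg (-(k : ℤ)) (word n k f) :=
  fun v w h => word_apply_of_ne (by rintro ⟨-, rfl⟩; simp at h) f

/-! ### Products of generators -/

/-- The product of the even generators of `u` and the odd generators of `t`. -/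
def gens (u : Fin n → X → K) (t : Fin k → X → K) : WordFun X K :=
  (List.ofFn fun i => genE (u i)).prod * (List.ofFn fun i => genO (t i)).prod

/-- The exterior product of functions of one variable. -/
def prodFun (u : Fin n → X → K) (t : Fin k → X → K) (v : Fin n ⊕ Fin k → X) : K :=
  (∏ i, u i (v (.inl i))) * ∏ i, t i (v (.inr i))

lemma genE_mul_ofFn (u : X → K) (G : WordFun X K) (v : Fin (n + 1) → X) (w : List X) :
    (genE u * G) (List.ofFn v) w = ∑ j, u (v j) * G (List.ofFn (v ∘ j.succAbove)) w := by
  induction n generalizing G with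
  | zero =>
    have h : (genE u * dE (v 0) G) [] w = 0 := nil_mul_apply _ _ (fun _ => rfl) _
    simp [List.ofFn_succ, mul_cons, smul_mul_assoc, h]
  | succ n ih =>
    rw [List.ofFn_succ, mul_cons, dE_genE, smul_mul_assoc, one_mul, smul_apply, smul_eq_mul,
      ih (dE (v 0) G) (fun i => v i.succ)]
    refine Eq.trans ?_ (Fin.sum_univ_succ _).symm
    congr 1
    refine Finset.sum_congr rfl fun j _ => ?_
    rw [dE_apply]
    congr 2
    rw [List.ofFn_succ]
    simp only [Function.comp_apply, Fin.succ_succAbove_zero, Fin.succ_succAbove_succ]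
    rfl

lemma genO_mul_ofFn (t : X → K) (G : WordFun X K) (w : Fin (n + 1) → X) :
    (genO t * G) [] (List.ofFn w) =
      ∑ j : Fin (n + 1), (-1) ^ (j : ℕ) * t (w j) * G [] (List.ofFn (w ∘ j.succAbove)) := by
  induction n generalizing G with
  | zero =>
    have h : (par (genO t) * dO (w 0) G) [] [] = 0 := by
      rw [par_genO, neg_mul]; simp [mul_nil, genO]
    simp [List.ofFn_succ, mul_nil_cons, smul_mul_assoc, -par_genO, h]
  | succ n ih =>
    have h : (par (genO t) * dO (w 0) G) [] (List.ofFn fun i : Fin (n + 1) => w i.succ) =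
        -((genO t * dO (w 0) G) [] (List.ofFn fun i : Fin (n + 1) => w i.succ)) := by
      rw [par_genO, neg_mul]; rfl
    rw [List.ofFn_succ, mul_nil_cons, h, dO_genO, smul_mul_assoc, one_mul, smul_apply, smul_eq_mul,
      ih (dO (w 0) G) (fun i => w i.succ), ← Finset.sum_neg_distrib]
    refine Eq.trans ?_ (Fin.sum_univ_succ _).symm
    congr 1
    · simp only [Fin.val_zero, pow_zero, one_mul]; rfl
    refine Finset.sum_congr rfl fun j _ => ?_
    have e : (List.ofFn (w ∘ j.succ.succAbove)) =
        w 0 :: List.ofFn ((fun i => w i.succ) ∘ j.succAbove) := by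
      rw [List.ofFn_succ]
      simp only [Function.comp_apply, Fin.succ_succAbove_zero, Fin.succ_succAbove_succ]
      rfl
    rw [e, Fin.val_succ, pow_succ]
    rw [dO_apply]
    ring

lemma prod_genE_mul_ofFn (u : Fin n → X → K) {G : WordFun X K}
    (hG : ∀ v w, v ≠ [] → G v w = 0) (v : Fin n → X) (w : List X) :
    ((List.ofFn fun i => genE (u i)).prod * G) (List.ofFn v) w =
      (∑ σ : Equiv.Perm (Fin n), ∏ i, u i (v (σ i))) * G [] w := by
  induction n with
  | zero => simp
  | succ n ih =>
    rw [List.ofFn_succ, List.prod_cons, mul_assoc, genE_mul_ofFn,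
      sum_perm_prod_succ (fun i j => u i (v j)), Finset.sum_mul]
    refine Finset.sum_congr rfl fun j _ => ?_
    rw [ih (fun i => u i.succ) (v ∘ j.succAbove), mul_assoc]
    rfl

lemma prod_genE_mul_of_ne (u : Fin n → X → K) {G : WordFun X K}
    (hG : ∀ v w, v ≠ [] → G v w = 0) {m : ℕ} (hm : m ≠ n) (v : Fin m → X) (w : List X) :
    ((List.ofFn fun i => genE (u i)).prod * G) (List.ofFn v) w = 0 := by
  induction n generalizing m with
  | zero =>
    rw [List.ofFn_zero, List.prod_nil, one_mul]
    refine hG _ _ fun h => hm ?_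
    simpa using congrArg List.length h
  | succ n ih =>
    rw [List.ofFn_succ, List.prod_cons, mul_assoc]
    cases m with
    | zero => exact nil_mul_apply _ _ (fun w => rfl) _
    | succ m =>
      rw [genE_mul_ofFn]
      exact Finset.sum_eq_zero fun j _ => by
        rw [ih (fun i => u i.succ) (by omega), mul_zero]

lemma prod_genO_of_ne (t : Fin k → X → K) : ∀ v w, v ≠ [] →
    (List.ofFn fun i => genO (t i)).prod v w = 0 := by
  induction k with
  | zero => intro v w hv; simp [one_apply, hv]
  | succ k ih =>
    intro v w hv
    obtain ⟨x, v, rfl⟩ := List.exists_cons_of_ne_nil hv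
    rw [List.ofFn_succ, List.prod_cons, mul_cons, dE_genO, zero_mul]
    have : dE x (List.ofFn fun i : Fin k => genO (t i.succ)).prod = 0 := by
      ext v w; exact ih _ _ _ (by simp)
    rw [this, mul_zero]; simp

lemma prod_genO_ofFn (t : Fin k → X → K) (w : Fin k → X) :
    (List.ofFn fun i => genO (t i)).prod [] (List.ofFn w) =
      (Matrix.of fun i j => t i (w j)).det := by
  induction k with
  | zero => simp
  | succ k ih =>
    rw [List.ofFn_succ, List.prod_cons, genO_mul_ofFn, Matrix.det_succ_row_zero]
    refine Finset.sum_congr rfl fun j _ => ?_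
    rw [ih]; rfl

lemma hasDeg_genE (u : X → K) : HasDeg 0 (genE u) := fun v w h => by
  match v, w with
  | [_], [] => simp at h
  | [_], _ :: _ => rfl
  | [], _ => rfl
  | _ :: _ :: _, _ => rfl

lemma hasDeg_genO (u : X → K) : HasDeg (-1) (genO u) := fun v w h => by
  match v, w with
  | [], [_] => simp at h
  | [], [] => rfl
  | [], _ :: _ :: _ => rfl
  | _ :: _, _ => rfl

lemma hasDeg_prod_ofFn {j : ℤ} {g : (X → K) → WordFun X K} (hg : ∀ u, HasDeg j (g u))
    (t : Fin k → X → K) : HasDeg (k * j) (List.ofFn fun i => g (t i)).prod := by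
  induction k with
  | zero => simpa using hasDeg_one
  | succ k ih =>
    rw [List.ofFn_succ, List.prod_cons]
    exact ((hg _).mul (ih _)).congr (by push_cast; ring)

lemma hasDeg_gens (u : Fin n → X → K) (t : Fin k → X → K) : HasDeg (-(k : ℤ)) (gens u t) :=
  ((hasDeg_prod_ofFn hasDeg_genE u).mul (hasDeg_prod_ofFn hasDeg_genO t)).congr (by ring)

lemma altFun_prodFun (u : Fin n → X → K) (t : Fin k → X → K) (v : Fin n ⊕ Fin k → X) :
    altFun (prodFun u t) v = (∑ σ : Equiv.Perm (Fin n), ∏ i, u i (v (.inl (σ i)))) *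
      (Matrix.of fun i j => t i (v (.inr j))).det := by
  rw [← Matrix.det_transpose, Matrix.det_apply', Finset.sum_mul_sum]
  refine Finset.sum_congr rfl fun σ _ => Finset.sum_congr rfl fun τ _ => ?_
  rw [mul_left_comm]
  rfl

lemma word_prodFun (u : Fin n → X → K) (t : Fin k → X → K) :
    word n k (prodFun u t) = gens u t := by
  refine ext_wcomp fun m l => ?_
  by_cases hm : m = n
  · by_cases hl : l = k
    · subst hm hl
      rw [wcomp_word]
      funext v
      rw [altFun_prodFun, wcomp, gens, prod_genE_mul_ofFn u (prod_genO_of_ne t), prod_genO_ofFn]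
    · rw [wcomp_word_of_ne (by tauto)]
      funext v
      exact (hasDeg_gens u t _ _ (by simp; omega)).symm
  · rw [wcomp_word_of_ne (by tauto)]
    funext v
    exact (prod_genE_mul_of_ne u (prod_genO_of_ne t) hm _ _).symm

lemma gens_mul_gens (u : Fin n → X → K) (t : Fin k → X → K) (u' : Fin n' → X → K)
    (t' : Fin k' → X → K) :
    gens u t * gens u' t' = gens (Fin.append u u') (Fin.append t t') := by
  have h := (hasDeg_prod_ofFn hasDeg_genE u').mul_comm (hasDeg_prod_ofFn hasDeg_genO t)
  rw [mul_zero, zero_mul, sgn_zero, one_smul] at h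
  have e1 : ∀ {m m' : ℕ} (g : (X → K) → WordFun X K) (a : Fin m → X → K) (a' : Fin m' → X → K),
      (List.ofFn fun i => g (Fin.append a a' i)).prod =
        (List.ofFn fun i => g (a i)).prod * (List.ofFn fun i => g (a' i)).prod := by
    intro m m' g a a'
    rw [← List.prod_append, ← List.ofFn_fin_append]
    congr 2
    funext i
    refine Fin.addCases (fun i => ?_) (fun i => ?_) i <;> simp
  rw [gens, gens, gens, e1 genE, e1 genO, mul_assoc, ← mul_assoc _ _ (List.prod _), ← h]
  simp only [mul_assoc]

/-! ### The product of word functions -/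

/-- Restriction of letters. -/
def res (i : Y → X) (F : WordFun X K) : WordFun Y K := fun v w => F (v.map i) (w.map i)

lemma res_mul (i : Y → X) (F G : WordFun X K) : res i (F * G) = res i F * res i G := by
  refine WordFun.ext fun v w => ?_
  induction v generalizing F G with
  | nil =>
    induction w generalizing F G with
    | nil =>
      rw [mul_nil]
      exact mul_nil F G
    | cons x w ih =>
      have e : par (res i F) = res i (par F) := by
        refine WordFun.ext fun v w => ?_
        rw [res, par_apply, par_apply, List.length_map, res]
      rw [mul_nil_cons, e]
      exact (mul_nil_cons F G (i x) (w.map i)).trans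
        (congrArg₂ (· + ·) (ih (dO (i x) F) G) (ih (par F) (dO (i x) G)))
  | cons x v ih =>
    rw [mul_cons]
    exact (mul_cons F G (i x) (v.map i) (w.map i)).trans
      (congrArg₂ (· + ·) (ih (dE (i x) F) G) (ih F (dE (i x) G)))

lemma wcomp_res (i : Y → X) (F : WordFun X K) (v : Fin n ⊕ Fin k → Y) :
    wcomp n k (res i F) v = wcomp n k F (i ∘ v) := by
  simp only [wcomp, res, List.map_ofFn]
  rfl

lemma res_word (i : Y → X) (f : (Fin n ⊕ Fin k → X) → K) :
    res i (word n k f) = word n k fun v => f (i ∘ v) := by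
  refine ext_wcomp fun m l => ?_
  funext v
  rw [wcomp_res]
  by_cases h : m = n ∧ l = k
  · obtain ⟨rfl, rfl⟩ := h
    rw [wcomp_word, wcomp_word]
    rfl
  · rw [wcomp_word_of_ne h, wcomp_word_of_ne h]; rfl

lemma ext_res {F G : WordFun X K} (h : ∀ s : Finset X, res (Subtype.val : s → X) F = res Subtype.val G) :
    F = G := by
  classical
  ext v w
  have hv : ((v.attachWith (· ∈ (v ++ w).toFinset) (by simp +contextual)).map Subtype.val) = v := by simp
  have hw : ((w.attachWith (· ∈ (v ++ w).toFinset) (by simp +contextual)).map Subtype.val) = w := by simp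
  have := congrFun (congrFun (h (v ++ w).toFinset) (v.attachWith _ (by simp +contextual)))
    (w.attachWith _ (by simp +contextual))
  simp only [res] at this
  rwa [hv, hw] at this

/-- The exterior product. -/
def extProd (f : (Fin n ⊕ Fin k → X) → K) (f' : (Fin n' ⊕ Fin k' → X) → K)
    (v : Fin (n + n') ⊕ Fin (k + k') → X) : K :=
  f (v ∘ Sum.map (Fin.castAdd n') (Fin.castAdd k')) * f' (v ∘ Sum.map (Fin.natAdd n) (Fin.natAdd k))

lemma extProd_prodFun (u : Fin n → X → K) (t : Fin k → X → K) (u' : Fin n' → X → K)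
    (t' : Fin k' → X → K) : extProd (prodFun u t) (prodFun u' t') =
      prodFun (Fin.append u u') (Fin.append t t') := by
  funext v
  simp only [extProd, prodFun, Fin.prod_univ_add, Fin.append_left, Fin.append_right,
    Function.comp_apply, Sum.map_inl, Sum.map_inr]
  ring

lemma mem_span_prodFun [Finite X] (f : (Fin n ⊕ Fin k → X) → K) :
    f ∈ Submodule.span K {g | ∃ (u : Fin n → X → K) (t : Fin k → X → K), g = prodFun u t} := by
  classical
  have := Fintype.ofFinite X
  have e : f = ∑ y : Fin n ⊕ Fin k → X, f y • prodFun
      (fun i z => if z = y (.inl i) then (1 : K) else 0)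
      (fun i z => if z = y (.inr i) then (1 : K) else 0) := by
    funext v
    rw [Finset.sum_apply, Finset.sum_eq_single v]
    · simp [prodFun]
    · intro y _ hy
      obtain ⟨i, hi⟩ := Function.ne_iff.1 hy
      rw [Pi.smul_apply, smul_eq_mul]
      rcases i with i | i
      · rw [prodFun, Finset.prod_eq_zero (Finset.mem_univ i) (if_neg hi.symm), zero_mul, mul_zero]
      · rw [prodFun, Finset.prod_eq_zero (f := fun i => if v (.inr i) = y (.inr i) then (1 : K) else 0)
          (Finset.mem_univ i) (if_neg hi.symm), mul_zero, mul_zero]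
    · simp
  rw [e]
  exact Submodule.sum_mem _ fun y _ => Submodule.smul_mem _ _ (Submodule.subset_span ⟨_, _, rfl⟩)

lemma word_mul_word (f : (Fin n ⊕ Fin k → X) → K) (f' : (Fin n' ⊕ Fin k' → X) → K) :
    word n k f * word n' k' f' = word (n + n') (k + k') (extProd f f') := by
  refine ext_res fun s => ?_
  rw [res_mul, res_word, res_word, res_word]
  change word n k _ * word n' k' _ = word (n + n') (k + k')
    (extProd (fun v => f (Subtype.val ∘ v)) fun v => f' (Subtype.val ∘ v))
  generalize (fun v : Fin n ⊕ Fin k → s => f (Subtype.val ∘ v)) = g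
  generalize (fun v : Fin n' ⊕ Fin k' → s => f' (Subtype.val ∘ v)) = g'
  induction mem_span_prodFun g using Submodule.span_induction with
  | mem g hg =>
    obtain ⟨u, t, rfl⟩ := hg
    induction mem_span_prodFun g' using Submodule.span_induction with
    | mem g' hg =>
      obtain ⟨u', t', rfl⟩ := hg
      rw [word_prodFun, word_prodFun, gens_mul_gens, extProd_prodFun, word_prodFun]
    | zero =>
      have := word_smul (n := n') (k := k') (X := s) (0 : K) 0
      have h2 := word_smul (n := n + n') (k := k + k') (X := s) (0 : K) 0
      simp only [zero_smul] at this h2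
      have e : extProd (prodFun u t) (0 : (Fin n' ⊕ Fin k' → s) → K) = 0 := by
        funext v; exact mul_zero _
      rw [this, mul_zero, e, h2]
    | add x y _ _ hx hy =>
      have e : extProd (prodFun u t) (x + y) = extProd (prodFun u t) x + extProd (prodFun u t) y := by
        funext v; exact mul_add _ _ _
      rw [word_add, mul_add, hx, hy, e, word_add]
    | smul c x _ hx =>
      have e : extProd (prodFun u t) (c • x) = c • extProd (prodFun u t) x := by
        funext v; exact mul_left_comm _ _ _
      rw [word_smul, mul_smul_comm, hx, e, word_smul]
  | zero =>
    have := word_smul (n := n) (k := k) (X := s) (0 : K) 0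
    have h2 := word_smul (n := n + n') (k := k + k') (X := s) (0 : K) 0
    simp only [zero_smul] at this h2
    have e : extProd (0 : (Fin n ⊕ Fin k → s) → K) g' = 0 := by
      funext v; exact zero_mul _
    rw [this, zero_mul, e, h2]
  | add x y _ _ hx hy =>
    have e : extProd (x + y) g' = extProd x g' + extProd y g' := by
      funext v; exact add_mul _ _ _
    rw [word_add, add_mul, hx, hy, e, word_add]
  | smul c x _ hx =>
    have e : extProd (c • x) g' = c • extProd x g' := by
      funext v; exact mul_assoc _ _ _
    rw [word_smul, smul_mul_assoc, hx, e, word_smul]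

end WordFun

end WordComponents

/-! ## The operators on products of generators -/

section GeneratedWords

namespace WordFun

variable {X K : Type*} [CommRing K]

/-- Linear combinations of products of linear generators in `S`. -/
inductive IsGen (S : Submodule K (X → K)) : WordFun X K → Prop
  | one : IsGen S 1
  | add (F G : WordFun X K) : IsGen S F → IsGen S G → IsGen S (F + G)
  | smul (c : K) (F : WordFun X K) : IsGen S F → IsGen S (c • F)
  | genE (u : X → K) (F : WordFun X K) : u ∈ S → IsGen S F → IsGen S (genE u * F)
  | genO (u : X → K) (F : WordFun X K) : u ∈ S → IsGen S F → IsGen S (genO u * F)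

variable {S : Submodule K (X → K)}

lemma isGen_gens {n k : ℕ} {u : Fin n → X → K} {t : Fin k → X → K} (hu : ∀ i, u i ∈ S)
    (ht : ∀ i, t i ∈ S) : IsGen S (gens u t) := by
  have h : ∀ {k : ℕ} (t : Fin k → X → K), (∀ i, t i ∈ S) →
      IsGen S (List.ofFn fun i => WordFun.genO (t i)).prod := by
    intro k t ht
    induction k with
    | zero => exact IsGen.one
    | succ k ih =>
      rw [List.ofFn_succ, List.prod_cons]
      exact IsGen.genO _ _ (ht 0) (ih _ fun i => ht i.succ)
  rw [gens]
  induction n with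
  | zero => simpa using h t ht
  | succ n ih =>
    rw [List.ofFn_succ, List.prod_cons, mul_assoc]
    exact IsGen.genE _ _ (hu 0) (ih (u := fun i => u i.succ) fun i => hu i.succ)

/-- The odd derivation as linear map. -/
def derL (L : (X → K) →ₗ[K] (X → K)) : WordFun X K →ₗ[K] WordFun X K where
  toFun := der L
  map_add' := der_add L
  map_smul' := der_smul L

/-- The second order operator as linear map. -/
def lapL (I : (X × X → K) →ₗ[K] K) : WordFun X K →ₗ[K] WordFun X K where
  toFun := lap I
  map_add' := lap_add I
  map_smul' := lap_smul I

/-- The bracket with an element as linear map. -/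
def braL (I : (X × X → K) →ₗ[K] K) (G : WordFun X K) : WordFun X K →ₗ[K] WordFun X K where
  toFun := bra I G
  map_add' := bra_add I G
  map_smul' c := bra_smul I c G

lemma IsGen.eq_of {T T' : WordFun X K →ₗ[K] WordFun X K} {F : WordFun X K} (h : IsGen S F)
    (h1 : T 1 = T' 1)
    (hE : ∀ u ∈ S, ∀ G, IsGen S G → T G = T' G → T (WordFun.genE u * G) = T' (WordFun.genE u * G))
    (hO : ∀ u ∈ S, ∀ G, IsGen S G → T G = T' G → T (WordFun.genO u * G) = T' (WordFun.genO u * G)) :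
    T F = T' F := by
  induction h with
  | one => exact h1
  | add F G _ _ hF hG => rw [map_add, map_add, hF, hG]
  | smul c F _ hF => rw [map_smul, map_smul, hF]
  | genE u F hu hF ih => exact hE u hu F hF ih
  | genO u F hu hF ih => exact hO u hu F hF ih

variable {I : (X × X → K) →ₗ[K] K} {L : (X → K) →ₗ[K] (X → K)} (u t : X → K) (F : WordFun X K)

lemma der_genE_mul : derL L (genE u * F) = genE u * derL L F := by
  change der L _ = _; rw [der_mul, der_genE, par_genE, zero_mul, zero_add]; rfl

lemma der_genO_mul : derL L (genO u * F) = genE (L u) * F - genO u * derL L F := by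
  change der L _ = _; rw [der_mul, der_genO, par_genO, neg_mul, ← sub_eq_add_neg]; rfl

lemma lap_genE_mul : lapL I (genE u * F) = genE u * lapL I F + braL I (genE u) F := by
  change lap I _ = _; rw [lap_mul, lap_genE, par_genE, zero_mul, zero_add]; rfl

lemma lap_genO_mul : lapL I (genO u * F) = -(genO u * lapL I F) + braL I (genO u) F := by
  change lap I _ = _; rw [lap_mul, lap_genO, par_genO, zero_mul, zero_add, neg_mul]; rfl

lemma bra_genE_genE_mul : braL I (genE u) (genE t * F) = genE t * braL I (genE u) F := by
  change bra I _ _ = _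
  rw [(hasDeg_genE u).bra_mul I (hasDeg_genE t), bra_genE_genE, zero_mul, zero_add, mul_zero,
    sgn_zero, one_smul]; rfl

lemma bra_genE_genO_mul : braL I (genE u) (genO t * F) =
    I (fun p => t p.1 * u p.2) • F - genO t * braL I (genE u) F := by
  change bra I _ _ = _
  rw [(hasDeg_genE u).bra_mul I (hasDeg_genO t), (hasDeg_genE u).bra_comm I (hasDeg_genO t),
    bra_genO_genE, zero_mul, sgn_zero, one_smul, smul_mul_assoc, one_mul, sub_eq_add_neg,
    show ((0 : ℤ) + 1) * -1 = -1 from rfl, show sgn (-1) = -1 from rfl, Units.neg_smul, one_smul]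
  rfl

lemma bra_genO_genE_mul : braL I (genO u) (genE t * F) =
    I (fun p => u p.1 * t p.2) • F + genE t * braL I (genO u) F := by
  change bra I _ _ = _
  rw [(hasDeg_genO u).bra_mul I (hasDeg_genE t), bra_genO_genE, mul_zero, sgn_zero, one_smul,
    smul_mul_assoc, one_mul]; rfl

lemma bra_genO_genO_mul : braL I (genO u) (genO t * F) = genO t * braL I (genO u) F := by
  change bra I _ _ = _
  rw [(hasDeg_genO u).bra_mul I (hasDeg_genO t), bra_genO_genO, zero_mul, zero_add,
    show ((-1 : ℤ) + 1) * -1 = 0 from rfl, sgn_zero, one_smul]; rfl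

lemma derL_one : derL L (1 : WordFun X K) = 0 := der_one L
lemma lapL_one : lapL I (1 : WordFun X K) = 0 := lap_one I
lemma braL_one (G : WordFun X K) : braL I G 1 = 0 := by
  change bra I G 1 = 0; rw [bra, ← intW_zero (X := X) I]; congr 1; funext p; simp

variable {u t F} (h : IsGen S F)
include h

lemma IsGen.bra_bra : (∀ u t, braL I (WordFun.genE u) (braL I (WordFun.genE t) F) =
    -braL I (WordFun.genE t) (braL I (WordFun.genE u) F)) ∧
    (∀ u t, braL I (WordFun.genE u) (braL I (WordFun.genO t) F) =
      braL I (WordFun.genO t) (braL I (WordFun.genE u) F)) ∧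
    ∀ u t, braL I (WordFun.genO u) (braL I (WordFun.genO t) F) =
      braL I (WordFun.genO t) (braL I (WordFun.genO u) F) := by
  induction h with
  | one => simp [braL_one]
  | add F G _ _ hF hG =>
    refine ⟨fun a b => ?_, fun a b => ?_, fun a b => ?_⟩ <;>
      simp only [map_add, hF.1 a b, hF.2.1, hF.2.2 a b, hG.1 a b, hG.2.1, hG.2.2 a b, neg_add]
  | smul c F _ hF =>
    refine ⟨fun a b => ?_, fun a b => ?_, fun a b => ?_⟩ <;>
      simp only [map_smul, hF.1 a b, hF.2.1, hF.2.2 a b, smul_neg]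
  | genE u F hu hF ih =>
    obtain ⟨h1, h2, h3⟩ := ih
    refine ⟨fun a b => ?_, fun a b => ?_, fun a b => ?_⟩ <;>
    · simp only [bra_genE_genE_mul, bra_genO_genE_mul, map_add, map_smul, h1 a, h2, h3 a, mul_neg]
      try abel
  | genO u F hu hF ih =>
    obtain ⟨h1, h2, h3⟩ := ih
    refine ⟨fun a b => ?_, fun a b => ?_, fun a b => ?_⟩ <;>
    · simp only [bra_genE_genO_mul, bra_genO_genO_mul, map_sub, map_smul, h1 a, h2, h3 a, mul_neg]
      try abel

lemma IsGen.lap_bra : (∀ u, lapL I (braL I (WordFun.genE u) F) =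
    -braL I (WordFun.genE u) (lapL I F)) ∧
    ∀ u, lapL I (braL I (WordFun.genO u) F) = braL I (WordFun.genO u) (lapL I F) := by
  induction h with
  | one => simp [braL_one, lapL_one]
  | add F G _ _ hF hG => simp [hF, hG, add_comm]
  | smul c F _ hF => simp [hF]
  | genE u F hu hF ih =>
    refine ⟨fun a => ?_, fun a => ?_⟩
    · simp only [bra_genE_genE_mul, lap_genE_mul, map_add, ih, mul_neg, (hF.bra_bra (I := I)).1 a u]
      module
    · simp only [bra_genO_genE_mul, lap_genE_mul, map_add, map_smul, ih, (hF.bra_bra (I := I)).2.1]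
      module
  | genO u F hu hF ih =>
    refine ⟨fun a => ?_, fun a => ?_⟩
    · simp only [bra_genE_genO_mul, lap_genO_mul, map_add, map_sub, map_neg, map_smul, ih, mul_neg,
        (hF.bra_bra (I := I)).2.1]
      module
    · simp only [bra_genO_genO_mul, lap_genO_mul, map_add, map_neg, ih,
        (hF.bra_bra (I := I)).2.2 a u]

lemma IsGen.lap_lap (I : (X × X → K) →ₗ[K] K) : lap I (lap I F) = 0 := by
  change ((lapL I).comp (lapL I)) F = (0 : WordFun X K →ₗ[K] WordFun X K) F
  refine h.eq_of (by simp [lapL_one]) (fun u hu G hG ih => ?_) fun u hu G hG ih => ?_ <;>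
  · simp only [LinearMap.comp_apply, LinearMap.zero_apply] at ih ⊢
    simp only [lap_genE_mul, lap_genO_mul, map_add, map_neg, ih, hG.lap_bra, mul_zero]
    abel

lemma IsGen.der_der (L : (X → K) →ₗ[K] (X → K)) : der L (der L F) = 0 := by
  change ((derL L).comp (derL L)) F = (0 : WordFun X K →ₗ[K] WordFun X K) F
  refine h.eq_of (by simp [derL_one]) (fun u hu G hG ih => ?_) fun u hu G hG ih => ?_ <;>
  · simp only [LinearMap.comp_apply, LinearMap.zero_apply] at ih ⊢
    simp only [der_genE_mul, der_genO_mul, map_sub, ih, mul_zero, sub_zero, sub_self]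

lemma IsGen.der_lap (L : (X → K) →ₗ[K] (X → K)) (I : (X × X → K) →ₗ[K] K)
    (hvar : ∀ a ∈ S, ∀ b ∈ S, I (fun p => a p.1 * L b p.2) = I fun p => b p.1 * L a p.2) :
    der L (lap I F) = -lap I (der L F) := by
  have hE : ∀ {F}, IsGen S F → ∀ u, derL L (braL I (WordFun.genE u) F) =
      -braL I (WordFun.genE u) (derL L F) := fun h u => by
    change ((derL L).comp (braL I (WordFun.genE u))) _ = (-(braL I (WordFun.genE u)).comp (derL L)) _
    refine h.eq_of (by simp [derL_one, braL_one]) (fun u hu G hG ih => ?_) fun u hu G hG ih => ?_ <;>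
    · simp only [LinearMap.comp_apply, LinearMap.neg_apply] at ih ⊢
      simp only [bra_genE_genE_mul, bra_genE_genO_mul, der_genE_mul, der_genO_mul, map_sub,
        map_smul, ih, mul_neg]
      try module
  have hO : ∀ {F}, IsGen S F → ∀ t ∈ S, derL L (braL I (WordFun.genO t) F) =
      braL I (WordFun.genO t) (derL L F) - braL I (WordFun.genE (L t)) F := fun h t ht => by
    change ((derL L).comp (braL I (WordFun.genO t))) _ =
      ((braL I (WordFun.genO t)).comp (derL L) - braL I (WordFun.genE (L t))) _
    refine h.eq_of (by simp [derL_one, braL_one]) (fun u hu G hG ih => ?_) fun u hu G hG ih => ?_ <;>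
    · simp only [LinearMap.comp_apply, LinearMap.sub_apply] at ih ⊢
      simp only [bra_genE_genE_mul, bra_genE_genO_mul, bra_genO_genE_mul, bra_genO_genO_mul,
        der_genE_mul, der_genO_mul, map_add, map_sub, map_smul, ih, mul_sub, hvar u hu t ht]
      try module
  change ((derL L).comp (lapL I)) F = (-(lapL I).comp (derL L)) F
  refine h.eq_of (by simp [derL_one, lapL_one]) (fun u hu G hG ih => ?_) fun u hu G hG ih => ?_
  all_goals simp only [LinearMap.comp_apply, LinearMap.neg_apply] at ih ⊢
  · simp only [lap_genE_mul, der_genE_mul, map_add, ih, hE hG]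
    noncomm_ring
  · simp only [lap_genE_mul, lap_genO_mul, der_genO_mul, map_add, map_neg, map_sub, ih, hO hG u hu]
    noncomm_ring

end WordFun

end GeneratedWords

/-! ## Word functions with values in formal power series -/

section PowerSeriesWords

open PowerSeries

namespace WordFun

variable {X R : Type*} [CommRing R]

/-- The coefficients of a word function with values in formal power series. -/
def coefW (n : ℕ) : WordFun X R⟦X⟧ →+ WordFun X R where
  toFun F := fun v w => coeff n (F v w)
  map_zero' := WordFun.ext fun _ _ => map_zero _
  map_add' _ _ := WordFun.ext fun _ _ => map_add _ _ _

lemma coefW_ext {F G : WordFun X R⟦X⟧} (h : ∀ n, coefW n F = coefW n G) : F = G :=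
  WordFun.ext fun v w => PowerSeries.ext fun n => congrFun (congrFun (h n) v) w

lemma hasDeg_coefW {j : ℤ} {F : WordFun X R⟦X⟧} : HasDeg j F ↔ ∀ n, HasDeg j (coefW n F) :=
  ⟨fun h n v w hw => by change coeff n (F v w) = 0; rw [h v w hw, map_zero],
    fun h v w hw => PowerSeries.ext fun n => (h n v w hw).trans (map_zero _).symm⟩

lemma coefW_one (n : ℕ) : coefW n (1 : WordFun X R⟦X⟧) = if n = 0 then 1 else 0 :=
  WordFun.ext fun v w => by
    change coeff n (if v = [] ∧ w = [] then 1 else 0) = _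
    split_ifs <;> simp_all [one_apply, coeff_one]

lemma coefW_smul (n : ℕ) (F : WordFun X R⟦X⟧) :
    coefW n ((PowerSeries.X : R⟦X⟧) • F) = hshift (fun n => coefW n F) n := WordFun.ext fun v w => by
  change coeff n (PowerSeries.X * F v w) = _
  cases n with
  | zero => exact coeff_zero_X_mul _
  | succ n => exact coeff_succ_X_mul _ _

lemma coefW_par (n : ℕ) (F : WordFun X R⟦X⟧) : coefW n (par F) = par (coefW n F) :=
  WordFun.ext fun v w => by
    change coeff n ((-1) ^ w.length * F v w) = (-1) ^ w.length * coeff n (F v w)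
    rcases neg_one_pow_eq_or R⟦X⟧ w.length with h | h <;>
    rcases w.length.even_or_odd with h' | h' <;> simp [h'.neg_one_pow]

lemma coefW_mul (n : ℕ) (F G : WordFun X R⟦X⟧) : coefW n (F * G) =
    ∑ p ∈ Finset.HasAntidiagonal.antidiagonal n, coefW p.1 F * coefW p.2 G := by
  have hs : ∀ (f : ℕ × ℕ → WordFun X R) v w, (∑ p ∈ Finset.HasAntidiagonal.antidiagonal n, f p) v w =
      ∑ p ∈ Finset.HasAntidiagonal.antidiagonal n, f p v w := fun f v w =>
    map_sum ({ toFun := fun G => G v w, map_zero' := rfl, map_add' := fun _ _ => rfl } :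
      WordFun X R →+ R) f (Finset.HasAntidiagonal.antidiagonal n)
  refine WordFun.ext fun v w => ?_
  rw [hs]
  change coeff n ((F * G) v w) = _
  induction v generalizing F G with
  | cons x v ih =>
    simp only [mul_cons, map_add, ih, Finset.sum_add_distrib]
    rfl
  | nil =>
    induction w generalizing F G with
    | nil => simp only [mul_nil, coeff_mul]; rfl
    | cons x w ih =>
      simp only [mul_nil_cons, map_add, ih, Finset.sum_add_distrib, coefW_par]
      rfl

/-- The coefficientwise extension of a linear functional. -/
def psMap {Y : Type*} (ℓ : (Y → R) →ₗ[R] R) : (Y → R⟦X⟧) →ₗ[R⟦X⟧] R⟦X⟧ where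
  toFun u := mk fun n => ℓ fun y => coeff n (u y)
  map_add' u u' := PowerSeries.ext fun n => by
    rw [map_add, coeff_mk, coeff_mk, coeff_mk, ← map_add]
    exact congrArg ℓ (funext fun y => map_add _ _ _)
  map_smul' c u := PowerSeries.ext fun n => by
    rw [coeff_mk, RingHom.id_apply, smul_eq_mul, coeff_mul]
    simp only [coeff_mk, ← smul_eq_mul, ← map_smul, ← map_sum]
    refine congrArg ℓ (funext fun y => ?_)
    simp [coeff_mul]

lemma coeff_psMap {Y : Type*} (ℓ : (Y → R) →ₗ[R] R) (u : Y → R⟦X⟧) (n : ℕ) :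
    coeff n (psMap ℓ u) = ℓ fun y => coeff n (u y) :=
  coeff_mk n fun n => ℓ fun y => coeff n (u y)

variable (L : (X → R) →ₗ[R] (X → R)) (I : (X × X → R) →ₗ[R] R)

lemma coefW_lap (n : ℕ) (F : WordFun X R⟦X⟧) : coefW n (lap (psMap I) F) = lap I (coefW n F) :=
  WordFun.ext fun _ _ => coeff_psMap I _ n

lemma coefW_der (n : ℕ) (F : WordFun X R⟦X⟧) :
    coefW n (der (LinearMap.pi fun x => psMap (evalAt L x)) F) = der L (coefW n F) := by
  refine WordFun.ext fun v w => ?_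
  change coeff n (der _ F v w) = _
  induction v generalizing F with
  | nil => exact map_zero _
  | cons x v ih =>
    rw [der_cons, map_add, ih, der_cons]
    exact congrArg (_ + ·) (coeff_psMap (evalAt L x) _ n)

lemma coefW_bra (n : ℕ) (F G : WordFun X R⟦X⟧) : coefW n (bra (psMap I) F G) =
    ∑ p ∈ Finset.HasAntidiagonal.antidiagonal n, bra I (coefW p.1 F) (coefW p.2 G) := by
  have h1 := congrArg (coefW n) (lap_mul (psMap I) F G)
  have h2 : ∀ F G : WordFun X R, bra I F G = lap I (F * G) - lap I F * G - par F * lap I G :=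
    fun F G => by rw [lap_mul]; abel
  have h3 : ∀ f : ℕ × ℕ → WordFun X R, lap I (∑ p ∈ Finset.HasAntidiagonal.antidiagonal n, f p) =
      ∑ p ∈ Finset.HasAntidiagonal.antidiagonal n, lap I (f p) := fun f => map_sum (lapL I) _ _
  simp only [map_add, coefW_lap, coefW_mul, coefW_par, h3] at h1
  simp only [h2, Finset.sum_sub_distrib, h1]
  abel

end WordFun

end PowerSeriesWords

/-! ## Locally convex direct sums -/

open scoped NNReal

section Seminorms

variable {𝕜 : Type*} [RCLike 𝕜] {A B : Type*} [AddCommGroup A] [Module 𝕜 A] [AddCommGroup B]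
  [Module 𝕜 B]

/-- Classes of seminorms which consist of the continuous seminorms of some topology. -/
structure IsSeminormIdeal (C : Seminorm 𝕜 A → Prop) : Prop where
  zero : C 0
  sup : ∀ p q, C p → C q → C (p ⊔ q)
  smul : ∀ (r : ℝ≥0) p, C p → C (r • p)
  mono : ∀ p q, p ≤ q → C q → C p

lemma IsSeminormIdeal.continuous_iff {C : Seminorm 𝕜 A → Prop} (hC : IsSeminormIdeal C)
    [TopologicalSpace A] [Nonempty {p // C p}]
    (hw : WithSeminorms (fun p : {p // C p} => p.1 : SeminormFamily 𝕜 A {p // C p}))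
    (p : Seminorm 𝕜 A) : Continuous p ↔ C p := by
  refine ⟨fun hp => ?_, fun hp => hw.continuous_seminorm ⟨p, hp⟩⟩
  obtain ⟨s, r, -, hr⟩ := Seminorm.bound_of_continuous hw p hp
  refine hC.mono _ _ hr (hC.smul _ _ ?_)
  clear hr
  induction s using Finset.cons_induction with
  | empty => exact hC.zero
  | cons i s hi ih =>
    rw [Finset.sup_cons]
    exact hC.sup _ _ i.2 ih

lemma Seminorm.map_sum_le_sum (p : Seminorm 𝕜 A) {ι : Type*} (s : Finset ι) (f : ι → A) :
    p (∑ i ∈ s, f i) ≤ ∑ i ∈ s, p (f i) :=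
  Finset.le_sum_of_subadditive p (map_zero p).le (map_add_le_add p) s f

/-- The sum of a pointwise finite family of seminorms. -/
def finsumSeminorm {ι : Type*} (p : ι → Seminorm 𝕜 A)
    (hp : ∀ x, (Function.support fun i => p i x).Finite) : Seminorm 𝕜 A :=
  Seminorm.of (fun x => ∑ᶠ i, p i x)
    (fun x y => by
      rw [← finsum_add_distrib (hp x) (hp y)]
      exact finsum_le_finsum' (hp _) (((hp x).union (hp y)).subset fun i hi => by
        by_contra h
        rw [mem_union, not_or, Function.notMem_support, Function.notMem_support] at h
        exact hi (by simp only [h.1, h.2, add_zero])) fun i => map_add_le_add (p i) x y)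
    (fun c x => by simp only [map_smul_eq_mul, ← mul_finsum])

lemma finsumSeminorm_apply {ι : Type*} (p : ι → Seminorm 𝕜 A)
    (hp : ∀ x, (Function.support fun i => p i x).Finite) (x : A) :
    finsumSeminorm p hp x = ∑ᶠ i, p i x := rfl

lemma le_finsumSeminorm {ι : Type*} (p : ι → Seminorm 𝕜 A)
    (hp : ∀ x, (Function.support fun i => p i x).Finite) (i : ι) (x : A) :
    p i x ≤ finsumSeminorm p hp x :=
  single_le_finsum i (hp x) fun j => apply_nonneg (p j) x

variable [TopologicalSpace A] [TopologicalSpace B]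

lemma PolynormableSpace.isVonNBounded_iff [PolynormableSpace 𝕜 A] {S : Set A} :
    Bornology.IsVonNBounded 𝕜 S ↔
      ∀ p : Seminorm 𝕜 A, Continuous p → ∃ R : ℝ, ∀ x ∈ S, p x ≤ R := by
  rw [(PolynormableSpace.withSeminorms 𝕜 A).isVonNBounded_iff_seminorm_bddAbove]
  simp only [Subtype.forall, bddAbove_def, forall_mem_image]

lemma PolynormableSpace.continuous_of_comp [PolynormableSpace 𝕜 A] [PolynormableSpace 𝕜 B]
    (f : A →ₗ[𝕜] B) (hf : ∀ q : Seminorm 𝕜 B, Continuous q → Continuous (q.comp f)) :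
    Continuous f :=
  have := (PolynormableSpace.withSeminorms 𝕜 A).topologicalAddGroup
  WithSeminorms.continuous_of_continuous_comp (PolynormableSpace.withSeminorms 𝕜 B) f fun q => hf q.1 q.2

lemma PolynormableSpace.tendsto_iff [PolynormableSpace 𝕜 A] {ι : Type*} {l : Filter ι} {u : ι → A}
    {a : A} : Tendsto u l (𝓝 a) ↔ ∀ p : Seminorm 𝕜 A, Continuous p →
      ∀ ε > 0, ∀ᶠ i in l, p (u i - a) < ε := by
  rw [(PolynormableSpace.withSeminorms 𝕜 A).tendsto_nhds]
  simp only [Subtype.forall]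

lemma PolynormableSpace.separating [PolynormableSpace 𝕜 A] [T2Space A] {x : A} (hx : x ≠ 0) :
    ∃ p : Seminorm 𝕜 A, Continuous p ∧ p x ≠ 0 := by
  obtain ⟨p, hp⟩ := (PolynormableSpace.withSeminorms 𝕜 A).separating_of_T1 x hx
  exact ⟨p.1, p.2, hp⟩

lemma PolynormableSpace.t2Space [PolynormableSpace 𝕜 A]
    (h : ∀ x : A, x ≠ 0 → ∃ p : Seminorm 𝕜 A, Continuous p ∧ p x ≠ 0) : T2Space A := by
  have := (PolynormableSpace.withSeminorms 𝕜 A).topologicalAddGroup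
  have := (PolynormableSpace.withSeminorms 𝕜 A).T1_of_separating fun x hx => by
    obtain ⟨p, h1, h2⟩ := h x hx
    exact ⟨⟨p, h1⟩, h2⟩
  infer_instance

lemma isMackeyCauchy_map [PolynormableSpace 𝕜 A] [PolynormableSpace 𝕜 B] {f : A →ₗ[𝕜] B}
    (hf : IsBddLinear f) {x : ℕ → A} (hx : IsMackeyCauchy 𝕜 x) : IsMackeyCauchy 𝕜 (f ∘ x) := by
  obtain ⟨S, hS, μ, hμ, h⟩ := hx
  refine ⟨f '' S, hf S hS, μ, hμ, fun m n => ?_⟩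
  obtain ⟨b, hb, e⟩ := h m n
  exact ⟨f b, mem_image_of_mem f hb, by simp only [Function.comp_apply, ← map_sub, e, map_smul]⟩

lemma isConvenient_pi {ι : Type*} {V : ι → Type*} [∀ i, AddCommGroup (V i)] [∀ i, Module 𝕜 (V i)]
    [∀ i, TopologicalSpace (V i)] (hV : ∀ i, IsConvenient 𝕜 (V i)) : IsConvenient 𝕜 (∀ i, V i) := by
  have := fun i => (hV i).locallyConvex
  have := fun i => (hV i).hausdorff
  refine ⟨inferInstance, inferInstance, fun x hx => ?_⟩
  have h : ∀ i, ∃ a, Tendsto (fun m => x m i) atTop (𝓝 a) := fun i =>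
    (hV i).complete _ (isMackeyCauchy_map (f := (LinearMap.proj i : (∀ i, V i) →ₗ[𝕜] V i))
      (isBddLinear_of_continuous (continuous_apply i)) hx)
  choose a ha using h
  exact ⟨a, tendsto_pi_nhds.2 ha⟩

end Seminorms

/-- The locally convex direct sum. -/
def LCSum (𝕜 : Type*) [RCLike 𝕜] (V : ℕ → Type*) [∀ k, AddCommGroup (V k)] [∀ k, Module 𝕜 (V k)] :
    Type _ := ⨁ k, V k

lemma isVonNBounded_of_isInducing {𝕜 A B : Type*} [RCLike 𝕜] [AddCommGroup A] [Module 𝕜 A]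
    [TopologicalSpace A] [AddCommGroup B] [Module 𝕜 B] [TopologicalSpace B] {f : A →ₗ[𝕜] B}
    (hf : IsInducing f) {S : Set A} (h : Bornology.IsVonNBounded 𝕜 (f '' S)) :
    Bornology.IsVonNBounded 𝕜 S := by
  rw [Bornology.isVonNBounded_iff_tendsto_smallSets_nhds] at h ⊢
  rw [hf.nhds_eq_comap, smallSets_comap_eq_comap_image, tendsto_comap_iff, map_zero]
  exact h.congr fun c => (image_smul_set f c S).symm

namespace LCSum

variable {𝕜 : Type*} [RCLike 𝕜] {V : ℕ → Type*} [∀ k, AddCommGroup (V k)] [∀ k, Module 𝕜 (V k)]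

instance : AddCommGroup (LCSum 𝕜 V) := inferInstanceAs (AddCommGroup (⨁ k, V k))

instance : Module 𝕜 (LCSum 𝕜 V) := inferInstanceAs (Module 𝕜 (⨁ k, V k))

/-- The inclusion of a summand. -/
def lof (k : ℕ) : V k →ₗ[𝕜] LCSum 𝕜 V := DirectSum.lof 𝕜 ℕ V k

/-- The projection to a summand. -/
def comp (k : ℕ) : LCSum 𝕜 V →ₗ[𝕜] V k := DirectSum.component 𝕜 ℕ V k

@[simp] lemma comp_lof_same (k : ℕ) (x : V k) : comp (𝕜 := 𝕜) k (lof k x) = x :=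
  DirectSum.component.lof_self 𝕜 k x

lemma comp_lof_of_ne {k l : ℕ} (h : l ≠ k) (x : V k) : comp (𝕜 := 𝕜) l (lof k x) = 0 :=
  DirectSum.of_eq_of_ne k l x h

lemma ext {x y : LCSum 𝕜 V} (h : ∀ k, comp k x = comp k y) : x = y :=
  DirectSum.ext_component 𝕜 h

lemma finite_support (x : LCSum 𝕜 V) : {k | comp k x ≠ 0}.Finite := by
  classical
  exact (DFinsupp.finite_support (show Π₀ k, V k from x))

lemma exists_bound (x : LCSum 𝕜 V) : ∃ N, ∀ k, N ≤ k → comp k x = 0 := by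
  obtain ⟨N, hN⟩ := (finite_support x).bddAbove
  refine ⟨N + 1, fun k hk => by_contra fun h => ?_⟩
  have := hN h
  omega

lemma sum_lof {x : LCSum 𝕜 V} {N : ℕ} (hN : ∀ k, N ≤ k → comp k x = 0) :
    ∑ k ∈ Finset.range N, lof k (comp k x) = x := by
  refine ext fun l => ?_
  rw [map_sum]
  by_cases hl : l < N
  · rw [Finset.sum_eq_single l, comp_lof_same]
    · exact fun k _ hk => comp_lof_of_ne hk.symm _
    · exact fun h => absurd (Finset.mem_range.2 hl) h
  · rw [hN l (not_lt.1 hl)]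
    exact Finset.sum_eq_zero fun k hk => comp_lof_of_ne
      (by rintro rfl; exact hl (Finset.mem_range.1 hk)) _

lemma hom_ext {B : Type*} [AddCommGroup B] [Module 𝕜 B] {f g : LCSum 𝕜 V →ₗ[𝕜] B}
    (h : ∀ k x, f (lof k x) = g (lof k x)) : f = g := by
  ext x
  obtain ⟨N, hN⟩ := exists_bound x
  rw [← sum_lof hN, map_sum, map_sum]
  exact Finset.sum_congr rfl fun k _ => h k _

/-- The linear map determined by its restrictions to the summands. -/
def desc {B : Type*} [AddCommGroup B] [Module 𝕜 B] (f : ∀ k, V k →ₗ[𝕜] B) : LCSum 𝕜 V →ₗ[𝕜] B :=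
  DirectSum.toModule 𝕜 ℕ B f

@[simp] lemma desc_lof {B : Type*} [AddCommGroup B] [Module 𝕜 B] (f : ∀ k, V k →ₗ[𝕜] B) (k : ℕ)
    (x : V k) : desc f (lof k x) = f k x := DirectSum.toModule_lof 𝕜 k x

variable [∀ k, TopologicalSpace (V k)]

variable (𝕜 V) in
/-- Seminorms with continuous restrictions to all summands. -/
def IsContSeminorm (p : Seminorm 𝕜 (LCSum 𝕜 V)) : Prop := ∀ k, Continuous fun x : V k => p (lof k x)

instance : Nonempty {p // IsContSeminorm 𝕜 V p} := ⟨⟨0, fun _ => continuous_const⟩⟩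

instance : TopologicalSpace (LCSum 𝕜 V) :=
  (SeminormFamily.moduleFilterBasis
    (fun p : {p // IsContSeminorm 𝕜 V p} => p.1)).topology

lemma withSeminorms : WithSeminorms
    (fun p : {p // IsContSeminorm 𝕜 V p} => p.1 : SeminormFamily 𝕜 (LCSum 𝕜 V) _) := ⟨rfl⟩

instance : PolynormableSpace 𝕜 (LCSum 𝕜 V) := withSeminorms.toPolynormableSpace

variable [∀ k, PolynormableSpace 𝕜 (V k)]

lemma isSeminormIdeal : IsSeminormIdeal (IsContSeminorm 𝕜 V) where
  zero _ := continuous_const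
  sup p q hp hq k := by simpa only [Seminorm.sup_apply] using (hp k).sup (hq k)
  smul r p hp k := (hp k).const_smul r
  mono p q h hq k := by
    have := (PolynormableSpace.withSeminorms 𝕜 (V k)).topologicalAddGroup
    have := (PolynormableSpace.withSeminorms 𝕜 (V k)).continuousSMul
    exact Seminorm.continuous_of_le (p := p.comp (lof k)) (q := q.comp (lof k)) (hq k)
      fun x => h _

lemma continuous_seminorm_iff (p : Seminorm 𝕜 (LCSum 𝕜 V)) :
    Continuous p ↔ ∀ k, Continuous fun x : V k => p (lof k x) :=
  isSeminormIdeal.continuous_iff withSeminorms p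

lemma continuous_lof (k : ℕ) : Continuous (lof (𝕜 := 𝕜) (V := V) k) :=
  PolynormableSpace.continuous_of_comp _ fun q hq => (continuous_seminorm_iff q).1 hq k

lemma continuous_comp (k : ℕ) : Continuous (comp (𝕜 := 𝕜) (V := V) k) := by
  refine PolynormableSpace.continuous_of_comp _ fun q hq => (continuous_seminorm_iff _).2 fun l => ?_
  rcases eq_or_ne k l with rfl | h
  · simpa using hq
  · simpa [comp_lof_of_ne h] using continuous_const

lemma isVonNBounded_iff [∀ k, T2Space (V k)] {S : Set (LCSum 𝕜 V)} :
    Bornology.IsVonNBounded 𝕜 S ↔ (∃ N, ∀ x ∈ S, ∀ k, N ≤ k → comp k x = 0) ∧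
      ∀ k, Bornology.IsVonNBounded 𝕜 (comp k '' S) := by
  constructor
  · intro hS
    refine ⟨?_, fun k => isBddLinear_of_continuous (continuous_comp k) S hS⟩
    by_contra! h
    have hq : ∀ k, ∃ q : Seminorm 𝕜 (V k), Continuous q ∧
        ((∃ x ∈ S, comp k x ≠ 0) → ∃ x ∈ S, (k : ℝ) ≤ q (comp k x)) := by
      intro k
      by_cases hk : ∃ x ∈ S, comp k x ≠ 0
      · obtain ⟨x, hx, hx0⟩ := hk
        obtain ⟨q, hq, hqx⟩ := PolynormableSpace.separating (𝕜 := 𝕜) hx0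
        have hpos : 0 < q (comp k x) := lt_of_le_of_ne (apply_nonneg _ _) hqx.symm
        refine ⟨Real.toNNReal (k / q (comp k x)) • q, hq.const_smul _, fun _ => ⟨x, hx, ?_⟩⟩
        rw [_root_.smul_apply, NNReal.smul_def, Real.coe_toNNReal _ (by positivity), smul_eq_mul,
          div_mul_cancel₀ _ hqx]
      · exact ⟨0, continuous_const, fun h => absurd h hk⟩
    choose q hq hqS using hq
    have hfin : ∀ x : LCSum 𝕜 V, (Function.support fun k => (q k).comp (comp k) x).Finite :=
      fun x => (finite_support x).subset fun k hk h => hk (by simp [h])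
    have hP : Continuous (finsumSeminorm _ hfin) := by
      refine (continuous_seminorm_iff _).2 fun k => ?_
      convert hq k using 2 with x
      rw [finsumSeminorm_apply, finsum_eq_single _ k]
      · simp
      · intro l hl; simp [comp_lof_of_ne hl]
    obtain ⟨R, hR⟩ := PolynormableSpace.isVonNBounded_iff.1 hS _ hP
    obtain ⟨N, hN⟩ := exists_nat_gt R
    obtain ⟨x, hx, k, hk, hxk⟩ := h N
    obtain ⟨y, hy, hky⟩ := hqS k ⟨x, hx, hxk⟩
    have h1 := hR y hy
    have h2 := le_finsumSeminorm _ hfin k y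
    have h3 : (N : ℝ) ≤ k := by exact_mod_cast hk
    simp only [Seminorm.comp_apply] at h2
    linarith
  · rintro ⟨⟨N, hN⟩, h⟩
    refine PolynormableSpace.isVonNBounded_iff.2 fun p hp => ?_
    have h' : ∀ k, ∃ R : ℝ, ∀ x ∈ S, p (lof k (comp k x)) ≤ R := fun k => by
      obtain ⟨R, hR⟩ := PolynormableSpace.isVonNBounded_iff.1 (h k) (p.comp (lof k))
        ((continuous_seminorm_iff p).1 hp k)
      exact ⟨R, fun x hx => hR _ (mem_image_of_mem _ hx)⟩
    choose R hR using h'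
    refine ⟨∑ k ∈ Finset.range N, R k, fun x hx => ?_⟩
    rw [← sum_lof (hN x hx)]
    refine (Seminorm.map_sum_le_sum p _ _).trans ?_
    exact Finset.sum_le_sum fun k _ => hR k x hx

lemma isConvenient (hV : ∀ k, IsConvenient 𝕜 (V k)) : IsConvenient 𝕜 (LCSum 𝕜 V) := by
  have := fun k => (hV k).hausdorff
  have hag := (PolynormableSpace.withSeminorms 𝕜 (LCSum 𝕜 V)).topologicalAddGroup
  refine ⟨inferInstance, PolynormableSpace.t2Space (𝕜 := 𝕜) fun x hx => ?_, fun x hx => ?_⟩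
  · obtain ⟨k, hk⟩ : ∃ k, comp k x ≠ 0 := by
      by_contra! h
      exact hx (ext fun k => by rw [h k, map_zero])
    obtain ⟨q, hq, hqx⟩ := PolynormableSpace.separating (𝕜 := 𝕜) hk
    exact ⟨q.comp (comp k), hq.comp (continuous_comp k), hqx⟩
  · have h : ∀ k, ∃ a, Tendsto (fun m => comp k (x m)) atTop (𝓝 a) := fun k =>
      (hV k).complete _ (isMackeyCauchy_map (isBddLinear_of_continuous (continuous_comp k)) hx)
    choose a ha using h
    obtain ⟨S, hS, μ, -, hμ⟩ := hx
    obtain ⟨⟨N, hN⟩, -⟩ := isVonNBounded_iff.1 hS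
    refine ⟨x 0 + ∑ k ∈ Finset.range N, lof k (a k - comp k (x 0)), ?_⟩
    have e : ∀ m, x m = x 0 + ∑ k ∈ Finset.range N, lof k (comp k (x m) - comp k (x 0)) := by
      intro m
      have := sum_lof (x := x m - x 0) (N := N) fun k hk => by
        obtain ⟨b, hb, e⟩ := hμ m 0
        rw [e, map_smul, hN b hb k hk, smul_zero]
      simp only [map_sub] at this ⊢
      rw [this]; abel
    refine Tendsto.congr (fun m => (e m).symm) ?_
    refine Tendsto.add (M := LCSum 𝕜 V) tendsto_const_nhds (tendsto_finsetSum _ fun k _ => ?_)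
    have := (PolynormableSpace.withSeminorms 𝕜 (V k)).topologicalAddGroup
    exact ((continuous_lof k).tendsto _).comp ((ha k).sub_const _)

lemma isBddLinear_of_lof [∀ k, T2Space (V k)] {B : Type*} [AddCommGroup B] [Module 𝕜 B]
    [TopologicalSpace B] [PolynormableSpace 𝕜 B] {f : LCSum 𝕜 V →ₗ[𝕜] B}
    (hf : ∀ k, IsBddLinear (f.comp (lof k))) : IsBddLinear f := by
  intro S hS
  obtain ⟨⟨N, hN⟩, h⟩ := isVonNBounded_iff.1 hS
  refine PolynormableSpace.isVonNBounded_iff.2 fun p hp => ?_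
  have h' : ∀ k, ∃ R : ℝ, ∀ x ∈ S, p (f (lof k (comp k x))) ≤ R := fun k => by
    obtain ⟨R, hR⟩ := PolynormableSpace.isVonNBounded_iff.1 (hf k _ (h k)) p hp
    exact ⟨R, fun x hx => hR _ (mem_image_of_mem _ (mem_image_of_mem _ hx))⟩
  choose R hR using h'
  refine ⟨∑ k ∈ Finset.range N, R k, ?_⟩
  rintro _ ⟨x, hx, rfl⟩
  rw [← sum_lof (hN x hx), map_sum]
  refine (Seminorm.map_sum_le_sum p _ _).trans ?_
  exact Finset.sum_le_sum fun k _ => hR k x hx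

variable (𝕜 V) in
/-- The homogeneous pieces: the `k`-th summand has degree `-k`. -/
def deg (j : ℤ) : Submodule 𝕜 (LCSum 𝕜 V) where
  carrier := {x | ∀ k : ℕ, (k : ℤ) + j ≠ 0 → comp k x = 0}
  zero_mem' _ _ := map_zero _
  add_mem' hx hy k hk := by rw [map_add, hx k hk, hy k hk, add_zero]
  smul_mem' c x hx k hk := by rw [map_smul, hx k hk, smul_zero]

lemma mem_deg {j : ℤ} {x : LCSum 𝕜 V} :
    x ∈ deg 𝕜 V j ↔ ∀ k : ℕ, (k : ℤ) + j ≠ 0 → comp k x = 0 := Iff.rfl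

lemma lof_mem_deg (k : ℕ) (x : V k) : lof (𝕜 := 𝕜) k x ∈ deg 𝕜 V (-(k : ℤ)) :=
  fun l hl => comp_lof_of_ne (by rintro rfl; simp at hl) _

/-- The `k`-th summand as homogeneous piece of degree `-k`. -/
def degEquiv (k : ℕ) : V k ≃L[𝕜] deg 𝕜 V (-(k : ℤ)) where
  toFun x := ⟨lof k x, lof_mem_deg k x⟩
  map_add' _ _ := Subtype.ext (map_add _ _ _)
  map_smul' _ _ := Subtype.ext (map_smul _ _ _)
  invFun x := comp k (x : LCSum 𝕜 V)
  left_inv x := comp_lof_same k x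
  right_inv x := Subtype.ext (ext fun l => by
    rcases eq_or_ne l k with rfl | h
    · exact comp_lof_same _ _
    · rw [x.2 l (by omega)]
      exact comp_lof_of_ne h _)
  continuous_toFun := (continuous_lof k).subtype_mk _
  continuous_invFun := (continuous_comp k).comp continuous_subtype_val

@[simp] lemma coe_degEquiv (k : ℕ) (x : V k) : (degEquiv (𝕜 := 𝕜) k x : LCSum 𝕜 V) = lof k x := rfl

lemma deg_eq_bot {j : ℤ} (hj : 0 < j) : deg 𝕜 V j = ⊥ :=
  (Submodule.eq_bot_iff _).2 fun x hx => ext fun k => by rw [hx k (by omega), map_zero]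

lemma isInternal : DirectSum.IsInternal (deg 𝕜 V) := by
  have key : ∀ (z : ⨁ j : ℤ, deg 𝕜 V j) (k : ℕ),
      comp k (DirectSum.coeAddMonoidHom (deg 𝕜 V) z) =
        comp k (z (-(k : ℤ)) : LCSum 𝕜 V) := by
    intro z k
    induction z using DirectSum.induction_on with
    | zero => simp
    | of j x =>
      rw [DirectSum.coeAddMonoidHom_of]
      rcases eq_or_ne j (-(k : ℤ)) with rfl | h
      · rw [DirectSum.of_eq_same]
      · rw [DirectSum.of_eq_of_ne _ _ _ (Ne.symm h), Submodule.coe_zero, map_zero, x.2 k (by omega)]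
    | add x y hx hy => simp only [map_add, hx, hy, DirectSum.add_apply, Submodule.coe_add]
  constructor
  · refine (injective_iff_map_eq_zero _).2 fun z hz => DFinsupp.ext fun j => Subtype.ext
      (ext fun k => ?_)
    by_cases hk : (k : ℤ) + j = 0
    · obtain rfl : j = -(k : ℤ) := by omega
      rw [← key, hz]; rfl
    · exact ((z j).2 k hk).trans (map_zero _).symm
  · intro x
    obtain ⟨N, hN⟩ := exists_bound x
    refine ⟨∑ k ∈ Finset.range N, DirectSum.of (fun j => deg 𝕜 V j) (-(k : ℤ))
      (degEquiv k (comp k x)), ?_⟩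
    rw [map_sum]
    simpa using sum_lof hN

lemma continuous_of_deg (p : Seminorm 𝕜 (LCSum 𝕜 V))
    (hp : ∀ j, Continuous fun x : deg 𝕜 V j => p (x : LCSum 𝕜 V)) : Continuous p :=
  (continuous_seminorm_iff p).2 fun k => (hp (-(k : ℤ))).comp (degEquiv k).continuous

variable {V' : ℕ → Type*} [∀ k, AddCommGroup (V' k)] [∀ k, Module 𝕜 (V' k)] [∀ k, T2Space (V k)]
  [∀ k, TopologicalSpace (V' k)] [∀ k, PolynormableSpace 𝕜 (V' k)] [∀ k, T2Space (V' k)]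

/-! ## Formal power series with coefficients in a graded space -/

/-- The components of `x` of order at least `N` vanish. -/
def IsBelow (N : ℕ) (x : LCSum 𝕜 V) : Prop := ∀ k, N ≤ k → comp k x = 0

lemma IsBelow.mono {N N' : ℕ} {x : LCSum 𝕜 V} (h : IsBelow N x) (hN : N ≤ N') : IsBelow N' x :=
  fun k hk => h k (hN.trans hk)

lemma IsBelow.sum {ι : Type*} {s : Finset ι} {N : ℕ} {x : ι → LCSum 𝕜 V}
    (h : ∀ i ∈ s, IsBelow N (x i)) : IsBelow N (∑ i ∈ s, x i) := fun k hk => by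
  rw [map_sum]; exact Finset.sum_eq_zero fun i hi => h i hi k hk

lemma IsBelow.of_deg {N : ℕ} {j : ℤ} {x : LCSum 𝕜 V} (h : x ∈ deg 𝕜 V j)
    (hj : -N < j) : IsBelow N x := fun k hk => h k (by omega)

lemma IsBelow.map {s : ℤ} {f : LCSum 𝕜 V →ₗ[𝕜] LCSum 𝕜 V'}
    (hf : ∀ j, ∀ x ∈ deg 𝕜 V j, f x ∈ deg 𝕜 V' (j + s)) {N : ℕ}
    {x : LCSum 𝕜 V} (hx : IsBelow N x) : IsBelow (N + s.natAbs) (f x) := by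
  rw [← sum_lof hx, map_sum]
  refine IsBelow.sum fun k hk => .of_deg (hf _ _ (lof_mem_deg k _)) ?_
  have := Finset.mem_range.1 hk
  omega

lemma IsBelow.map₂ {s : ℤ} {f : LCSum 𝕜 V →ₗ[𝕜] LCSum 𝕜 V →ₗ[𝕜] LCSum 𝕜 V}
    (hf : ∀ i j, ∀ x ∈ deg 𝕜 V i, ∀ y ∈ deg 𝕜 V j,
      f x y ∈ deg 𝕜 V (i + j + s)) {N N' : ℕ} {x y : LCSum 𝕜 V}
    (hx : IsBelow N x) (hy : IsBelow N' y) : IsBelow (N + N' + s.natAbs) (f x y) := by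
  rw [← sum_lof hx, ← sum_lof hy, map_sum f, LinearMap.sum_apply]
  refine IsBelow.sum fun k hk => ?_
  rw [map_sum]
  refine IsBelow.sum fun l hl => .of_deg (hf _ _ _ (lof_mem_deg k _) _ (lof_mem_deg l _)) ?_
  have := Finset.mem_range.1 hk
  have := Finset.mem_range.1 hl
  omega

variable (𝕜 V) in
/-- Formal power series, degree by degree. -/
abbrev Formal : Type _ := LCSum 𝕜 fun k => ℕ → V k

/-- The coefficients of formal power series. -/
def coef (n : ℕ) : Formal 𝕜 V →ₗ[𝕜] LCSum 𝕜 V := desc fun k => (lof k).comp (LinearMap.proj n)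

lemma coef_lof (n k : ℕ) (x : ℕ → V k) : coef (𝕜 := 𝕜) n (lof k x) = lof k (x n) := desc_lof _ _ _

lemma comp_coef (n k : ℕ) (x : Formal 𝕜 V) : comp k (coef n x) = comp k x n := by
  refine LinearMap.congr_fun (f := (comp k).comp (coef n)) (g := (LinearMap.proj (φ := fun _ : ℕ => V k) n).comp (comp k))
    (hom_ext fun l x => ?_) x
  rw [LinearMap.comp_apply, LinearMap.comp_apply, coef_lof]
  rcases eq_or_ne k l with rfl | h
  · rw [comp_lof_same, comp_lof_same]; rfl
  · rw [comp_lof_of_ne h, comp_lof_of_ne h]; rfl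

lemma coef_ext {x y : Formal 𝕜 V} (h : ∀ n, coef n x = coef n y) : x = y :=
  ext fun k => funext fun n => by rw [← comp_coef, h, comp_coef]

lemma mem_deg_coef {j : ℤ} {x : Formal 𝕜 V} : x ∈ deg 𝕜 (fun k => ℕ → V k) j ↔
    ∀ n, coef n x ∈ deg 𝕜 V j :=
  ⟨fun h n k hk => by rw [comp_coef, h k hk]; rfl,
    fun h k hk => funext fun n => by rw [← comp_coef]; exact h n k hk⟩

lemma isBelow_coef {N : ℕ} {x : Formal 𝕜 V} : IsBelow N x ↔ ∀ n, IsBelow N (coef n x) :=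
  ⟨fun h n k hk => by rw [comp_coef, h k hk]; rfl,
    fun h k hk => funext fun n => by rw [← comp_coef]; exact h n k hk⟩

lemma exists_ofCoef (y : ℕ → LCSum 𝕜 V) (h : ∃ N, ∀ n, IsBelow N (y n)) :
    ∃ x : Formal 𝕜 V, ∀ n, coef n x = y n := by
  obtain ⟨N, hN⟩ := h
  refine ⟨∑ k ∈ Finset.range N, lof k fun n => comp k (y n), fun n => ?_⟩
  rw [map_sum]
  exact (Finset.sum_congr rfl fun k _ => coef_lof _ _ _).trans (sum_lof (hN n))

lemma continuous_coef (n : ℕ) : Continuous (coef (𝕜 := 𝕜) (V := V) n) :=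
  PolynormableSpace.continuous_of_comp _ fun q hq => (continuous_seminorm_iff _).2 fun k => by
    change Continuous fun x : ℕ → V k => q (coef n (lof k x))
    simp only [coef_lof]
    exact hq.comp ((continuous_lof k).comp (continuous_apply n))

lemma isVonNBounded_formal {S : Set (Formal 𝕜 V)} : Bornology.IsVonNBounded 𝕜 S ↔
    (∃ N, ∀ x ∈ S, IsBelow N x) ∧ ∀ n, Bornology.IsVonNBounded 𝕜 (coef n '' S) := by
  refine ⟨fun h => ⟨(isVonNBounded_iff.1 h).1,
    fun n => isBddLinear_of_continuous (continuous_coef n) S h⟩,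
    fun h => isVonNBounded_iff.2 ⟨h.1, fun k => Bornology.isVonNBounded_pi_iff.2 fun n => ?_⟩⟩
  refine (isBddLinear_of_continuous (continuous_comp k) _ (h.2 n)).subset ?_
  rintro _ ⟨_, ⟨x, hx, rfl⟩, rfl⟩
  exact ⟨_, mem_image_of_mem _ hx, comp_coef n k x⟩

/-- Constants as formal power series. -/
def const : LCSum 𝕜 V →ₗ[𝕜] Formal 𝕜 V :=
  have h (x : LCSum 𝕜 V) := exists_ofCoef (fun n => if n = 0 then x else 0) ⟨_, fun n k hk => by
    rw [apply_ite (comp k), (exists_bound x).choose_spec k hk, map_zero, ite_self]⟩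
  { toFun := fun x => (h x).choose
    map_add' := fun x y => coef_ext fun n => by
      rw [map_add, (h _).choose_spec, (h _).choose_spec, (h _).choose_spec]
      split_ifs <;> simp
    map_smul' := fun c x => coef_ext fun n => by
      rw [RingHom.id_apply, map_smul, (h _).choose_spec, (h _).choose_spec]
      split_ifs <;> simp }

lemma coef_const (n : ℕ) (x : LCSum 𝕜 V) : coef n (const x) = if n = 0 then x else 0 :=
  (exists_ofCoef (fun n => if n = 0 then x else 0) ⟨_, fun n k hk => by
    rw [apply_ite (comp k), (exists_bound x).choose_spec k hk, map_zero, ite_self]⟩).choose_spec n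

lemma isBddLinear_const : IsBddLinear (const (𝕜 := 𝕜) (V := V)) := fun S hS => by
  refine isVonNBounded_formal.2 ⟨(isVonNBounded_iff.1 hS).1.imp fun N hN => ?_, fun n => ?_⟩
  · rintro _ ⟨x, hx, rfl⟩
    refine isBelow_coef.2 fun n k hk => ?_
    rw [coef_const, apply_ite (comp k), hN x hx k hk, map_zero, ite_self]
  · simp only [image_image, coef_const]
    rcases n with _ | n
    · simpa using hS
    · have := (PolynormableSpace.withSeminorms 𝕜 (LCSum 𝕜 V)).continuousSMul
      exact (Bornology.isVonNBounded_singleton (𝕜 := 𝕜) 0).subset (by simp [subset_def])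

section Linear

variable {s : ℤ} (f g : LCSum 𝕜 V →ₗ[𝕜] LCSum 𝕜 V')
  (hf : ∀ j, ∀ x ∈ deg 𝕜 V j, f x ∈ deg 𝕜 V' (j + s))
  (hg : ∀ j, ∀ x ∈ deg 𝕜 V j, g x ∈ deg 𝕜 V' (j + s))

include hf hg in
lemma isBelow_hshift {N : ℕ} {x : Formal 𝕜 V} (hx : IsBelow N x) (n : ℕ) :
    IsBelow (N + s.natAbs) (f (coef n x) + hshift (fun n => g (coef n x)) n) := fun k hk => by
  rw [map_add, (isBelow_coef.1 hx n).map hf k hk, zero_add]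
  cases n with
  | zero => exact map_zero _
  | succ n => exact (isBelow_coef.1 hx n).map hg k hk

/-- The `ħ`-linear extension of `f + ħ g`. -/
def formalLin : Formal 𝕜 V →ₗ[𝕜] Formal 𝕜 V' :=
  have h (x : Formal 𝕜 V) := exists_ofCoef _ ⟨_, fun n =>
    isBelow_hshift f g hf hg (exists_bound x).choose_spec n⟩
  { toFun := fun x => (h x).choose
    map_add' := fun x y => coef_ext fun n => by
      rw [map_add, (h _).choose_spec, (h _).choose_spec, (h _).choose_spec]
      cases n <;> simp [hshift, add_add_add_comm]
    map_smul' := fun c x => coef_ext fun n => by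
      rw [RingHom.id_apply, map_smul, (h _).choose_spec, (h _).choose_spec]
      cases n <;> simp [hshift] }

lemma coef_formalLin (n : ℕ) (x : Formal 𝕜 V) : coef n (formalLin f g hf hg x) =
    f (coef n x) + hshift (fun n => g (coef n x)) n :=
  (exists_ofCoef _ ⟨_, fun n => isBelow_hshift f g hf hg (exists_bound x).choose_spec n⟩).choose_spec n

lemma isBddLinear_formalLin (hf' : IsBddLinear f) (hg' : IsBddLinear g) :
    IsBddLinear (formalLin f g hf hg) := fun S hS => by
  obtain ⟨⟨N, hN⟩, h⟩ := isVonNBounded_formal.1 hS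
  refine isVonNBounded_formal.2 ⟨⟨N + s.natAbs, ?_⟩, fun n => ?_⟩
  · rintro _ ⟨x, hx, rfl⟩
    refine isBelow_coef.2 fun n => ?_
    rw [coef_formalLin]
    exact isBelow_hshift f g hf hg (hN x hx) n
  · have e : ∀ x ∈ S, coef n (formalLin f g hf hg x) = _ := fun x _ => coef_formalLin f g hf hg n x
    rw [image_image, image_congr e]
    cases n with
    | zero => simpa [hshift, image_image] using hf' _ (h 0)
    | succ n =>
      have := (PolynormableSpace.withSeminorms 𝕜 (LCSum 𝕜 V')).topologicalAddGroup
      refine ((hf' _ (h (n + 1))).add (hg' _ (h n))).subset ?_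
      rintro _ ⟨x, hx, rfl⟩
      exact Set.add_mem_add (mem_image_of_mem _ (mem_image_of_mem _ hx))
        (mem_image_of_mem _ (mem_image_of_mem _ hx))

end Linear

section Bilinear

variable {s : ℤ} (f : LCSum 𝕜 V →ₗ[𝕜] LCSum 𝕜 V →ₗ[𝕜] LCSum 𝕜 V)
  (hf : ∀ i j, ∀ x ∈ deg 𝕜 V i, ∀ y ∈ deg 𝕜 V j,
    f x y ∈ deg 𝕜 V (i + j + s))

include hf in
lemma isBelow_antidiagonal {N N' : ℕ} {x y : Formal 𝕜 V} (hx : IsBelow N x) (hy : IsBelow N' y)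
    (n : ℕ) : IsBelow (N + N' + s.natAbs)
      (∑ p ∈ Finset.HasAntidiagonal.antidiagonal n, f (coef p.1 x) (coef p.2 y)) :=
  .sum fun p _ => (isBelow_coef.1 hx p.1).map₂ hf (isBelow_coef.1 hy p.2)

/-- The `ħ`-bilinear extension of `f`. -/
def formalBil : Formal 𝕜 V →ₗ[𝕜] Formal 𝕜 V →ₗ[𝕜] Formal 𝕜 V :=
  have h (x y : Formal 𝕜 V) := exists_ofCoef _ ⟨_, fun n =>
    isBelow_antidiagonal f hf (exists_bound x).choose_spec (exists_bound y).choose_spec n⟩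
  LinearMap.mk₂ 𝕜 (fun x y => (h x y).choose)
    (fun x x' y => coef_ext fun n => by
      rw [map_add, (h _ _).choose_spec, (h _ _).choose_spec, (h _ _).choose_spec]
      simp [Finset.sum_add_distrib])
    (fun c x y => coef_ext fun n => by
      rw [map_smul, (h _ _).choose_spec, (h _ _).choose_spec]
      simp [Finset.smul_sum])
    (fun x y y' => coef_ext fun n => by
      rw [map_add, (h _ _).choose_spec, (h _ _).choose_spec, (h _ _).choose_spec]
      simp [Finset.sum_add_distrib])
    (fun c x y => coef_ext fun n => by
      rw [map_smul, (h _ _).choose_spec, (h _ _).choose_spec]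
      simp [Finset.smul_sum])

lemma coef_formalBil (n : ℕ) (x y : Formal 𝕜 V) : coef n (formalBil f hf x y) =
    ∑ p ∈ Finset.HasAntidiagonal.antidiagonal n, f (coef p.1 x) (coef p.2 y) :=
  (exists_ofCoef _ ⟨_, fun n => isBelow_antidiagonal f hf (exists_bound x).choose_spec
    (exists_bound y).choose_spec n⟩).choose_spec n

lemma isBddBilinear_formalBil (hf' : IsBddBilinear f) : IsBddBilinear (formalBil f hf) :=
  fun S T hS hT => by
  obtain ⟨⟨N, hN⟩, h⟩ := isVonNBounded_formal.1 hS
  obtain ⟨⟨N', hN'⟩, h'⟩ := isVonNBounded_formal.1 hT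
  refine isVonNBounded_formal.2 ⟨⟨N + N' + s.natAbs, ?_⟩, fun n => ?_⟩
  · rintro _ ⟨x, hx, y, hy, rfl⟩
    refine isBelow_coef.2 fun n => ?_
    rw [coef_formalBil]
    exact isBelow_antidiagonal f hf (hN x hx) (hN' y hy) n
  · refine PolynormableSpace.isVonNBounded_iff.2 fun p hp => ?_
    choose R hR using fun q : ℕ × ℕ =>
      PolynormableSpace.isVonNBounded_iff.1 (hf' _ _ (h q.1) (h' q.2)) p hp
    refine ⟨∑ q ∈ Finset.HasAntidiagonal.antidiagonal n, R q, ?_⟩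
    rintro _ ⟨_, ⟨x, hx, y, hy, rfl⟩, rfl⟩
    rw [coef_formalBil]
    exact (Seminorm.map_sum_le_sum p _ _).trans (Finset.sum_le_sum fun q _ => hR q _
      ⟨_, mem_image_of_mem _ hx, _, mem_image_of_mem _ hy, rfl⟩)

end Bilinear

/-- Homogeneous formal power series. -/
def formalEquiv (j : ℤ) : (ℕ → deg 𝕜 V j) ≃L[𝕜]
    deg 𝕜 (fun k => ℕ → V k) j :=
  have h (x : deg 𝕜 V j) : lof (-j).toNat (comp (-j).toNat (x : LCSum 𝕜 V)) =
      (x : LCSum 𝕜 V) := ext fun k => by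
    rcases eq_or_ne k (-j).toNat with rfl | hk
    · rw [comp_lof_same]
    · rw [comp_lof_of_ne hk]
      by_cases h0 : (k : ℤ) + j = 0
      · omega
      · exact (x.2 k h0).symm
  { toFun := fun x => ⟨lof (-j).toNat fun n => comp (-j).toNat (x n : LCSum 𝕜 V),
      mem_deg_coef.2 fun n => by rw [coef_lof, h]; exact (x n).2⟩
    map_add' := fun x y => Subtype.ext (map_add (lof _) _ _)
    map_smul' := fun c x => Subtype.ext (map_smul (lof _) c _)
    invFun := fun y n => ⟨coef n (y : Formal 𝕜 V), mem_deg_coef.1 y.2 n⟩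
    left_inv := fun x => funext fun n => Subtype.ext ((coef_lof _ _ _).trans (h _))
    right_inv := fun y => Subtype.ext (coef_ext fun n => (coef_lof _ _ _).trans
      (h ⟨coef n (y : Formal 𝕜 V), mem_deg_coef.1 y.2 n⟩))
    continuous_toFun := ((continuous_lof _).comp (continuous_pi fun n => (continuous_comp _).comp
      (continuous_subtype_val.comp (continuous_apply n)))).subtype_mk _
    continuous_invFun := continuous_pi fun n =>
      ((continuous_coef n).comp continuous_subtype_val).subtype_mk _ }

lemma coef_formalEquiv (j : ℤ) (x : ℕ → deg 𝕜 V j) (n : ℕ) :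
    coef n (formalEquiv j x : Formal 𝕜 V) = x n :=
  congrArg Subtype.val (congrFun ((formalEquiv j).symm_apply_apply x) n)

/-! ## Formal extensions of linear maps -/

universe w

/-- Multiplication by `ħ`. -/
def hbar : Formal 𝕜 V →ₗ[𝕜] Formal 𝕜 V :=
  formalLin (s := 0) 0 LinearMap.id (fun _ _ _ => zero_mem _) fun j x hx => by rwa [add_zero]

lemma coef_hbar (x : Formal 𝕜 V) (n : ℕ) : coef n (hbar x) = hshift (fun n => coef n x) n :=
  (coef_formalLin _ _ _ _ _ _).trans (zero_add _)

lemma exists_hbar {j : ℤ} {x : Formal 𝕜 V} (hx : x ∈ deg 𝕜 (fun k => ℕ → V k) j) :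
    ∃ y ∈ deg 𝕜 (fun k => ℕ → V k) j, const (coef 0 x) + hbar y = x := by
  obtain ⟨y, hy⟩ := exists_ofCoef (fun n => coef (n + 1) x) ⟨_, fun n =>
    isBelow_coef.1 (exists_bound x).choose_spec (n + 1)⟩
  refine ⟨y, mem_deg_coef.2 fun n => by rw [hy]; exact mem_deg_coef.1 hx _, coef_ext fun n => ?_⟩
  rw [map_add, coef_const, coef_hbar]
  cases n with
  | zero => exact add_zero _
  | succ n => exact (zero_add _).trans (hy n)

lemma formalEquiv_single (j : ℤ) (a : deg 𝕜 V j) :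
    (formalEquiv j (Pi.single 0 a) : Formal 𝕜 V) = const (a : LCSum 𝕜 V) :=
  coef_ext fun n => by
    rw [coef_formalEquiv, coef_const]
    cases n with
    | zero => rw [Pi.single_eq_same]; rfl
    | succ n => rw [Pi.single_eq_of_ne n.succ_ne_zero]; rfl

lemma hbar_formalEquiv (j : ℤ) (x : ℕ → deg 𝕜 V j) :
    hbar (formalEquiv j x : Formal 𝕜 V) = formalEquiv j (hshift x) :=
  coef_ext fun n => by
    rw [coef_hbar, coef_formalEquiv]
    cases n with
    | zero => rfl
    | succ n => exact coef_formalEquiv j x n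

lemma formalBil_const {s : ℤ} (f : LCSum 𝕜 V →ₗ[𝕜] LCSum 𝕜 V →ₗ[𝕜] LCSum 𝕜 V)
    (hf : ∀ i j, ∀ x ∈ deg 𝕜 V i, ∀ y ∈ deg 𝕜 V j,
      f x y ∈ deg 𝕜 V (i + j + s)) (x y : LCSum 𝕜 V) :
    formalBil f hf (const x) (const y) = const (f x y) := coef_ext fun n => by
  rw [coef_formalBil, coef_const, Finset.sum_eq_single (n, 0)]
  · rw [coef_const, coef_const, if_pos rfl]
    split_ifs
    · rfl
    · rw [map_zero]; rfl
  · intro p hp hp'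
    have : p.2 ≠ 0 := fun h => hp' (Prod.ext (by simpa [h] using hp) h)
    rw [coef_const p.2, if_neg this, map_zero]
  · simp

variable {Z : ConvComplex.{w} 𝕜} (hZ : Z.IsFormal)
include hZ

lemma eq_zero_of_const {s : ℤ} {f : Formal 𝕜 V →ₗ[𝕜] Z}
    (hf : ∀ j, ∀ x ∈ deg 𝕜 (fun k => ℕ → V k) j, f x ∈ Z.deg (j + s))
    (hf' : ∀ x, f (hbar x) = Z.hbar (f x)) (h0 : ∀ x, f (const x) = 0) : f = 0 := by
  refine hom_ext fun k x => ?_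
  have hx := lof_mem_deg (𝕜 := 𝕜) (V := fun k => ℕ → V k) k x
  revert hx
  generalize lof (𝕜 := 𝕜) (V := fun k => ℕ → V k) k x = x
  generalize -(k : ℤ) = j
  intro hx
  obtain ⟨A, Φ, -, hΦ⟩ := hZ (j + s)
  have key : ∀ m, ∀ x (hx : x ∈ deg 𝕜 (fun k => ℕ → V k) j),
      Φ.symm ⟨f x, hf j x hx⟩ m = 0 := by
    intro m
    induction m with
    | zero | succ m ih =>
      intro x hx
      obtain ⟨y, hy, e⟩ := exists_hbar hx
      have h1 : (⟨f x, hf j x hx⟩ : Z.deg (j + s)) = Φ (hshift (Φ.symm ⟨f y, hf j y hy⟩)) :=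
        Subtype.ext <| by
          rw [← hΦ, Φ.apply_symm_apply]
          change f x = Z.hbar (f y)
          rw [← e, map_add, h0, zero_add, hf']
      rw [h1, Φ.symm_apply_apply]
      first | rfl | exact ih y hy
  have h1 : (⟨f x, hf j x hx⟩ : Z.deg (j + s)) = 0 :=
    Φ.symm.injective ((funext fun m => key m x hx).trans (map_zero _).symm)
  exact congrArg Subtype.val h1

lemma exists_formal {f : LCSum 𝕜 V →ₗ[𝕜] Z} (hb : IsBddLinear f)
    (hf : ∀ j, ∀ x ∈ deg 𝕜 V j, f x ∈ Z.deg j) :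
    ∃ F : Formal 𝕜 V →ₗ[𝕜] Z, IsBddLinear F ∧
      (∀ j, ∀ x ∈ deg 𝕜 (fun k => ℕ → V k) j, F x ∈ Z.deg j) ∧
      (∀ x, F (hbar x) = Z.hbar (F x)) ∧ ∀ x, F (const x) = f x := by
  have := Z.convenient.locallyConvex
  have := (PolynormableSpace.withSeminorms 𝕜 Z).topologicalAddGroup
  choose A Φ hA hΦ using hZ
  let a (k : ℕ) : V k →ₗ[𝕜] (ℕ → A (-k)) := (Φ (-k)).symm.toLinearMap.comp
    ((f.comp (lof k)).codRestrict (Z.deg (-k)) fun v => hf _ _ (lof_mem_deg k v))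
  have ha : ∀ (k : ℕ) v, (Φ (-(k : ℤ)) (a k v) : Z) = f (lof k v) := fun k v =>
    congrArg Subtype.val ((Φ (-k)).apply_symm_apply _)
  let T (k : ℕ) : (ℕ → ℕ → A (-k)) →ₗ[𝕜] (ℕ → A (-k)) :=
    { toFun := fun u m => ∑ p ∈ Finset.HasAntidiagonal.antidiagonal m, u p.1 p.2
      map_add' := fun u v => funext fun m => Finset.sum_add_distrib
      map_smul' := fun c u => funext fun m => by simp [Finset.smul_sum] }
  let G (k : ℕ) : (ℕ → V k) →ₗ[𝕜] Z := (Z.deg (-k)).subtype.comp <|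
    (Φ (-k)).toLinearMap.comp <| (T k).comp <| LinearMap.pi fun n => (a k).comp (LinearMap.proj n)
  refine ⟨desc G, isBddLinear_of_lof fun k => ?_, fun j x hx => ?_, fun x => ?_, fun x => ?_⟩
  · intro S hS
    have h1 : Bornology.IsVonNBounded 𝕜 ((LinearMap.pi fun n => (a k).comp
        (LinearMap.proj (φ := fun _ : ℕ => V k) n)) '' S) := by
      refine Bornology.isVonNBounded_pi_iff.2 fun n => ?_
      have h2 := hb _ (isBddLinear_of_continuous (continuous_lof k) _
        (Bornology.isVonNBounded_pi_iff.1 hS n))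
      have h3 : Bornology.IsVonNBounded 𝕜 ((((f.comp (lof k)).codRestrict (Z.deg (-k)) fun v =>
          hf _ _ (lof_mem_deg k v)) '' (Function.eval n '' S))) := by
        refine isVonNBounded_of_isInducing (f := (Z.deg (-k)).subtype) .subtypeVal ?_
        rwa [← image_comp] at h2 ⊢
      refine (isBddLinear_of_continuous (f := (Φ (-k)).symm.toLinearMap) (Φ (-k)).symm.continuous _
        h3).subset ?_
      rintro _ ⟨_, ⟨x, hx, rfl⟩, rfl⟩
      exact mem_image_of_mem _ (mem_image_of_mem _ (mem_image_of_mem _ hx))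
    have h2 : Continuous (T k) := continuous_pi fun m => by
      change Continuous fun u : ℕ → ℕ → A (-k) =>
        ∑ p ∈ Finset.HasAntidiagonal.antidiagonal m, u p.1 p.2
      fun_prop
    refine (isBddLinear_of_continuous (f := (Z.deg (-k)).subtype.comp <|
      (Φ (-k)).toLinearMap.comp (T k)) (continuous_subtype_val.comp
        ((Φ (-k)).continuous.comp h2)) _ h1).subset ?_
    rintro _ ⟨x, hx, rfl⟩
    rw [LinearMap.comp_apply, desc_lof]
    exact ⟨_, mem_image_of_mem _ hx, rfl⟩
  · obtain ⟨N, hN⟩ := exists_bound x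
    rw [← sum_lof hN, map_sum]
    refine Submodule.sum_mem _ fun k _ => ?_
    rw [desc_lof]
    by_cases hk : (k : ℤ) + j = 0
    · obtain rfl : j = -k := by omega
      exact (Φ (-k) _).2
    · rw [hx k hk, map_zero]
      exact zero_mem _
  · refine LinearMap.congr_fun (f := (desc G).comp hbar) (g := Z.hbar.comp (desc G))
      (hom_ext fun k x => ?_) x
    have e : hbar (lof (𝕜 := 𝕜) (V := fun k => ℕ → V k) k x) =
        lof (𝕜 := 𝕜) (V := fun k => ℕ → V k) k (hshift x) := coef_ext fun n => by
      rw [coef_hbar, coef_lof]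
      cases n with
      | zero => exact (map_zero _).symm
      | succ n => exact coef_lof _ _ _
    rw [LinearMap.comp_apply, LinearMap.comp_apply, e, desc_lof, desc_lof]
    refine Eq.trans ?_ (hΦ _ _).symm
    refine congrArg (fun u => (Φ (-k) u : Z)) (funext fun m => ?_)
    change ∑ p ∈ Finset.HasAntidiagonal.antidiagonal m, a k (hshift x p.1) p.2 = _
    cases m with
    | zero => simp [hshift]
    | succ m =>
      rw [Finset.Nat.sum_antidiagonal_succ]
      exact (congrArg (· + _) (congrFun (map_zero (a k)) (m + 1))).trans (zero_add _)
  · refine LinearMap.congr_fun (f := (desc G).comp const) (g := f) (hom_ext fun k v => ?_) x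
    have e : const (lof (𝕜 := 𝕜) (V := V) k v) =
        lof (𝕜 := 𝕜) (V := fun k => ℕ → V k) k (Pi.single 0 v) := coef_ext fun n => by
      rw [coef_const, coef_lof]
      split_ifs with h
      · subst h; rw [Pi.single_eq_same]
      · rw [Pi.single_eq_of_ne h, map_zero]
    rw [LinearMap.comp_apply, e, desc_lof, ← ha]
    refine congrArg (fun u => (Φ (-k) u : Z)) (funext fun m => ?_)
    change ∑ p ∈ Finset.HasAntidiagonal.antidiagonal m, a k (Pi.single (M := fun _ => V k) 0 v p.1) p.2 = _
    rw [Finset.sum_eq_single (0, m)]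
    · rw [Pi.single_eq_same]
    · intro p hp hp'
      have : p.1 ≠ 0 := fun h => hp' (Prod.ext h (by simpa [h] using hp))
      rw [Pi.single_eq_of_ne this, map_zero]; rfl
    · simp

end LCSum

/-! ## Smoothly bounded families -/

section SmoothlyBounded

variable {α : Type*} {E E' : Type*} [NormedAddCommGroup E] [NormedSpace ℝ E]
  [NormedAddCommGroup E'] [NormedSpace ℝ E'] {G G' G'' : Type*} [NormedAddCommGroup G]
  [NormedSpace ℝ G] [NormedAddCommGroup G'] [NormedSpace ℝ G'] [NormedAddCommGroup G'']
  [NormedSpace ℝ G'']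

/-- Families of smooth functions on an open set, all of whose derivatives are uniformly bounded on
compact sets. -/
structure SB (O : Set E) (f : α → E → G) : Prop where
  smooth : ∀ a, ContDiffOn ℝ ∞ (f a) O
  bdd : ∀ C ⊆ O, IsCompact C → ∀ j : ℕ, ∃ R : ℝ, ∀ a, ∀ z ∈ C, ‖iteratedFDeriv ℝ j (f a) z‖ ≤ R

lemma natCast_le_infty (j : ℕ) : (j : WithTop ℕ∞) ≤ ∞ := by exact_mod_cast le_top

namespace SB

variable {O : Set E} {f : α → E → G} {g : α → E → G'}

lemma bdd_within (hf : SB O f) (hO : IsOpen O) {C : Set E} (hC : C ⊆ O) (hC' : IsCompact C) (j : ℕ) :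
    ∃ R : ℝ, 0 ≤ R ∧ ∀ i ≤ j, ∀ a, ∀ z ∈ C, ‖iteratedFDerivWithin ℝ i (f a) O z‖ ≤ R := by
  choose R hR using hf.bdd C hC hC'
  refine ⟨∑ i ∈ Finset.range (j + 1), |R i|, Finset.sum_nonneg fun _ _ => abs_nonneg _,
    fun i hi a z hz => ?_⟩
  rw [iteratedFDerivWithin_of_isOpen i hO (hC hz)]
  exact ((hR i a z hz).trans (le_abs_self _)).trans (Finset.single_le_sum
    (f := fun i => |R i|) (fun _ _ => abs_nonneg _) (Finset.mem_range.2 (by omega)))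

lemma of_within (hO : IsOpen O) (hs : ∀ a, ContDiffOn ℝ ∞ (f a) O) (h : ∀ C ⊆ O, IsCompact C →
    ∀ j : ℕ, ∃ R : ℝ, ∀ a, ∀ z ∈ C, ‖iteratedFDerivWithin ℝ j (f a) O z‖ ≤ R) : SB O f :=
  ⟨hs, fun C hC hC' j => by
    obtain ⟨R, hR⟩ := h C hC hC' j
    exact ⟨R, fun a z hz => by rw [← iteratedFDerivWithin_of_isOpen j hO (hC hz)]; exact hR a z hz⟩⟩

lemma congr (hf : SB O f) (hO : IsOpen O) {f' : α → E → G} (h : ∀ a, EqOn (f' a) (f a) O) :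
    SB O f' :=
  of_within hO (fun a => (hf.smooth a).congr (h a)) fun C hC hC' j => by
    obtain ⟨R, -, hR⟩ := hf.bdd_within hO hC hC' j
    exact ⟨R, fun a z hz => by
      rw [iteratedFDerivWithin_congr (h a) (hC hz)]; exact hR j le_rfl a z hz⟩

lemma reindex (hf : SB O f) {β : Type*} (φ : β → α) : SB O fun b => f (φ b) :=
  ⟨fun _ => hf.smooth _, fun C hC hC' j => by
    obtain ⟨R, hR⟩ := hf.bdd C hC hC' j
    exact ⟨R, fun a => hR _⟩⟩

lemma mono (hf : SB O f) {O' : Set E} (h : O' ⊆ O) : SB O' f :=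
  ⟨fun a => (hf.smooth a).mono h, fun C hC => hf.bdd C (hC.trans h)⟩

lemma of_contDiffOn (hO : IsOpen O) {h : E → G} (hh : ContDiffOn ℝ ∞ h O) :
    SB O fun _ : α => h :=
  ⟨fun _ => hh, fun C hC hC' j => by
    have : ContinuousOn (fun z => ‖iteratedFDeriv ℝ j h z‖) C :=
      ((((hh.continuousOn_iteratedFDerivWithin (natCast_le_infty j) hO.uniqueDiffOn).congr
        fun z hz => (iteratedFDerivWithin_of_isOpen j hO hz).symm)).mono hC).norm
    obtain ⟨R, hR⟩ := (hC'.image_of_continuousOn this).bddAbove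
    exact ⟨R, fun a z hz => hR (mem_image_of_mem _ hz)⟩⟩

lemma of_const {c : α → G} {R : ℝ} (hc : ∀ a, ‖c a‖ ≤ R) : SB O fun a _ => c a :=
  ⟨fun _ => contDiffOn_const, fun C hC hC' j => by
    rcases Nat.eq_zero_or_pos j with rfl | hj
    · exact ⟨R, fun a z _ => by rw [norm_iteratedFDeriv_zero]; exact hc a⟩
    · exact ⟨0, fun a z _ => by
        rw [iteratedFDeriv_const_of_ne hj.ne']; simp⟩⟩

set_option synthInstance.maxHeartbeats 100000 in
lemma bilin (hf : SB O f) (hg : SB O g) (hO : IsOpen O) (B : G →L[ℝ] G' →L[ℝ] G'') :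
    SB O fun a z => B (f a z) (g a z) :=
  of_within hO (fun a => B.isBoundedBilinearMap.contDiff.comp_contDiffOn
      ((hf.smooth a).prodMk (hg.smooth a))) fun C hC hC' j => by
    obtain ⟨R, hR0, hR⟩ := hf.bdd_within hO hC hC' j
    obtain ⟨R', hR0', hR'⟩ := hg.bdd_within hO hC hC' j
    refine ⟨‖B‖ * ∑ i ∈ Finset.range (j + 1), (j.choose i : ℝ) * R * R', fun a z hz => ?_⟩
    refine (B.norm_iteratedFDerivWithin_le_of_bilinear (hf.smooth a) (hg.smooth a) hO.uniqueDiffOn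
      (hC hz) (natCast_le_infty j)).trans ?_
    refine mul_le_mul_of_nonneg_left (Finset.sum_le_sum fun i hi => ?_)
      (ContinuousLinearMap.opNorm_nonneg B)
    have hi' := Finset.mem_range.1 hi
    gcongr
    · exact hR i (by omega) a z hz
    · exact hR' (j - i) (by omega) a z hz

lemma clm (hf : SB O f) (hO : IsOpen O) (L : G →L[ℝ] G') : SB O fun a z => L (f a z) :=
  of_within hO (fun a => L.contDiff.comp_contDiffOn (hf.smooth a)) fun C hC hC' j => by
    obtain ⟨R, hR0, hR⟩ := hf.bdd_within hO hC hC' j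
    refine ⟨‖L‖ * R, fun a z hz => ?_⟩
    refine (L.norm_iteratedFDerivWithin_comp_left ((hf.smooth a) z (hC hz)) hO.uniqueDiffOn (hC hz)
      (natCast_le_infty j)).trans ?_
    exact mul_le_mul_of_nonneg_left (hR j le_rfl a z hz) (norm_nonneg _)

lemma add {f' : α → E → G} (hf : SB O f) (hf' : SB O f') (hO : IsOpen O) :
    SB O fun a z => f a z + f' a z :=
  of_within hO (fun a => (hf.smooth a).add (hf'.smooth a)) fun C hC hC' j => by
    obtain ⟨R, hR0, hR⟩ := hf.bdd_within hO hC hC' j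
    obtain ⟨R', hR0', hR'⟩ := hf'.bdd_within hO hC hC' j
    refine ⟨R + R', fun a z hz => ?_⟩
    have := iteratedFDerivWithin_add_apply (i := j) (((hf.smooth a) z (hC hz)).of_le
      (natCast_le_infty j)) (((hf'.smooth a) z (hC hz)).of_le (natCast_le_infty j))
      hO.uniqueDiffOn (hC hz)
    change ‖iteratedFDerivWithin ℝ j (f a + f' a) O z‖ ≤ _
    rw [this]
    exact (norm_add_le _ _).trans (add_le_add (hR j le_rfl a z hz) (hR' j le_rfl a z hz))

lemma zero : SB O fun (_ : α) (_ : E) => (0 : G) := of_const (R := 0) fun _ => by simp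

lemma sum {ι : Type*} (s : Finset ι) {f : ι → α → E → G} (hf : ∀ i ∈ s, SB O (f i))
    (hO : IsOpen O) : SB O fun a z => ∑ i ∈ s, f i a z := by
  induction s using Finset.cons_induction with
  | empty => simpa using zero
  | cons i s hi ih =>
    simp only [Finset.sum_cons]
    exact (hf i (Finset.mem_cons_self _ _)).add (ih fun j hj => hf j (Finset.mem_cons_of_mem hj)) hO

lemma fderiv (hf : SB O f) (hO : IsOpen O) : SB O fun a => _root_.fderiv ℝ (f a) :=
  ⟨fun a => (hf.smooth a).fderiv_of_isOpen hO le_rfl, fun C hC hC' j => by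
    obtain ⟨R, hR⟩ := hf.bdd C hC hC' (j + 1)
    exact ⟨R, fun a z hz => by rw [norm_iteratedFDeriv_fderiv]; exact hR a z hz⟩⟩

lemma iteratedFDeriv (hf : SB O f) (hO : IsOpen O) (k : ℕ) :
    SB O fun a => _root_.iteratedFDeriv ℝ k (f a) := by
  induction k with
  | zero =>
    exact hf.clm hO ((continuousMultilinearCurryFin0 ℝ E G).symm.toContinuousLinearEquiv :
      G →L[ℝ] (E [×0]→L[ℝ] G))
  | succ k ih =>
    exact (ih.fderiv hO).clm hO ((continuousMultilinearCurryLeftEquiv ℝ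
      (fun _ : Fin (k + 1) => E) G).symm.toContinuousLinearEquiv :
        (E →L[ℝ] E [×k]→L[ℝ] G) →L[ℝ] (E [×(k + 1)]→L[ℝ] G))

lemma comp (hf : SB O f) (hO : IsOpen O) {O' : Set E'} (hO' : IsOpen O') {h : α → E' → E}
    (hh : SB O' h) (hm : ∀ C ⊆ O', IsCompact C → ∃ D ⊆ O, IsCompact D ∧ ∀ a, MapsTo (h a) C D) :
    SB O' fun a z => f a (h a z) := by
  have hm' : ∀ a, MapsTo (h a) O' O := fun a z hz => by
    obtain ⟨D, hD, -, h⟩ := hm {z} (singleton_subset_iff.2 hz) isCompact_singleton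
    exact hD (h a rfl)
  refine of_within hO' (fun a => (hf.smooth a).comp (hh.smooth a) (hm' a)) fun C hC hC' j => ?_
  obtain ⟨D, hD, hD', hCD⟩ := hm C hC hC'
  obtain ⟨R, hR0, hR⟩ := hf.bdd_within hO hD hD' j
  obtain ⟨R', hR0', hR'⟩ := hh.bdd_within hO' hC hC' j
  refine ⟨j.factorial * R * (max R' 1) ^ j, fun a z hz => ?_⟩
  refine norm_iteratedFDerivWithin_comp_le (hf.smooth a) (hh.smooth a) (natCast_le_infty j)
    hO.uniqueDiffOn hO'.uniqueDiffOn (hm' a) (hC hz) (fun i hi => hR i hi a _ (hCD a hz))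
    fun i hi hij => (hR' i hij a z hz).trans ((le_max_left R' 1).trans ?_)
  exact le_self_pow₀ (le_max_right _ _) (by omega)

lemma comp_contDiffOn (hf : SB O f) (hO : IsOpen O) {O' : Set E'} (hO' : IsOpen O') {h : E' → E}
    (hh : ContDiffOn ℝ ∞ h O') (hm : MapsTo h O' O) : SB O' fun a z => f a (h z) :=
  hf.comp hO hO' (of_contDiffOn hO' hh) fun C hC hC' =>
    ⟨h '' C, (hm.mono_left hC).image_subset, hC'.image_of_continuousOn (hh.continuousOn.mono hC),
      fun _ => mapsTo_image _ _⟩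

lemma of_param {Pa : Type*} [NormedAddCommGroup Pa] [NormedSpace ℝ Pa] {Q : Set Pa}
    (hQ : IsCompact Q) (hO : IsOpen O) {Ψ : Pa × E → G} (hΨ : ContDiffOn ℝ ∞ Ψ (univ ×ˢ O)) :
    SB O fun (q : Q) z => Ψ (q, z) := by
  have h1 : SB O fun (q : Q) (z : E) => ((q, z) : Pa × E) := by
    obtain ⟨R, hR⟩ := hQ.isBounded.exists_norm_le
    have := (of_const (α := Q) (O := O) (c := fun q => ((q : Pa), (0 : E))) (R := R) fun q => by
      simpa using hR _ q.2).add
      (of_contDiffOn hO (ContinuousLinearMap.inr ℝ Pa E).contDiff.contDiffOn) hO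
    refine this.congr hO fun q z _ => ?_
    simp
  refine (of_contDiffOn (α := Q) (isOpen_univ.prod hO) hΨ).comp (isOpen_univ.prod hO) hO h1
    fun C hC hC' => ⟨Q ×ˢ C, prod_mono (subset_univ _) hC, hQ.prod hC', fun q z hz => ⟨q.2, hz⟩⟩

end SB

lemma iteratedFDeriv_prod_left {F' : Type*} [NormedAddCommGroup F'] [NormedSpace ℝ F']
    {W : Set (E × F')} (hW : IsOpen W) {Ψ : E × F' → G} (hΨ : ContDiffOn ℝ ∞ Ψ W) {z : E} {y : F'}
    (hz : (z, y) ∈ W) (j : ℕ) : iteratedFDeriv ℝ j (fun z => Ψ (z, y)) z =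
      (iteratedFDeriv ℝ j Ψ (z, y)).compContinuousLinearMap
        fun _ => ContinuousLinearMap.inl ℝ E F' := by
  set s : Set (E × F') := (fun p => p + (0, y)) ⁻¹' W with hs
  have hso : IsOpen s := hW.preimage (continuous_id.add continuous_const)
  have hf : ContDiffOn ℝ ∞ (fun p => Ψ (p + (0, y))) s :=
    hΨ.comp (contDiff_id.add contDiff_const).contDiffOn (mapsTo_preimage _ _)
  have hzs : ContinuousLinearMap.inl ℝ E F' z ∈ s := by simpa [hs] using hz
  have hso' : IsOpen (ContinuousLinearMap.inl ℝ E F' ⁻¹' s) :=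
    hso.preimage (ContinuousLinearMap.inl ℝ E F').continuous
  have := (ContinuousLinearMap.inl ℝ E F').iteratedFDerivWithin_comp_right hf hso.uniqueDiffOn
    hso'.uniqueDiffOn hzs (natCast_le_infty j)
  rw [iteratedFDerivWithin_of_isOpen j hso' hzs, iteratedFDerivWithin_of_isOpen j hso hzs,
    iteratedFDeriv_comp_add_right] at this
  convert this using 2
  · ext z; simp
  · simp

lemma hasFDerivAt_iteratedFDeriv {O : Set E} (hO : IsOpen O) {h : E → G} (hh : ContDiffOn ℝ ∞ h O)
    {z : E} (hz : z ∈ O) (j : ℕ) :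
    HasFDerivAt (iteratedFDeriv ℝ j h) (iteratedFDeriv ℝ (j + 1) h z).curryLeft z := by
  have h1 : DifferentiableAt ℝ (iteratedFDeriv ℝ j h) z :=
    (hh.contDiffAt (hO.mem_nhds hz)).differentiableAt_iteratedFDeriv (m := j)
      (WithTop.coe_lt_coe.2 (ENat.natCast_lt_top j))
  have h2 := h1.hasFDerivAt
  rw [fderiv_iteratedFDeriv] at h2
  exact h2

section Integral

variable [FiniteDimensional ℝ E] {Y : Type*} [TopologicalSpace Y] [T2Space Y] [MeasurableSpace Y]
  [BorelSpace Y] {μ : Measure Y} [IsFiniteMeasureOnCompacts μ] {K : Set Y} {O : Set E}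

lemma exists_compact_nhds_subset (hO : IsOpen O) {z : E} (hz : z ∈ O) :
    ∃ C ∈ 𝓝 z, C ⊆ O ∧ IsCompact C := by
  have := FiniteDimensional.proper ℝ E
  obtain ⟨C, h1, h2, h3⟩ := local_compact_nhds (hO.mem_nhds hz)
  exact ⟨C, h1, h2, h3⟩

set_option synthInstance.maxHeartbeats 200000 in
lemma integral_curryLeft [CompleteSpace G] {j : ℕ} {u : Y → E [×(j + 1)]→L[ℝ] G} {ν : Measure Y}
    (hu : Integrable u ν) : (∫ y, u y ∂ν).curryLeft = ∫ y, (u y).curryLeft ∂ν := by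
  have := ContinuousLinearMap.integral_comp_comm (𝕜 := ℝ) (E := E [×(j + 1)]→L[ℝ] G)
    (Fₗ := E →L[ℝ] E [×j]→L[ℝ] G)
    ((continuousMultilinearCurryLeftEquiv ℝ (fun _ : Fin (j + 1) => E)
      G).toContinuousLinearEquiv.toContinuousLinearMap) hu
  exact this.symm

lemma integral_curry0 [CompleteSpace G] {u : Y → E [×0]→L[ℝ] G} {ν : Measure Y}
    (hu : Integrable u ν) : (∫ y, u y ∂ν).curry0 = ∫ y, (u y).curry0 ∂ν := by
  have := ContinuousLinearMap.integral_comp_comm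
    ((continuousMultilinearCurryFin0 ℝ E G).toContinuousLinearEquiv :
      (E [×0]→L[ℝ] G) →L[ℝ] G) hu
  exact this.symm

lemma continuous_curryLeft {j : ℕ} :
    Continuous fun u : E [×(j + 1)]→L[ℝ] G => u.curryLeft :=
  (continuousMultilinearCurryLeftEquiv ℝ (fun _ : Fin (j + 1) => E) G).continuous

set_option maxHeartbeats 400000 in
set_option synthInstance.maxHeartbeats 200000 in
lemma hasFTaylorSeriesUpToOn_integral (hK : IsCompact K) (hO : IsOpen O) {f : E → Y → G}
    [CompleteSpace G]
    (h1 : ∀ y ∈ K, ContDiffOn ℝ ∞ (f · y) O)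
    (h2 : ∀ j : ℕ, ContinuousOn (fun p : E × Y => iteratedFDeriv ℝ j (f · p.2) p.1) (O ×ˢ K)) :
    HasFTaylorSeriesUpToOn ∞ (fun z => ∫ y in K, f z y ∂μ)
      (fun z j => ∫ y in K, iteratedFDeriv ℝ j (f · y) z ∂μ) O := by
  have hKm : MeasurableSet K := hK.measurableSet
  have hfin : μ K ≠ ⊤ := hK.measure_lt_top.ne
  have hc : ∀ (j : ℕ) z, z ∈ O → ContinuousOn (fun y => iteratedFDeriv ℝ j (f · y) z) K :=
    fun j z hz => (h2 j).comp (f := fun y => (z, y)) (by fun_prop) fun y hy => ⟨hz, hy⟩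
  have hi : ∀ (j : ℕ) z, z ∈ O → IntegrableOn (fun y => iteratedFDeriv ℝ j (f · y) z) K μ :=
    fun j z hz => (hc j z hz).integrableOn_compact hK
  have hb : ∀ (j : ℕ) C, C ⊆ O → IsCompact C → ∃ R, ∀ z ∈ C, ∀ y ∈ K,
      ‖iteratedFDeriv ℝ j (f · y) z‖ ≤ R := by
    intro j C hC hC'
    obtain ⟨R, hR⟩ := (hC'.prod hK).exists_bound_of_continuousOn
      ((h2 j).mono (prod_mono hC subset_rfl))
    exact ⟨R, fun z hz y hy => hR (z, y) ⟨hz, hy⟩⟩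
  have hd : ∀ (j : ℕ) z, z ∈ O → HasFDerivAt
      (fun z => ∫ y in K, iteratedFDeriv ℝ j (f · y) z ∂μ)
      (∫ y in K, iteratedFDeriv ℝ (j + 1) (f · y) z ∂μ).curryLeft z := by
    intro j z hz
    obtain ⟨C, hC, hCO, hC'⟩ := exists_compact_nhds_subset hO hz
    obtain ⟨R, hR⟩ := hb (j + 1) C hCO hC'
    rw [integral_curryLeft (hi (j + 1) z hz)]
    refine hasFDerivAt_integral_of_dominated_of_fderiv_le (bound := fun _ => R) (μ := μ.restrict K)
      (F := fun z y => iteratedFDeriv ℝ j (f · y) z)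
      (F' := fun z y => (iteratedFDeriv ℝ (j + 1) (f · y) z).curryLeft) hC ?_ (hi j z hz)
      (continuous_curryLeft.comp_aestronglyMeasurable (hi (j + 1) z hz).aestronglyMeasurable)
      ?_ (integrableOn_const hfin) ?_
    · filter_upwards [hO.mem_nhds hz] with z' hz'
      exact (hi j z' hz').aestronglyMeasurable
    · filter_upwards [ae_restrict_mem hKm] with y hy z' hz'
      rw [ContinuousMultilinearMap.curryLeft_norm]
      exact hR z' hz' y hy
    · filter_upwards [ae_restrict_mem hKm] with y hy z' hz'
      exact hasFDerivAt_iteratedFDeriv hO (h1 y hy) (hCO hz') j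
  refine ⟨fun z hz => ?_, fun j _ z hz => (hd j z hz).hasFDerivWithinAt, fun j _ z hz =>
    (hd j z hz).continuousAt.continuousWithinAt⟩
  exact integral_curry0 (hi 0 z hz)

lemma SB.integral [CompleteSpace G] (hK : IsCompact K) (hO : IsOpen O) {f : α → E → Y → G}
    (h1 : ∀ a, ∀ y ∈ K, ContDiffOn ℝ ∞ (f a · y) O)
    (h2 : ∀ a, ∀ j : ℕ, ContinuousOn (fun p : E × Y => _root_.iteratedFDeriv ℝ j (f a · p.2) p.1)
      (O ×ˢ K))
    (h3 : ∀ C ⊆ O, IsCompact C → ∀ j : ℕ, ∃ R : ℝ, ∀ a, ∀ z ∈ C, ∀ y ∈ K,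
      ‖_root_.iteratedFDeriv ℝ j (f a · y) z‖ ≤ R) :
    SB O fun a z => ∫ y in K, f a z y ∂μ := by
  have h := fun a => hasFTaylorSeriesUpToOn_integral (μ := μ) hK hO (h1 a) (h2 a)
  refine SB.of_within hO (fun a => (h a).contDiffOn) fun C hC hC' j => ?_
  obtain ⟨R, hR⟩ := h3 C hC hC' j
  refine ⟨R * μ.real K, fun a z hz => ?_⟩
  rw [← (h a).eq_iteratedFDerivWithin_of_uniqueDiffOn (natCast_le_infty j) hO.uniqueDiffOn (hC hz)]
  exact norm_setIntegral_le_of_norm_le_const hK.measure_lt_top fun y hy => hR a z hz y hy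

end Integral

lemma exists_contDiffOn_limit [FiniteDimensional ℝ E] [CompleteSpace G] {O : Set E} (hO : IsOpen O)
    {f : ℕ → E → G} (hf : ∀ m, ContDiffOn ℝ ∞ (f m) O)
    (hC : ∀ C ⊆ O, IsCompact C → ∀ j : ℕ, ∀ ε > 0, ∃ N, ∀ m ≥ N, ∀ n ≥ N, ∀ z ∈ C,
      ‖iteratedFDeriv ℝ j (f m - f n) z‖ ≤ ε) {F : E → G}
    (hF : ∀ z ∈ O, Tendsto (fun m => f m z) atTop (𝓝 (F z))) :
    ContDiffOn ℝ ∞ F O ∧ ∀ j : ℕ, ∀ z ∈ O,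
      Tendsto (fun m => iteratedFDeriv ℝ j (f m) z) atTop (𝓝 (iteratedFDeriv ℝ j F z)) := by
  have hsub : ∀ (j m n : ℕ) z, z ∈ O → iteratedFDeriv ℝ j (f m - f n) z =
      iteratedFDeriv ℝ j (f m) z - iteratedFDeriv ℝ j (f n) z := by
    intro j m n z hz
    have hm := ((hf m).contDiffAt (hO.mem_nhds hz)).of_le (natCast_le_infty j)
    have hn := ((hf n).contDiffAt (hO.mem_nhds hz)).of_le (natCast_le_infty j)
    exact iteratedFDeriv_sub_apply hm hn
  have hcau : ∀ (j : ℕ) C, C ⊆ O → IsCompact C →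
      UniformCauchySeqOn (fun m => iteratedFDeriv ℝ j (f m)) atTop C := by
    intro j C hCO hC'
    rw [Metric.uniformCauchySeqOn_iff]
    intro ε hε
    obtain ⟨N, hN⟩ := hC C hCO hC' j (ε / 2) (by positivity)
    refine ⟨N, fun m hm n hn z hz => ?_⟩
    rw [dist_eq_norm, ← hsub j m n z (hCO hz)]
    exact (hN m hm n hn z hz).trans_lt (by linarith)
  have hlim : ∀ (j : ℕ) z, ∃ p, z ∈ O → Tendsto (fun m => iteratedFDeriv ℝ j (f m) z) atTop (𝓝 p) := by
    intro j z
    by_cases hz : z ∈ O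
    · obtain ⟨p, hp⟩ := cauchySeq_tendsto_of_complete
        ((hcau j {z} (singleton_subset_iff.2 hz) isCompact_singleton).cauchySeq rfl)
      exact ⟨p, fun _ => hp⟩
    · exact ⟨0, fun h => absurd h hz⟩
  choose p hp using hlim
  have hloc : ∀ j : ℕ, TendstoLocallyUniformlyOn (fun m => iteratedFDeriv ℝ j (f m)) (p j) atTop O := by
    intro j
    have := FiniteDimensional.proper ℝ E
    rw [tendstoLocallyUniformlyOn_iff_forall_isCompact hO]
    exact fun C hCO hC' => (hcau j C hCO hC').tendstoUniformlyOn_of_tendsto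
      fun z hz => hp j z (hCO hz)
  have hcurry : ∀ j : ℕ, TendstoLocallyUniformlyOn
      (fun m z => (iteratedFDeriv ℝ (j + 1) (f m) z).curryLeft) (fun z => (p (j + 1) z).curryLeft)
      atTop O := fun j =>
    (continuousMultilinearCurryLeftEquiv ℝ (fun _ : Fin (j + 1) => E)
      G).isometry.uniformContinuous.comp_tendstoLocallyUniformlyOn (hloc (j + 1))
  have hd : ∀ (j : ℕ) z, z ∈ O → HasFDerivAt (p j) (p (j + 1) z).curryLeft z := by
    intro j z hz
    refine hasFDerivAt_of_tendstoLocallyUniformlyOn hO (hcurry j)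
      (fun m w hw => hasFDerivAt_iteratedFDeriv hO (hf m) hw j) (fun w hw => hp j w hw) hz
  have hT : HasFTaylorSeriesUpToOn ∞ F (fun z j => p j z) O := by
    refine ⟨fun z hz => ?_, fun j _ z hz => (hd j z hz).hasFDerivWithinAt, fun j _ z hz =>
      (hd j z hz).continuousAt.continuousWithinAt⟩
    refine tendsto_nhds_unique ?_ (hF z hz)
    exact ((continuousMultilinearCurryFin0 ℝ E G).continuous.tendsto _).comp (hp 0 z hz)
  refine ⟨hT.contDiffOn, fun j z hz => ?_⟩
  rw [← iteratedFDerivWithin_of_isOpen j hO hz,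
    ← hT.eq_iteratedFDerivWithin_of_uniqueDiffOn (natCast_le_infty j) hO.uniqueDiffOn hz]
  exact hp j z hz

end SmoothlyBounded

/-! ## Density of products of functions of one coordinate -/

section CoordinateProducts

section Parameters

variable {Z G : Type*} [NormedAddCommGroup Z] [NormedSpace ℝ Z] [FiniteDimensional ℝ Z]
  [NormedAddCommGroup G] [NormedSpace ℝ G] [CompleteSpace G]

lemma contDiff_integral_param {A : ℝ × Z → G} (hA : ContDiff ℝ ∞ A) (a b : ℝ) :
    ContDiff ℝ ∞ fun z => ∫ s in a..b, A (s, z) := by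
  have hc : ∀ j : ℕ, Continuous fun p : Z × ℝ => iteratedFDeriv ℝ j (fun z => A (p.2, z)) p.1 := by
    intro j
    have h1 : ContDiff ℝ ∞ fun p : Z × ℝ => A (p.2, p.1) := hA.comp (by fun_prop)
    have h2 := fun p : Z × ℝ => iteratedFDeriv_prod_left isOpen_univ h1.contDiffOn
      (mem_univ (p.1, p.2)) j
    simp only [h2]
    exact (ContinuousMultilinearMap.compContinuousLinearMapL
      fun _ : Fin j => ContinuousLinearMap.inl ℝ Z ℝ).continuous.comp
      (h1.continuous_iteratedFDeriv (natCast_le_infty j))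
  have key : ∀ a b : ℝ, ContDiff ℝ ∞ fun z => ∫ s in Ioc a b, A (s, z) := by
    intro a b
    simp only [← integral_Icc_eq_integral_Ioc]
    rw [← contDiffOn_univ]
    refine ((SB.integral (α := Unit) (f := fun _ z s => A (s, z)) (μ := volume) isCompact_Icc
      isOpen_univ (fun _ s _ => ?_) (fun _ j => ?_) fun C _ hC j => ?_)).smooth ()
    · exact (hA.comp (contDiff_const.prodMk contDiff_id)).contDiffOn
    · exact (hc j).continuousOn
    · obtain ⟨R, hR⟩ := (hC.prod isCompact_Icc).exists_bound_of_continuousOn (hc j).continuousOn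
      exact ⟨R, fun _ z hz s hs => hR (z, s) ⟨hz, hs⟩⟩
  simp only [intervalIntegral]
  exact (key a b).sub (key b a)

lemma exists_hadamard {Ψ : ℝ × Z → G} (hΨ : ContDiff ℝ ∞ Ψ) (q : ℝ) :
    ∃ Q : ℝ × Z → G, ContDiff ℝ ∞ Q ∧ (∀ h z, Ψ (q + h, z) = Ψ (q, z) + h • Q (h, z)) ∧
      ∀ z, HasDerivAt (fun t => Ψ (t, z)) (Q (0, z)) q := by
  have hΨ' : ContDiff ℝ ∞ fun p : ℝ × Z => fderiv ℝ Ψ p (1, 0) :=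
    (hΨ.fderiv_right (by simp)).clm_apply contDiff_const
  have hd : ∀ t z, HasDerivAt (fun t => Ψ (t, z)) (fderiv ℝ Ψ (t, z) (1, 0)) t := fun t z =>
    ((hΨ.differentiable (by simp)).differentiableAt.hasFDerivAt (x := (t, z))).comp_hasDerivAt t
      ((hasDerivAt_id t).prodMk (hasDerivAt_const t z))
  refine ⟨fun p => ∫ s in (0 : ℝ)..1, fderiv ℝ Ψ (q + s * p.1, p.2) (1, 0), ?_, fun h z => ?_,
    fun z => ?_⟩
  · refine contDiff_integral_param (A := fun x : ℝ × (ℝ × Z) =>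
      fderiv ℝ Ψ (q + x.1 * x.2.1, x.2.2) (1, 0)) ?_ 0 1
    exact hΨ'.comp (by fun_prop)
  · have h1 : ∀ s ∈ uIcc (0 : ℝ) 1, HasDerivAt (fun s => Ψ (q + s * h, z))
        (h • fderiv ℝ Ψ (q + s * h, z) (1, 0)) s := fun s _ => by
      have := (hd (q + s * h) z).scomp s (((hasDerivAt_id s).mul_const h).const_add q)
      simpa [Function.comp_def] using this
    have h2 := intervalIntegral.integral_eq_sub_of_hasDerivAt h1
      (Continuous.intervalIntegrable (by
        exact continuous_const.smul (hΨ'.continuous.comp (by fun_prop))) _ _)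
    rw [intervalIntegral.integral_smul] at h2
    simp only [one_mul, zero_mul, add_zero] at h2
    rw [h2]; abel
  · simpa using hd q z

end Parameters

variable {𝕜 : Type*} [RCLike 𝕜]

/-- Linear functionals on smooth functions which are bounded on bounded families. -/
def IsBddOnSmooth {Z : Type*} [NormedAddCommGroup Z] [NormedSpace ℝ Z]
    (ℓ : (Z → 𝕜) →ₗ[𝕜] 𝕜) : Prop :=
  ∀ {Q : Set ℝ} (φ : Q → Z → 𝕜), SB univ φ → ∃ R : ℝ, ∀ a, ‖ℓ (φ a)‖ ≤ R

namespace IsBddOnSmooth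

variable {Z : Type*} [NormedAddCommGroup Z] [NormedSpace ℝ Z]
  [FiniteDimensional ℝ Z] {ℓ : (Z → 𝕜) →ₗ[𝕜] 𝕜}
  (hℓ : IsBddOnSmooth ℓ)
include hℓ

lemma hasDerivAt {Ψ : ℝ × Z → 𝕜} (hΨ : ContDiff ℝ ∞ Ψ) (q : ℝ) : ∃ Q : Z → 𝕜,
    (∀ z, HasDerivAt (fun t => Ψ (t, z)) (Q z) q) ∧
    HasDerivAt (fun t => ℓ fun z => Ψ (t, z)) (ℓ Q) q := by
  obtain ⟨Q, hQ, h1, h2⟩ := exists_hadamard hΨ q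
  obtain ⟨Q', hQ', h1', -⟩ := exists_hadamard hQ 0
  refine ⟨fun z => Q (0, z), h2, ?_⟩
  obtain ⟨R, hR⟩ := hℓ _ (SB.of_param (Q := Icc (-1 : ℝ) 1) isCompact_Icc isOpen_univ
    (Ψ := Q') hQ'.contDiffOn)
  rw [hasDerivAt_iff_isLittleO_nhds_zero]
  have e : ∀ h : ℝ, (ℓ fun z => Ψ (q + h, z)) - (ℓ fun z => Ψ (q, z)) - h • (ℓ fun z => Q (0, z)) =
      ((h * h : ℝ) : 𝕜) * ℓ fun z => Q' (h, z) := fun h => by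
    have : (fun z => Ψ (q + h, z)) = (fun z => Ψ (q, z)) + (h : 𝕜) • (fun z => Q (0, z)) +
        ((h * h : ℝ) : 𝕜) • fun z => Q' (h, z) := by
      funext z
      have := h1' h z
      rw [zero_add] at this
      simp only [h1 h z, this, Pi.add_apply, Pi.smul_apply, RCLike.real_smul_eq_coe_mul, smul_eq_mul]
      push_cast
      ring
    rw [this, map_add, map_add, map_smul, map_smul, RCLike.real_smul_eq_coe_mul]
    simp only [smul_eq_mul]
    ring
  simp only [e]
  refine Asymptotics.IsBigO.trans_isLittleO (g := fun h : ℝ => h * h) ?_ ?_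
  · refine Asymptotics.IsBigO.of_bound R ?_
    filter_upwards [Icc_mem_nhds (show (-1 : ℝ) < 0 by norm_num) zero_lt_one] with h hh
    rw [norm_mul, RCLike.norm_ofReal, ← Real.norm_eq_abs, mul_comm]
    exact mul_le_mul_of_nonneg_right (hR ⟨h, hh⟩) (norm_nonneg _)
  · have : (fun h : ℝ => h * h) = fun h : ℝ => h ^ 2 := funext fun h => (sq h).symm
    rw [this]
    simpa using Asymptotics.isLittleO_pow_pow (𝕜 := ℝ) (m := 1) (n := 2) (by norm_num)

lemma integral_eq_zero {A : ℝ × Z → 𝕜} (hA : ContDiff ℝ ∞ A)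
    (h : ∀ s, ℓ (fun z => A (s, z)) = 0) (a b : ℝ) : ℓ (fun z => ∫ s in a..b, A (s, z)) = 0 := by
  have h1 : ContDiff ℝ ∞ fun p : ℝ × Z => ∫ s in a..p.1, A (s, p.2) := by
    have : (fun p : ℝ × Z => ∫ s in a..p.1, A (s, p.2)) =
        fun p => (p.1 - a) • ∫ s in (0 : ℝ)..1, A (a + (p.1 - a) * s, p.2) := funext fun p => by
      rw [intervalIntegral.smul_integral_comp_add_mul fun s => A (s, p.2)]
      simp
    rw [this]
    refine (contDiff_fst.sub contDiff_const).smul (contDiff_integral_param (A := fun x : ℝ × (ℝ × Z) =>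
      A (a + (x.2.1 - a) * x.1, x.2.2)) (hA.comp (by fun_prop)) 0 1)
  have h2 : ∀ t, HasDerivAt (fun t => ℓ fun z => ∫ s in a..t, A (s, z)) 0 t := fun t => by
    obtain ⟨Q, hQ, hQ'⟩ := hℓ.hasDerivAt h1 t
    have : Q = fun z => A (t, z) := funext fun z => by
      have hc : Continuous fun s => A (s, z) := hA.continuous.comp (by fun_prop)
      exact (hQ z).unique (intervalIntegral.integral_hasDerivAt_right (hc.intervalIntegrable _ _)
        (hc.stronglyMeasurableAtFilter _ _) hc.continuousAt)
    rwa [this, h] at hQ'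
  have h3 := is_const_of_deriv_eq_zero (fun t => (h2 t).differentiableAt) (fun t => (h2 t).deriv) b a
  refine h3.trans ?_
  simp only [intervalIntegral.integral_same]
  exact map_zero ℓ

lemma eq_zero_of_pos {Ψ : ℝ × Z → 𝕜} (hΨ : ContDiff ℝ ∞ Ψ)
    (h : ∀ ε > 0, ℓ (fun z => Ψ (ε, z)) = 0) : ℓ (fun z => Ψ (0, z)) = 0 := by
  obtain ⟨Q, -, hQ⟩ := hℓ.hasDerivAt hΨ 0
  refine tendsto_nhds_unique (hQ.continuousAt.tendsto.mono_left nhdsWithin_le_nhds)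
    (tendsto_const_nhds.congr' ?_ : Tendsto _ (𝓝[>] (0 : ℝ)) _)
  filter_upwards [self_mem_nhdsWithin] with ε hε
  exact (h ε hε).symm

end IsBddOnSmooth

section Mollification

variable {J : Type*} [Fintype J] [DecidableEq J]

theorem IsBddOnSmooth.eq_zero_of_products {ℓ : ((J → ℝ) → 𝕜) →ₗ[𝕜] 𝕜} (hℓ : IsBddOnSmooth ℓ)
    (h : ∀ g : J → ℝ → 𝕜, (∀ j, ContDiff ℝ ∞ (g j)) → ℓ (fun y => ∏ j, g j (y j)) = 0)
    {φ : (J → ℝ) → 𝕜} (hφ : ContDiff ℝ ∞ φ) {R : ℝ} (hR : ∀ y, (∃ j, R < |y j|) → φ y = 0) :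
    ℓ φ = 0 := by
  have key : ∀ S : Finset J, ∀ ψ : (J → ℝ) → 𝕜, ContDiff ℝ ∞ ψ →
      (∀ y y', (∀ j ∈ S, y j = y' j) → ψ y = ψ y') → (∀ y, (∃ j ∈ S, R < |y j|) → ψ y = 0) →
      ∀ g : J → ℝ → 𝕜, (∀ j, ContDiff ℝ ∞ (g j)) → ℓ (fun y => ψ y * ∏ j ∈ Sᶜ, g j (y j)) = 0 := by
    intro S
    induction S using Finset.induction_on with
    | empty =>
      intro ψ _ hψ _ g hg
      have : (fun y => ψ y * ∏ j ∈ (∅ : Finset J)ᶜ, g j (y j)) =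
          ψ 0 • fun y => ∏ j, g j (y j) := funext fun y => by
        rw [hψ y 0 (by simp), Finset.compl_empty]; rfl
      rw [this, map_smul, h g hg, smul_zero]
    | insert j S hj ih =>
      intro ψ hψ hS hψR g hg
      let f : ContDiffBump (0 : ℝ) := ⟨1 / 2, 1, by norm_num, by norm_num⟩
      let ρ : ℝ → ℝ := f.normed volume
      have hρ : ContDiff ℝ ∞ ρ := f.contDiff_normed
      have hρ0 : ∀ s, s ∉ Ioc (-1 : ℝ) 1 → ρ s = 0 := fun s hs => by
        have := f.support_normed_eq (μ := volume)
        by_contra h0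
        have h1 : s ∈ Function.support (f.normed volume) := h0
        rw [this, mem_ball_zero_iff, Real.norm_eq_abs, abs_lt] at h1
        exact hs ⟨h1.1, h1.2.le⟩
      let sh : ℝ → (J → ℝ) → J → ℝ := fun u y => y + (u - y j) • Pi.single j (1 : ℝ)
      have sh_j : ∀ u y, sh u y j = u := fun u y => by simp [sh]
      have sh_ne : ∀ u y i, i ≠ j → sh u y i = y i := fun u y i hi => by simp [sh, hi]
      have hsh : ContDiff ℝ ∞ fun p : ℝ × (J → ℝ) => sh p.1 p.2 := by fun_prop
      let G : (J → ℝ) → 𝕜 := fun y => ∏ i ∈ (insert j S)ᶜ, g i (y i)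
      have hG : ContDiff ℝ ∞ G := contDiff_prod fun i _ => (hg i).comp (contDiff_apply ℝ ℝ i)
      let Ψ : ℝ × (J → ℝ) → 𝕜 := fun p =>
        (∫ s in (-1 : ℝ)..1, ρ s • ψ (sh (p.2 j - p.1 * s) p.2)) * G p.2
      have hΨ : ContDiff ℝ ∞ Ψ := by
        refine (contDiff_integral_param (A := fun x : ℝ × (ℝ × (J → ℝ)) =>
          ρ x.1 • ψ (sh (x.2.2 j - x.2.1 * x.1) x.2.2)) ?_ _ _).mul (hG.comp contDiff_snd)
        exact (hρ.comp contDiff_fst).smul (hψ.comp (hsh.comp (f := fun x : ℝ × (ℝ × (J → ℝ)) =>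
          (x.2.2 j - x.2.1 * x.1, x.2.2)) (by fun_prop)))
      have hint : ∀ (p : ℝ × (J → ℝ)), (∫ s in (-1 : ℝ)..1, ρ s • ψ (sh (p.2 j - p.1 * s) p.2)) =
          ∫ s, ρ s • ψ (sh (p.2 j - p.1 * s) p.2) := fun p => by
        refine intervalIntegral.integral_eq_integral_of_support_subset fun s hs => ?_
        by_contra h0
        exact hs (by simp [hρ0 s h0])
      have h0 := hℓ.eq_zero_of_pos hΨ fun ε hε => ?_
      · convert h0 using 2
        funext y
        have h1 : ∀ s, sh (y j - 0 * s) y = y := fun s => by simp [sh]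
        simp only [Ψ]
        rw [hint (0, y)]
        simp only [h1]
        rw [integral_smul_const, f.integral_normed, one_smul]
      · let A : ℝ × (J → ℝ) → 𝕜 := fun x => (ε⁻¹ * ρ (ε⁻¹ * (x.2 j - x.1))) • ψ (sh x.1 x.2) * G x.2
        have hA : ContDiff ℝ ∞ A := by
          refine ContDiff.mul (ContDiff.smul (contDiff_const.mul (hρ.comp ?_)) (hψ.comp hsh))
            (hG.comp contDiff_snd)
          fun_prop
        have h1 := hℓ.integral_eq_zero hA (fun u => ?_) (-R - 1) R
        · convert h1 using 2
          funext y
          have h2 : (∫ u, (ε⁻¹ * ρ (ε⁻¹ * (y j - u))) • ψ (sh u y)) =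
              ∫ s, ρ s • ψ (sh (y j - ε * s) y) := by
            rw [← integral_sub_left_eq_self (fun u => (ε⁻¹ * ρ (ε⁻¹ * (y j - u))) • ψ (sh u y)) volume
              (y j)]
            have h3 := Measure.integral_comp_mul_left
              (fun u => ρ (ε⁻¹ * u) • ψ (sh (y j - u) y)) ε
            simp only [inv_mul_cancel_left₀ hε.ne', abs_of_pos (inv_pos.2 hε)] at h3
            simp only [sub_sub_cancel, mul_smul]
            rw [h3, integral_smul]
          simp only [Ψ, A]
          rw [hint (ε, y), intervalIntegral.integral_mul_const, ← h2]
          congr 1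
          refine (intervalIntegral.integral_eq_integral_of_support_subset fun u hu => ?_).symm
          by_contra h4
          refine hu ?_
          simp only
          rw [hψR (sh u y) ⟨j, Finset.mem_insert_self _ _, ?_⟩, smul_zero]
          rw [sh_j, lt_abs]
          rw [mem_Ioc, not_and_or, not_lt, not_le] at h4
          exact h4.symm.imp id fun h => by linarith
        · have h2 := ih (fun y => ψ (sh u y)) (hψ.comp (hsh.comp
            (f := fun y => (u, y)) (by fun_prop))) (fun y y' hy => hS _ _ fun i hi => ?_) (fun y ⟨i, hi, hy⟩ => hψR _ ⟨i,
              Finset.mem_insert_of_mem hi, ?_⟩) (Function.update g j fun t =>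
              ((ε⁻¹ * ρ (ε⁻¹ * (t - u)) : ℝ) : 𝕜)) (fun i => ?_)
          · convert h2 using 2
            funext y
            have h3 : Sᶜ = insert j (insert j S)ᶜ := by
              ext i; by_cases hi : i = j <;> simp [hi, hj]
            have h4 : ∏ i ∈ (insert j S)ᶜ, Function.update g j (fun t =>
                ((ε⁻¹ * ρ (ε⁻¹ * (t - u)) : ℝ) : 𝕜)) i (y i) = G y :=
              Finset.prod_congr rfl fun i hi => by
                rw [Function.update_of_ne (show i ≠ j by rintro rfl; simp at hi)]
            rw [h3, Finset.prod_insert (by simp), Function.update_self, h4]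
            simp only [A]
            rw [RCLike.real_smul_eq_coe_mul]
            ring
          · by_cases hij : i = j
            · subst hij; rw [sh_j, sh_j]
            · rw [sh_ne _ _ _ hij, sh_ne _ _ _ hij]
              exact hy i (Finset.mem_of_mem_insert_of_ne hi hij)
          · rwa [sh_ne]
            rintro rfl; exact hj hi
          · by_cases hij : i = j
            · subst hij
              rw [Function.update_self]
              exact (RCLike.ofRealCLM (K := 𝕜)).contDiff.comp (contDiff_const.mul
                (hρ.comp (f := fun t => ε⁻¹ * (t - u)) (by fun_prop)))
            · rw [Function.update_of_ne hij]; exact hg i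
  simpa using key Finset.univ φ hφ (fun y y' hy => congrArg φ (funext fun j => hy j (Finset.mem_univ j)))
    (fun y ⟨j, _, hj⟩ => hR y ⟨j, hj⟩) (fun _ _ => 1) fun _ => contDiff_const

end Mollification

end CoordinateProducts

section Manifold

universe v w
variable {d : ℕ} {M : Type uM} [TopologicalSpace M] [T2Space M] [SecondCountableTopology M]
  [ChartedSpace (EuclideanSpace ℝ (Fin d)) M] [IsManifold (𝓡 d) ∞ M]
  {𝕜 : Type uK} [RCLike 𝕜]
  {F : Type uF} [NormedAddCommGroup F] [NormedSpace ℝ F] [FiniteDimensional ℝ F]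
  {E : M → Type uE} [TopologicalSpace (TotalSpace F E)] [∀ x, TopologicalSpace (E x)]
  [∀ x, AddCommGroup (E x)] [∀ x, Module ℝ (E x)] [FiberBundle F E] [VectorBundle ℝ F E]
  [ContMDiffVectorBundle ∞ F E (𝓡 d)]
  {α : Type v} {β : Type*} {ι κ : Type} [Fintype ι] [hι : DecidableEq ι] [Fintype κ] [DecidableEq κ]
  {n k n' k' : ℕ} {U V W : Opens M} {𝒰 : Set (Opens M)}
  {L : (TotalSpace F E → 𝕜) →ₗ[𝕜] (TotalSpace F E → 𝕜)}
  {I : (TotalSpace F E × TotalSpace F E → 𝕜) →ₗ[𝕜] 𝕜}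

local notation "𝔼" => EuclideanSpace ℝ (Fin d)
local notation "𝕏" => TotalSpace F E
local notation "𝒲" => WordFun (TotalSpace F E) 𝕜
local notation "𝔠" => extChartAt (𝓡 d)
local notation "𝔟" => extChartAt (ModelWithCorners.prod (𝓡 d) 𝓘(ℝ, F))
local notation "𝔇" => localDomain (d := d) F E
local notation "𝔱" => trivializationAt F E
local notation "𝒯" => TestTensors d 𝕜 F E
local notation "𝒱" => PV d 𝕜 F E
local notation:max "𝒱ₛ" U:max => fun k => PV d 𝕜 F E k U

open WordFun LCSum PowerSeries

/-! ## Families of test tensors -/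

lemma isOpen_repDomain (c : ι → 𝕏) : IsOpen (repDomain d c) :=
  isOpen_set_pi finite_univ fun i _ => isOpen_extChartAt_target (c i)

variable (d F E) in
/-- The coordinates of a family of points in the bundle charts at these points. -/
def centre (c : ι → 𝕏) (i : ι) : 𝔼 × F :=
  𝔟 (c i) (c i)

lemma centre_mem (c : ι → 𝕏) : centre d F E c ∈ repDomain d c :=
  fun i _ => mem_extChartAt_target (c i)

lemma localRep_centre (c : ι → 𝕏) (f : (ι → 𝕏) → 𝕜) :
    localRep d c f (centre d F E c) = f c :=
  congrArg f (funext fun i => extChartAt_to_inv (c i))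

variable {f g : α → (ι → TotalSpace F E) → 𝕜}

variable (d) in
/-- Bounded families of test tensors. -/
structure IsTTFam (U : Opens M) (f : α → (ι → 𝕏) → 𝕜) : Prop where
  linear : ∀ a, IsFiberwiseMultilinear (f a)
  supp : ∃ K : Set M, IsCompact K ∧ K ⊆ U ∧ ∀ a, IsSupportedIn K (f a)
  bdd : ∀ c, SB (repDomain d c) fun a => localRep d c (f a)

namespace IsTTFam

lemma mem (hf : IsTTFam d U f) (a : α) : f a ∈ 𝒯 ι U := by
  obtain ⟨K, hK, hKU, h⟩ := hf.supp
  exact ⟨fun c => (hf.bdd c).smooth a, hf.linear a, K, hK, hKU, h a⟩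

lemma of_mem {f : (ι → 𝕏) → 𝕜} (hf : f ∈ 𝒯 ι U) :
    IsTTFam d U fun _ : α => f := by
  obtain ⟨h1, h2, K, hK, hKU, h3⟩ := hf
  exact ⟨fun _ => h2, ⟨K, hK, hKU, fun _ => h3⟩,
    fun c => SB.of_contDiffOn (isOpen_repDomain c) (h1 c)⟩

lemma of_isBddFamily {S : Set (𝒯 ι U)} (hS : IsBddFamily S) :
    IsTTFam d U fun f : S => f.1.1 := by
  obtain ⟨⟨K, hK, hKU, h⟩, hb⟩ := hS
  refine ⟨fun f => f.1.2.2.1, ⟨K, hK, hKU, fun f => h _ f.2⟩, fun c =>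
    ⟨fun f => f.1.2.1 c, fun C hC hC' j => ?_⟩⟩
  obtain ⟨R, hR⟩ := hb c C hC' hC j
  exact ⟨R, fun f z hz => hR f.1 f.2 z hz⟩

lemma isBddFamily (hf : IsTTFam d U f) {S : Set (𝒯 ι U)}
    (hS : ∀ s ∈ S, ∃ a, s.1 = f a) : IsBddFamily S := by
  obtain ⟨K, hK, hKU, h⟩ := hf.supp
  refine ⟨⟨K, hK, hKU, fun s hs => ?_⟩, fun c C hC hC' j => ?_⟩
  · obtain ⟨a, ha⟩ := hS s hs
    rw [ha]; exact h a
  · obtain ⟨R, hR⟩ := (hf.bdd c).bdd C hC' hC j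
    refine ⟨R, fun s hs z hz => ?_⟩
    obtain ⟨a, ha⟩ := hS s hs
    rw [ha]; exact hR a z hz

lemma reindex (hf : IsTTFam d U f) (φ : β → α) : IsTTFam d U fun b => f (φ b) := by
  obtain ⟨K, hK, hKU, h⟩ := hf.supp
  exact ⟨fun _ => hf.linear _, ⟨K, hK, hKU, fun _ => h _⟩, fun c => (hf.bdd c).reindex φ⟩

lemma mono (hf : IsTTFam d U f) (hUV : U ≤ V) : IsTTFam d V f := by
  obtain ⟨K, hK, hKU, h⟩ := hf.supp
  exact ⟨hf.linear, ⟨K, hK, hKU.trans hUV, h⟩, hf.bdd⟩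

lemma bound (hf : IsTTFam d U f) (v : ι → 𝕏) : ∃ R : ℝ, ∀ a, ‖f a v‖ ≤ R := by
  obtain ⟨R, hR⟩ := (hf.bdd v).bdd {centre d F E v} (singleton_subset_iff.2 (centre_mem v))
    isCompact_singleton 0
  refine ⟨R, fun a => ?_⟩
  have := hR a _ rfl
  rwa [norm_iteratedFDeriv_zero, localRep_centre] at this

lemma add (hf : IsTTFam d U f) (hg : IsTTFam d U g) : IsTTFam d U fun a v => f a v + g a v := by
  obtain ⟨K, hK, hKU, h⟩ := hf.supp
  obtain ⟨K', hK', hKU', h'⟩ := hg.supp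
  refine ⟨fun a v i x y z r => ?_, ⟨K ∪ K', hK.union hK', union_subset hKU hKU', ?_⟩,
    fun c => (hf.bdd c).add (hg.bdd c) (isOpen_repDomain c)⟩
  · simp only [hf.linear a v i x y z r, hg.linear a v i x y z r, smul_add]; abel
  · rintro a v ⟨i, hi⟩
    rw [mem_union, not_or] at hi
    simp only [h a v ⟨i, hi.1⟩, h' a v ⟨i, hi.2⟩, add_zero]

lemma smul (hf : IsTTFam d U f) {r : α → 𝕜} {R : ℝ} (hr : ∀ a, ‖r a‖ ≤ R) :
    IsTTFam d U fun a v => r a * f a v := by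
  obtain ⟨K, hK, hKU, h⟩ := hf.supp
  refine ⟨fun a v i x y z s => ?_, ⟨K, hK, hKU, ?_⟩,
    fun c => (SB.of_const hr).bilin (hf.bdd c) (isOpen_repDomain c) (ContinuousLinearMap.mul ℝ 𝕜)⟩
  · simp only [hf.linear a v i x y z s, mul_add, mul_smul_comm]
  · rintro a v hv
    simp only [h a v hv, mul_zero]

lemma const_smul (hf : IsTTFam d U f) (r : 𝕜) : IsTTFam d U fun a v => r * f a v :=
  hf.smul fun _ => le_rfl

lemma zero : IsTTFam d U fun (_ : α) (_ : ι → 𝕏) => (0 : 𝕜) :=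
  of_mem (zero_mem _)

lemma sum {I : Type*} (s : Finset I) {f : I → α → (ι → 𝕏) → 𝕜}
    (hf : ∀ i ∈ s, IsTTFam d U (f i)) : IsTTFam d U fun a v => ∑ i ∈ s, f i a v := by
  induction s using Finset.cons_induction with
  | empty => simpa using zero
  | cons i s hi ih =>
    simp only [Finset.sum_cons]
    exact (hf i (Finset.mem_cons_self _ _)).add (ih fun j hj => hf j (Finset.mem_cons_of_mem hj))

lemma sb_localRep_comp {f : α → (ι → 𝕏) → 𝕜}
    (hf : ∀ c, SB (repDomain d c) fun a => localRep d c (f a)) (e : ι → κ)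
    (c : κ → 𝕏) :
    SB (repDomain d c) fun a => localRep d c fun v => f a (v ∘ e) := by
  have h : ContDiff ℝ ∞ fun (z : κ → 𝔼 × F) (i : ι) => z (e i) :=
    contDiff_pi.2 fun i => contDiff_apply ℝ _ (e i)
  exact (hf (c ∘ e)).comp_contDiffOn (isOpen_repDomain _) (isOpen_repDomain c) h.contDiffOn
    fun z hz i _ => hz (e i) (mem_univ _)

lemma comp (hf : IsTTFam d U f) (e : ι ≃ κ) :
    IsTTFam d U fun a (v : κ → 𝕏) => f a (v ∘ e) := by
  obtain ⟨K, hK, hKU, h⟩ := hf.supp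
  refine ⟨fun a v i x y z r => ?_, ⟨K, hK, hKU, ?_⟩, sb_localRep_comp hf.bdd e⟩
  · simp only [Function.update_comp_equiv]
    exact hf.linear a _ _ x y z r
  · rintro a v ⟨i, hi⟩
    exact h a _ ⟨e.symm i, by simpa using hi⟩

lemma mul {g : α → (κ → 𝕏) → 𝕜} (hf : IsTTFam d U f) (hg : IsTTFam d U g) :
    IsTTFam d U fun a (v : ι ⊕ κ → 𝕏) => f a (v ∘ Sum.inl) * g a (v ∘ Sum.inr) := by
  obtain ⟨K, hK, hKU, h⟩ := hf.supp
  obtain ⟨K', hK', hKU', h'⟩ := hg.supp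
  refine ⟨fun a v i x y z r => ?_, ⟨K ∪ K', hK.union hK', union_subset hKU hKU', ?_⟩,
    fun c => (sb_localRep_comp hf.bdd Sum.inl c).bilin (sb_localRep_comp hg.bdd Sum.inr c)
      (isOpen_repDomain c) (ContinuousLinearMap.mul ℝ 𝕜)⟩
  · rcases i with i | i
    · simp only [Sum.update_inl_comp_inl, Sum.update_inl_comp_inr]
      rw [hf.linear a _ i x y z r, add_mul, smul_mul_assoc]
    · simp only [Sum.update_inr_comp_inl, Sum.update_inr_comp_inr]
      rw [hg.linear a _ i x y z r, mul_add, mul_smul_comm]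
  · rintro a v ⟨i, hi⟩
    rw [mem_union, not_or] at hi
    rcases i with i | i
    · simp only [h a (v ∘ Sum.inl) ⟨i, hi.1⟩, zero_mul]
    · simp only [h' a (v ∘ Sum.inr) ⟨i, hi.2⟩, mul_zero]

end IsTTFam

/-! ## The spaces of polyvector fields -/

lemma IsTTFam.altFun {f : α → (Fin n ⊕ Fin k → 𝕏) → 𝕜} (hf : IsTTFam d U f) :
    IsTTFam d U fun a => _root_.altFun (f a) :=
  IsTTFam.sum _ fun σ _ => IsTTFam.sum _ fun τ _ =>
    (hf.comp (Equiv.sumCongr σ τ)).const_smul _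

variable (d 𝕜 F E) in
/-- Alternation of test tensors. -/
def altLin (n k : ℕ) (U : Opens M) :
    𝒯 (Fin n ⊕ Fin k) U →ₗ[𝕜] 𝒯 (Fin n ⊕ Fin k) U where
  toFun f := ⟨altFun f.1, (IsTTFam.of_mem (α := Unit) f.2).altFun.mem ()⟩
  map_add' f g := Subtype.ext (altFun_add f.1 g.1)
  map_smul' c f := Subtype.ext (altFun_smul c f.1)

lemma altLin_relations : coinvariantRelations d 𝕜 F E n k U ≤ LinearMap.ker (altLin d 𝕜 F E n k U) := by
  refine Submodule.span_le.2 ?_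
  rintro _ ⟨f, f', σ, τ, h, rfl⟩
  refine LinearMap.mem_ker.2 ?_
  rw [map_sub, sub_eq_zero]
  have e : f'.1 = fun v => f.1 (v ∘ Sum.map σ τ) := funext h
  refine Subtype.ext (funext fun v => ?_)
  change altFun f'.1 v = altFun (Equiv.Perm.sign τ • f : 𝒯 _ U).1 v
  rw [e, altFun_of_comp]
  rcases Int.units_eq_one_or (Equiv.Perm.sign τ) with h | h
  · rw [h]; simp
  · rw [h]
    have : ((-1 : ℤˣ) • f : 𝒯 _ U).1 = (-1 : 𝕜) • f.1 := by
      rw [Units.neg_smul, one_smul, neg_one_smul]; rfl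
    rw [this, altFun_smul]
    simp

/-- Alternation of a coinvariant class. -/
def Coinvariants.alt (n k : ℕ) (U : Opens M) :
    Coinvariants d 𝕜 F E n k U →ₗ[𝕜] 𝒯 (Fin n ⊕ Fin k) U :=
  (coinvariantRelations d 𝕜 F E n k U).liftQ (altLin d 𝕜 F E n k U) altLin_relations

/-- The class of a section in the coinvariants. -/
def Coinvariants.mk (n k : ℕ) (U : Opens M) :
    𝒯 (Fin n ⊕ Fin k) U →ₗ[𝕜] Coinvariants d 𝕜 F E n k U :=
  (coinvariantRelations d 𝕜 F E n k U).mkQ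

lemma Coinvariants.alt_mk (f : 𝒯 (Fin n ⊕ Fin k) U) :
    Coinvariants.alt n k U (Coinvariants.mk n k U f) = altLin d 𝕜 F E n k U f := rfl

lemma Coinvariants.mk_comp (f f' : 𝒯 (Fin n ⊕ Fin k) U) (σ : Equiv.Perm (Fin n))
    (τ : Equiv.Perm (Fin k)) (h : ∀ v, f'.1 v = f.1 (v ∘ Sum.map σ τ)) :
    Coinvariants.mk n k U f' = ((Equiv.Perm.sign τ : ℤ) : 𝕜) • Coinvariants.mk n k U f := by
  have h1 : f' - Equiv.Perm.sign τ • f ∈ coinvariantRelations d 𝕜 F E n k U :=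
    Submodule.subset_span ⟨f, f', σ, τ, h, rfl⟩
  have h2 : Coinvariants.mk n k U (f' - Equiv.Perm.sign τ • f) = 0 :=
    (Submodule.Quotient.mk_eq_zero _).2 h1
  rw [map_sub, sub_eq_zero] at h2
  rw [h2]
  rcases Int.units_eq_one_or (Equiv.Perm.sign τ) with h | h <;> rw [h]
  · simp
  · rw [Units.neg_smul, one_smul, map_neg]; simp

lemma Coinvariants.mk_alt (y : Coinvariants d 𝕜 F E n k U) : Coinvariants.mk n k U
    (Coinvariants.alt n k U y) = ((n.factorial * k.factorial : ℕ) : 𝕜) • y := by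
  obtain ⟨f, rfl⟩ := Submodule.mkQ_surjective _ y
  change Coinvariants.mk n k U (altLin d 𝕜 F E n k U f) = _ • Coinvariants.mk n k U f
  let g : Equiv.Perm (Fin n) → Equiv.Perm (Fin k) → 𝒯 (Fin n ⊕ Fin k) U :=
    fun σ τ => ⟨fun v => f.1 (v ∘ Equiv.sumCongr σ τ),
      ((IsTTFam.of_mem (α := Unit) f.2).comp (Equiv.sumCongr σ τ)).mem ()⟩
  have e : altLin d 𝕜 F E n k U f =
      ∑ σ, ∑ τ : Equiv.Perm (Fin k), ((Equiv.Perm.sign τ : ℤ) : 𝕜) • g σ τ := by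
    refine Subtype.ext (funext fun v => ?_)
    simp only [Submodule.coe_sum, Finset.sum_apply, Submodule.coe_smul, Pi.smul_apply, smul_eq_mul]
    rfl
  simp only [e, map_sum, map_smul]
  simp only [fun σ τ => Coinvariants.mk_comp f (g σ τ) σ τ fun v => rfl, smul_smul,
    sign_mul_self_cast, one_smul, Finset.sum_const, Finset.card_univ, Fintype.card_perm,
    Fintype.card_fin, mul_nsmul', ← Nat.cast_smul_eq_nsmul 𝕜, ← mul_smul, Nat.cast_mul]

lemma factorial_ne_zero' : ((n.factorial * k.factorial : ℕ) : 𝕜) ≠ 0 :=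
  Nat.cast_ne_zero.2 (mul_ne_zero n.factorial_ne_zero k.factorial_ne_zero)

namespace PV

/-- The alternated component in `n` even variables. -/
def alt (n : ℕ) : 𝒱 k U →ₗ[𝕜] 𝒯 (Fin n ⊕ Fin k) U :=
  (Coinvariants.alt n k U).comp
    (LCSum.comp (𝕜 := 𝕜) (V := fun n => Coinvariants d 𝕜 F E n k U) n)

lemma alt_mk (f : 𝒯 (Fin n ⊕ Fin k) U) :
    alt n (mk f) = altLin d 𝕜 F E n k U f := by
  rw [← Coinvariants.alt_mk]
  exact congrArg _ (LCSum.comp_lof_same (𝕜 := 𝕜) (V := fun n => Coinvariants d 𝕜 F E n k U) n _)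

lemma alt_mk_of_ne {m : ℕ} (h : m ≠ n) (f : 𝒯 (Fin n ⊕ Fin k) U) :
    alt m (mk f) = 0 := by
  refine (congrArg (Coinvariants.alt m k U) (LCSum.comp_lof_of_ne (𝕜 := 𝕜)
    (V := fun n => Coinvariants d 𝕜 F E n k U) h _)).trans (map_zero _)

lemma comp_eq (x : 𝒱 k U) (n : ℕ) :
    LCSum.comp (𝕜 := 𝕜) (V := fun n => Coinvariants d 𝕜 F E n k U) n x =
      ((n.factorial * k.factorial : ℕ) : 𝕜)⁻¹ • Coinvariants.mk n k U (alt n x) := by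
  have h := Coinvariants.mk_alt (𝕜 := 𝕜) (LCSum.comp (𝕜 := 𝕜) (V := fun n => Coinvariants d 𝕜 F E n k U) n x)
  exact ((congrArg _ h).trans (inv_smul_smul₀ factorial_ne_zero' _)).symm

lemma sum_mk {x : 𝒱 k U} {N : ℕ} (hN : ∀ n, N ≤ n → alt n x = 0) :
    ∑ n ∈ Finset.range N, ((n.factorial * k.factorial : ℕ) : 𝕜)⁻¹ • mk (alt n x) = x := by
  refine Eq.trans (Finset.sum_congr rfl fun n _ => ?_)
    (LCSum.sum_lof (𝕜 := 𝕜) (V := fun n => Coinvariants d 𝕜 F E n k U) (x := x) (N := N)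
      fun n hn => ?_)
  · rw [comp_eq, ← map_smul]; rfl
  · rw [comp_eq, hN n hn, map_zero, smul_zero]

lemma exists_bound (x : 𝒱 k U) : ∃ N, ∀ n, N ≤ n → alt n x = 0 := by
  obtain ⟨N, hN⟩ := LCSum.exists_bound (𝕜 := 𝕜) (V := fun n => Coinvariants d 𝕜 F E n k U) x
  exact ⟨N, fun n hn => (congrArg (Coinvariants.alt n k U) (hN n hn)).trans (map_zero _)⟩

lemma ext_alt {x y : 𝒱 k U} (h : ∀ n, alt n x = alt n y) : x = y := by
  have h' : ∀ n, 0 ≤ n → alt n (x - y) = 0 := fun n _ => by rw [map_sub, h n, sub_self]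
  have := sum_mk h'
  rw [Finset.range_zero, Finset.sum_empty] at this
  exact (sub_eq_zero.1 this.symm)

lemma hom_ext {B : Type*} [AddCommGroup B] [Module 𝕜 B] {f g : 𝒱 k U →ₗ[𝕜] B}
    (h : ∀ n (t : 𝒯 (Fin n ⊕ Fin k) U), f (mk t) = g (mk t)) : f = g := by
  ext x
  obtain ⟨N, hN⟩ := exists_bound x
  rw [← sum_mk hN, map_sum, map_sum]
  exact Finset.sum_congr rfl fun n _ => by rw [map_smul, map_smul, h]

/-! ### The topology -/

lemma withSeminorms : WithSeminorms (fun p : {p // IsLFSeminorm d 𝕜 F E k U p} => p.1 :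
    SeminormFamily 𝕜 (𝒱 k U) _) := ⟨rfl⟩

instance : PolynormableSpace 𝕜 (𝒱 k U) := withSeminorms.toPolynormableSpace

lemma isSeminormIdeal : IsSeminormIdeal (IsLFSeminorm d 𝕜 F E k U) where
  zero _ _ _ := ⟨0, fun _ _ => le_rfl⟩
  sup p q hp hq n S hS := by
    obtain ⟨R, hR⟩ := hp n S hS
    obtain ⟨R', hR'⟩ := hq n S hS
    exact ⟨max R R', fun f hf => max_le_max (hR f hf) (hR' f hf)⟩
  smul r p hp n S hS := by
    obtain ⟨R, hR⟩ := hp n S hS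
    exact ⟨r * R, fun f hf => mul_le_mul_of_nonneg_left (hR f hf) r.2⟩
  mono p q h hq n S hS := by
    obtain ⟨R, hR⟩ := hq n S hS
    exact ⟨R, fun f hf => (h _).trans (hR f hf)⟩

lemma continuous_seminorm_iff (p : Seminorm 𝕜 (𝒱 k U)) :
    Continuous p ↔ IsLFSeminorm d 𝕜 F E k U p :=
  isSeminormIdeal.continuous_iff withSeminorms p

lemma isVonNBounded_mk {S : Set (𝒯 (Fin n ⊕ Fin k) U)} (hS : IsBddFamily S) :
    Bornology.IsVonNBounded 𝕜 (mk '' S) :=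
  PolynormableSpace.isVonNBounded_iff.2 fun p hp => by
    obtain ⟨R, hR⟩ := (continuous_seminorm_iff p).1 hp n S hS
    exact ⟨R, by rintro _ ⟨f, hf, rfl⟩; exact hR f hf⟩

lemma continuous_of_bdd {B : Type*} [AddCommGroup B] [Module 𝕜 B] [TopologicalSpace B]
    [PolynormableSpace 𝕜 B] {f : 𝒱 k U →ₗ[𝕜] B}
    (hf : ∀ n (S : Set (𝒯 (Fin n ⊕ Fin k) U)), IsBddFamily S →
      Bornology.IsVonNBounded 𝕜 ((fun t => f (mk t)) '' S)) : Continuous f :=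
  PolynormableSpace.continuous_of_comp f fun q hq => (continuous_seminorm_iff _).2 fun n S hS => by
    obtain ⟨R, hR⟩ := PolynormableSpace.isVonNBounded_iff.1 (hf n S hS) q hq
    exact ⟨R, fun t ht => hR _ (mem_image_of_mem _ ht)⟩

lemma eventually_zero {S : Set (𝒱 k U)} (hS : Bornology.IsVonNBounded 𝕜 S)
    (q : ℕ → Seminorm 𝕜 (𝒱 k U)) (hq : ∀ m, IsLFSeminorm d 𝕜 F E k U (q m))
    (hfin : ∀ n (S : Set (𝒯 (Fin n ⊕ Fin k) U)), IsBddFamily S →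
      ∃ N, ∀ m ≥ N, ∀ f ∈ S, q m (mk f) = 0) : ∃ N, ∀ m ≥ N, ∀ x ∈ S, q m x = 0 := by
  by_contra! h
  have hr : ∀ m, ∃ r : NNReal, (∃ x ∈ S, q m x ≠ 0) → ∃ x ∈ S, (m : ℝ) ≤ (r • q m) x := by
    intro m
    by_cases hm : ∃ x ∈ S, q m x ≠ 0
    · obtain ⟨x, hx, hx0⟩ := hm
      refine ⟨Real.toNNReal (m / q m x), fun _ => ⟨x, hx, ?_⟩⟩
      have : 0 ≤ q m x := apply_nonneg _ _
      rw [_root_.smul_apply, NNReal.smul_def, Real.coe_toNNReal _ (by positivity), smul_eq_mul,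
        div_mul_cancel₀ _ hx0]
    · exact ⟨0, fun h => absurd h hm⟩
  choose r hr using hr
  have hle : ∀ {m x}, q m x = 0 → (r m • q m) x = 0 := fun {m x} h => by
    rw [_root_.smul_apply, h, smul_zero]
  have hfin' : ∀ x, (Function.support fun m => (r m • q m) x).Finite := by
    intro x
    obtain ⟨N, hN⟩ := exists_bound x
    have h1 : ∀ n, ∃ L, ∀ m ≥ L, q m (mk (alt n x)) = 0 := fun n => by
      have hb : IsBddFamily {alt n x} :=
        (IsTTFam.of_mem (α := Unit) (alt n x).2).isBddFamily fun s hs => ⟨(), by rw [hs]⟩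
      obtain ⟨L, hL⟩ := hfin n _ hb
      exact ⟨L, fun m hm => hL m hm _ rfl⟩
    choose L hL using h1
    refine (Set.finite_lt_nat ((Finset.range N).sup L)).subset fun m hm => ?_
    by_contra hlt
    have hlt' : (Finset.range N).sup L ≤ m := not_lt.1 hlt
    refine hm (hle (le_antisymm ?_ (apply_nonneg _ _)))
    rw [← sum_mk hN]
    refine (Seminorm.map_sum_le_sum _ _ _).trans (Finset.sum_nonpos fun n hn => ?_)
    rw [map_smul_eq_mul, hL n m ((Finset.le_sup hn).trans hlt'), mul_zero]
  have hP : Continuous (finsumSeminorm _ hfin') := by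
    refine (continuous_seminorm_iff _).2 fun n T hT => ?_
    obtain ⟨N, hN⟩ := hfin n T hT
    choose R hR using fun m => isSeminormIdeal.smul (r m) _ (hq m) n T hT
    refine ⟨∑ m ∈ Finset.range N, R m, fun f hf => ?_⟩
    rw [finsumSeminorm_apply, finsum_eq_sum_of_support_subset _ (s := Finset.range N)]
    · exact Finset.sum_le_sum fun m _ => hR m f hf
    · intro m hm
      by_contra hlt
      exact hm (hle (hN m (not_lt.1 fun h => hlt (Finset.mem_coe.2 (Finset.mem_range.2 h))) f hf))
  obtain ⟨R, hR⟩ := PolynormableSpace.isVonNBounded_iff.1 hS _ hP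
  obtain ⟨N, hN⟩ := exists_nat_gt R
  obtain ⟨m, hm, x, hx, hxm⟩ := h N
  obtain ⟨y, hy, hmy⟩ := hr m ⟨x, hx, hxm⟩
  have h1 := hR y hy
  have h2 := le_finsumSeminorm _ hfin' m y
  have h3 : (N : ℝ) ≤ m := by exact_mod_cast hm
  linarith

/-- The seminorm given by evaluation of an alternated component. -/
def evalSeminorm (n : ℕ) (v : Fin n ⊕ Fin k → 𝕏) : Seminorm 𝕜 (𝒱 k U) :=
  (normSeminorm 𝕜 𝕜).comp ((LinearMap.proj v).comp ((Submodule.subtype _).comp (alt n)))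

lemma evalSeminorm_apply (n : ℕ) (v : Fin n ⊕ Fin k → 𝕏) (x : 𝒱 k U) :
    evalSeminorm n v x = ‖(alt n x).1 v‖ := rfl

lemma bddFamily_alt {S : Set (𝒯 (Fin n ⊕ Fin k) U)} (hS : IsBddFamily S) :
    IsTTFam d U fun f : S => (alt n (mk f.1)).1 := by
  simp only [alt_mk]
  exact (IsTTFam.of_isBddFamily hS).altFun

lemma isLFSeminorm_eval (n : ℕ) (v : Fin n ⊕ Fin k → 𝕏) :
    IsLFSeminorm d 𝕜 F E k U (evalSeminorm n v) := by
  intro m S hS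
  rcases eq_or_ne n m with rfl | h
  · obtain ⟨R, hR⟩ := (bddFamily_alt hS).bound v
    exact ⟨R, fun f hf => hR ⟨f, hf⟩⟩
  · exact ⟨0, fun f hf => by rw [evalSeminorm_apply, alt_mk_of_ne h]; simp⟩

lemma exists_alt_bound {S : Set (𝒱 k U)} (hS : Bornology.IsVonNBounded 𝕜 S) :
    ∃ N, ∀ n ≥ N, ∀ x ∈ S, alt n x = 0 := by
  have h : ∀ n, ∃ q : Seminorm 𝕜 (𝒱 k U), IsLFSeminorm d 𝕜 F E k U q ∧
      (∀ m, m ≠ n → ∀ f : 𝒯 (Fin m ⊕ Fin k) U, q (mk f) = 0) ∧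
      ((∃ x ∈ S, alt n x ≠ 0) → ∃ x ∈ S, q x ≠ 0) := by
    intro n
    by_cases hn : ∃ x ∈ S, alt n x ≠ 0
    · obtain ⟨x, hx, hx0⟩ := hn
      obtain ⟨v, hv⟩ : ∃ v, (alt n x).1 v ≠ 0 := by
        by_contra! hv
        exact hx0 (Subtype.ext (funext hv))
      refine ⟨evalSeminorm n v, isLFSeminorm_eval n v, fun m hm f => ?_, fun _ => ⟨x, hx, ?_⟩⟩
      · rw [evalSeminorm_apply, alt_mk_of_ne hm.symm]; simp
      · rw [evalSeminorm_apply]; exact norm_ne_zero_iff.2 hv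
    · exact ⟨0, isSeminormIdeal.zero, fun _ _ _ => rfl, fun h => absurd h hn⟩
  choose q hq hq0 hqS using h
  obtain ⟨N, hN⟩ := eventually_zero hS q hq fun n T _ => ⟨n + 1, fun m hm f _ =>
    hq0 m n (by omega) f⟩
  refine ⟨N, fun n hn x hx => ?_⟩
  by_contra h
  obtain ⟨y, hy, hy0⟩ := hqS n ⟨x, hx, h⟩
  exact hy0 (hN n hn y hy)

end PV

/-! ## Bounded subsets and completeness of the spaces of polyvector fields -/

lemma exists_limit_testTensors [FiniteDimensional ℝ F] {β : Type*} {ι : Type} [Fintype ι]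
    [DecidableEq ι] {g : β → (ι → 𝕏) → 𝕜} (hg : IsTTFam d U g)
    {f : ℕ → 𝒯 ι U} {μ : ℕ × ℕ → ℝ} (hμ : Tendsto μ atTop (𝓝 0))
    (h : ∀ m m', ∃ b, ∀ v, (f m).1 v - (f m').1 v = (μ (m, m') : 𝕜) * g b v) :
    ∃ (G : 𝒯 ι U) (S : Set (𝒯 ι U)), IsBddFamily S ∧
      ∀ ε : ℝ, 0 < ε → ∃ N, ∀ m ≥ N, ∃ s ∈ S, f m - G = (ε : 𝕜) • s := by
  have hμ' : ∀ ε : ℝ, 0 < ε → ∃ N, ∀ m ≥ N, ∀ m' ≥ N, |μ (m, m')| ≤ ε := by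
    intro ε hε
    obtain ⟨⟨N, N'⟩, hN⟩ := eventually_atTop.1 (Metric.tendsto_nhds.1 hμ ε hε)
    refine ⟨max N N', fun m hm m' hm' => ?_⟩
    have := hN (m, m') ⟨(le_max_left _ _).trans hm, (le_max_right _ _).trans hm'⟩
    rw [Real.dist_eq, sub_zero] at this
    exact this.le
  have hsub : ∀ c m m', ∃ b, localRep d c (f m).1 - localRep d c (f m').1 =
      (μ (m, m') : 𝕜) • localRep d c (g b) := fun c m m' => by
    obtain ⟨b, hb⟩ := h m m'
    exact ⟨b, funext fun z => hb _⟩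
  have hlim : ∀ v, ∃ y, Tendsto (fun m => (f m).1 v) atTop (𝓝 y) := by
    intro v
    obtain ⟨R, hR⟩ := hg.bound v
    refine cauchySeq_tendsto_of_complete (Metric.cauchySeq_iff.2 fun ε hε => ?_)
    obtain ⟨N, hN⟩ := hμ' (ε / (|R| + 1)) (by positivity)
    refine ⟨N, fun m hm m' hm' => ?_⟩
    obtain ⟨b, hb⟩ := h m m'
    rw [dist_eq_norm, hb, norm_mul, RCLike.norm_ofReal]
    calc |μ (m, m')| * ‖g b v‖ ≤ ε / (|R| + 1) * |R| :=
          mul_le_mul (hN m hm m' hm') ((hR b).trans (le_abs_self R)) (norm_nonneg _) (by positivity)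
      _ < ε / (|R| + 1) * (|R| + 1) := by gcongr; linarith
      _ = ε := by field_simp
  choose G hG using hlim
  have hderiv : ∀ c, ∀ C ⊆ repDomain d c, IsCompact C → ∀ j : ℕ, ∃ R : ℝ, 0 ≤ R ∧
      ∀ m m', ∀ z ∈ C, ‖iteratedFDeriv ℝ j (localRep d c (f m).1 - localRep d c (f m').1) z‖ ≤
        |μ (m, m')| * R := by
    intro c C hC hC' j
    obtain ⟨R, hR⟩ := (hg.bdd c).bdd C hC hC' j
    refine ⟨|R|, abs_nonneg R, fun m m' z hz => ?_⟩
    obtain ⟨b, hb⟩ := hsub c m m'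
    rw [hb, iteratedFDeriv_const_smul_apply ((((hg.bdd c).smooth b).contDiffAt
      ((isOpen_repDomain c).mem_nhds (hC hz))).of_le (natCast_le_infty j)), norm_smul,
      RCLike.norm_ofReal]
    exact mul_le_mul_of_nonneg_left ((hR b z hz).trans (le_abs_self R)) (abs_nonneg _)
  have hcont : ∀ c, ContDiffOn ℝ ∞ (localRep d c G) (repDomain d c) ∧ ∀ j : ℕ,
      ∀ z ∈ repDomain d c, Tendsto (fun m => iteratedFDeriv ℝ j (localRep d c (f m).1) z) atTop
        (𝓝 (iteratedFDeriv ℝ j (localRep d c G) z)) := by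
    intro c
    refine exists_contDiffOn_limit (isOpen_repDomain c) (fun m => (f m).2.1 c) ?_ fun z hz => hG _
    intro C hC hC' j ε hε
    obtain ⟨R, hR0, hR⟩ := hderiv c C hC hC' j
    obtain ⟨N, hN⟩ := hμ' (ε / (R + 1)) (by positivity)
    refine ⟨N, fun m hm m' hm' z hz => (hR m m' z hz).trans ?_⟩
    calc |μ (m, m')| * R ≤ ε / (R + 1) * (R + 1) :=
          mul_le_mul (hN m hm m' hm') (by linarith) hR0 (by positivity)
      _ = ε := by field_simp
  obtain ⟨K, hK, hKU, hgK⟩ := hg.supp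
  obtain ⟨K0, hK0, hKU0, hfK⟩ := (f 0).2.2.2
  have hfm : ∀ m, IsSupportedIn (K ∪ K0) (f m).1 := fun m v ⟨i, hi⟩ => by
    rw [mem_union, not_or] at hi
    obtain ⟨b, hb⟩ := h m 0
    have := hb v
    rw [hfK v ⟨i, hi.2⟩, hgK b v ⟨i, hi.1⟩] at this
    simpa using this
  have hGm : G ∈ 𝒯 ι U := by
    refine ⟨fun c => (hcont c).1, fun v i x a b c => ?_, K ∪ K0, hK.union hK0,
      union_subset hKU hKU0, fun v hv => ?_⟩
    · refine tendsto_nhds_unique (hG _) (((hG _).add ((hG _).const_smul c)).congr fun m => ?_)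
      exact ((f m).2.2.1 v i x a b c).symm
    · exact tendsto_nhds_unique (hG v) (tendsto_const_nhds.congr fun m => (hfm m v hv).symm)
  choose R hR0 hR using hderiv
  refine ⟨⟨G, hGm⟩, {s | IsSupportedIn K s.1 ∧ ∀ c C hC hC' (j : ℕ), ∀ z ∈ C,
    ‖iteratedFDeriv ℝ j (localRep d c s.1) z‖ ≤ R c C hC hC' j}, ⟨⟨K, hK, hKU, fun s hs => hs.1⟩,
    fun c C hC hC' j => ⟨R c C hC' hC j, fun s hs => hs.2 c C hC' hC j⟩⟩, fun ε hε => ?_⟩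
  obtain ⟨N, hN⟩ := hμ' ε hε
  have hε' : (ε : 𝕜) ≠ 0 := RCLike.ofReal_ne_zero.2 hε.ne'
  refine ⟨N, fun m hm => ⟨(ε : 𝕜)⁻¹ • (f m - ⟨G, hGm⟩), ⟨fun v hv => ?_, ?_⟩,
    (smul_inv_smul₀ hε' _).symm⟩⟩
  · have h0 : (f m).1 v - G v = 0 := by
      refine tendsto_nhds_unique (tendsto_const_nhds.sub (hG v))
        ((tendsto_const_nhds (x := (0 : 𝕜))).congr fun m' => ?_)
      obtain ⟨b, hb⟩ := h m m'
      rw [hb, hgK b v hv, mul_zero]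
    change (ε : 𝕜)⁻¹ * ((f m).1 v - G v) = 0
    rw [h0, mul_zero]
  · intro c C hC hC' j z hz
    have hn := (isOpen_repDomain c).mem_nhds (hC hz)
    have h1 : ∀ m, ContDiffAt ℝ j (localRep d c (f m).1) z := fun m =>
      (((f m).2.1 c).contDiffAt hn).of_le (natCast_le_infty j)
    have h2 : ContDiffAt ℝ j (localRep d c G) z := ((hcont c).1.contDiffAt hn).of_le
      (natCast_le_infty j)
    have e1 : localRep d c ((ε : 𝕜)⁻¹ • (f m - ⟨G, hGm⟩) : 𝒯 ι U).1 =
        (ε : 𝕜)⁻¹ • (localRep d c (f m).1 - localRep d c G) := rfl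
    rw [e1, iteratedFDeriv_const_smul_apply (f := localRep d c (f m).1 - localRep d c G) ((h1 m).sub h2), norm_smul, norm_inv,
      RCLike.norm_ofReal, abs_of_pos hε, inv_mul_le_iff₀ hε, iteratedFDeriv_sub_apply (h1 m) h2]
    refine le_of_tendsto ((tendsto_const_nhds.sub ((hcont c).2 j z (hC hz))).norm) ?_
    filter_upwards [eventually_ge_atTop N] with m' hm'
    rw [← iteratedFDeriv_sub_apply (h1 m) (h1 m')]
    exact (hR c C hC hC' j m m' z hz).trans
      (mul_le_mul_of_nonneg_right (hN m hm m' hm') (hR0 _ _ _ _ _))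

namespace PV

/-- The norm of a derivative of an alternated component in a chart. -/
def derivSeminorm (n : ℕ) (c : Fin n ⊕ Fin k → 𝕏) (j : ℕ) (z : repDomain d c) :
    Seminorm 𝕜 (𝒱 k U) :=
  Seminorm.of (fun x => ‖iteratedFDeriv ℝ j (localRep d c (alt n x).1) z‖)
    (fun x y => by
      have h : ∀ x : 𝒱 k U, ContDiffAt ℝ j (localRep d c (alt n x).1) z := fun x =>
        (((alt n x).2.1 c).contDiffAt ((isOpen_repDomain c).mem_nhds z.2)).of_le
          (natCast_le_infty j)
      have e : localRep d c (alt n (x + y)).1 =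
          localRep d c (alt n x).1 + localRep d c (alt n y).1 := by rw [map_add]; rfl
      rw [e, iteratedFDeriv_add_apply (h x) (h y)]
      exact norm_add_le _ _)
    (fun r x => by
      have h : ContDiffAt ℝ j (localRep d c (alt n x).1) z :=
        (((alt n x).2.1 c).contDiffAt ((isOpen_repDomain c).mem_nhds z.2)).of_le
          (natCast_le_infty j)
      have e : localRep d c (alt n (r • x)).1 = r • localRep d c (alt n x).1 := by
        rw [map_smul]; rfl
      rw [e, iteratedFDeriv_const_smul_apply h, norm_smul])

lemma derivSeminorm_apply (n : ℕ) (c : Fin n ⊕ Fin k → 𝕏) (j : ℕ)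
    (z : repDomain d c) (x : 𝒱 k U) :
    derivSeminorm n c j z x = ‖iteratedFDeriv ℝ j (localRep d c (alt n x).1) z‖ := rfl

lemma exists_deriv_bound {S : Set (𝒱 k U)} (hS : Bornology.IsVonNBounded 𝕜 S) (n : ℕ)
    (c : Fin n ⊕ Fin k → 𝕏) {C : Set (Fin n ⊕ Fin k → 𝔼 × F)}
    (hC : C ⊆ repDomain d c) (hC' : IsCompact C) (j : ℕ) :
    ∃ R : ℝ, ∀ x ∈ S, ∀ z ∈ C, ‖iteratedFDeriv ℝ j (localRep d c (alt n x).1) z‖ ≤ R := by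
  let p : C → Seminorm 𝕜 (𝒱 k U) := fun z => derivSeminorm n c j ⟨z, hC z.2⟩
  have hp : ∀ x, BddAbove (range fun z => p z x) := fun x => by
    obtain ⟨R, hR⟩ := ((IsTTFam.of_mem (α := Unit) (alt n x).2).bdd c).bdd C hC hC' j
    exact ⟨R, by rintro _ ⟨z, rfl⟩; exact hR () z z.2⟩
  have hp' : BddAbove (range p) := Seminorm.bddAbove_range_iff.2 hp
  have hc : IsLFSeminorm d 𝕜 F E k U (⨆ z, p z) := by
    intro m T hT
    have : ∃ R : ℝ, 0 ≤ R ∧ ∀ f ∈ T, ∀ z : C, p z (mk f) ≤ R := by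
      rcases eq_or_ne n m with rfl | h
      · obtain ⟨R, hR⟩ := ((bddFamily_alt hT).bdd c).bdd C hC hC' j
        exact ⟨|R|, abs_nonneg R, fun f hf z => (hR ⟨f, hf⟩ z z.2).trans (le_abs_self R)⟩
      · refine ⟨0, le_rfl, fun f hf z => le_of_eq ?_⟩
        change ‖iteratedFDeriv ℝ j (localRep d c (alt n (mk f)).1) z‖ = 0
        rw [alt_mk_of_ne h]
        have : localRep d c (0 : 𝒯 (Fin n ⊕ Fin k) U).1 = fun _ => 0 := rfl
        rw [this, iteratedFDeriv_fun_zero]; simp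
    obtain ⟨R, hR0, hR⟩ := this
    refine ⟨R, fun f hf => ?_⟩
    rw [Seminorm.iSup_apply hp']
    exact Real.iSup_le (hR f hf) hR0
  obtain ⟨R, hR⟩ := PolynormableSpace.isVonNBounded_iff.1 hS _ ((continuous_seminorm_iff _).2 hc)
  exact ⟨R, fun x hx z hz => (le_ciSup hp' ⟨z, hz⟩ x).trans (hR x hx)⟩

variable (d) in
include d in
lemma exists_exhaustion (U : Opens M) :
    ∃ K : ℕ → Set M, (∀ m, IsCompact (K m) ∧ K m ⊆ U) ∧
    ∀ C : Set M, IsCompact C → C ⊆ U → ∃ N, ∀ m ≥ N, C ⊆ K m := by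
  have : LocallyCompactSpace M := ChartedSpace.locallyCompactSpace 𝔼 M
  have : LocallyCompactSpace U := U.isOpen.locallyCompactSpace
  let X : CompactExhaustion U := default
  refine ⟨fun m => Subtype.val '' X m, fun m => ⟨(X.isCompact m).image continuous_subtype_val, ?_⟩,
    fun C hC hCU => ?_⟩
  · rintro _ ⟨x, -, rfl⟩; exact x.2
  · have : IsCompact (Subtype.val ⁻¹' C : Set U) :=
      Topology.IsInducing.subtypeVal.isCompact_preimage' hC (by
        rw [Subtype.range_coe]; exact hCU)
    obtain ⟨N, hN⟩ := X.exists_superset_of_isCompact this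
    exact ⟨N, fun m hm x hx => ⟨⟨x, hCU hx⟩, X.subset hm (hN hx), rfl⟩⟩

lemma exists_common_support {S : Set (𝒱 k U)} (hS : Bornology.IsVonNBounded 𝕜 S) (n : ℕ) :
    ∃ K : Set M, IsCompact K ∧ K ⊆ U ∧ ∀ x ∈ S, IsSupportedIn K (alt n x).1 := by
  obtain ⟨K, hK, hKU⟩ := exists_exhaustion d U
  by_contra! hcon
  have h : ∀ m, ∃ (v : Fin n ⊕ Fin k → 𝕏), (∃ i, (v i).proj ∉ K m) ∧
      ∃ x ∈ S, (alt n x).1 v ≠ 0 := fun m => by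
    obtain ⟨x, hx, h⟩ := hcon (K m) (hK m).1 (hK m).2
    rw [IsSupportedIn] at h
    push Not at h
    obtain ⟨v, hv, h0⟩ := h
    exact ⟨v, hv, x, hx, h0⟩
  choose v hv hS0 using h
  obtain ⟨N, hN⟩ := eventually_zero hS (fun m => evalSeminorm n (v m))
    (fun m => isLFSeminorm_eval n (v m)) fun n' T hT => by
      rcases eq_or_ne n n' with rfl | h
      · obtain ⟨C, hC, hCU, hT'⟩ := (bddFamily_alt hT).supp
        obtain ⟨N, hN⟩ := hKU C hC hCU
        refine ⟨N, fun m hm f hf => ?_⟩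
        obtain ⟨i, hi⟩ := hv m
        rw [evalSeminorm_apply, hT' ⟨f, hf⟩ _ ⟨i, fun h => hi (hN m hm h)⟩, norm_zero]
      · exact ⟨0, fun m _ f hf => by rw [evalSeminorm_apply, alt_mk_of_ne h]; simp⟩
  obtain ⟨x, hx, h0⟩ := hS0 N
  have := hN N le_rfl x hx
  rw [evalSeminorm_apply] at this
  exact h0 (norm_eq_zero.1 this)

lemma isTTFam_alt {S : Set (𝒱 k U)} (hS : Bornology.IsVonNBounded 𝕜 S) (n : ℕ) :
    IsTTFam d U fun x : S => (alt n x.1).1 where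
  linear x := (alt n x.1).2.2.1
  supp := by
    obtain ⟨K, hK, hKU, h⟩ := exists_common_support hS n
    exact ⟨K, hK, hKU, fun x => h x x.2⟩
  bdd c := ⟨fun x => (alt n x.1).2.1 c, fun C hC hC' j => by
    obtain ⟨R, hR⟩ := exists_deriv_bound hS n c hC hC' j
    exact ⟨R, fun x => hR x x.2⟩⟩

lemma isBddFamily_alt {S : Set (𝒱 k U)} (hS : Bornology.IsVonNBounded 𝕜 S) (n : ℕ) :
    IsBddFamily (alt n '' S) :=
  (isTTFam_alt hS n).isBddFamily (by rintro _ ⟨x, hx, rfl⟩; exact ⟨⟨x, hx⟩, rfl⟩)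

variable (d 𝕜 F E k U) in
lemma isConvenient [FiniteDimensional ℝ F] : IsConvenient 𝕜 (𝒱 k U) where
  locallyConvex := inferInstance
  hausdorff := PolynormableSpace.t2Space (𝕜 := 𝕜) fun x hx => by
    obtain ⟨n, v, hv⟩ : ∃ n v, (alt n x).1 v ≠ 0 := by
      by_contra! h
      exact hx (ext_alt fun n => by rw [map_zero]; exact Subtype.ext (funext (h n)))
    exact ⟨evalSeminorm n v, (continuous_seminorm_iff _).2 (isLFSeminorm_eval n v),
      norm_ne_zero_iff.2 hv⟩
  complete x hx := by
    obtain ⟨B, hB, μ, hμ, h⟩ := hx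
    obtain ⟨N1, hN1⟩ := exists_alt_bound hB
    obtain ⟨N2, hN2⟩ := exists_bound (x 0)
    have hN : ∀ m n, max N1 N2 ≤ n → alt n (x m) = 0 := fun m n hn => by
      obtain ⟨b, hb, e⟩ := h m 0
      rw [sub_eq_iff_eq_add] at e
      rw [e, map_add, map_smul, hN1 n ((le_max_left _ _).trans hn) b hb,
        hN2 n ((le_max_right _ _).trans hn), smul_zero, add_zero]
    have key : ∀ n, ∃ (G : 𝒯 (Fin n ⊕ Fin k) U)
        (S : Set (𝒯 (Fin n ⊕ Fin k) U)), IsBddFamily S ∧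
        ∀ ε : ℝ, 0 < ε → ∃ N, ∀ m ≥ N, ∃ s ∈ S, alt n (x m) - G = (ε : 𝕜) • s := fun n =>
      exists_limit_testTensors (isTTFam_alt hB n) hμ fun m m' => by
        obtain ⟨b, hb, e⟩ := h m m'
        refine ⟨⟨b, hb⟩, fun v => ?_⟩
        have := congrArg (fun y => (alt n y).1 v) e
        simp only [map_sub, map_smul] at this
        exact this
    choose G S hS hG using key
    refine ⟨∑ n ∈ Finset.range (max N1 N2), ((n.factorial * k.factorial : ℕ) : 𝕜)⁻¹ • mk (G n), ?_⟩
    refine (PolynormableSpace.tendsto_iff (𝕜 := 𝕜)).2 fun p hp ε hε => ?_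
    choose R hR using fun n => (continuous_seminorm_iff p).1 hp n (S n) (hS n)
    set D : ℝ := ∑ n ∈ Finset.range (max N1 N2), |R n| with hD
    have hD0 : 0 ≤ D := Finset.sum_nonneg fun _ _ => abs_nonneg _
    have hδ : 0 < ε / (D + 1) := by positivity
    choose L hL using fun n => hG n _ hδ
    filter_upwards [eventually_ge_atTop ((Finset.range (max N1 N2)).sup L)] with m hm
    rw [← sum_mk (hN m), ← Finset.sum_sub_distrib]
    refine (Seminorm.map_sum_le_sum _ _ _).trans_lt ?_
    calc _ ≤ ∑ n ∈ Finset.range (max N1 N2), ε / (D + 1) * |R n| := Finset.sum_le_sum fun n hn => by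
          obtain ⟨s, hs, e⟩ := hL n m ((Finset.le_sup hn).trans hm)
          rw [← smul_sub, ← map_sub, e, map_smul_eq_mul, LinearMap.map_smul, map_smul_eq_mul,
            RCLike.norm_ofReal, abs_of_pos hδ, norm_inv]
          have h1 : ‖((n.factorial * k.factorial : ℕ) : 𝕜)‖⁻¹ ≤ 1 := by
            rw [RCLike.norm_natCast]
            exact inv_le_one_of_one_le₀ (by exact_mod_cast Nat.mul_pos n.factorial_pos k.factorial_pos)
          refine (mul_le_of_le_one_left (by positivity) h1).trans ?_
          gcongr
          exact (hR n s hs).trans (le_abs_self _)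
      _ = ε / (D + 1) * D := by rw [← Finset.mul_sum]
      _ < ε / (D + 1) * (D + 1) := by gcongr; linarith
      _ = ε := by field_simp

lemma isBddLinear_iff {B : Type*} [AddCommGroup B] [Module 𝕜 B] [TopologicalSpace B]
    [PolynormableSpace 𝕜 B] {f : 𝒱 k U →ₗ[𝕜] B} : IsBddLinear f ↔
      ∀ n (S : Set (𝒯 (Fin n ⊕ Fin k) U)), IsBddFamily S →
        Bornology.IsVonNBounded 𝕜 ((fun t => f (mk t)) '' S) := by
  refine ⟨fun h n S hS => ?_, fun h => isBddLinear_of_continuous (continuous_of_bdd h)⟩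
  have := h _ (isVonNBounded_mk hS)
  rwa [image_image] at this

lemma continuous_of_isBddLinear {B : Type*} [AddCommGroup B] [Module 𝕜 B] [TopologicalSpace B]
    [PolynormableSpace 𝕜 B] {f : 𝒱 k U →ₗ[𝕜] B} (h : IsBddLinear f) : Continuous f :=
  continuous_of_bdd (isBddLinear_iff.1 h)

end PV

/-! ## The graded spaces of polyvector fields as word functions -/

variable (d) in
/-- Bounded families of word functions which represent polyvector fields. -/
structure IsGoodFam (U : Opens M)
    (G : α → 𝒲) : Prop where
  bound : ∃ N, ∀ a n k, N ≤ n ∨ N ≤ k → wcomp n k (G a) = 0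
  fam : ∀ n k, IsTTFam d U fun a => wcomp n k (G a)
  alt : ∀ a n k (v : Fin n ⊕ Fin k → 𝕏) (σ : Equiv.Perm (Fin n))
    (τ : Equiv.Perm (Fin k)),
    wcomp n k (G a) (v ∘ Sum.map σ τ) = ((Equiv.Perm.sign τ : ℤ) : 𝕜) * wcomp n k (G a) v

namespace IsGoodFam

variable {G H : α → WordFun (TotalSpace F E) 𝕜}

lemma reindex (hG : IsGoodFam d U G) (φ : β → α) : IsGoodFam d U fun b => G (φ b) where
  bound := by
    obtain ⟨N, hN⟩ := hG.bound
    exact ⟨N, fun b => hN _⟩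
  fam n k := (hG.fam n k).reindex φ
  alt b := hG.alt _

lemma mono (hG : IsGoodFam d U G) (hUV : U ≤ V) : IsGoodFam d V G :=
  ⟨hG.bound, fun n k => (hG.fam n k).mono hUV, hG.alt⟩

lemma word {f : α → (Fin n ⊕ Fin k → 𝕏) → 𝕜} (hf : IsTTFam d U f) :
    IsGoodFam d U fun a => WordFun.word n k (f a) where
  bound := ⟨max n k + 1, fun a m l h => wcomp_word_of_ne (by
    have := le_max_left n k
    have := le_max_right n k
    omega) _⟩
  fam m l := by
    by_cases h : m = n ∧ l = k
    · obtain ⟨rfl, rfl⟩ := h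
      simp only [wcomp_word]
      exact hf.altFun
    · simp only [wcomp_word_of_ne h]
      exact IsTTFam.zero
  alt a m l v σ τ := by
    by_cases h : m = n ∧ l = k
    · obtain ⟨rfl, rfl⟩ := h
      rw [wcomp_word, altFun_comp]
    · simp [wcomp_word_of_ne h]

lemma add (hG : IsGoodFam d U G) (hH : IsGoodFam d U H) : IsGoodFam d U fun a => G a + H a where
  bound := by
    obtain ⟨N, hN⟩ := hG.bound
    obtain ⟨N', hN'⟩ := hH.bound
    refine ⟨max N N', fun a n k h => ?_⟩
    have h1 : wcomp n k (G a + H a) = wcomp n k (G a) + wcomp n k (H a) := rfl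
    rw [h1, hN a n k (h.imp (le_max_left _ _).trans (le_max_left _ _).trans),
      hN' a n k (h.imp (le_max_right _ _).trans (le_max_right _ _).trans), add_zero]
  fam n k := (hG.fam n k).add (hH.fam n k)
  alt a n k v σ τ := by
    have h1 : wcomp n k (G a + H a) = wcomp n k (G a) + wcomp n k (H a) := rfl
    rw [h1, Pi.add_apply, Pi.add_apply, hG.alt, hH.alt, mul_add]

lemma const_smul (hG : IsGoodFam d U G) (c : 𝕜) : IsGoodFam d U fun a => c • G a where
  bound := by
    obtain ⟨N, hN⟩ := hG.bound
    refine ⟨N, fun a n k h => ?_⟩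
    have h1 : wcomp n k (c • G a) = c • wcomp n k (G a) := rfl
    rw [h1, hN a n k h, smul_zero]
  fam n k := (hG.fam n k).const_smul c
  alt a n k v σ τ := by
    have h1 : wcomp n k (c • G a) = c • wcomp n k (G a) := rfl
    rw [h1, Pi.smul_apply, Pi.smul_apply, hG.alt, smul_eq_mul, smul_eq_mul, mul_left_comm]

lemma zero : IsGoodFam d U fun _ : α => (0 : 𝒲) where
  bound := ⟨0, fun _ _ _ _ => rfl⟩
  fam _ _ := IsTTFam.zero
  alt a n k v σ τ := (mul_zero _).symm

lemma sum {ι : Type*} (s : Finset ι) {G : ι → α → 𝒲}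
    (hG : ∀ i ∈ s, IsGoodFam d U (G i)) : IsGoodFam d U fun a => ∑ i ∈ s, G i a := by
  induction s using Finset.cons_induction with
  | empty => simpa using zero
  | cons i s hi ih =>
    simp only [Finset.sum_cons]
    exact (hG i (Finset.mem_cons_self _ _)).add (ih fun j hj => hG j (Finset.mem_cons_of_mem hj))

lemma neg (hG : IsGoodFam d U G) : IsGoodFam d U fun a => -G a := by
  simpa only [neg_one_smul] using hG.const_smul (-1)

lemma eq_sum (hG : IsGoodFam d U G) {N : ℕ}
    (hN : ∀ a n k, N ≤ n ∨ N ≤ k → wcomp n k (G a) = 0) (a : α) :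
    G a = ∑ k ∈ Finset.range N, ∑ n ∈ Finset.range N,
      ((n.factorial * k.factorial : ℕ) : 𝕜)⁻¹ • WordFun.word n k (wcomp n k (G a)) := by
  have hsum : ∀ (s : Finset ℕ) (f : ℕ → 𝒲) m l,
      wcomp m l (∑ i ∈ s, f i) = ∑ i ∈ s, wcomp m l (f i) := fun s f m l =>
    map_sum ({ toFun := wcomp m l, map_zero' := rfl, map_add' := fun _ _ => rfl } :
      𝒲 →+ _) f s
  have hsmul : ∀ (c : 𝕜) (f : 𝒲) m l,
      wcomp m l (c • f) = c • wcomp m l f := fun _ _ _ _ => rfl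
  refine ext_wcomp fun m l => ?_
  rw [hsum]
  simp only [hsum, hsmul]
  by_cases h : m < N ∧ l < N
  · rw [Finset.sum_eq_single_of_mem l (Finset.mem_range.2 h.2),
      Finset.sum_eq_single_of_mem m (Finset.mem_range.2 h.1), wcomp_word]
    · funext v
      rw [Pi.smul_apply, altFun_of_alternating (hG.alt a m l), smul_eq_mul,
        inv_mul_cancel_left₀ factorial_ne_zero']
    · intro n _ hn
      rw [wcomp_word_of_ne (by omega), smul_zero]
    · intro k _ hk
      exact Finset.sum_eq_zero fun n _ => by rw [wcomp_word_of_ne (by omega), smul_zero]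
  · rw [hN a m l (by omega)]
    refine (Finset.sum_eq_zero fun k hk => Finset.sum_eq_zero fun n hn => ?_).symm
    rw [Finset.mem_range] at hk hn
    have : ¬(m = n ∧ l = k) := by omega
    simp only [wcomp_word_of_ne this, smul_zero]

end IsGoodFam

lemma IsTTFam.extProd {f : α → (Fin n ⊕ Fin k → 𝕏) → 𝕜}
    {f' : α → (Fin n' ⊕ Fin k' → 𝕏) → 𝕜} (hf : IsTTFam d U f)
    (hf' : IsTTFam d U f') : IsTTFam d U fun a => WordFun.extProd (f a) (f' a) := by
  have := (hf.mul hf').comp ((Equiv.sumSumSumComm (Fin n) (Fin k) (Fin n') (Fin k')).trans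
    (Equiv.sumCongr finSumFinEquiv finSumFinEquiv))
  convert this using 3 with a v
  rw [WordFun.extProd]
  congr 2 <;>
  · funext i
    rcases i with i | i <;> simp

lemma IsGoodFam.mul {G H : α → 𝒲} (hG : IsGoodFam d U G)
    (hH : IsGoodFam d U H) : IsGoodFam d U fun a => G a * H a := by
  obtain ⟨N, hN⟩ := hG.bound
  obtain ⟨N', hN'⟩ := hH.bound
  have e : ∀ a, G a * H a = _ := fun a =>
    congrArg₂ (· * ·) (hG.eq_sum hN a) (hH.eq_sum hN' a)
  simp only [Finset.sum_mul, Finset.mul_sum, smul_mul_assoc, mul_smul_comm, word_mul_word,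
    Finset.smul_sum] at e
  simp only [e]
  exact IsGoodFam.sum _ fun _ _ => IsGoodFam.sum _ fun _ _ => IsGoodFam.sum _ fun _ _ =>
    IsGoodFam.sum _ fun _ _ => ((IsGoodFam.word ((hG.fam _ _).extProd
      (hH.fam _ _))).const_smul _).const_smul _

lemma IsGoodFam.par {G : α → 𝒲} (hG : IsGoodFam d U G) :
    IsGoodFam d U fun a => WordFun.par (G a) := by
  have h1 : ∀ n k (G : 𝒲),
      wcomp n k (WordFun.par G) = (-1 : 𝕜) ^ k • wcomp n k G := fun n k G => by
    funext v
    simp [wcomp, par_apply]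
  refine ⟨?_, fun n k => ?_, fun a n k v σ τ => ?_⟩
  · obtain ⟨N, hN⟩ := hG.bound
    exact ⟨N, fun a n k h => by rw [h1, hN a n k h, smul_zero]⟩
  · simp only [h1]
    exact (hG.fam n k).const_smul _
  · rw [h1, Pi.smul_apply, Pi.smul_apply, hG.alt, smul_eq_mul, smul_eq_mul, mul_left_comm]

lemma IsGoodFam.one : IsGoodFam d U fun _ : α => (1 : 𝒲) := by
  have : IsTTFam d U fun (_ : α) (_ : Fin 0 ⊕ Fin 0 → 𝕏) => (1 : 𝕜) := by
    refine IsTTFam.of_mem ⟨fun c => contDiffOn_const, fun v i => isEmptyElim i, ∅, isCompact_empty,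
      empty_subset _, fun v ⟨i, hi⟩ => isEmptyElim i⟩
  have h := IsGoodFam.word this
  have e : (1 : 𝒲) = WordFun.word 0 0 fun _ => 1 := by
    have := word_prodFun (n := 0) (k := 0) (K := 𝕜) (X := 𝕏) isEmptyElim isEmptyElim
    rw [gens, List.ofFn_zero, List.ofFn_zero, List.prod_nil, one_mul] at this
    rw [← this]
    congr 1
    funext v
    simp [prodFun]
  simpa only [← e] using h

variable (d 𝕜 F E) in
/-- The total space `⨁ₖ PV^{-k}(U)`. -/
abbrev Tot (U : Opens M) : Type _ := LCSum 𝕜 fun k => 𝒱 k U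

local notation "𝒮" => Tot d 𝕜 F E

namespace Tot

/-- The class of a test tensor. -/
def mk : 𝒯 (Fin n ⊕ Fin k) U →ₗ[𝕜] 𝒮 U :=
  (LCSum.lof k).comp PV.mk

/-- Polyvector fields as word functions. -/
def J (U : Opens M) : 𝒮 U →ₗ[𝕜] 𝒲 where
  toFun x := ofComp fun n k => (PV.alt n (LCSum.comp k x)).1
  map_add' x y := WordFun.ext fun v w => by simp [ofComp]
  map_smul' c x := WordFun.ext fun v w => by simp [ofComp]

lemma wcomp_J (x : 𝒮 U) (n k : ℕ) :
    wcomp n k (J U x) = (PV.alt n (LCSum.comp k x)).1 :=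
  wcomp_ofComp (X := 𝕏) (K := 𝕜) fun n k =>
    (PV.alt n (LCSum.comp (𝕜 := 𝕜) (V := 𝒱ₛ U) k x)).1

lemma J_injective : Function.Injective (J (d := d) (𝕜 := 𝕜) (F := F) (E := E) U) := fun x y h =>
  LCSum.ext fun k => PV.ext_alt fun n => Subtype.ext (by rw [← wcomp_J, ← wcomp_J, h])

lemma J_mk (f : 𝒯 (Fin n ⊕ Fin k) U) : J U (mk f) = word n k f.1 := by
  refine ext_wcomp fun m l => ?_
  rw [wcomp_J, mk, LinearMap.comp_apply]
  by_cases hl : l = k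
  · subst hl
    rw [LCSum.comp_lof_same]
    by_cases hm : m = n
    · subst hm
      rw [PV.alt_mk, wcomp_word]; rfl
    · rw [PV.alt_mk_of_ne hm, wcomp_word_of_ne (by tauto)]; rfl
  · rw [LCSum.comp_lof_of_ne hl, map_zero, wcomp_word_of_ne (by tauto)]; rfl

lemma mem_deg_iff (j : ℤ) (x : 𝒮 U) :
    x ∈ LCSum.deg 𝕜 𝒱ₛ U j ↔ HasDeg j (J U x) := by
  rw [LCSum.mem_deg]
  constructor
  · intro h v w hw
    refine (apply_eq_wcomp _ v w).trans ?_
    rw [wcomp_J, h _ hw, map_zero]; rfl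
  · intro h k hk
    refine PV.ext_alt fun n => Subtype.ext ?_
    rw [← wcomp_J, map_zero]
    funext v
    exact h _ _ (by simpa using hk)

lemma isConvenient (U : Opens M) : IsConvenient 𝕜 (𝒮 U) :=
  LCSum.isConvenient fun k => PV.isConvenient d 𝕜 F E k U

lemma isGoodFam {S : Set (𝒮 U)} (hS : Bornology.IsVonNBounded 𝕜 S) :
    IsGoodFam d U fun x : S => J U x.1 := by
  have := fun k => (PV.isConvenient d 𝕜 F E k U).hausdorff
  obtain ⟨⟨N, hN⟩, hS'⟩ := LCSum.isVonNBounded_iff.1 hS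
  choose L hL using fun k => PV.exists_alt_bound (hS' k)
  refine ⟨⟨max N ((Finset.range N).sup L), fun a n k h => ?_⟩, fun n k => ?_,
    fun a n k v σ τ => ?_⟩
  · rw [wcomp_J]
    by_cases hk : N ≤ k
    · rw [hN a a.2 k hk, map_zero]; rfl
    · have hk' : k ∈ Finset.range N := Finset.mem_range.2 (not_le.1 hk)
      have h1 := le_max_left N ((Finset.range N).sup L)
      have h2 := le_max_right N ((Finset.range N).sup L)
      have h3 := Finset.le_sup (f := L) hk'
      rw [hL k n (by omega) _ (mem_image_of_mem _ a.2)]; rfl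
  · simp only [wcomp_J]
    exact (PV.isTTFam_alt (hS' k) n).reindex fun a : S =>
      ⟨LCSum.comp k a.1, mem_image_of_mem _ a.2⟩
  · rw [wcomp_J]
    obtain ⟨y, hy⟩ := Submodule.mkQ_surjective _
      (LCSum.comp (𝕜 := 𝕜) (V := fun n => Coinvariants d 𝕜 F E n k U) n (LCSum.comp k a.1))
    have : PV.alt n (LCSum.comp k a.1) = altLin d 𝕜 F E n k U y :=
      (congrArg (Coinvariants.alt n k U) hy).symm
    rw [this]
    exact altFun_comp _ _ _ _

lemma exists_lift {G : α → 𝒲} (hG : IsGoodFam d U G) :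
    ∃ x : α → 𝒮 U, (∀ a, J U (x a) = G a) ∧ Bornology.IsVonNBounded 𝕜 (range x) := by
  obtain ⟨N, hN⟩ := hG.bound
  refine ⟨fun a => ∑ k ∈ Finset.range N, ∑ n ∈ Finset.range N,
      ((n.factorial * k.factorial : ℕ) : 𝕜)⁻¹ • mk ⟨wcomp n k (G a), (hG.fam n k).mem a⟩,
    fun a => ?_, PolynormableSpace.isVonNBounded_iff.2 fun p hp => ?_⟩
  · simp only [map_sum, map_smul, J_mk]
    exact (hG.eq_sum hN a).symm
  · have h1 : ∀ n k, ∃ R : ℝ, ∀ a, p (mk ⟨wcomp n k (G a), (hG.fam n k).mem a⟩) ≤ R := fun n k => by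
      have h2 := PV.isVonNBounded_mk ((hG.fam n k).isBddFamily
        (S := range fun a => ⟨wcomp n k (G a), (hG.fam n k).mem a⟩)
        (by rintro _ ⟨a, rfl⟩; exact ⟨a, rfl⟩))
      obtain ⟨R, hR⟩ := PolynormableSpace.isVonNBounded_iff.1
        (isBddLinear_of_continuous (LCSum.continuous_lof (V := 𝒱ₛ U) k) _ h2) p hp
      exact ⟨R, fun a => hR _ (mem_image_of_mem _ (mem_image_of_mem _ (mem_range_self a)))⟩
    choose R hR using h1
    refine ⟨∑ k ∈ Finset.range N, ∑ n ∈ Finset.range N,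
      ‖((n.factorial * k.factorial : ℕ) : 𝕜)⁻¹‖ * R n k, ?_⟩
    rintro _ ⟨a, rfl⟩
    refine (Seminorm.map_sum_le_sum _ _ _).trans (Finset.sum_le_sum fun k _ =>
      (Seminorm.map_sum_le_sum _ _ _).trans (Finset.sum_le_sum fun n _ => ?_))
    rw [map_smul_eq_mul]
    exact mul_le_mul_of_nonneg_left (hR n k a) (norm_nonneg _)

lemma bounded_of_good {x : α → 𝒮 U} (h : IsGoodFam d U fun a => J U (x a)) :
    Bornology.IsVonNBounded 𝕜 (range x) := by
  obtain ⟨y, hy, hb⟩ := exists_lift h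
  have : x = y := funext fun a => J_injective (hy a).symm
  rwa [this]

lemma good (x : 𝒮 U) : IsGoodFam d U fun _ : α => J U x := by
  have := (PolynormableSpace.withSeminorms 𝕜 (𝒮 U)).continuousSMul
  exact (isGoodFam (Bornology.isVonNBounded_singleton (𝕜 := 𝕜) x)).reindex fun _ => ⟨x, rfl⟩

lemma exists_of_good {G : 𝒲} (hG : IsGoodFam d U fun _ : Unit => G) :
    ∃ x : 𝒮 U, J U x = G := by
  obtain ⟨x, hx, -⟩ := exists_lift hG
  exact ⟨x (), hx ()⟩

/-- The polyvector field represented by a word function. -/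
def ofFun (G : 𝒲) (hG : IsGoodFam d U fun _ : Unit => G) :
    𝒮 U := (exists_of_good hG).choose

lemma J_ofFun {G : 𝒲} (hG : IsGoodFam d U fun _ : Unit => G) :
    J U (ofFun G hG) = G := (exists_of_good hG).choose_spec

variable {A : Type*} [AddCommGroup A] [Module 𝕜 A] (f : A →ₗ[𝕜] WordFun (TotalSpace F E) 𝕜)
  (hf : ∀ x, IsGoodFam d U fun _ : Unit => f x)

/-- A linear map into word functions that takes values in polyvector fields. -/
def lift : A →ₗ[𝕜] 𝒮 U where
  toFun x := ofFun (f x) (hf x)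
  map_add' x y := J_injective <| (J_ofFun _).trans <| (map_add f x y).trans <|
    ((map_add (J U) _ _).trans (congrArg₂ (· + ·) (J_ofFun _) (J_ofFun _))).symm
  map_smul' c x := J_injective <| (J_ofFun _).trans <| (map_smul f c x).trans <|
    ((map_smul (J U) _ _).trans (congrArg (c • ·) (J_ofFun _))).symm

lemma J_lift (x : A) : J U (lift f hf x) = f x := J_ofFun (hf x)

lemma isBddLinear_lift [TopologicalSpace A] (h : ∀ S : Set A, Bornology.IsVonNBounded 𝕜 S →
    IsGoodFam d U fun x : S => f x) : IsBddLinear (lift f hf) := fun S hS => by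
  have h1 : IsGoodFam d U fun x : S => J U (lift f hf x) := by
    simp only [J_lift]; exact h S hS
  have := bounded_of_good h1
  rwa [← image_eq_range] at this

/-- Extension by zero. -/
def ext (hUV : U ≤ V) : 𝒮 U →ₗ[𝕜] 𝒮 V :=
  lift (J U) fun x => (good x).mono hUV

lemma J_ext (hUV : U ≤ V) (x : 𝒮 U) : J V (ext hUV x) = J U x := J_lift _ _ _

lemma isBddLinear_ext (hUV : U ≤ V) :
    IsBddLinear (ext (d := d) (𝕜 := 𝕜) (F := F) (E := E) hUV) :=
  isBddLinear_lift _ _ fun _ hS => (isGoodFam hS).mono hUV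

/-- The product. -/
def mul (U : Opens M) : 𝒮 U →ₗ[𝕜] 𝒮 U →ₗ[𝕜] 𝒮 U :=
  LinearMap.mk₂ 𝕜 (fun x y => ofFun (J U x * J U y) ((good x).mul (good y)))
    (fun x x' y => J_injective <| (J_ofFun _).trans <| ((congrArg (· * J U y) (map_add (J U) x x')).trans
      (add_mul _ _ _)).trans
      ((map_add (J U) _ _).trans (congrArg₂ (· + ·) (J_ofFun _) (J_ofFun _))).symm)
    (fun c x y => J_injective <| (J_ofFun _).trans <| ((congrArg (· * J U y) (map_smul (J U) c x)).trans
      (smul_mul_assoc _ _ _)).trans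
      ((map_smul (J U) _ _).trans (congrArg (c • ·) (J_ofFun _))).symm)
    (fun x y y' => J_injective <| (J_ofFun _).trans <| ((congrArg (J U x * ·) (map_add (J U) y y')).trans
      (mul_add _ _ _)).trans
      ((map_add (J U) _ _).trans (congrArg₂ (· + ·) (J_ofFun _) (J_ofFun _))).symm)
    (fun c x y => J_injective <| (J_ofFun _).trans <| ((congrArg (J U x * ·) (map_smul (J U) c y)).trans
      (mul_smul_comm _ _ _)).trans
      ((map_smul (J U) _ _).trans (congrArg (c • ·) (J_ofFun _))).symm)

lemma J_mul (x y : 𝒮 U) : J U (mul U x y) = J U x * J U y :=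
  J_ofFun ((good x).mul (good y))

lemma isBddBilinear_of_good {f : 𝒮 U →ₗ[𝕜] 𝒮 U →ₗ[𝕜] 𝒮 U}
    (B : 𝒲 → 𝒲 → 𝒲)
    (hB : ∀ {S T : Set (𝒮 U)} (G H : S × T → 𝒲),
      IsGoodFam d U G → IsGoodFam d U H → IsGoodFam d U fun a => B (G a) (H a))
    (hf : ∀ x y, J U (f x y) = B (J U x) (J U y)) : IsBddBilinear f := fun S T hS hT => by
  have h1 : IsGoodFam d U fun p : S × T => J U (f p.1.1 p.2.1) := by
    simp only [hf]
    exact hB _ _ ((isGoodFam hS).reindex Prod.fst) ((isGoodFam hT).reindex Prod.snd)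
  refine (bounded_of_good h1).subset ?_
  rintro _ ⟨x, hx, y, hy, rfl⟩
  exact ⟨(⟨x, hx⟩, ⟨y, hy⟩), rfl⟩

lemma isBddBilinear_mul (U : Opens M) :
    IsBddBilinear (mul (d := d) (𝕜 := 𝕜) (F := F) (E := E) U) :=
  isBddBilinear_of_good (· * ·) (fun _ _ hG hH => hG.mul hH) J_mul

/-- The unit. -/
def one (U : Opens M) : 𝒮 U := (exists_of_good IsGoodFam.one).choose

lemma J_one : J (d := d) (𝕜 := 𝕜) (F := F) (E := E) U (one U) = 1 :=
  (exists_of_good IsGoodFam.one).choose_spec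

end Tot

/-! ## Localisation in bundle charts -/

lemma SB.union {α Z G : Type*} [NormedAddCommGroup Z] [NormedSpace ℝ Z] [NormedAddCommGroup G]
    [NormedSpace ℝ G] {O O' : Set Z} {f : α → Z → G} (hf : SB O f) (hf' : SB O' f) (hO : IsOpen O)
    (hO' : IsOpen O') : SB (O ∪ O') f :=
  ⟨fun a => (hf.smooth a).union_of_isOpen (hf'.smooth a) hO hO', fun C hC hC' j => by
    obtain ⟨C₁, C₂, h1, h2, h1', h2', rfl⟩ := hC'.binary_compact_cover hO hO' hC
    obtain ⟨R₁, hR₁⟩ := hf.bdd C₁ h1' h1 j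
    obtain ⟨R₂, hR₂⟩ := hf'.bdd C₂ h2' h2 j
    exact ⟨max R₁ R₂, fun a z hz => hz.elim (fun h => (hR₁ a z h).trans (le_max_left _ _))
      fun h => (hR₂ a z h).trans (le_max_right _ _)⟩⟩

lemma exists_smooth_partition {κ : Type*} {K : Set M} (hK : IsCompact K) {W : κ → Set M}
    (hW : ∀ i, IsOpen (W i)) (hKW : K ⊆ ⋃ i, W i) : ∃ (t : Finset κ) (φ : κ → M → ℝ),
      (∀ i, ContMDiff (𝓡 d) 𝓘(ℝ, ℝ) ∞ (φ i)) ∧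
      (∀ i, ∃ L, IsCompact L ∧ L ⊆ W i ∧ ∀ x ∉ L, φ i x = 0) ∧ ∀ x ∈ K, ∑ i ∈ t, φ i x = 1 := by
  have := ChartedSpace.locallyCompactSpace 𝔼 M
  obtain ⟨t, ht⟩ := hK.elim_finite_subcover W hW hKW
  obtain ⟨L, hL, hKL, -⟩ := exists_compact_between hK isOpen_univ (subset_univ K)
  obtain ⟨χ, hχ, hχ', -⟩ := exists_contMDiffMap_one_nhds_of_subset_interior (𝓡 d) (n := ⊤)
    hK.isClosed hKL
  obtain ⟨ψ, hψ⟩ := SmoothPartitionOfUnity.exists_isSubordinate (𝓡 d) hK.isClosed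
    (fun i : t => W i) (fun i => hW i) (by simpa [iUnion_subtype] using ht)
  classical
  refine ⟨t, fun i x => if h : i ∈ t then ψ ⟨i, h⟩ x * χ x else 0, fun i => ?_, fun i => ?_,
    fun x hx => ?_⟩
  · by_cases h : i ∈ t
    · simp only [h, dite_true]
      exact (ψ ⟨i, h⟩).contMDiff.mul χ.contMDiff
    · simp only [h, dite_false]
      exact contMDiff_const
  · by_cases h : i ∈ t
    · refine ⟨L ∩ tsupport (ψ ⟨i, h⟩), hL.inter_right (isClosed_tsupport _),
        inter_subset_right.trans (hψ ⟨i, h⟩), fun x hx => ?_⟩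
      simp only [h, dite_true]
      by_cases hxL : x ∈ L
      · rw [image_eq_zero_of_notMem_tsupport fun h' => hx ⟨hxL, h'⟩, zero_mul]
      · rw [hχ' x hxL, mul_zero]
    · exact ⟨∅, isCompact_empty, empty_subset _, fun x _ => by simp [h]⟩
  · have h1 := ψ.sum_eq_one hx
    rw [finsum_eq_sum_of_fintype] at h1
    rw [← Finset.sum_coe_sort]
    have h2 : χ x = 1 := hχ.self_of_nhdsSet x hx
    simpa [h2] using h1

lemma exists_cutoff {K W : Set M} (hK : IsCompact K) (hW : IsOpen W) (hKW : K ⊆ W) :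
    ∃ χ : M → ℝ, ContMDiff (𝓡 d) 𝓘(ℝ, ℝ) ∞ χ ∧
      (∃ L, IsCompact L ∧ L ⊆ W ∧ ∀ x ∉ L, χ x = 0) ∧ ∀ x ∈ K, χ x = 1 := by
  obtain ⟨t, φ, h1, h2, h3⟩ := exists_smooth_partition (d := d) (κ := Unit) hK (fun _ => hW)
    (hKW.trans (subset_iUnion (fun _ : Unit => W) ()))
  obtain ⟨L, hL, hLW, h4⟩ := h2 ()
  exact ⟨fun x => ∑ i ∈ t, φ i x, contMDiff_finsetSum fun i _ => h1 i,
    ⟨L, hL, hLW, fun x hx => Finset.sum_eq_zero fun i _ => h4 x hx⟩, h3⟩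

variable (F E) in
/-- The bundle chart at a point of the base. -/
def bundleChart (p : M) : PartialEquiv 𝕏 (𝔼 × F) :=
  𝔟 (⟨p, 0⟩ : 𝕏)

local notation "𝔲" => bundleChart (d := d) F E

variable (d F E) in
/-- The domain of the bundle chart in the base. -/
def chartDom (p : M) : Set M := (chartAt 𝔼 p).source ∩
  (𝔱 p).baseSet

lemma isOpen_chartDom (p : M) : IsOpen (chartDom d F E p) :=
  (chartAt _ p).open_source.inter (𝔱 p).open_baseSet

lemma mem_chartDom (p : M) : p ∈ chartDom d F E p :=
  ⟨mem_chart_source _ p, mem_baseSet_trivializationAt F E p⟩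

lemma extChartAt_eq_bundleChart (c : 𝕏) :
    𝔟 c = 𝔲 c.proj := by
  rw [bundleChart, FiberBundle.extChartAt, FiberBundle.extChartAt]

lemma mem_bundleChart_source {p : M} {v : 𝕏} :
    v ∈ (𝔲 p).source ↔ v.proj ∈ chartDom d F E p := by
  rw [bundleChart, FiberBundle.extChartAt, chartDom]
  simp only [PartialEquiv.trans_source, mem_inter_iff, mem_preimage]
  simp only [PartialEquiv.prod_source, PartialEquiv.refl_source, extChartAt_source, mem_prod,
    mem_univ, and_true]
  constructor
  · rintro ⟨h1, h2⟩
    have h1' := (𝔱 p).mem_source.1 h1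
    exact ⟨by rwa [← (𝔱 p).coe_fst' h1'], h1'⟩
  · rintro ⟨h1, h2⟩
    refine ⟨(𝔱 p).mem_source.2 h2, ?_⟩
    change (𝔱 p v).1 ∈ _
    rwa [(𝔱 p).coe_fst' h2]

lemma bundleChart_target (p : M) :
    (𝔲 p).target = 𝔇 p ×ˢ univ := by
  rw [bundleChart, FiberBundle.extChartAt_target]; rfl

lemma bundleChart_apply (p : M) (v : 𝕏) : 𝔲 p v =
    (𝔠 p (𝔱 p v).1, (𝔱 p v).2) := by
  rw [bundleChart, FiberBundle.extChartAt]; rfl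

lemma bundleChart_fst {p : M} {v : 𝕏} (hv : v.proj ∈ chartDom d F E p) :
    (𝔲 p v).1 = 𝔠 p v.proj := by
  rw [bundleChart_apply, Trivialization.coe_fst' _ hv.2]

lemma proj_bundleChart_symm {p : M} {z : 𝔼 × F}
    (hz : z.1 ∈ 𝔇 p) :
    ((𝔲 p).symm z).proj = (𝔠 p).symm z.1 := by
  rw [bundleChart, FiberBundle.extChartAt]
  exact (𝔱 p).proj_symm_apply' hz.2

lemma isOpen_localDomain (p : M) : IsOpen (𝔇 p) :=
  (continuousOn_extChartAt_symm p).isOpen_inter_preimage (isOpen_extChartAt_target p)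
    (𝔱 p).open_baseSet

lemma contDiffOn_bundleChart (p : M) (c : 𝕏) : ContDiffOn ℝ ∞
    (fun z => 𝔲 p ((𝔟 c).symm z))
    ((𝔟 c).target ∩
      {z | ((𝔟 c).symm z).proj ∈ chartDom d F E p}) := by
  rw [← contMDiffOn_iff_contDiffOn]
  refine (contMDiffOn_extChartAt (I := (𝓡 d).prod 𝓘(ℝ, F)) (x := (⟨p, 0⟩ : 𝕏))).comp
    ((contMDiffOn_extChartAt_symm c).mono inter_subset_left) fun z hz => ?_
  rw [← extChartAt_source ((𝓡 d).prod 𝓘(ℝ, F))]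
  exact mem_bundleChart_source.2 hz.2

lemma contDiffOn_base {χ : M → ℝ} (hχ : ContMDiff (𝓡 d) 𝓘(ℝ, ℝ) ∞ χ) (c : 𝕏) :
    ContDiffOn ℝ ∞ (fun z => χ ((𝔟 c).symm z).proj)
      (𝔟 c).target := by
  rw [← contMDiffOn_iff_contDiffOn]
  exact (hχ.comp (contMDiff_proj E)).comp_contMDiffOn (contMDiffOn_extChartAt_symm c)

lemma isOpen_chart_preimage (c : 𝕏) {O : Set M} (hO : IsOpen O) :
    IsOpen ((𝔟 c).target ∩
      {z | ((𝔟 c).symm z).proj ∈ O}) :=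
  (continuousOn_extChartAt_symm c).isOpen_inter_preimage (isOpen_extChartAt_target c)
    (hO.preimage (FiberBundle.continuous_proj F E))

lemma IsTTFam.of_supp {f : α → (ι → 𝕏) → 𝕜} (hf : IsTTFam d U f) {K : Set M}
    (hK : IsCompact K) (hKV : K ⊆ V) (h : ∀ a, IsSupportedIn K (f a)) : IsTTFam d V f :=
  ⟨hf.linear, ⟨K, hK, hKV, h⟩, hf.bdd⟩

lemma IsTTFam.mul_base {f : α → (ι → 𝕏) → 𝕜} (hf : IsTTFam d U f) {χ : ι → M → ℝ}
    (hχ : ∀ i, ContMDiff (𝓡 d) 𝓘(ℝ, ℝ) ∞ (χ i)) :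
    IsTTFam d U fun a v => ((∏ i, χ i (v i).proj : ℝ) : 𝕜) * f a v := by
  obtain ⟨K, hK, hKU, h⟩ := hf.supp
  refine ⟨fun a v i x y z r => ?_, ⟨K, hK, hKU, fun a v hv => by simp only [h a v hv, mul_zero]⟩,
    fun c => ?_⟩
  · have e : ∀ (y : E x), (∏ j, χ j (Function.update v i ⟨x, y⟩ j).proj) =
        ∏ j, χ j (Function.update (fun j => (v j).proj) i x j) := fun y =>
      Finset.prod_congr rfl fun j _ => by
        by_cases hj : j = i
        · subst hj; simp
        · simp [hj]
    simp only [e, hf.linear a v i x y z r, mul_add, mul_smul_comm]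
  · have h1 : ContDiffOn ℝ ∞ (fun z : ι → 𝔼 × F =>
        ((∏ i, χ i ((𝔟 (c i)).symm (z i)).proj : ℝ) : 𝕜))
        (repDomain d c) := by
      refine (RCLike.ofRealCLM (K := 𝕜)).contDiff.comp_contDiffOn (contDiffOn_prod fun i _ => ?_)
      exact (contDiffOn_base (hχ i) (c i)).comp (contDiff_apply ℝ _ i).contDiffOn
        fun z hz => hz i (mem_univ i)
    exact (SB.of_contDiffOn (isOpen_repDomain c) h1).bilin (hf.bdd c) (isOpen_repDomain c)
      (ContinuousLinearMap.mul ℝ 𝕜)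

lemma isTTFam_coordinates {φ : α → (ι × Fin d → ℝ) → 𝕜} (hφ : SB univ φ) (p : ι → M)
    (ξ : ι → F →L[ℝ] ℝ) {χ : ι → M → ℝ} (hχ : ∀ i, ContMDiff (𝓡 d) 𝓘(ℝ, ℝ) ∞ (χ i))
    {K : ι → Set M} (hK : ∀ i, IsCompact (K i)) (hKp : ∀ i, K i ⊆ chartDom d F E (p i))
    (hKU : ∀ i, K i ⊆ U) (hχK : ∀ i, ∀ x ∉ K i, χ i x = 0) :
    IsTTFam d U fun a (v : ι → 𝕏) =>
      φ a (fun j => (𝔲 (p j.1) (v j.1)).1 j.2) *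
        ((∏ i, χ i (v i).proj * ξ i (𝔲 (p i) (v i)).2 : ℝ) : 𝕜) := by
  refine ⟨fun a v i x y z r => ?_, ⟨⋃ i, K i, isCompact_iUnion hK, iUnion_subset hKU,
    fun a v ⟨i, hi⟩ => ?_⟩, fun c => ?_⟩
  · by_cases hx : x ∈ chartDom d F E (p i)
    · have e1 : ∀ y : E x, (fun j : ι × Fin d => (𝔲 (p j.1)
          (Function.update v i ⟨x, y⟩ j.1)).1 j.2) = fun j => (Function.update (fun j =>
            (𝔲 (p j) (v j)).1) i (𝔠 (p i) x) j.1) j.2 := by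
        intro y; funext j
        by_cases hj : j.1 = i
        · rw [hj, Function.update_self, Function.update_self, bundleChart_fst hx]
        · rw [Function.update_of_ne hj, Function.update_of_ne hj]
      have e2 : ∀ y : E x, (∏ j, χ j (Function.update v i ⟨x, y⟩ j).proj *
          ξ j (𝔲 (p j) (Function.update v i ⟨x, y⟩ j)).2) =
          (χ i x * ξ i ((𝔱 (p i)) ⟨x, y⟩).2) *
          ∏ j ∈ Finset.univ.erase i, χ j (v j).proj *
            ξ j (𝔲 (p j) (v j)).2 := by
        intro y
        rw [← Finset.mul_prod_erase _ _ (Finset.mem_univ i), Function.update_self,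
          bundleChart_apply]
        congr 1
        refine Finset.prod_congr rfl fun j hj => ?_
        rw [Function.update_of_ne (Finset.ne_of_mem_erase hj)]
      have e3 := ((𝔱 (p i)).linear ℝ hx.2)
      simp only [e1, e2, e3.map_add, e3.map_smul, map_add, map_smul, smul_eq_mul]
      rw [RCLike.real_smul_eq_coe_mul]
      push_cast
      ring
    · have e : ∀ y : E x, (∏ j, χ j (Function.update v i ⟨x, y⟩ j).proj *
          ξ j (𝔲 (p j) (Function.update v i ⟨x, y⟩ j)).2) = 0 := fun y =>
        Finset.prod_eq_zero (Finset.mem_univ i) (by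
          rw [Function.update_self, hχK i x fun h => hx (hKp i h), zero_mul])
      simp [e]
  · beta_reduce
    rw [Finset.prod_eq_zero (Finset.mem_univ i), RCLike.ofReal_zero, mul_zero]
    rw [hχK i _ fun h => hi (mem_iUnion_of_mem i h), zero_mul]
  · let π' : (ι → 𝔼 × F) → ι → M := fun z i =>
      ((𝔟 (c i)).symm (z i)).proj
    let W : Set (ι → 𝔼 × F) := Set.pi univ fun i =>
      (𝔟 (c i)).target ∩
        {z | ((𝔟 (c i)).symm z).proj ∈ chartDom d F E (p i)}
    let W' : Set (ι → 𝔼 × F) := ⋃ i, repDomain d c ∩ {z |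
      z i ∈ (𝔟 (c i)).target ∩
        {z | ((𝔟 (c i)).symm z).proj ∈ (K i)ᶜ}}
    have hW : IsOpen W := isOpen_set_pi finite_univ fun i _ =>
      isOpen_chart_preimage _ (isOpen_chartDom _)
    have hW' : IsOpen W' := isOpen_iUnion fun i => (isOpen_repDomain c).inter
      ((isOpen_chart_preimage (c i) (hK i).isClosed.isOpen_compl).preimage (continuous_apply i))
    have hWW : repDomain d c ⊆ W ∪ W' := fun z hz => by
      by_cases h : ∀ i, π' z i ∈ K i
      · exact .inl fun i _ => ⟨hz i (mem_univ i), hKp i (h i)⟩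
      · push Not at h
        obtain ⟨i, hi⟩ := h
        exact .inr (mem_iUnion_of_mem i ⟨hz, hz i (mem_univ i), hi⟩)
    have hT : ∀ i, ContDiffOn ℝ ∞ (fun z : ι → 𝔼 × F =>
        𝔲 (p i) ((𝔟 (c i)).symm (z i))) W :=
      fun i => (contDiffOn_bundleChart (p i) (c i)).comp (contDiff_apply ℝ _ i).contDiffOn
        fun z hz => hz i (mem_univ i)
    refine (SB.union ?_ ?_ hW hW').mono hWW
    · refine SB.bilin (hφ.comp_contDiffOn isOpen_univ hW (contDiffOn_pi.2 fun j => ?_)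
        (mapsTo_univ _ _)) (SB.of_contDiffOn hW ((RCLike.ofRealCLM (K := 𝕜)).contDiff.comp_contDiffOn
          (contDiffOn_prod fun i _ => ContDiffOn.mul ?_ ((ξ i).contDiff.comp_contDiffOn
            (contDiff_snd.comp_contDiffOn (hT i)))))) hW (ContinuousLinearMap.mul ℝ 𝕜)
      · exact (EuclideanSpace.proj (𝕜 := ℝ) j.2).contDiff.comp_contDiffOn
          (contDiff_fst.comp_contDiffOn (hT j.1))
      · exact (contDiffOn_base (hχ i) (c i)).comp (contDiff_apply ℝ _ i).contDiffOn
          fun z hz => (hz i (mem_univ i)).1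
    · refine SB.zero.congr hW' fun a z hz => ?_
      obtain ⟨i, hi⟩ := mem_iUnion.1 hz
      simp only [localRep]
      rw [Finset.prod_eq_zero (Finset.mem_univ i), RCLike.ofReal_zero, mul_zero]
      rw [hχK i _ hi.2.2, zero_mul]

/-! ## Density of products of linear functions -/

variable (d 𝕜 F E) in
/-- Test tensors in one variable, as functions on the total space. -/
def LinFuns (U : Opens M) : Submodule 𝕜 (𝕏 → 𝕜) :=
  (𝒯 Unit U).comap (LinearMap.funLeft 𝕜 𝕜 fun v : Unit → 𝕏 => v ())

local notation "𝓛" => LinFuns d 𝕜 F E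

lemma LinFuns.isTTFam {U : Opens M} {α : Type*} {u : 𝕏 → 𝕜}
    (hu : u ∈ 𝓛 U) {ι : Type} [Fintype ι] [DecidableEq ι] [Unique ι] :
    IsTTFam d U fun (_ : α) (v : ι → 𝕏) => u (v default) := by
  have := (IsTTFam.of_mem (α := α) hu).comp (Equiv.ofUnique Unit ι)
  convert this using 3 with a v
  exact congrArg (fun i => u (v i)) (Subsingleton.elim _ _)

lemma LinFuns.mono {U V : Opens M} (hUV : U ≤ V) : 𝓛 U ≤ 𝓛 V :=
  fun u hu => ((IsTTFam.of_mem (α := Unit) hu).mono hUV).mem ()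

/-- A fibrewise multilinear function on a product of fibres. -/
def IsFiberwiseMultilinear.toMultilinearMap {f : (ι → 𝕏) → 𝕜}
    (hf : IsFiberwiseMultilinear f) (x : ι → M) : MultilinearMap ℝ (fun i => E (x i)) 𝕜 where
  toFun w := f fun i => ⟨x i, w i⟩
  map_update_add' {dec} w i a b := by
    obtain rfl : dec = hι := Subsingleton.elim _ _
    have h : ∀ a, (fun j => (⟨x j, Function.update w i a j⟩ : 𝕏)) =
        Function.update (fun j => ⟨x j, w j⟩) i ⟨x i, a⟩ := fun a => funext fun j => by
      by_cases hj : j = i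
      · subst hj; simp
      · simp [hj]
    have := hf (fun j => ⟨x j, w j⟩) i (x i) a b 1
    rw [one_smul, one_smul] at this
    simp only [h, this]
  map_update_smul' {dec} w i c a := by
    obtain rfl : dec = hι := Subsingleton.elim _ _
    have h : ∀ a, (fun j => (⟨x j, Function.update w i a j⟩ : 𝕏)) =
        Function.update (fun j => ⟨x j, w j⟩) i ⟨x i, a⟩ := fun a => funext fun j => by
      by_cases hj : j = i
      · subst hj; simp
      · simp [hj]
    have h0 := hf (fun j => ⟨x j, w j⟩) i (x i) 0 0 1
    rw [one_smul, one_smul, add_zero, left_eq_add] at h0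
    have := hf (fun j => ⟨x j, w j⟩) i (x i) 0 a c
    rw [zero_add, h0, zero_add] at this
    simp only [h, this]

lemma bundleChart_expand (p : M) (v : 𝕏) (hv : v.proj ∈ chartDom d F E p) :
    ∃ w : Fin (Module.finrank ℝ F) → E v.proj,
      (∀ β, (⟨v.proj, w β⟩ : 𝕏) =
        (𝔲 p).symm ((𝔲 p v).1, Module.finBasis ℝ F β)) ∧
      v.2 = ∑ β, (Module.finBasis ℝ F).coord β (𝔲 p v).2 • w β := by
  let e := (𝔱 p).continuousLinearEquivAt ℝ v.proj hv.2
  have he : ∀ w : E v.proj, (𝔱 p ⟨v.proj, w⟩).2 = e w := fun w => rfl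
  refine ⟨fun β => e.symm (Module.finBasis ℝ F β), fun β => ?_, ?_⟩
  · have h1 : (⟨v.proj, e.symm (Module.finBasis ℝ F β)⟩ : 𝕏) ∈
      (𝔲 p).source := mem_bundleChart_source.2 hv
    have h2 : (𝔱 p ⟨v.proj, e.symm (Module.finBasis ℝ F β)⟩).1 = v.proj :=
      Trivialization.coe_fst' _ hv.2
    rw [← (𝔲 p).left_inv h1, bundleChart_apply (d := d) p ⟨_, _⟩, h2, he,
      e.apply_symm_apply, bundleChart_fst hv]
  · apply e.injective
    have h2 : (𝔲 p v).2 = e v.2 := by rw [bundleChart_apply]; rfl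
    simp only [map_sum, map_smul, e.apply_symm_apply, h2, Module.Basis.coord_apply]
    exact ((Module.finBasis ℝ F).sum_repr _).symm

lemma IsFiberwiseMultilinear.expand {f : (ι → 𝕏) → 𝕜} (hf : IsFiberwiseMultilinear f)
    (p : ι → M) (v : ι → 𝕏) (hv : ∀ i, (v i).proj ∈ chartDom d F E (p i)) :
    f v = ∑ β : ι → Fin (Module.finrank ℝ F),
      ((∏ i, (Module.finBasis ℝ F).coord (β i) (𝔲 (p i) (v i)).2 : ℝ) : 𝕜) *
      f fun i => (𝔲 (p i)).symm
        ((𝔲 (p i) (v i)).1, Module.finBasis ℝ F (β i)) := by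
  choose w hw hw' using fun i => bundleChart_expand (d := d) (p i) (v i) (hv i)
  have h1 : f v = hf.toMultilinearMap (fun i => (v i).proj) fun i => (v i).2 := rfl
  rw [h1, show (fun i => (v i).2) = _ from funext hw', MultilinearMap.map_sum]
  refine Finset.sum_congr rfl fun β _ => ?_
  rw [MultilinearMap.map_smul_univ, RCLike.real_smul_eq_coe_mul]
  congr 1
  exact congrArg f (funext fun i => hw i (β i))

/-- The coordinates with respect to the basis of the model fibre. -/
def fibreCoord (F : Type uF) [NormedAddCommGroup F] [NormedSpace ℝ F] [FiniteDimensional ℝ F]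
    (β : Fin (Module.finrank ℝ F)) : F →L[ℝ] ℝ :=
  LinearMap.toContinuousLinearMap ((Module.finBasis ℝ F).coord β)

lemma exists_coordinates {f : (ι → 𝕏) → 𝕜} (hf : f ∈ 𝒯 ι U)
    (p : ι → M) {φ : ι → M → ℝ} (hφ : ∀ i, ContMDiff (𝓡 d) 𝓘(ℝ, ℝ) ∞ (φ i)) {L : ι → Set M}
    (hL : ∀ i, IsCompact (L i)) (hLp : ∀ i, L i ⊆ chartDom d F E (p i))
    (hφL : ∀ i, ∀ x ∉ L i, φ i x = 0) (β : ι → Fin (Module.finrank ℝ F)) :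
    ∃ g : (ι × Fin d → ℝ) → 𝕜, ContDiff ℝ ∞ g ∧ (∃ R, ∀ y, (∃ j, R < |y j|) → g y = 0) ∧
      ∀ v : ι → 𝕏, (∀ i, (v i).proj ∈ chartDom d F E (p i)) →
        g (fun j => (𝔲 (p j.1) (v j.1)).1 j.2) =
          ((∏ i, φ i (v i).proj : ℝ) : 𝕜) * f fun i => (𝔲 (p i)).symm
            ((𝔲 (p i) (v i)).1, Module.finBasis ℝ F (β i)) := by
  classical
  let Y : (ι × Fin d → ℝ) → ι → 𝔼 := fun y i => WithLp.toLp 2 fun a => y (i, a)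
  have hY : ∀ i, ContDiff ℝ ∞ fun y => Y y i := fun i =>
    (EuclideanSpace.equiv (Fin d) ℝ).symm.contDiff.comp
      (contDiff_pi.2 fun a => contDiff_apply ℝ ℝ (i, a))
  have hYc : Continuous Y := continuous_pi fun i => (hY i).continuous
  let D : Set (ι × Fin d → ℝ) := Y ⁻¹' Set.pi univ fun i => 𝔇 (p i)
  have hD : IsOpen D := (isOpen_set_pi finite_univ fun i _ => isOpen_localDomain (p i)).preimage hYc
  let g₀ : (ι × Fin d → ℝ) → 𝕜 := fun y =>
    ((∏ i, φ i ((𝔠 (p i)).symm (Y y i)) : ℝ) : 𝕜) *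
      f fun i => (𝔲 (p i)).symm (Y y i, Module.finBasis ℝ F (β i))
  have hg₀ : ContDiffOn ℝ ∞ g₀ D := by
    refine ContDiffOn.mul ((RCLike.ofRealCLM (K := 𝕜)).contDiff.comp_contDiffOn
      (contDiffOn_prod fun i _ => ?_)) ?_
    · have h1 : ContDiffOn ℝ ∞ (fun y => φ i ((𝔠 (p i)).symm y))
          (𝔠 (p i)).target := by
        rw [← contMDiffOn_iff_contDiffOn]
        exact (hφ i).comp_contMDiffOn (contMDiffOn_extChartAt_symm (p i))
      exact h1.comp (hY i).contDiffOn fun y hy => (hy i (mem_univ i)).1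
    · refine (hf.1 fun i => ⟨p i, 0⟩).comp (f := fun y i => (Y y i, Module.finBasis ℝ F (β i)))
        (contDiff_pi.2 fun i => (hY i).prodMk contDiff_const).contDiffOn fun y hy i _ => ?_
      exact (bundleChart_target (E := E) (F := F) (p i)).symm.subset ⟨hy i (mem_univ i), mem_univ _⟩
  let C : Set (ι × Fin d → ℝ) := (fun (w : ι → 𝔼) (j : ι × Fin d) => w j.1 j.2) ''
    Set.pi univ fun i => 𝔠 (p i) '' L i
  have hC : IsCompact C := by
    refine (isCompact_univ_pi fun i => (hL i).image_of_continuousOn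
      ((continuousOn_extChartAt (p i)).mono fun x hx => ?_)).image (by fun_prop)
    rw [extChartAt_source]; exact (hLp i hx).1
  have hDC : ∀ y ∈ D, y ∉ C → g₀ y = 0 := fun y hy hyC => by
    have h1 : ∃ i, (𝔠 (p i)).symm (Y y i) ∉ L i := by
      by_contra! h
      exact hyC ⟨Y y, fun i _ => ⟨_, h i, (𝔠 (p i)).right_inv (hy i (mem_univ i)).1⟩,
        rfl⟩
    obtain ⟨i, hi⟩ := h1
    simp only [g₀]
    rw [Finset.prod_eq_zero (Finset.mem_univ i) (hφL i _ hi), RCLike.ofReal_zero, zero_mul]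
  have hCD : C ⊆ D := by
    rintro _ ⟨w, hw, rfl⟩ i _
    obtain ⟨x, hx, hx'⟩ := hw i (mem_univ i)
    have hs : x ∈ (𝔠 (p i)).source := by
      rw [extChartAt_source]; exact (hLp i hx).1
    change w i ∈ _
    rw [← hx']
    refine ⟨(𝔠 (p i)).map_source hs, ?_⟩
    rw [mem_preimage, (𝔠 (p i)).left_inv hs]
    exact (hLp i hx).2
  have h0 : ∀ y ∉ C, D.indicator g₀ y = 0 := fun y hy => by
    by_cases hyD : y ∈ D
    · rw [indicator_of_mem hyD, hDC y hyD hy]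
    · exact indicator_of_notMem hyD _
  refine ⟨D.indicator g₀, contDiff_iff_contDiffAt.2 fun y => ?_, ?_, fun v hv => ?_⟩
  · by_cases hy : y ∈ D
    · exact (hg₀.contDiffAt (hD.mem_nhds hy)).congr_of_eventuallyEq
        (by filter_upwards [hD.mem_nhds hy] with z hz using indicator_of_mem hz _)
    · refine (contDiffAt_const (c := (0 : 𝕜))).congr_of_eventuallyEq ?_
      filter_upwards [hC.isClosed.isOpen_compl.mem_nhds fun h => hy (hCD h)] with z hz using h0 z hz
  · obtain ⟨R, hR⟩ := hC.isBounded.exists_norm_le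
    exact ⟨R, fun y ⟨j, hj⟩ => h0 y fun hy => hj.not_ge ((norm_le_pi_norm y j).trans (hR y hy))⟩
  · have h1 : Y (fun j => (𝔲 (p j.1) (v j.1)).1 j.2) =
      fun i => (𝔲 (p i) (v i)).1 := rfl
    have h2 : ∀ i, (v i).proj ∈ (𝔠 (p i)).source := fun i => by
      rw [extChartAt_source]; exact (hv i).1
    rw [indicator_of_mem]
    · have h3 : ∀ i, (𝔠 (p i)).symm (𝔲 (p i) (v i)).1 =
          (v i).proj := fun i => by
        rw [bundleChart_fst (hv i), (𝔠 (p i)).left_inv (h2 i)]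
      change ((∏ i, φ i ((𝔠 (p i)).symm (𝔲 (p i) (v i)).1) :
        ℝ) : 𝕜) * _ = _
      simp only [h3]
      rfl
    · intro i _
      change (𝔲 (p i) (v i)).1 ∈ 𝔇 (p i)
      rw [bundleChart_fst (hv i)]
      refine ⟨(𝔠 (p i)).map_source (h2 i), ?_⟩
      rw [mem_preimage, (𝔠 (p i)).left_inv (h2 i)]
      exact (hv i).2

theorem TestTensors.eq_zero_of_products (ℓ : 𝒯 ι U →ₗ[𝕜] 𝕜)
    (hℓ : ∀ B : Set (𝒯 ι U), IsBddFamily B → ∃ R : ℝ, ∀ f ∈ B, ‖ℓ f‖ ≤ R)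
    (h : ∀ (u : ι → 𝕏 → 𝕜), (∀ i, u i ∈ 𝓛 U) →
      ∀ f : 𝒯 ι U, (f.1 = fun v => ∏ i, u i (v i)) → ℓ f = 0) : ℓ = 0 := by
  obtain ⟨ℓ', hℓ'⟩ := ℓ.exists_extend
  have hm : ∀ f : 𝒯 ι U, ℓ' f.1 = ℓ f := fun f => LinearMap.congr_fun hℓ' f
  have hfam : ∀ {Q : Set ℝ} (f : Q → (ι → 𝕏) → 𝕜), IsTTFam d U f →
      ∃ R : ℝ, ∀ a, ‖ℓ' (f a)‖ ≤ R := fun f hf => by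
    obtain ⟨R, hR⟩ := hℓ _ (hf.isBddFamily (S := range fun a => ⟨f a, hf.mem a⟩)
      (by rintro _ ⟨a, rfl⟩; exact ⟨a, rfl⟩))
    exact ⟨R, fun a => (congrArg norm (hm ⟨f a, hf.mem a⟩)).trans_le (hR _ (mem_range_self a))⟩
  refine LinearMap.ext fun f => ?_
  obtain ⟨K, hK, hKU, hfK⟩ := f.2.2.2
  obtain ⟨t, φ, hφ, hφL, hφK⟩ := exists_smooth_partition (d := d) hK
    (W := fun p => chartDom d F E p ∩ U) (fun p => (isOpen_chartDom p).inter U.isOpen)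
    fun x hx => mem_iUnion_of_mem x ⟨mem_chartDom x, hKU hx⟩
  choose L hL hLW hLφ using hφL
  suffices hc : ∀ p : ι → M, ℓ' (fun v => ((∏ i, φ (p i) (v i).proj : ℝ) : 𝕜) * f.1 v) = 0 by
    have e : f.1 = ∑ p ∈ Fintype.piFinset fun _ : ι => t,
        fun v => ((∏ i, φ (p i) (v i).proj : ℝ) : 𝕜) * f.1 v := by
      funext v
      simp only [Finset.sum_apply]
      rw [← Finset.sum_mul, ← RCLike.ofReal_sum,
        ← Finset.prod_univ_sum (fun _ : ι => t) fun i q => φ q (v i).proj]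
      by_cases hv : ∀ i, (v i).proj ∈ K
      · rw [Finset.prod_congr rfl fun i _ => hφK _ (hv i)]; simp
      · rw [hfK v (not_forall.1 hv), mul_zero]
    rw [← hm, e, map_sum, Finset.sum_eq_zero fun p _ => hc p]; rfl
  intro p
  choose χ hχ hχL hχ1 using fun i => exists_cutoff (d := d) (hL (p i))
    ((isOpen_chartDom (p i)).inter U.isOpen) (hLW (p i))
  choose L' hL' hLW' hLχ using hχL
  choose g hg hgR hgv using fun β => exists_coordinates f.2 p (fun i => hφ (p i))
    (fun i => hL (p i)) (fun i => (hLW (p i)).trans inter_subset_left) (fun i => hLφ (p i)) β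
  let Θ : (ι → Fin (Module.finrank ℝ F)) → ((ι × Fin d → ℝ) → 𝕜) →ₗ[𝕜] ((ι → 𝕏) → 𝕜) :=
    fun β => { toFun := fun ψ v => ψ (fun j => (𝔲 (p j.1) (v j.1)).1 j.2) *
                ((∏ i, χ i (v i).proj * fibreCoord F (β i) (𝔲 (p i) (v i)).2
                  : ℝ) : 𝕜)
               map_add' := fun ψ ψ' => funext fun v => add_mul _ _ _
               map_smul' := fun c ψ => funext fun v => mul_assoc _ _ _ }
  have hΘ : ∀ {α : Type} β {ψ : α → (ι × Fin d → ℝ) → 𝕜}, SB univ ψ →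
      IsTTFam d U fun a => Θ β (ψ a) := fun β ψ hψ => isTTFam_coordinates hψ p
    (fun i => fibreCoord F (β i)) hχ hL' (fun i => (hLW' i).trans inter_subset_left)
    (fun i => (hLW' i).trans inter_subset_right) hLχ
  have e : (fun v => ((∏ i, φ (p i) (v i).proj : ℝ) : 𝕜) * f.1 v) = ∑ β, Θ β (g β) := by
    funext v
    rw [Finset.sum_apply]
    by_cases hv : ∀ i, (v i).proj ∈ chartDom d F E (p i)
    · rw [f.2.2.1.expand p v hv, Finset.mul_sum]
      refine Finset.sum_congr rfl fun β _ => ?_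
      simp only [Θ, LinearMap.coe_mk, AddHom.coe_mk]
      rw [hgv β v hv]
      by_cases hvL : ∀ i, (v i).proj ∈ L (p i)
      · rw [Finset.prod_congr rfl fun i _ => show χ i (v i).proj * _ = _ by
          rw [hχ1 i _ (hvL i), one_mul]]
        simp only [fibreCoord, LinearMap.coe_toContinuousLinearMap']
        ring
      · push Not at hvL
        obtain ⟨i, hi⟩ := hvL
        rw [Finset.prod_eq_zero (Finset.mem_univ i) (hLφ (p i) _ hi)]
        simp
    · push Not at hv
      obtain ⟨i, hi⟩ := hv
      rw [Finset.prod_eq_zero (Finset.mem_univ i) (hLφ (p i) _ fun h => hi (hLW _ h).1),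
        RCLike.ofReal_zero, zero_mul]
      refine (Finset.sum_eq_zero fun β _ => ?_).symm
      simp only [Θ, LinearMap.coe_mk, AddHom.coe_mk]
      rw [Finset.prod_eq_zero (Finset.mem_univ i), RCLike.ofReal_zero, mul_zero]
      rw [hLχ i _ fun h => hi (hLW' i h).1, zero_mul]
  rw [e, map_sum]
  refine Finset.sum_eq_zero fun β _ => ?_
  obtain ⟨R, hR⟩ := hgR β
  have hb : IsBddOnSmooth (ℓ'.comp (Θ β)) := fun ψ hψ => hfam _ (hΘ β hψ)
  refine hb.eq_zero_of_products (fun ψ hψ => ?_) (hg β) hR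
  have hu : ∀ i, (fun w : 𝕏 => (∏ a, ψ (i, a) ((𝔲 (p i) w).1 a)) *
      ((χ i w.proj * fibreCoord F (β i) (𝔲 (p i) w).2 : ℝ) : 𝕜)) ∈
        𝓛 U := fun i => by
    have h1 : SB univ fun (_ : Unit) (y : Unit × Fin d → ℝ) => ∏ a, ψ (i, a) (y ((), a)) :=
      SB.of_contDiffOn isOpen_univ (contDiff_prod fun a _ =>
        (hψ (i, a)).comp (contDiff_apply ℝ ℝ ((), a))).contDiffOn
    have := (isTTFam_coordinates (E := E) (ι := Unit) h1 (fun _ => p i)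
      (fun _ => fibreCoord F (β i)) (fun _ => hχ i) (fun _ => hL' i)
      (fun _ => (hLW' i).trans inter_subset_left) (fun _ => (hLW' i).trans inter_subset_right)
      (fun _ => hLχ i)).mem ()
    simp only [Finset.univ_unique, Finset.prod_singleton] at this
    exact this
  have hP : SB univ fun (_ : Unit) (y : ι × Fin d → ℝ) => ∏ j, ψ j (y j) :=
    SB.of_contDiffOn isOpen_univ (contDiff_prod fun j _ =>
      (hψ j).comp (contDiff_apply ℝ ℝ j)).contDiffOn
  refine (hm ⟨_, (hΘ β hP).mem ()⟩).trans (h _ hu _ (funext fun v => ?_))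
  simp only [Θ, LinearMap.coe_mk, AddHom.coe_mk]
  rw [Fintype.prod_prod_type, RCLike.ofReal_prod, ← Finset.prod_mul_distrib]

/-! ## Operators on polyvector fields -/

variable (d) in
/-- Linear operators on functions which act on the test tensors in each variable. -/
def IsSlotOperator (L : (𝕏 → 𝕜) →ₗ[𝕜] (𝕏 → 𝕜)) : Prop :=
  ∀ {α : Type v} {ι : Type} [Fintype ι] [DecidableEq ι] {U : Opens M}
    {f : α → (ι → 𝕏) → 𝕜}, IsTTFam d U f → ∀ i,
    IsTTFam d U fun a v => L (fun y => f a (Function.update v i y)) (v i)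

variable (d) in
/-- Linear functionals by which two variables of test tensors can be contracted. -/
def IsContraction (I : (𝕏 × 𝕏 → 𝕜) →ₗ[𝕜] 𝕜) : Prop :=
  ∀ {α : Type v} {ι : Type} [Fintype ι] [DecidableEq ι] {U : Opens M}
    {f : α → (ι ⊕ Fin 2 → 𝕏) → 𝕜}, IsTTFam d U f →
    IsTTFam d U fun a v => I fun p => f a (Sum.elim v ![p.1, p.2])

lemma wcomp_der (G : 𝒲) (v : Fin (n + 1) ⊕ Fin k → 𝕏) :
    wcomp (n + 1) k (der L G) v = ∑ p, L (fun y => wcomp n (k + 1) G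
      (Sum.elim (v ∘ .inl ∘ p.succAbove) (Fin.cons y (v ∘ .inr)))) (v (.inl p)) := by
  have h : ∀ (n : ℕ) (G : 𝒲) (a : Fin (n + 1) → 𝕏) w,
      der L G (List.ofFn a) w =
        ∑ p, L (fun y => G (List.ofFn (a ∘ p.succAbove)) (y :: w)) (a p) := by
    intro n
    induction n with
    | zero =>
      intro G a w
      rw [List.ofFn_succ, der_cons]
      simp
    | succ n ih =>
      intro G a w
      rw [List.ofFn_succ, der_cons, Fin.sum_univ_succ, add_comm]
      refine congrArg₂ (· + ·) ?_ ((ih _ (fun i => a i.succ) w).trans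
        (Finset.sum_congr rfl fun p _ => ?_))
      · rfl
      · rw [show a ∘ p.succ.succAbove = Fin.cons (a 0) ((fun i => a i.succ) ∘ p.succAbove) from ?_]
        · simp only [List.ofFn_cons]; rfl
        · funext i
          refine Fin.cases ?_ (fun j => ?_) i <;> simp
  refine (h n G (fun i => v (.inl i)) _).trans (Finset.sum_congr rfl fun p _ => ?_)
  refine congrFun (congrArg L (funext fun y => ?_)) _
  simp [wcomp, List.ofFn_succ]
  rfl

lemma wcomp_zero_der (G : 𝒲) : wcomp 0 k (der L G) = 0 := by
  funext v
  simp [wcomp]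

lemma wcomp_lap (G : 𝒲) (v : Fin n ⊕ Fin k → 𝕏) :
    wcomp n k (lap I G) v = I fun p => wcomp (n + 1) (k + 1) G
      (Sum.elim (Fin.cons p.2 (v ∘ .inl)) (Fin.cons p.1 (v ∘ .inr))) := by
  simp only [wcomp, List.ofFn_succ]
  rfl

lemma exists_perm_succAbove (σ : Equiv.Perm (Fin (n + 1))) (p : Fin (n + 1)) :
    ∃ ρ : Equiv.Perm (Fin n), σ ∘ p.succAbove = (σ p).succAbove ∘ ρ := by
  have h : ∀ i, ∃ j, (σ p).succAbove j = σ (p.succAbove i) := fun i =>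
    Fin.exists_succAbove_eq (σ.injective.ne (Fin.succAbove_ne p i))
  choose ρ hρ using h
  have hinj : Function.Injective ρ := fun i j hij =>
    Fin.succAbove_right_injective (σ.injective ((hρ i).symm.trans ((congrArg _ hij).trans (hρ j))))
  exact ⟨Equiv.ofBijective ρ (Finite.injective_iff_bijective.1 hinj), funext fun i => (hρ i).symm⟩

lemma exists_perm_cons {X : Type*} (τ : Equiv.Perm (Fin n)) : ∃ ρ : Equiv.Perm (Fin (n + 1)),
    Equiv.Perm.sign ρ = Equiv.Perm.sign τ ∧ ∀ (y : X) (a : Fin n → X),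
      (Fin.cons y (a ∘ τ) : Fin (n + 1) → X) = Fin.cons y a ∘ ρ := by
  refine ⟨Equiv.Perm.decomposeFin.symm (0, τ), by simp, fun y a => funext fun i => ?_⟩
  refine Fin.cases ?_ (fun j => ?_) i
  · simp
  · simp [Equiv.Perm.decomposeFin_symm_apply_succ]

lemma IsGoodFam.der (hL : IsSlotOperator.{uK, uM, uF, uE, v} d L)
    {G : α → 𝒲} (hG : IsGoodFam d U G) :
    IsGoodFam d U fun a => WordFun.der L (G a) where
  bound := by
    obtain ⟨N, hN⟩ := hG.bound
    refine ⟨N + 1, fun a n k h => ?_⟩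
    rcases n with _ | n
    · exact wcomp_zero_der _
    · funext v
      rw [wcomp_der]
      refine Finset.sum_eq_zero fun p _ => ?_
      rw [hN a n (k + 1) (by omega)]
      exact congrFun (map_zero L) _
  fam n k := by
    rcases n with _ | n
    · simp only [wcomp_zero_der]
      exact IsTTFam.zero
    · have e : ∀ a, wcomp (n + 1) k (WordFun.der L (G a)) = _ := fun a => funext (wcomp_der (G a))
      simp only [e]
      refine IsTTFam.sum _ fun p _ => ?_
      let f : Fin n ⊕ Fin (k + 1) → Fin (n + 1) ⊕ Fin k :=
        Sum.elim (fun i => .inl (p.succAbove i)) (Fin.cons (.inl p) .inr)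
      have hf : Function.Surjective f := by
        rintro (i | i)
        · by_cases hi : i = p
          · exact ⟨.inr 0, by simp [f, hi]⟩
          · obtain ⟨j, rfl⟩ := Fin.exists_succAbove_eq hi
            exact ⟨.inl j, rfl⟩
        · exact ⟨.inr i.succ, by simp [f]⟩
      let e : Fin n ⊕ Fin (k + 1) ≃ Fin (n + 1) ⊕ Fin k := Equiv.ofBijective f
        ((Fintype.bijective_iff_surjective_and_card f).2 ⟨hf, by simp; omega⟩)
      convert hL ((hG.fam n (k + 1)).comp e) (.inl p) using 8 with a v y
      funext i
      rcases i with i | i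
      · simp [e, f]
      · refine Fin.cases ?_ (fun j => ?_) i <;> simp [e, f]
  alt a n k v σ τ := by
    rcases n with _ | n
    · simp [wcomp_zero_der]
    · rw [wcomp_der, wcomp_der, Finset.mul_sum]
      conv_rhs => rw [← Equiv.sum_comp σ]
      refine Finset.sum_congr rfl fun p _ => ?_
      obtain ⟨ρ, hρ⟩ := exists_perm_succAbove σ p
      obtain ⟨τ', hτ, hτ'⟩ := exists_perm_cons (X := 𝕏) τ
      rw [← smul_eq_mul, ← Pi.smul_apply, ← map_smul]
      refine congrFun (congrArg L (funext fun y => ?_)) _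
      rw [Pi.smul_apply, smul_eq_mul, ← hτ, ← hG.alt a n (k + 1) _ ρ τ']
      congr 1
      funext i
      rcases i with i | i
      · exact congrArg (fun j => v (.inl j)) (congrFun hρ i)
      · exact congrFun (hτ' y (v ∘ .inr)) i

lemma IsGoodFam.lap (hI : IsContraction.{uK, uM, uF, uE, v} d I)
    {G : α → 𝒲} (hG : IsGoodFam d U G) :
    IsGoodFam d U fun a => WordFun.lap I (G a) where
  bound := by
    obtain ⟨N, hN⟩ := hG.bound
    refine ⟨N, fun a n k h => ?_⟩
    funext v
    rw [wcomp_lap, hN a (n + 1) (k + 1) (by omega)]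
    exact map_zero I
  fam n k := by
    have e : ∀ a, wcomp n k (WordFun.lap I (G a)) = _ := fun a => funext (wcomp_lap (G a))
    simp only [e]
    let f : Fin (n + 1) ⊕ Fin (k + 1) → (Fin n ⊕ Fin k) ⊕ Fin 2 :=
      Sum.elim (Fin.cons (.inr 1) fun i => .inl (.inl i)) (Fin.cons (.inr 0) fun i => .inl (.inr i))
    have hf : Function.Surjective f := by
      rintro ((i | i) | i)
      · exact ⟨.inl i.succ, by simp [f]⟩
      · exact ⟨.inr i.succ, by simp [f]⟩
      · fin_cases i
        · exact ⟨.inr 0, by simp [f]⟩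
        · exact ⟨.inl 0, by simp [f]⟩
    let e : Fin (n + 1) ⊕ Fin (k + 1) ≃ (Fin n ⊕ Fin k) ⊕ Fin 2 := Equiv.ofBijective f
      ((Fintype.bijective_iff_surjective_and_card f).2 ⟨hf, by simp; omega⟩)
    convert hI ((hG.fam (n + 1) (k + 1)).comp e) using 6 with a v p
    funext i
    rcases i with i | i <;> refine Fin.cases ?_ (fun j => ?_) i <;> simp [e, f]
  alt a n k v σ τ := by
    rw [wcomp_lap, wcomp_lap, ← smul_eq_mul, ← map_smul]
    refine congrArg I (funext fun p => ?_)
    obtain ⟨σ', -, hσ'⟩ := exists_perm_cons (X := 𝕏) σ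
    obtain ⟨τ', hτ, hτ'⟩ := exists_perm_cons (X := 𝕏) τ
    rw [Pi.smul_apply, smul_eq_mul, ← hτ, ← hG.alt a (n + 1) (k + 1) _ σ' τ']
    congr 1
    funext i
    rcases i with i | i
    · exact congrFun (hσ' p.2 (v ∘ .inl)) i
    · exact congrFun (hτ' p.1 (v ∘ .inr)) i

lemma IsGoodFam.bra (hI : IsContraction.{uK, uM, uF, uE, v} d I)
    {G H : α → 𝒲} (hG : IsGoodFam d U G) (hH : IsGoodFam d U H) :
    IsGoodFam d U fun a => WordFun.bra I (G a) (H a) := by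
  have e : ∀ a, WordFun.bra I (G a) (H a) = WordFun.lap I (G a * H a) +
      (-(WordFun.lap I (G a) * H a) + -(WordFun.par (G a) * WordFun.lap I (H a))) := fun a => by
    rw [lap_mul]; abel
  simp only [e]
  exact ((hG.mul hH).lap hI).add (((hG.lap hI).mul hH).neg.add (hG.par.mul (hH.lap hI)).neg)

lemma IsGoodFam.bound_apply {G : α → 𝒲} (hG : IsGoodFam d U G) (v w) :
    ∃ R : ℝ, ∀ a, ‖G a v w‖ ≤ R := by
  obtain ⟨R, hR⟩ := (hG.fam v.length w.length).bound (Sum.elim v.get w.get)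
  refine ⟨R, fun a => ?_⟩
  exact (congrArg norm (apply_eq_wcomp (G a) v w)).trans_le (hR a)

lemma Tot.eq_zero_of_isGen (Φ : 𝒲 →ₗ[𝕜] 𝒲)
    (hΦ : ∀ {α : Type (max uK uM uE)} {G : α → 𝒲}, IsGoodFam d U G →
      IsGoodFam d U fun a => Φ (G a))
    (h : ∀ G, IsGen (𝓛 U) G → Φ G = 0) (x : 𝒮 U) : Φ (J U x) = 0 := by
  have key : ∀ (n k : ℕ) (f : 𝒯 (Fin n ⊕ Fin k) U),
      Φ (WordFun.word n k f.1) = 0 := by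
    intro n k f
    refine WordFun.ext fun v w => ?_
    let ℓ : 𝒯 (Fin n ⊕ Fin k) U →ₗ[𝕜] 𝕜 :=
      { toFun := fun f => Φ (WordFun.word n k f.1) v w
        map_add' := fun f g => by
          change Φ (WordFun.word n k (f.1 + g.1)) v w = _
          rw [word_add, map_add]; rfl
        map_smul' := fun c f => by
          change Φ (WordFun.word n k (c • f.1)) v w = _
          rw [word_smul, map_smul]; rfl }
    have hℓ : ℓ = 0 := by
      refine TestTensors.eq_zero_of_products ℓ (fun B hB => ?_) fun u hu f hf => ?_
      · obtain ⟨R, hR⟩ := (hΦ (IsGoodFam.word (IsTTFam.of_isBddFamily hB))).bound_apply v w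
        exact ⟨R, fun f hf => hR ⟨f, hf⟩⟩
      · have h1 : f.1 = prodFun (fun i => u (.inl i)) fun i => u (.inr i) := by
          rw [hf]; funext v
          exact Fintype.prod_sum_type _
        change Φ (WordFun.word n k f.1) v w = 0
        rw [h1, word_prodFun, h _ (isGen_gens (fun i => hu _) fun i => hu _)]
        rfl
    exact LinearMap.congr_fun hℓ f
  obtain ⟨N, hN⟩ := (Tot.good x).bound
  have := (Tot.good x).eq_sum hN ()
  rw [this, map_sum]
  refine Finset.sum_eq_zero fun k _ => ?_
  rw [map_sum]
  refine Finset.sum_eq_zero fun n _ => ?_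
  rw [map_smul, key n k ⟨_, ((Tot.good x).fam n k).mem ()⟩, smul_zero]

lemma IsTTFam.update {f : α → (ι → 𝕏) → 𝕜} (hf : IsTTFam d U f)
    (v : ι → 𝕏) (i : ι) :
    IsTTFam d U fun a (y : Unit → 𝕏) => f a (Function.update v i (y ())) := by
  obtain ⟨K, hK, hKU, h⟩ := hf.supp
  refine ⟨fun a y j x s t r => ?_, ⟨K, hK, hKU, ?_⟩, fun c => ?_⟩
  · simpa using hf.linear a v i x s t r
  · rintro a y ⟨j, hj⟩
    exact h a _ ⟨i, by simpa using hj⟩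
  · let c' := Function.update v i (c ())
    have h1 : ContDiff ℝ ∞ fun (z : Unit → 𝔼 × F) =>
        Function.update (centre d F E v) i (z ()) := by
      refine contDiff_pi.2 fun j => ?_
      by_cases hj : j = i
      · subst hj; simp only [Function.update_self]; fun_prop
      · simp only [Function.update_of_ne hj]; fun_prop
    have := (hf.bdd c').comp_contDiffOn (isOpen_repDomain _) (isOpen_repDomain c) h1.contDiffOn
      (fun z hz j _ => ?_)
    · convert this using 3 with a z
      refine congrArg (f a) (funext fun j => ?_)
      by_cases hj : j = i
      · subst hj; simp [c']
      · simp only [c', Function.update_of_ne hj]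
        exact (extChartAt_to_inv (v j)).symm
    · by_cases hj : j = i
      · subst hj; simpa [c'] using hz () (mem_univ _)
      · simpa [c', hj] using centre_mem v j (mem_univ _)

/-! ## The classical complex -/

variable (d L I) in
/-- The properties of the equation of motion operator `L` and of the contraction `I` with the
fibre pairing on which the construction of the models relies. -/
structure IsFieldTheory : Prop where
  slot : IsSlotOperator.{uK, uM, uF, uE, max uK uM uE} d L
  contract : IsContraction.{uK, uM, uF, uE, max uK uM uE} d I
  variational : ∀ a ∈ 𝓛 ⊤, ∀ b ∈ 𝓛 ⊤,
    I (fun p => a p.1 * L b p.2) = I fun p => b p.1 * L a p.2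
  local' : ∀ {U V : Opens M}, Disjoint U V → ∀ a ∈ 𝓛 U, ∀ b ∈ 𝓛 V,
    I (fun p => a p.1 * b p.2) = 0

lemma IsGoodFam.to_unit {α : Type*} [Nonempty α] {G : 𝒲}
    (h : IsGoodFam d U fun _ : α => G) : IsGoodFam d U fun _ : Unit => G :=
  h.reindex fun _ => Classical.arbitrary α

lemma IsGoodFam.odd_mem {G : 𝒲} (h : IsGoodFam d U fun _ : Unit => G)
    (v w) : (fun y => G v (y :: w)) ∈ 𝓛 U := by
  rcases isEmpty_or_nonempty 𝕏 with h0 | ⟨⟨y₀⟩⟩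
  · rw [Subsingleton.elim (fun y => G v (y :: w)) 0]; exact zero_mem _
  · have h1 := ((h.fam v.length (w.length + 1)).update
      (Sum.elim v.get (Fin.cons y₀ w.get)) (.inr 0)).mem ()
    refine (congrArg (· ∈ 𝒯 Unit U) (funext fun y => ?_)).mp h1
    refine (Eq.trans ?_ (apply_eq_wcomp G v (y () :: w)).symm)
    refine congrArg (wcomp _ _ G) (funext fun i => ?_)
    rcases i with i | i
    · rfl
    · refine Fin.cases ?_ (fun j => ?_) i
      · simp
      · simp

lemma IsGoodFam.even_mem {G : 𝒲} (h : IsGoodFam d U fun _ : Unit => G)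
    (v w) : (fun y => G (y :: v) w) ∈ 𝓛 U := by
  rcases isEmpty_or_nonempty 𝕏 with h0 | ⟨⟨y₀⟩⟩
  · rw [Subsingleton.elim (fun y => G (y :: v) w) 0]; exact zero_mem _
  · have h1 := ((h.fam (v.length + 1) w.length).update
      (Sum.elim (Fin.cons y₀ v.get) w.get) (.inl 0)).mem ()
    refine (congrArg (· ∈ 𝒯 Unit U) (funext fun y => ?_)).mp h1
    refine (Eq.trans ?_ (apply_eq_wcomp G (y () :: v) w).symm)
    refine congrArg (wcomp _ _ G) (funext fun i => ?_)
    rcases i with i | i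
    · refine Fin.cases ?_ (fun j => ?_) i
      · simp
      · simp
    · rfl

namespace IsFieldTheory

variable (H : IsFieldTheory d L I)
include H

lemma lap_lap (x : 𝒮 U) : lap I (lap I (Tot.J U x)) = 0 :=
  Tot.eq_zero_of_isGen ((lapL I).comp (lapL I)) (fun hG => (hG.lap H.contract).lap H.contract)
    (fun _ hG => hG.lap_lap I) x

lemma der_der (x : 𝒮 U) : der L (der L (Tot.J U x)) = 0 :=
  Tot.eq_zero_of_isGen ((derL L).comp (derL L)) (fun hG => (hG.der H.slot).der H.slot)
    (fun _ hG => hG.der_der L) x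

lemma der_lap (x : 𝒮 U) : der L (lap I (Tot.J U x)) = -lap I (der L (Tot.J U x)) := by
  rw [eq_neg_iff_add_eq_zero]
  refine Tot.eq_zero_of_isGen ((derL L).comp (lapL I) + (lapL I).comp (derL L))
    (fun hG => ((hG.lap H.contract).der H.slot).add ((hG.der H.slot).lap H.contract))
    (fun G hG => ?_) x
  change der L (lap I G) + lap I (der L G) = 0
  rw [hG.der_lap L I fun a ha b hb => H.variational a (LinFuns.mono le_top ha) b
    (LinFuns.mono le_top hb), neg_add_cancel]

lemma disjoint (hUV : Disjoint U V) {G G' : 𝒲}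
    (hG : IsGoodFam d U fun _ : Unit => G) (hG' : IsGoodFam d V fun _ : Unit => G') :
    bra I G G' = 0 := by
  refine bra_eq_zero I (fun v w v' w' => H.local' hUV _ (hG.odd_mem v w) _ (hG'.even_mem v' w'))
    fun v w v' w' => ?_
  rw [← H.local' hUV.symm _ (hG'.odd_mem v' w') _ (hG.even_mem v w)]
  exact congrArg I (funext fun p => mul_comm _ _)

end IsFieldTheory

namespace Tot

/-- The parity operator. -/
def par (U : Opens M) : 𝒮 U →ₗ[𝕜] 𝒮 U :=
  lift (({ WordFun.par with map_smul' := fun c G => par_smul c G } :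
    𝒲 →ₗ[𝕜] 𝒲).comp (J U)) fun x => (good x).par

lemma J_par (x : 𝒮 U) : J U (par U x) = WordFun.par (J U x) := J_lift _ _ _

variable (H : IsFieldTheory d L I)
include H

/-- The differential. -/
def der (U : Opens M) : 𝒮 U →ₗ[𝕜] 𝒮 U :=
  lift ((derL L).comp (J U)) fun x =>
    ((good x).reindex fun _ : PUnit => ()).der H.slot |>.to_unit

lemma J_der (x : 𝒮 U) : J U (der H U x) = WordFun.der L (J U x) := J_lift _ _ _

lemma isBddLinear_der : IsBddLinear (der H U) := isBddLinear_lift _ _ fun S hS =>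
  (((isGoodFam hS).reindex ULift.down).der H.slot).reindex fun x : S => ULift.up.{max uK uM uE} x

/-- The Laplacian. -/
def lap (U : Opens M) : 𝒮 U →ₗ[𝕜] 𝒮 U :=
  lift ((lapL I).comp (J U)) fun x =>
    ((good x).reindex fun _ : PUnit => ()).lap H.contract |>.to_unit

lemma J_lap (x : 𝒮 U) : J U (lap H U x) = WordFun.lap I (J U x) := J_lift _ _ _

lemma isBddLinear_lap : IsBddLinear (lap H U) := isBddLinear_lift _ _ fun S hS =>
  (((isGoodFam hS).reindex ULift.down).lap H.contract).reindex fun x : S =>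
    ULift.up.{max uK uM uE} x

/-- The bracket. -/
def br (U : Opens M) : 𝒮 U →ₗ[𝕜] 𝒮 U →ₗ[𝕜] 𝒮 U :=
  (mul U).compr₂ (lap H U) - (mul U).comp (lap H U) - ((mul U).comp (par U)).compl₂ (lap H U)

lemma J_br (x y : 𝒮 U) : J U (br H U x y) = bra I (J U x) (J U y) := by
  have e : br H U x y = lap H U (mul U x y) - mul U (lap H U x) y - mul U (par U x) (lap H U y) :=
    rfl
  rw [e, map_sub, map_sub, J_lap, J_mul, J_mul, J_mul, J_lap, J_lap, J_par, lap_mul]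
  abel

lemma isBddBilinear_br : IsBddBilinear (br H U) :=
  isBddBilinear_of_good (bra I) (fun G G' hG hG' => hG.bra H.contract hG') (J_br H)

/-- The complex of classical observables on `U`. -/
def complex (U : Opens M) : ConvComplex.{max uK uM uE} 𝕜 where
  carrier := 𝒮 U
  convenient := isConvenient U
  deg := LCSum.deg _ _
  internal := LCSum.isInternal
  directSum_topology := LCSum.continuous_of_deg
  d := der H U
  d_bdd := isBddLinear_der H
  d_deg j x hx := (mem_deg_iff _ _).2 (by rw [J_der]; exact ((mem_deg_iff _ _).1 hx).der L)
  d_d x := J_injective (by rw [J_der, J_der, H.der_der, map_zero])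
  hbar := 0
  hbar_bdd S hS := by
    have := isBddLinear_of_continuous
      (f := (0 : 𝒮 U →ₗ[𝕜] 𝒮 U)) continuous_zero
    exact this S hS
  hbar_deg j x hx := zero_mem _
  hbar_d x := (map_zero (der H U)).symm

end Tot

/-! ## Smooth partitions subordinate to Weiss covers -/

lemma exists_inclusion_exclusion {κ : Type*} [DecidableEq κ] (t : Finset κ) (m : ℕ) :
    ∃ c : Finset κ → ℝ, ∀ s ⊆ t, s.card ≤ m →
      ∑ B ∈ t.powerset with s ⊆ B ∧ B.card ≤ m, c B = 1 := by
  suffices h : ∀ r, ∃ c : Finset κ → ℝ, ∀ s ⊆ t, s.card ≤ m → m < s.card + r →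
      ∑ B ∈ t.powerset with s ⊆ B ∧ B.card ≤ m, c B = 1 by
    obtain ⟨c, hc⟩ := h (m + 1)
    exact ⟨c, fun s hs hm => hc s hs hm (by omega)⟩
  intro r
  induction r with
  | zero => exact ⟨0, fun s _ h1 h2 => by omega⟩
  | succ r ih =>
    obtain ⟨c, hc⟩ := ih
    refine ⟨fun B => if B.card + r = m then
      1 - ∑ B' ∈ t.powerset with B ⊂ B' ∧ B'.card ≤ m, c B' else c B, fun s hs h1 h2 => ?_⟩
    by_cases h : s.card + r = m
    · have e : (t.powerset.filter fun B => s ⊆ B ∧ B.card ≤ m) =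
          insert s (t.powerset.filter fun B => s ⊂ B ∧ B.card ≤ m) := by
        ext B
        simp only [Finset.mem_filter, Finset.mem_powerset, Finset.mem_insert]
        constructor
        · rintro ⟨hB, h3, h4⟩
          exact h3.eq_or_ssubset.imp Eq.symm fun h5 => ⟨hB, h5, h4⟩
        · rintro (rfl | ⟨hB, h3, h4⟩)
          · exact ⟨hs, subset_rfl, h1⟩
          · exact ⟨hB, h3.subset, h4⟩
      rw [e, Finset.sum_insert (by simp), if_pos h, Finset.sum_congr rfl fun B hB => if_neg ?_,
        sub_add_cancel]
      have := Finset.card_lt_card (Finset.mem_filter.1 hB).2.1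
      omega
    · rw [← hc s hs h1 (by omega)]
      refine Finset.sum_congr rfl fun B hB => if_neg ?_
      have := Finset.card_le_card (Finset.mem_filter.1 hB).2.1
      omega

variable (d) in
include d in
lemma IsWeissCover.exists_small (h𝒰 : IsWeissCover 𝒰 U) {K : Set M} (hK : IsCompact K)
    (hKU : K ⊆ U) (N : ℕ) : ∃ O : M → Set M, (∀ x, IsOpen (O x) ∧ x ∈ O x) ∧
      ∀ B : Finset M, (B : Set M) ⊆ K → B.card ≤ N → ∃ W ∈ 𝒰, ∀ x ∈ B, O x ⊆ (W : Set M) := by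
  have := ChartedSpace.locallyCompactSpace 𝔼 M
  have := TopologicalSpace.metrizableSpace_of_t3_secondCountable M
  let := TopologicalSpace.metrizableSpaceMetric M
  obtain ⟨δ, hδ, h⟩ := lebesgue_number_lemma_of_metric (s := univ.pi fun _ : Fin N => K)
    (c := fun W : 𝒰 => univ.pi fun _ : Fin N => (W.1 : Set M)) (isCompact_univ_pi fun _ => hK)
    (fun W => isOpen_set_pi finite_univ fun _ _ => W.1.isOpen) fun x hx => by
      classical
      obtain ⟨W, hW, h⟩ := h𝒰.2 (Finset.univ.image x) (by
        simpa [Set.range_subset_iff] using fun i => hKU (hx i (mem_univ i)))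
      exact mem_iUnion.2 ⟨⟨W, hW⟩, fun i _ => h (by simp)⟩
  refine ⟨fun x => Metric.ball x δ, fun x => ⟨Metric.isOpen_ball, Metric.mem_ball_self hδ⟩,
    fun B hB hN => ?_⟩
  rcases B.eq_empty_or_nonempty with rfl | ⟨x₀, hx₀⟩
  · obtain ⟨W, hW, -⟩ := h𝒰.2 ∅ (by simp)
    exact ⟨W, hW, by simp⟩
  obtain ⟨e⟩ := Function.Embedding.nonempty_of_card_le (α := B) (β := Fin N) (by simpa using hN)
  have : Nonempty B := ⟨⟨x₀, hx₀⟩⟩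
  let g : Fin N → B := Function.invFun e
  obtain ⟨W, hW⟩ := h (fun i => (g i : M)) fun i _ => hB (g i).2
  refine ⟨W.1, W.2, fun x hx y hy => ?_⟩
  have h1 := hW (show Function.update (fun i => (g i : M)) (e ⟨x, hx⟩) y ∈ _ from ?_)
    (e ⟨x, hx⟩) (mem_univ _)
  · simpa using h1
  · refine (dist_pi_lt_iff hδ).2 fun i => ?_
    rcases eq_or_ne i (e ⟨x, hx⟩) with rfl | hi
    · simpa [g, Function.leftInverse_invFun e.injective _] using hy
    · simpa [hi] using hδ

lemma IsWeissCover.exists_partition [IsManifold (𝓡 d) ∞ M] (h𝒰 : IsWeissCover 𝒰 U) {K : Set M}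
    (hK : IsCompact K) (hKU : K ⊆ U) (N : ℕ) : ∃ (ι : Type uM) (_ : Fintype ι) (c : ι → ℝ)
      (W : ι → 𝒰) (ρ : ι → M → ℝ), (∀ i, ContMDiff (𝓡 d) 𝓘(ℝ, ℝ) ∞ (ρ i)) ∧
      (∀ i, ∃ L, IsCompact L ∧ L ⊆ ((W i).1 : Set M) ∧ ∀ x ∉ L, ρ i x = 0) ∧
      ∀ l : List M, l.length ≤ N → (∀ x ∈ l, x ∈ K) → ∑ i, c i * (l.map (ρ i)).prod = 1 := by
  classical
  obtain ⟨O, hO, hO'⟩ := h𝒰.exists_small d hK hKU N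
  obtain ⟨t, φ, hφ, hφ', h1⟩ := exists_smooth_partition (d := d) hK
    (W := fun x : K => O x) (fun x => (hO x).1) fun x hx => mem_iUnion.2 ⟨⟨x, hx⟩, (hO x).2⟩
  choose L hL hLO hφL using hφ'
  obtain ⟨c, hc⟩ := exists_inclusion_exclusion t N
  have hW : ∀ B : {B // B ∈ t.powerset.filter fun B => B.card ≤ N}, ∃ W : 𝒰,
      ∀ x ∈ B.1, O x ⊆ (W.1 : Set M) := fun B => by
    obtain ⟨W, hW, h⟩ := hO' (B.1.map (Function.Embedding.subtype _)) (by
      rintro _ hx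
      obtain ⟨y, -, rfl⟩ := Finset.mem_map.1 (Finset.mem_coe.1 hx)
      exact y.2) (by simpa using (Finset.mem_filter.1 B.2).2)
    exact ⟨⟨W, hW⟩, fun x hx => h x (Finset.mem_map_of_mem _ hx)⟩
  choose W hW using hW
  refine ⟨_, inferInstance, fun B => c B.1, W, fun B x => ∑ i ∈ B.1, φ i x,
    fun B => contMDiff_finsetSum fun i _ => hφ i, fun B => ⟨⋃ i ∈ B.1, L i,
      B.1.isCompact_biUnion fun i _ => hL i, iUnion₂_subset fun i hi => (hLO i).trans (hW B i hi),
      fun x hx => Finset.sum_eq_zero fun i hi => hφL i x fun h => hx (mem_biUnion hi h)⟩,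
    fun l hl hlK => ?_⟩
  have e : ∀ B : Finset K, (l.map fun x => ∑ i ∈ B, φ i x).prod =
      ∑ a ∈ Fintype.piFinset fun _ : Fin l.length => B, ∏ j, φ (a j) (l.get j) := fun B => by
    refine Eq.trans ?_ (Finset.prod_univ_sum (fun _ => B) fun j i => φ i (l.get j))
    conv_lhs => rw [← List.ofFn_get l, List.map_ofFn, List.prod_ofFn]
    rfl
  rw [Finset.sum_coe_sort (t.powerset.filter fun B => B.card ≤ N)
    fun B => c B * (l.map fun x => ∑ i ∈ B, φ i x).prod]
  simp only [e, Finset.mul_sum]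
  rw [Finset.sum_comm' (t' := Fintype.piFinset fun _ => t) (s' := fun a =>
    t.powerset.filter fun B => Finset.univ.image a ⊆ B ∧ B.card ≤ N)]
  · simp only [← Finset.sum_mul]
    rw [Finset.sum_congr rfl fun a ha => by
      rw [hc _ (Finset.image_subset_iff.2 fun j _ => Fintype.mem_piFinset.1 ha j)
        (Finset.card_image_le.trans (by simpa using hl)), one_mul], ← e t]
    rw [List.map_congr_left (g := fun _ => 1) fun x hx => h1 x (hlK x hx)]
    simp
  · intro B a
    simp only [Finset.mem_filter, Finset.mem_powerset, Fintype.mem_piFinset,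
      Finset.image_subset_iff, Finset.mem_univ, true_imp_iff]
    exact ⟨fun h => ⟨⟨h.1.1, h.2, h.1.2⟩, fun j => h.1.1 (h.2 j)⟩,
      fun h => ⟨⟨h.1.1, h.1.2.2⟩, h.1.2.1⟩⟩

/-! ## The cosheaf property -/

variable {ρ : M → ℝ}

variable (𝕜 F E) in
/-- Multiplication of word functions by the products of the values of `ρ` at the base points. -/
def mulBase (ρ : M → ℝ) : 𝒲 →ₗ[𝕜] 𝒲 where
  toFun G := fun (v w : List 𝕏) =>
    (((((v ++ w).map TotalSpace.proj).map ρ).prod : ℝ) : 𝕜) * G v w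
  map_add' _ _ := WordFun.ext fun _ _ => mul_add _ _ _
  map_smul' _ _ := WordFun.ext fun _ _ => mul_left_comm _ _ _

lemma WordFun.HasDeg.mulBase {j : ℤ} {G : 𝒲} (h : HasDeg j G) :
    HasDeg j (mulBase 𝕜 F E ρ G) := fun v w hw => by
  change _ * G v w = 0
  rw [h v w hw, mul_zero]

lemma wcomp_mulBase (G : 𝒲) (n k : ℕ) : wcomp n k (mulBase 𝕜 F E ρ G) =
    fun v => ((∏ i, ρ (v i).proj : ℝ) : 𝕜) * wcomp n k G v := by
  funext v
  exact congrArg (fun r : ℝ => (r : 𝕜) * wcomp n k G v) (show (((List.ofFn fun i => v (.inl i)) ++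
    List.ofFn fun i => v (.inr i)).map TotalSpace.proj |>.map ρ).prod = _ by
      simp [List.map_ofFn, List.prod_ofFn, Fintype.prod_sum_type])

lemma IsGoodFam.mulBase {α : Type*} {G : α → 𝒲} (hG : IsGoodFam d V G)
    (hρ : ContMDiff (𝓡 d) 𝓘(ℝ, ℝ) ∞ ρ) {L : Set M} (hL : IsCompact L) (hLW : L ⊆ W)
    (h : ∀ x ∉ L, ρ x = 0) :
    IsGoodFam d (W ⊓ V) fun a => mulBase 𝕜 F E ρ (G a) where
  bound := by
    obtain ⟨N, hN⟩ := hG.bound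
    exact ⟨N, fun a n k hnk => by rw [wcomp_mulBase, hN a n k hnk]; exact funext fun v => mul_zero _⟩
  fam n k := by
    simp only [wcomp_mulBase]
    obtain ⟨K, hK, hKV, hGK⟩ := (hG.fam n k).supp
    refine ((hG.fam n k).mul_base fun _ => hρ).of_supp (hL.inter hK)
      (fun x hx => ⟨hLW hx.1, hKV hx.2⟩) fun a v ⟨i, hi⟩ => ?_
    by_cases hv : (v i).proj ∈ K
    · refine mul_eq_zero_of_left ?_ _
      rw [Finset.prod_eq_zero (f := fun i => ρ (v i).proj) (Finset.mem_univ i)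
        (h _ fun h' => hi ⟨h', hv⟩), RCLike.ofReal_zero]
    · exact mul_eq_zero_of_right _ (hGK a v ⟨i, hv⟩)
  alt a n k v σ τ := by
    rw [wcomp_mulBase]
    beta_reduce
    rw [hG.alt a]
    have : ∏ i, ρ ((v ∘ Sum.map σ τ) i).proj = ∏ i, ρ (v i).proj :=
      (Equiv.sumCongr σ τ).prod_comp fun i => ρ (v i).proj
    simp only [this, mul_left_comm]

/-- The words on which `G` does not vanish have at most `N` letters, over points of `K`. -/
def IsWithin (K : Set M) (N : ℕ) (G : 𝒲) : Prop :=
  ∀ v w, G v w ≠ 0 → (v ++ w).length ≤ N ∧ ∀ x ∈ (v ++ w).map TotalSpace.proj, x ∈ K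

lemma IsWithin.mono {K K' : Set M} {N N' : ℕ} {G : 𝒲}
    (h : IsWithin K N G) (hK : K ⊆ K') (hN : N ≤ N') : IsWithin K' N' G := fun v w hG =>
  ⟨(h v w hG).1.trans hN, fun x hx => hK ((h v w hG).2 x hx)⟩

lemma IsWithin.mulBase {K : Set M} {N : ℕ} {G : 𝒲}
    (h : IsWithin K N G) : IsWithin K N (mulBase 𝕜 F E ρ G) := fun v w hG =>
  h v w (right_ne_zero_of_mul hG)

lemma IsGoodFam.exists_within {α : Type*} {G : α → 𝒲}
    (hG : IsGoodFam d U G) : ∃ K : Set M, IsCompact K ∧ K ⊆ U ∧ ∃ N, ∀ a, IsWithin K N (G a) := by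
  obtain ⟨N, hN⟩ := hG.bound
  choose K hK hKU hGK using fun n k => (hG.fam n k).supp
  refine ⟨⋃ n ∈ Finset.range N, ⋃ k ∈ Finset.range N, K n k, Finset.isCompact_biUnion _ fun n _ =>
    Finset.isCompact_biUnion _ fun k _ => hK n k, iUnion₂_subset fun n _ =>
    iUnion₂_subset fun k _ => hKU n k, N + N, fun a v w hvw => ?_⟩
  rw [apply_eq_wcomp (G a) v w] at hvw
  have hn : ¬(N ≤ v.length ∨ N ≤ w.length) := fun h => hvw (by rw [hN a _ _ h]; rfl)
  refine ⟨by rw [List.length_append]; omega, fun x hx => ?_⟩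
  obtain ⟨p, hp, rfl⟩ := List.mem_map.1 hx
  have : p.proj ∈ K v.length w.length := by
    by_contra h
    refine hvw (hGK _ _ a _ ?_)
    rcases List.mem_append.1 hp with hp | hp <;> obtain ⟨i, rfl⟩ := List.get_of_mem hp
    exacts [⟨.inl i, h⟩, ⟨.inr i, h⟩]
  simp only [mem_iUnion, Finset.mem_range]
  exact ⟨_, by omega, _, by omega, this⟩

namespace Tot

/-- Multiplication of polyvector fields by the products of the values of a cutoff function. -/
def cut (W : Opens M) (hρ : ContMDiff (𝓡 d) 𝓘(ℝ, ℝ) ∞ ρ)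
    (h : ∃ L, IsCompact L ∧ L ⊆ (W : Set M) ∧ ∀ x ∉ L, ρ x = 0) (V : Opens M) :
    𝒮 V →ₗ[𝕜] 𝒮 (W ⊓ V) :=
  lift ((mulBase 𝕜 F E ρ).comp (J V)) fun x => (good x).mulBase hρ h.choose_spec.1
    h.choose_spec.2.1 h.choose_spec.2.2

variable (hρ : ContMDiff (𝓡 d) 𝓘(ℝ, ℝ) ∞ ρ)
  (h : ∃ L, IsCompact L ∧ L ⊆ (W : Set M) ∧ ∀ x ∉ L, ρ x = 0)

lemma J_cut (x : 𝒮 V) : J (W ⊓ V) (cut W hρ h V x) = mulBase 𝕜 F E ρ (J V x) :=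
  J_lift _ _ _

lemma isBddLinear_cut : IsBddLinear (cut (𝕜 := 𝕜) (F := F) (E := E) W hρ h V) :=
  isBddLinear_lift _ _ fun _ hS => (isGoodFam hS).mulBase hρ h.choose_spec.1
    h.choose_spec.2.1 h.choose_spec.2.2

lemma exists_sum_ext (h𝒰 : IsWeissCover 𝒰 U) {K : Set M} (hK : IsCompact K) (hKU : K ⊆ U) (N : ℕ)
    {A : Type*} [AddCommGroup A] [Module 𝕜 A] [TopologicalSpace A] [PolynormableSpace 𝕜 A]
    (φ : ∀ W : 𝒰, 𝒮 W.1 →ₗ[𝕜] A) (hφ : ∀ W, IsBddLinear (φ W))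
    (hφ' : ∀ (W W' : 𝒰) (a : 𝒮 (W.1 ⊓ W'.1)),
      φ W (ext inf_le_left a) = φ W' (ext inf_le_right a)) :
    ∃ ψ : 𝒮 U →ₗ[𝕜] A, IsBddLinear ψ ∧
      (∀ (W : 𝒰) (y : 𝒮 W.1), IsWithin K N (J W.1 y) →
        ψ (ext (h𝒰.1 W.1 W.2) y) = φ W y) ∧
      ∀ x : 𝒮 U, IsWithin K N (J U x) → ∃ (ι : Type uM) (_ : Fintype ι) (W : ι → 𝒰)
        (y : ∀ i, 𝒮 (W i).1), (∀ i, IsWithin K N (J (W i).1 (y i))) ∧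
          (∀ i j, HasDeg j (J U x) → HasDeg j (J (W i).1 (y i))) ∧
          ∑ i, ext (h𝒰.1 (W i).1 (W i).2) (y i) = x := by
  obtain ⟨ι, _, c, W, ρ, hρ, hL, h1⟩ := h𝒰.exists_partition (d := d) hK hKU N
  have hsum : ∀ G : 𝒲, IsWithin K N G →
      ∑ i, (c i : 𝕜) • mulBase 𝕜 F E (ρ i) G = G := fun G hG => WordFun.ext fun v w => by
    have e : (∑ i, (c i : 𝕜) • mulBase 𝕜 F E (ρ i) G) v w = ((∑ i, c i *
        (((v ++ w).map TotalSpace.proj).map (ρ i)).prod : ℝ) : 𝕜) * G v w := by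
      rw [RCLike.ofReal_sum, Finset.sum_mul]
      refine (map_sum ({ toFun := fun G => G v w, map_zero' := rfl, map_add' := fun _ _ => rfl } :
        𝒲 →+ 𝕜) _ _).trans (Finset.sum_congr rfl fun i _ => ?_)
      rw [RCLike.ofReal_mul, mul_assoc]
      rfl
    rw [e]
    by_cases h : G v w = 0
    · rw [h, mul_zero]
    · rw [h1 _ (by simpa using (hG v w h).1) (hG v w h).2, RCLike.ofReal_one, one_mul]
  refine ⟨∑ i, (c i : 𝕜) • (φ (W i)).comp ((ext inf_le_left).comp (cut _ (hρ i) (hL i) U)),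
    fun S hS => ?_, fun W' y hy => ?_, fun x hx => ⟨ι, inferInstance, W, fun i => (c i : 𝕜) •
      ext inf_le_left (cut _ (hρ i) (hL i) U x), fun i v w hvw => ?_, fun i j hj => ?_, ?_⟩⟩
  · refine PolynormableSpace.isVonNBounded_iff.2 fun p hp => ?_
    choose R hR using fun i => PolynormableSpace.isVonNBounded_iff.1 (((hφ (W i)).comp
      ((isBddLinear_ext inf_le_left).comp (isBddLinear_cut (hρ i) (hL i)))) S hS) p hp
    refine ⟨∑ i, ‖(c i : 𝕜)‖ * R i, ?_⟩
    rintro _ ⟨x, hx, rfl⟩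
    rw [LinearMap.sum_apply]
    refine (Seminorm.map_sum_le_sum p _ _).trans (Finset.sum_le_sum fun i _ => ?_)
    rw [LinearMap.smul_apply, map_smul_eq_mul]
    exact mul_le_mul_of_nonneg_left (hR i _ (mem_image_of_mem _ hx)) (norm_nonneg _)
  · have h2 : ∀ i, φ (W i) (ext inf_le_left (cut _ (hρ i) (hL i) U (ext (h𝒰.1 W'.1 W'.2) y))) =
        φ W' (ext inf_le_right (cut _ (hρ i) (hL i) W'.1 y)) := fun i => by
      rw [← hφ']
      refine congrArg (φ (W i)) (J_injective ?_)
      rw [J_ext, J_ext, J_cut, J_cut, J_ext]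
    simp only [LinearMap.sum_apply, LinearMap.smul_apply, LinearMap.comp_apply, h2, ← map_smul,
      ← map_sum]
    refine congrArg (φ W') (J_injective ?_)
    simp only [map_sum, map_smul, J_ext, J_cut]
    exact hsum _ hy
  · rw [map_smul, J_ext, J_cut] at hvw
    exact hx.mulBase v w (right_ne_zero_of_mul hvw)
  · rw [map_smul, J_ext, J_cut]
    exact fun v w hw => mul_eq_zero_of_right _ (HasDeg.mulBase hj v w hw)
  · refine J_injective ?_
    simp only [map_sum, map_smul, J_ext, J_cut]
    exact hsum _ hx

theorem exists_glue (h𝒰 : IsWeissCover 𝒰 U)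
    {A : Type*} [AddCommGroup A] [Module 𝕜 A] [TopologicalSpace A] [PolynormableSpace 𝕜 A]
    (φ : ∀ W : 𝒰, 𝒮 W.1 →ₗ[𝕜] A) (hφ : ∀ W, IsBddLinear (φ W))
    (hφ' : ∀ (W W' : 𝒰) (a : 𝒮 (W.1 ⊓ W'.1)),
      φ W (ext inf_le_left a) = φ W' (ext inf_le_right a)) :
    ∃ ψ : 𝒮 U →ₗ[𝕜] A, IsBddLinear ψ ∧
      ∀ (W : 𝒰) (y : 𝒮 W.1), ψ (ext (h𝒰.1 W.1 W.2) y) = φ W y := by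
  let Q := {q : Set M × ℕ // IsCompact q.1 ∧ q.1 ⊆ U}
  choose ψ hψ h1 h2 using fun q : Q => exists_sum_ext h𝒰 q.2.1 q.2.2 q.1.2 φ hφ hφ'
  have hw : ∀ x : 𝒮 U, ∃ q : Q, IsWithin q.1.1 q.1.2 (J U x) := fun x => by
    obtain ⟨K, hK, hKU, N, hN⟩ := (good (α := Unit) x).exists_within
    exact ⟨⟨(K, N), hK, hKU⟩, hN ()⟩
  choose q hq using hw
  have mono : ∀ q q' : Q, q.1.1 ⊆ q'.1.1 → q.1.2 ≤ q'.1.2 → ∀ x, IsWithin q.1.1 q.1.2 (J U x) →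
      ψ q' x = ψ q x := fun q q' hK hN x hx => by
    obtain ⟨ι, _, W, y, hy, -, rfl⟩ := h2 q x hx
    rw [map_sum, map_sum]
    exact Finset.sum_congr rfl fun i _ =>
      (h1 q' _ _ ((hy i).mono hK hN)).trans (h1 q _ _ (hy i)).symm
  have key : ∀ (q' : Q) x, IsWithin q'.1.1 q'.1.2 (J U x) → ψ (q x) x = ψ q' x := fun q' x hx => by
    let r : Q := ⟨((q x).1.1 ∪ q'.1.1, max (q x).1.2 q'.1.2), (q x).2.1.union q'.2.1,
      union_subset (q x).2.2 q'.2.2⟩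
    rw [← mono (q x) r subset_union_left (le_max_left _ _) x (hq x),
      ← mono q' r subset_union_right (le_max_right _ _) x hx]
  refine ⟨{ toFun := fun x => ψ (q x) x, map_add' := fun x y => ?_, map_smul' := fun c x => ?_ },
    fun S hS => ?_, fun W y => ?_⟩
  · let r : Q := ⟨((q x).1.1 ∪ (q y).1.1, max (q x).1.2 (q y).1.2), (q x).2.1.union (q y).2.1,
      union_subset (q x).2.2 (q y).2.2⟩
    have hx := (hq x).mono (K' := r.1.1) subset_union_left (le_max_left _ (q y).1.2)
    have hy := (hq y).mono (K' := r.1.1) subset_union_right (le_max_right (q x).1.2 _)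
    rw [key r x hx, key r y hy, key r (x + y) fun v w hvw => ?_, map_add]
    by_cases h0 : J U x v w = 0
    · refine hy v w fun h3 => hvw ?_
      rw [map_add]
      exact (congrArg₂ (· + ·) h0 h3).trans (add_zero 0)
    · exact hx v w h0
  · have h3 := key (q x) (c • x) fun v w hvw => hq x v w fun h0 => hvw (by
      rw [map_smul]; exact (congrArg (c • ·) h0).trans (smul_zero c))
    exact h3.trans (map_smul _ _ _)
  · obtain ⟨K, hK, hKU, N, hr⟩ := (isGoodFam hS).exists_within
    let r : Q := ⟨(K, N), hK, hKU⟩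
    refine (hψ r S hS).subset ?_
    rintro _ ⟨x, hx, rfl⟩
    exact ⟨x, hx, (key r x (hr ⟨x, hx⟩)).symm⟩
  · refine h1 _ W y ?_
    simpa only [J_ext] using hq (ext (h𝒰.1 W.1 W.2) y)

end Tot

/-! ## The classical and the quantum model -/

namespace Tot

lemma exists_sum (h𝒰 : IsWeissCover 𝒰 U) (x : 𝒮 U) :
    ∃ (ι : Type uM) (_ : Fintype ι) (W : ι → 𝒰) (y : ∀ i, 𝒮 (W i).1),
      (∀ i j, HasDeg j (J U x) → HasDeg j (J (W i).1 (y i))) ∧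
      ∑ i, ext (h𝒰.1 (W i).1 (W i).2) (y i) = x := by
  obtain ⟨K, hK, hKU, N, hN⟩ := (good (α := Unit) x).exists_within
  have h := (exists_sum_ext (A := 𝕜) h𝒰 hK hKU N (φ := fun W => (0 : 𝒮 W.1 →ₗ[𝕜] 𝕜))
    (fun W => isBddLinear_of_continuous (f := (0 : 𝒮 W.1 →ₗ[𝕜] 𝕜)) continuous_zero)
    fun W W' a => rfl).choose_spec.2.2 x (hN ())
  exact h.imp fun _ => Exists.imp fun _ => Exists.imp fun _ => Exists.imp fun _ h => h.2

lemma hom_ext_cover (h𝒰 : IsWeissCover 𝒰 U) {A : Type*} [AddCommGroup A] [Module 𝕜 A]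
    {ψ ψ' : 𝒮 U →ₗ[𝕜] A} (h : ∀ (W : 𝒰) (y : 𝒮 W.1),
      ψ (ext (h𝒰.1 W.1 W.2) y) = ψ' (ext (h𝒰.1 W.1 W.2) y)) : ψ = ψ' := LinearMap.ext fun x => by
  obtain ⟨ι, _, W, y, -, rfl⟩ := exists_sum h𝒰 x
  rw [map_sum, map_sum]
  exact Finset.sum_congr rfl fun i _ => h _ _

lemma exists_glue_deg (h𝒰 : IsWeissCover 𝒰 U) {Z : ConvComplex.{w} 𝕜}
    (φ : ∀ W : 𝒰, 𝒮 W.1 →ₗ[𝕜] Z) (hφ : ∀ W, IsBddLinear (φ W))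
    (hd : ∀ W : 𝒰, ∀ j, ∀ x ∈ deg 𝕜 𝒱ₛ W.1 j, φ W x ∈ Z.deg j)
    (hφ' : ∀ (W W' : 𝒰) (a : 𝒮 (W.1 ⊓ W'.1)),
      φ W (ext inf_le_left a) = φ W' (ext inf_le_right a)) :
    ∃ ψ : 𝒮 U →ₗ[𝕜] Z, IsBddLinear ψ ∧
      (∀ j, ∀ x ∈ deg 𝕜 𝒱ₛ U j, ψ x ∈ Z.deg j) ∧
      ∀ (W : 𝒰) (y : 𝒮 W.1), ψ (ext (h𝒰.1 W.1 W.2) y) = φ W y := by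
  have := Z.convenient.locallyConvex
  obtain ⟨ψ, hψ, h⟩ := exists_glue h𝒰 φ hφ hφ'
  refine ⟨ψ, hψ, fun j x hx => ?_, h⟩
  obtain ⟨ι, _, W, y, hy, rfl⟩ := exists_sum h𝒰 x
  rw [map_sum]
  refine Submodule.sum_mem _ fun i _ => ?_
  rw [h]
  exact hd _ j _ ((mem_deg_iff _ _).2 (hy i j ((mem_deg_iff _ _).1 hx)))

lemma ext_deg (hUV : U ≤ V) (j : ℤ) (x : 𝒮 U)
    (hx : x ∈ deg 𝕜 𝒱ₛ U j) :
    ext hUV x ∈ deg 𝕜 𝒱ₛ V (j + 0) := by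
  rw [mem_deg_iff, J_ext, add_zero]
  exact (mem_deg_iff _ _).1 hx

lemma mul_deg (i j : ℤ) (x : 𝒮 U)
    (hx : x ∈ deg 𝕜 𝒱ₛ U i) (y : 𝒮 U)
    (hy : y ∈ deg 𝕜 𝒱ₛ U j) :
    mul U x y ∈ deg 𝕜 𝒱ₛ U (i + j + 0) := by
  rw [mem_deg_iff, J_mul, add_zero]
  exact ((mem_deg_iff _ _).1 hx).mul ((mem_deg_iff _ _).1 hy)

variable (H : IsFieldTheory d L I)

include H

lemma der_deg (j : ℤ) (x : 𝒮 U)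
    (hx : x ∈ deg 𝕜 𝒱ₛ U j) :
    der H U x ∈ deg 𝕜 𝒱ₛ U (j + 1) :=
  (complex H U).d_deg j x hx

lemma lap_deg (j : ℤ) (x : 𝒮 U)
    (hx : x ∈ deg 𝕜 𝒱ₛ U j) :
    lap H U x ∈ deg 𝕜 𝒱ₛ U (j + 1) := by
  rw [mem_deg_iff, J_lap]
  exact ((mem_deg_iff _ _).1 hx).lap I

lemma br_deg (i j : ℤ) (x : 𝒮 U)
    (hx : x ∈ deg 𝕜 𝒱ₛ U i) (y : 𝒮 U)
    (hy : y ∈ deg 𝕜 𝒱ₛ U j) :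
    br H U x y ∈ deg 𝕜 𝒱ₛ U (i + j + 1) := by
  rw [mem_deg_iff, J_br]
  exact ((mem_deg_iff _ _).1 hx).bra I ((mem_deg_iff _ _).1 hy)

lemma der_ext (hUV : U ≤ V) (x : 𝒮 U) : der H V (ext hUV x) = ext hUV (der H U x) :=
  J_injective (by rw [J_der, J_ext, J_ext, J_der])

lemma lap_ext (hUV : U ≤ V) (x : 𝒮 U) : lap H V (ext hUV x) = ext hUV (lap H U x) :=
  J_injective (by rw [J_lap, J_ext, J_ext, J_lap])

lemma J_der_eq (x : 𝒮 U) : J U (der H U x) = dW L I 0 (J U x) := by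
  rw [J_der, dW, zero_smul, add_zero]

/-- The classical model. -/
def classical : WordModel.{uM, max uK uM uE} 𝕜 ConvComplex.IsClassical M 𝕏 𝕜 where
  h := 0
  L := L
  I := I
  obj := complex H
  obj_mem U := rfl
  J := J
  J_inj U := J_injective
  mem_deg U := mem_deg_iff
  J_hbar U a := (map_zero (J U)).trans (zero_smul _ _).symm
  J_d U := J_der_eq H
  ext := ext
  ext_bdd := isBddLinear_ext
  J_ext := J_ext
  mul := mul
  mul_bdd := isBddBilinear_mul
  J_mul _ := J_mul
  one := one
  J_one _ := J_one
  br := br H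
  br_bdd U := isBddBilinear_br H
  J_br U := J_br H
  disjoint hUV a b := H.disjoint hUV (good a) (good b)
  lap_lap U := H.lap_lap
  der_lap U := H.der_lap
  cosheaf U 𝒰 h𝒰 Z hZ φ hφ hφ' := by
    obtain ⟨ψ, hψ, hd, h⟩ := exists_glue_deg h𝒰 φ (fun W => (hφ W).bdd) (fun W => (hφ W).deg) hφ'
    refine ⟨ψ, ⟨⟨hψ, hd, LinearMap.congr_fun (f := ψ.comp (der H U)) (g := Z.d.comp ψ)
      (hom_ext_cover h𝒰 fun W y => ?_), fun x => (map_zero ψ).trans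
        (LinearMap.congr_fun (show Z.hbar = 0 from hZ) (ψ x)).symm⟩, h⟩, fun ψ' h' =>
      hom_ext_cover h𝒰 fun W y => (h'.2 W y).trans (h W y).symm⟩
    change ψ (der H U _) = Z.d (ψ _)
    rw [der_ext, h, h]
    exact (hφ W).d y

end Tot

variable (d 𝕜 F E) in
/-- Formal power series of polyvector fields. -/
abbrev QTot (U : Opens M) : Type _ := Formal 𝕜 fun k => 𝒱 k U

local notation "𝒬" => QTot d 𝕜 F E

namespace QTot

/-- Formal power series of polyvector fields as word functions. -/
def J (U : Opens M) : 𝒬 U →ₗ[𝕜] WordFun 𝕏 𝕜⟦X⟧ where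
  toFun x := fun v w => PowerSeries.mk fun n => Tot.J U (coef n x) v w
  map_add' x y := WordFun.ext fun v w => PowerSeries.ext fun n => by
    refine (coeff_mk n fun n => Tot.J U (coef n (x + y)) v w).trans ?_
    refine Eq.trans ?_ (map_add (coeff (R := 𝕜) n) _ _).symm
    rw [coeff_mk, coeff_mk, map_add, map_add]; rfl
  map_smul' c x := WordFun.ext fun v w => PowerSeries.ext fun n => by
    refine (coeff_mk n fun n => Tot.J U (coef n (c • x)) v w).trans ?_
    rw [map_smul, map_smul]
    refine Eq.trans ?_ (map_smul (coeff (R := 𝕜) n) c (PowerSeries.mk fun n => Tot.J U (coef n x) v w)).symm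
    rw [coeff_mk]; rfl

lemma coefW_J (n : ℕ) (x : 𝒬 U) : coefW n (J U x) = Tot.J U (coef n x) :=
  WordFun.ext fun v w => coeff_mk n fun n => Tot.J U (coef n x) v w

instance (k : ℕ) (U : Opens M) : T2Space (𝒱 k U) := (PV.isConvenient d 𝕜 F E k U).hausdorff

/-- Extension by zero. -/
def ext (hUV : U ≤ V) : 𝒬 U →ₗ[𝕜] 𝒬 V :=
  formalLin (Tot.ext hUV) 0 (Tot.ext_deg hUV) fun _ _ _ => zero_mem _

lemma coef_ext' (hUV : U ≤ V) (n : ℕ) (x : 𝒬 U) :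
    coef n (ext hUV x) = Tot.ext hUV (coef n x) :=
  (coef_formalLin _ _ _ _ _ _).trans (by cases n <;> exact add_zero _)

lemma J_injective : Function.Injective (J (d := d) (𝕜 := 𝕜) (F := F) (E := E) U) := fun x y h =>
  LCSum.coef_ext fun n => Tot.J_injective (by rw [← coefW_J, h, coefW_J])

variable (H : IsFieldTheory d L I)

include H

/-- The differential. -/
def diff (U : Opens M) : 𝒬 U →ₗ[𝕜] 𝒬 U :=
  formalLin (Tot.der H U) (Tot.lap H U) (Tot.der_deg H) (Tot.lap_deg H)

lemma coef_diff (n : ℕ) (x : 𝒬 U) : coef n (diff H U x) =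
    Tot.der H U (coef n x) + hshift (fun n => Tot.lap H U (coef n x)) n := coef_formalLin _ _ _ _ _ _

/-- The complex of quantum observables on `U`. -/
def complex (U : Opens M) : ConvComplex.{max uK uM uE} 𝕜 where
  carrier := 𝒬 U
  convenient := LCSum.isConvenient fun k => isConvenient_pi fun _ => PV.isConvenient d 𝕜 F E k U
  deg := deg _ _
  internal := isInternal
  directSum_topology := continuous_of_deg
  d := diff H U
  d_bdd := isBddLinear_formalLin _ _ _ _ (Tot.isBddLinear_der H) (Tot.isBddLinear_lap H)
  d_deg j x hx := mem_deg_coef.2 fun n => by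
    rw [coef_diff]
    refine add_mem (Tot.der_deg H _ _ (mem_deg_coef.1 hx n)) ?_
    cases n with
    | zero => exact zero_mem _
    | succ n => exact Tot.lap_deg H _ _ (mem_deg_coef.1 hx n)
  d_d x := LCSum.coef_ext fun n => by
    have h1 (x : 𝒮 U) : Tot.der H U (Tot.der H U x) = 0 := (Tot.complex H U).d_d x
    have h2 (x : 𝒮 U) : Tot.lap H U (Tot.lap H U x) = 0 :=
      Tot.J_injective (by rw [Tot.J_lap, Tot.J_lap, H.lap_lap, map_zero])
    have h3 (x : 𝒮 U) : Tot.der H U (Tot.lap H U x) = -Tot.lap H U (Tot.der H U x) :=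
      Tot.J_injective (by rw [Tot.J_der, Tot.J_lap, H.der_lap, map_neg, Tot.J_lap, Tot.J_der])
    rcases n with _ | _ | n <;> simp [coef_diff, hshift, h1, h2, h3]
  hbar := hbar
  hbar_bdd := isBddLinear_formalLin _ _ _ _
    (isBddLinear_of_continuous continuous_zero) (isBddLinear_of_continuous continuous_id)
  hbar_deg j x hx := mem_deg_coef.2 fun n => by
    rw [coef_hbar]
    cases n with
    | zero => exact zero_mem _
    | succ n => exact mem_deg_coef.1 hx n
  hbar_d x := LCSum.coef_ext fun n => by
    rcases n with _ | _ | n <;> simp [coef_hbar, coef_diff, hshift]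

end QTot

lemma LCSum.isFormal {V : ℕ → Type*} [∀ k, AddCommGroup (V k)] [∀ k, Module 𝕜 (V k)]
    [∀ k, TopologicalSpace (V k)] [∀ k, PolynormableSpace 𝕜 (V k)] [∀ k, T2Space (V k)] (j : ℤ) :
    ∃ (A : Submodule 𝕜 (deg 𝕜 (fun k => ℕ → V k) j))
      (Φ : (ℕ → A) ≃L[𝕜] deg 𝕜 (fun k => ℕ → V k) j),
      (∀ v : A, Φ (Pi.single 0 v) = v) ∧
      ∀ x : ℕ → A, hbar (Φ x : Formal 𝕜 V) = (Φ (hshift x) : Formal 𝕜 V) := by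
  let Ψ := formalEquiv (𝕜 := 𝕜) (V := V) j
  let i : deg 𝕜 V j →L[𝕜] deg 𝕜 (fun k => ℕ → V k) j :=
    Ψ.toContinuousLinearMap.comp (ContinuousLinearMap.single 𝕜 (fun _ => deg 𝕜 V j) 0)
  let p : deg 𝕜 (fun k => ℕ → V k) j →L[𝕜] deg 𝕜 V j :=
    (ContinuousLinearMap.proj 0).comp Ψ.symm.toContinuousLinearMap
  have hpi : ∀ x, p (i x) = x := fun x => by simp [p, i]
  let e : LinearMap.range i.toLinearMap ≃L[𝕜] deg 𝕜 V j :=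
    { toFun := fun x => p x
      invFun := fun x => ⟨i x, x, rfl⟩
      map_add' := fun x y => map_add p _ _
      map_smul' := fun c x => map_smul p _ _
      left_inv := by
        rintro ⟨_, x, rfl⟩
        exact Subtype.ext (congrArg i (hpi x))
      right_inv := hpi
      continuous_toFun := p.continuous.comp continuous_subtype_val
      continuous_invFun := i.continuous.subtype_mk _ }
  have he : ∀ x : ℕ → LinearMap.range i.toLinearMap, ∀ n,
      coef n (Ψ (fun n => e (x n)) : Formal 𝕜 V) = e (x n) := fun x n => coef_formalEquiv j _ n
  refine ⟨LinearMap.range i.toLinearMap, (ContinuousLinearEquiv.piCongrRight fun _ => e).trans Ψ,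
    fun v => ?_, fun x => coef_ext fun n => ?_⟩
  · rw [← congrArg Subtype.val (e.symm_apply_apply v)]
    refine congrArg Ψ (funext fun n => ?_)
    change e (Pi.single (M := fun _ => LinearMap.range i.toLinearMap) 0 v n) = Pi.single (M := fun _ => deg 𝕜 V j) 0 (e v) n
    cases n with
    | zero => rw [Pi.single_eq_same, Pi.single_eq_same]
    | succ n => rw [Pi.single_eq_of_ne (by omega), Pi.single_eq_of_ne (by omega), map_zero]
  · rw [coef_hbar]
    refine Eq.trans ?_ (he (hshift x) n).symm
    cases n with
    | zero => exact (congrArg Subtype.val (map_zero e)).symm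
    | succ n => exact he x n

namespace QTot

/-- The unit. -/
def one (U : Opens M) : 𝒬 U := const (Tot.one U)

/-- The product. -/
def mul (U : Opens M) : 𝒬 U →ₗ[𝕜] 𝒬 U →ₗ[𝕜] 𝒬 U :=
  formalBil (Tot.mul U) Tot.mul_deg

lemma mem_deg (j : ℤ) (x : 𝒬 U) :
    x ∈ deg 𝕜 (fun k => ℕ → 𝒱 k U) j ↔ HasDeg j (J U x) := by
  rw [mem_deg_coef, hasDeg_coefW]
  exact forall_congr' fun n => by rw [coefW_J]; exact Tot.mem_deg_iff _ _

lemma J_hbar (x : 𝒬 U) : J U (hbar x) = (PowerSeries.X : 𝕜⟦X⟧) • J U x :=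
  coefW_ext fun n => by
    rw [coefW_J, coefW_smul, coef_hbar]
    cases n with
    | zero => exact map_zero _
    | succ n => exact (coefW_J _ _).symm

lemma J_ext (hUV : U ≤ V) (x : 𝒬 U) : J V (ext hUV x) = J U x :=
  coefW_ext fun n => by rw [coefW_J, coefW_J, coef_ext', Tot.J_ext]

lemma J_one : J U (one U : 𝒬 U) = 1 := coefW_ext fun n => by
  rw [coefW_J, coefW_one, one, coef_const, apply_ite (Tot.J U), Tot.J_one, map_zero]

lemma J_mul (x y : 𝒬 U) : J U (mul U x y) = J U x * J U y := coefW_ext fun n => by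
  rw [coefW_J, coefW_mul, mul, coef_formalBil, map_sum]
  exact Finset.sum_congr rfl fun p _ => by rw [Tot.J_mul, coefW_J, coefW_J]

lemma ext_const (hUV : U ≤ V) (x : 𝒮 U) : ext hUV (const x) = const (Tot.ext hUV x) :=
  LCSum.coef_ext fun n => by
    rw [coef_ext', coef_const, coef_const, apply_ite (Tot.ext hUV), map_zero]

lemma hom_ext_cover (h𝒰 : IsWeissCover 𝒰 U) {Z : ConvComplex.{w} 𝕜} (hZ : Z.IsFormal) {s : ℤ}
    {ψ ψ' : 𝒬 U →ₗ[𝕜] Z}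
    (hψ : ∀ j, ∀ x ∈ deg 𝕜 (fun k => ℕ → 𝒱 k U) j, ψ x ∈ Z.deg (j + s))
    (hψ' : ∀ j, ∀ x ∈ deg 𝕜 (fun k => ℕ → 𝒱 k U) j, ψ' x ∈ Z.deg (j + s))
    (h : ∀ x, ψ (hbar x) = Z.hbar (ψ x)) (h' : ∀ x, ψ' (hbar x) = Z.hbar (ψ' x))
    (hφ : ∀ (W : 𝒰) (y : 𝒬 W.1),
      ψ (ext (h𝒰.1 W.1 W.2) y) = ψ' (ext (h𝒰.1 W.1 W.2) y)) : ψ = ψ' := by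
  have e : ψ.comp const = ψ'.comp const := Tot.hom_ext_cover h𝒰 fun W y => by
    rw [LinearMap.comp_apply, LinearMap.comp_apply, ← ext_const]
    exact hφ W _
  refine sub_eq_zero.1 (eq_zero_of_const hZ (s := s) (fun j x hx => sub_mem (hψ j x hx) (hψ' j x hx))
    (fun x => ?_) fun x => sub_eq_zero.2 (LinearMap.congr_fun e x))
  rw [LinearMap.sub_apply, LinearMap.sub_apply, h, h', map_sub]

lemma exists_glue (h𝒰 : IsWeissCover 𝒰 U) {Z : ConvComplex.{w} 𝕜} (hZ : Z.IsFormal)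
    (φ : ∀ W : 𝒰, 𝒬 W.1 →ₗ[𝕜] Z) (hφ : ∀ W, IsBddLinear (φ W))
    (hd : ∀ W : 𝒰, ∀ j, ∀ x ∈ deg 𝕜 (fun k => ℕ → 𝒱 k W.1) j,
      φ W x ∈ Z.deg j) (hh : ∀ (W : 𝒰) x, φ W (hbar x) = Z.hbar (φ W x))
    (hφ' : ∀ (W W' : 𝒰) (a : 𝒬 (W.1 ⊓ W'.1)),
      φ W (ext inf_le_left a) = φ W' (ext inf_le_right a)) :
    ∃ ψ : 𝒬 U →ₗ[𝕜] Z, IsBddLinear ψ ∧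
      (∀ j, ∀ x ∈ deg 𝕜 (fun k => ℕ → 𝒱 k U) j, ψ x ∈ Z.deg j) ∧
      (∀ x, ψ (hbar x) = Z.hbar (ψ x)) ∧
      ∀ (W : 𝒰) (y : 𝒬 W.1), ψ (ext (h𝒰.1 W.1 W.2) y) = φ W y := by
  obtain ⟨ψ₀, hb, hψ, h⟩ := Tot.exists_glue_deg h𝒰 (fun W => (φ W).comp const)
    (fun W S hS => by
      have := hφ W _ (isBddLinear_const S hS)
      rwa [← image_comp] at this)
    (fun W j x hx => hd W j _ (mem_deg_coef.2 fun n => by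
      rw [coef_const]; split_ifs; exacts [hx, zero_mem _]))
    fun W W' a => by
      rw [LinearMap.comp_apply, LinearMap.comp_apply, ← ext_const, ← ext_const]
      exact hφ' W W' _
  obtain ⟨ψ, h1, h2, h3, h4⟩ := exists_formal hZ hb hψ
  refine ⟨ψ, h1, h2, h3, fun W y => ?_⟩
  have e : ∀ x : 𝒬 W.1, ext (h𝒰.1 W.1 W.2) (hbar x) = hbar (ext (h𝒰.1 W.1 W.2) x) :=
    fun x => J_injective (by rw [J_ext, J_hbar, J_hbar, J_ext])
  refine sub_eq_zero.1 (LinearMap.congr_fun (f := ψ.comp (ext (h𝒰.1 W.1 W.2)) - φ W) (g := 0)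
    (eq_zero_of_const hZ (s := 0) (fun j x hx => ?_) (fun x => ?_) fun x => ?_) y)
  · rw [add_zero]
    exact sub_mem (h2 j _ ((mem_deg _ _).2 (by rw [J_ext]; exact (mem_deg _ _).1 hx))) (hd W j x hx)
  · rw [LinearMap.sub_apply, LinearMap.sub_apply, LinearMap.comp_apply, LinearMap.comp_apply, e,
      h3, hh, map_sub]
  · rw [LinearMap.sub_apply, LinearMap.comp_apply, ext_const, h4, h]
    exact sub_self _

variable (H : IsFieldTheory d L I)

include H

/-- The bracket. -/
def br (U : Opens M) : 𝒬 U →ₗ[𝕜] 𝒬 U →ₗ[𝕜] 𝒬 U :=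
  formalBil (Tot.br H U) (Tot.br_deg H)

lemma J_br (x y : 𝒬 U) : J U (br H U x y) = bra (psMap I) (J U x) (J U y) :=
  coefW_ext fun n => by
    rw [coefW_J, coefW_bra, br, coef_formalBil, map_sum]
    exact Finset.sum_congr rfl fun p _ => by rw [Tot.J_br, coefW_J, coefW_J]

lemma J_d (x : 𝒬 U) : J U (diff H U x) =
    dW (LinearMap.pi fun x => psMap (evalAt L x)) (psMap I) (PowerSeries.X : 𝕜⟦X⟧) (J U x) := by
  refine coefW_ext fun n => ?_
  rw [coefW_J, dW, map_add, coefW_der, coefW_smul, coef_diff, map_add, Tot.J_der, coefW_J]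
  cases n with
  | zero => exact congrArg (_ + ·) (map_zero _)
  | succ n => exact congrArg (_ + ·) ((Tot.J_lap H _).trans (by rw [hshift, coefW_lap, coefW_J]))

lemma d_ext (hUV : U ≤ V) (x : 𝒬 U) :
    diff H V (ext hUV x) = ext hUV (diff H U x) :=
  J_injective (by rw [J_d, J_ext, J_ext, J_d])

lemma disjoint (hUV : Disjoint U V) (x : 𝒬 U) (y : 𝒬 V) :
    bra (psMap I) (J U x) (J V y) = 0 := coefW_ext fun n => by
  rw [coefW_bra, map_zero]
  refine Finset.sum_eq_zero fun p _ => ?_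
  rw [coefW_J, coefW_J]
  exact H.disjoint hUV (Tot.good _) (Tot.good _)

lemma lap_lap (x : 𝒬 U) : lap (psMap I) (lap (psMap I) (J U x)) = 0 :=
  coefW_ext fun n => by rw [coefW_lap, coefW_lap, coefW_J, H.lap_lap, map_zero]

lemma der_lap (x : 𝒬 U) :
    der (LinearMap.pi fun x => psMap (evalAt L x)) (lap (psMap I) (J U x)) =
      -lap (psMap I) (der (LinearMap.pi fun x => psMap (evalAt L x)) (J U x)) :=
  coefW_ext fun n => by rw [map_neg, coefW_der, coefW_lap, coefW_lap, coefW_der, coefW_J, H.der_lap]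

/-- The quantum model. -/
def quantum :
    WordModel.{uM, max uK uM uE} 𝕜 ConvComplex.IsFormal M 𝕏 𝕜⟦X⟧ where
  h := PowerSeries.X
  L := LinearMap.pi fun x => psMap (evalAt L x)
  I := psMap I
  obj := complex H
  obj_mem U := LCSum.isFormal
  J := J
  J_inj U := J_injective
  mem_deg U := mem_deg
  J_hbar U := J_hbar
  J_d U := J_d H
  ext := ext
  ext_bdd hUV := isBddLinear_formalLin _ _ _ _ (Tot.isBddLinear_ext hUV)
    (isBddLinear_of_continuous continuous_zero)
  J_ext := J_ext
  mul := mul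
  mul_bdd U := isBddBilinear_formalBil _ _ (Tot.isBddBilinear_mul U)
  J_mul U := J_mul
  one := one
  J_one U := J_one
  br := br H
  br_bdd U := isBddBilinear_formalBil _ _ (Tot.isBddBilinear_br H)
  J_br U := J_br H
  disjoint := disjoint H
  lap_lap U := lap_lap H
  der_lap U := der_lap H
  cosheaf U 𝒰 h𝒰 Z hZ φ hφ hφ' := by
    obtain ⟨ψ, hψ, hd, hh, h⟩ := exists_glue h𝒰 hZ φ (fun W => (hφ W).bdd) (fun W => (hφ W).deg)
      (fun W => (hφ W).hbar) hφ'
    refine ⟨ψ, ⟨⟨hψ, hd, LinearMap.congr_fun (f := ψ.comp (diff H U)) (g := Z.d.comp ψ)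
      (hom_ext_cover h𝒰 hZ (s := 1) (fun j x hx => hd _ _ ((complex H U).d_deg j x hx))
        (fun j x hx => Z.d_deg j _ (hd j x hx)) (fun x => ?_) (fun x => ?_) fun W y => ?_), hh⟩,
      h⟩, fun ψ' h' => hom_ext_cover h𝒰 hZ (s := 0) (fun j x hx => ?_) (fun j x hx => ?_)
        h'.1.hbar hh fun W y => (h'.2 W y).trans (h W y).symm⟩
    · exact (congrArg ψ ((complex H U).hbar_d x).symm).trans (hh _)
    · exact (congrArg Z.d (hh x)).trans (Z.hbar_d _).symm
    · refine (congrArg ψ (d_ext H _ y)).trans ((h W _).trans (((hφ W).d y).trans ?_))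
      exact congrArg Z.d (h W y).symm
    · exact (add_zero j).symm ▸ h'.1.deg j x hx
    · exact (add_zero j).symm ▸ hd j x hx

end QTot

/-! ## Verification of the universal properties -/

lemma Tot.functional_eq_zero {Λ : 𝒮 U →ₗ[𝕜] 𝕜} (hΛ : IsBddLinear Λ)
    (h : ∀ x, IsGen (𝓛 U) (Tot.J U x) → Λ x = 0) : Λ = 0 := by
  have key : ∀ (n k : ℕ) (f : 𝒯 (Fin n ⊕ Fin k) U), Λ (Tot.mk f) = 0 := by
    intro n k
    refine LinearMap.congr_fun (f := Λ.comp Tot.mk)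
      (TestTensors.eq_zero_of_products _ (fun B hB => ?_) fun u hu f hf => ?_)
    · have h1 := hΛ _ (Tot.bounded_of_good (x := fun f : B => Tot.mk f.1) (by
        simp only [Tot.J_mk]
        exact IsGoodFam.word (IsTTFam.of_isBddFamily hB)))
      obtain ⟨R, hR⟩ := (NormedSpace.isVonNBounded_iff' 𝕜).1 h1
      exact ⟨R, fun f hf => hR _ (mem_image_of_mem _ ⟨⟨f, hf⟩, rfl⟩)⟩
    · refine h _ ?_
      rw [Tot.J_mk, show f.1 = prodFun (fun i => u (.inl i)) fun i => u (.inr i) from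
        hf.trans (funext fun v => Fintype.prod_sum_type _), word_prodFun]
      exact isGen_gens (fun i => hu _) fun i => hu _
  refine LinearMap.ext fun x => ?_
  obtain ⟨N, hN⟩ := (Tot.good (α := Unit) x).bound
  have h1 := (Tot.good x).eq_sum hN ()
  rw [show x = ∑ k ∈ Finset.range N, ∑ n ∈ Finset.range N,
      ((n.factorial * k.factorial : ℕ) : 𝕜)⁻¹ •
        Tot.mk ⟨_, ((Tot.good (α := Unit) x).fam n k).mem ()⟩ from Tot.J_injective <| h1.trans <| by
    simp only [map_sum, map_smul, Tot.J_mk]]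
  simp only [map_sum, map_smul, key, smul_zero, Finset.sum_const_zero, LinearMap.zero_apply]

lemma eq_top_of_functionals {A : Type*} [AddCommGroup A] [Module 𝕜 A] [TopologicalSpace A]
    [PolynormableSpace 𝕜 A] {S : Submodule 𝕜 A} (hS : IsClosed (S : Set A))
    (h : ∀ f : A →L[𝕜] 𝕜, (∀ x ∈ S, f x = 0) → f = 0) : S = ⊤ := by
  let : Module ℝ A := Module.compHom A (algebraMap ℝ 𝕜)
  have : IsScalarTower ℝ 𝕜 A := ⟨fun r c x => by rw [Algebra.smul_def, mul_smul]; rfl⟩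
  have hw := PolynormableSpace.withSeminorms 𝕜 A
  have := hw.topologicalAddGroup
  have := hw.continuousSMul
  have := hw.toLocallyConvexSpace
  by_contra hne
  obtain ⟨x, hx⟩ : ∃ x, x ∉ S := by
    by_contra! hx
    exact hne (Submodule.eq_top_iff'.2 hx)
  obtain ⟨f, u, hu, hux⟩ := RCLike.geometric_hahn_banach_closed_point (𝕜 := 𝕜) (s := (S : Set A))
    (S.restrictScalars ℝ).convex hS hx
  have hf : ∀ y ∈ S, f y = 0 := fun y hy => by
    by_contra h0
    have h1 := hu _ (S.smul_mem ((u : 𝕜) / f y) hy)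
    rw [map_smul, smul_eq_mul, div_mul_cancel₀ _ h0, RCLike.ofReal_re] at h1
    exact lt_irrefl _ h1
  have h0 := hu 0 S.zero_mem
  rw [map_zero, map_zero] at h0
  rw [h f hf, _root_.zero_apply, map_zero] at hux
  exact lt_asymm h0 hux

namespace Tot

variable {u : TotalSpace F E → 𝕜}

/-- The linear generators of degree `0`. -/
def gen₀ (hu : u ∈ 𝓛 U) : 𝒮 U :=
  mk (n := 1) (k := 0) ⟨fun v => u (v default), (LinFuns.isTTFam (α := Unit) hu).mem ()⟩

/-- The linear generators of degree `-1`. -/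
def gen₁ (hu : u ∈ 𝓛 U) : 𝒮 U :=
  mk (n := 0) (k := 1) ⟨fun v => u (v default), (LinFuns.isTTFam (α := Unit) hu).mem ()⟩

lemma J_gen₀ (hu : u ∈ 𝓛 U) : J U (gen₀ hu) = genE u :=
  (J_mk _).trans <| (congrArg (word 1 0) <| funext fun v => (by simp [prodFun]; rfl :
    u (v default) = prodFun (fun _ => u) Fin.elim0 v)).trans <|
    (word_prodFun _ _).trans (by simp [gens])

lemma J_gen₁ (hu : u ∈ 𝓛 U) : J U (gen₁ hu) = genO u :=
  (J_mk _).trans <| (congrArg (word 0 1) <| funext fun v => (by simp [prodFun]; rfl :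
    u (v default) = prodFun Fin.elim0 (fun _ => u) v)).trans <|
    (word_prodFun _ _).trans (by simp [gens])

lemma gen_induction {p : 𝒮 U → Prop} (h1 : p (one U))
    (hadd : ∀ x y, p x → p y → p (x + y)) (hsmul : ∀ (c : 𝕜) x, p x → p (c • x))
    (h₀ : ∀ u (hu : u ∈ 𝓛 U) x, p x → p (mul U (gen₀ hu) x))
    (h₁ : ∀ u (hu : u ∈ 𝓛 U) x, p x → p (mul U (gen₁ hu) x))
    (x : 𝒮 U) (hx : IsGen (𝓛 U) (J U x)) : p x := by
  have key : ∀ G, IsGen (𝓛 U) G → ∃ y : 𝒮 U, J U y = G ∧ p y := by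
    intro G hG
    induction hG with
    | one => exact ⟨_, J_one, h1⟩
    | add _ _ _ _ hF hG =>
      obtain ⟨y, rfl, hy⟩ := hF
      obtain ⟨z, rfl, hz⟩ := hG
      exact ⟨_, map_add _ _ _, hadd _ _ hy hz⟩
    | smul c _ _ hF =>
      obtain ⟨y, rfl, hy⟩ := hF
      exact ⟨_, map_smul _ _ _, hsmul c _ hy⟩
    | genE u _ hu _ hF =>
      obtain ⟨y, rfl, hy⟩ := hF
      exact ⟨_, (J_mul _ _).trans (by rw [J_gen₀]), h₀ u hu _ hy⟩
    | genO u _ hu _ hF =>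
      obtain ⟨y, rfl, hy⟩ := hF
      exact ⟨_, (J_mul _ _).trans (by rw [J_gen₁]), h₁ u hu _ hy⟩
  obtain ⟨y, hy, h⟩ := key _ hx
  rwa [← J_injective hy]

lemma eq_top {A : Submodule 𝕜 (𝒮 U)} (hA : IsClosed (A : Set (𝒮 U)))
    (h1 : one U ∈ A) (hmul : ∀ x ∈ A, ∀ y ∈ A, mul U x y ∈ A)
    (h₀ : ∀ u (hu : u ∈ 𝓛 U), gen₀ hu ∈ A)
    (h₁ : ∀ u (hu : u ∈ 𝓛 U), gen₁ hu ∈ A) : A = ⊤ :=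
  eq_top_of_functionals hA fun f hf => ContinuousLinearMap.coe_injective <|
    functional_eq_zero (isBddLinear_of_continuous f.continuous) fun x hx => hf x <|
      gen_induction (p := (· ∈ A)) h1 (fun _ _ => A.add_mem) (fun c _ => A.smul_mem c)
        (fun u hu x => hmul _ (h₀ u hu) x) (fun u hu x => hmul _ (h₁ u hu) x) x hx

lemma eq_zero_of_derivation {D : 𝒮 U →ₗ[𝕜] 𝒮 U} (hD : IsBddLinear D)
    (hmul : ∀ i, ∀ x ∈ deg 𝕜 𝒱ₛ U i, ∀ y,
      D (mul U x y) = mul U (D x) y + sgn i • mul U x (D y))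
    (h1 : D (one U) = 0) (h₀ : ∀ u (hu : u ∈ 𝓛 U), D (gen₀ hu) = 0)
    (h₁ : ∀ u (hu : u ∈ 𝓛 U), D (gen₁ hu) = 0) : D = 0 := by
  refine LinearMap.ext fun x => J_injective (WordFun.ext fun v w => ?_)
  let Λ : 𝒮 U →ₗ[𝕜] 𝕜 :=
    { toFun := fun x => J U (D x) v w
      map_add' := fun x y => by rw [map_add, map_add]; rfl
      map_smul' := fun c x => by rw [map_smul, map_smul]; rfl }
  refine (LinearMap.congr_fun (f := Λ) (functional_eq_zero (fun S hS => ?_) fun x hx => ?_) x).trans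
    (congrFun (congrFun (map_zero (J U)) v) w).symm
  · obtain ⟨R, hR⟩ := (isGoodFam (hD S hS)).bound_apply v w
    refine (NormedSpace.isVonNBounded_iff' 𝕜).2 ⟨R, ?_⟩
    rintro _ ⟨x, hx, rfl⟩
    exact hR ⟨_, mem_image_of_mem D hx⟩
  · have : D x = 0 := gen_induction (p := fun x => D x = 0) h1
      (fun x y hx hy => by rw [map_add, hx, hy, add_zero])
      (fun c x hx => by rw [map_smul, hx, smul_zero])
      (fun u hu x hx => by
        rw [hmul _ (gen₀ hu) (lof_mem_deg _ _), h₀, hx, map_zero, map_zero, smul_zero, add_zero]; rfl)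
      (fun u hu x hx => by
        rw [hmul _ (gen₁ hu) (lof_mem_deg _ _), h₁, hx, map_zero, map_zero, smul_zero, add_zero]; rfl)
      x hx
    exact congrFun (congrFun ((congrArg (J U) this).trans (map_zero _)) v) w

end Tot

variable {u t : TotalSpace F E → 𝕜}

namespace Tot

lemma exists_mk_one : ∃ f : 𝒯 (Fin 0 ⊕ Fin 0) U, (∀ v, f.1 v = 1) ∧
    mk f = one U :=
  ⟨⟨fun _ => 1, fun c => contDiffOn_const, fun v i => isEmptyElim i, ∅, isCompact_empty,
    empty_subset _, fun v ⟨i, hi⟩ => isEmptyElim i⟩, fun _ => rfl,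
    J_injective <| (J_mk (n := 0) (k := 0) _).trans <| Eq.trans (by
      have := word_prodFun (K := 𝕜) (X := 𝕏) (n := 0) (k := 0) Fin.elim0 Fin.elim0
      simp only [gens, List.ofFn_zero, List.prod_nil, mul_one] at this
      rw [← this]
      exact congrArg (word 0 0) (funext fun v => by simp [prodFun])) J_one.symm⟩

lemma exists_mk_mul (f : 𝒯 (Fin n ⊕ Fin k) U)
    (f' : 𝒯 (Fin n' ⊕ Fin k') U) :
    ∃ h : 𝒯 (Fin (n + n') ⊕ Fin (k + k')) U, (∀ v, h.1 v = extProd f.1 f'.1 v) ∧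
      mul U (mk f) (mk f') = mk h :=
  ⟨⟨extProd f.1 f'.1, ((IsTTFam.of_mem (α := Unit) f.2).extProd (IsTTFam.of_mem f'.2)).mem ()⟩,
    fun _ => rfl, J_injective <| by rw [J_mul, J_mk, J_mk, J_mk, word_mul_word]⟩

lemma exists_mk_ext (hUV : U ≤ V) (f : 𝒯 (Fin n ⊕ Fin k) U) :
    ∃ h : 𝒯 (Fin n ⊕ Fin k) V, h.1 = f.1 ∧ ext hUV (mk f) = mk h :=
  ⟨⟨f.1, ((IsTTFam.of_mem (α := Unit) f.2).mono hUV).mem ()⟩, rfl,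
    J_injective <| by rw [J_ext, J_mk, J_mk]⟩

variable (H : IsFieldTheory d L I)

include H

lemma lap_mul {i : ℤ} {x : 𝒮 U}
    (hx : x ∈ deg 𝕜 𝒱ₛ U i) (y : 𝒮 U) :
    lap H U (mul U x y) = mul U (lap H U x) y + sgn i • mul U x (lap H U y) + br H U x y :=
  J_injective <| by
    have h : J U (sgn i • mul U x (lap H U y)) = sgn i • (J U x * WordFun.lap I (J U y)) := by
      rw [← J_lap H, ← J_mul]
      rcases Int.units_eq_one_or (sgn i) with h | h <;> rw [h] <;> simp
    rw [J_lap, J_mul, ((mem_deg_iff _ _).1 hx).lap_mul, map_add, map_add, h, J_mul, J_lap, J_br]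

lemma lap_one : lap H U (one U) = 0 :=
  J_injective (by rw [J_lap, J_one, WordFun.lap_one, map_zero])

lemma lap_gen₀ (hu : u ∈ 𝓛 U) : lap H U (gen₀ hu) = 0 :=
  J_injective (by rw [J_lap, J_gen₀, lap_genE, map_zero])

lemma lap_gen₁ (hu : u ∈ 𝓛 U) : lap H U (gen₁ hu) = 0 :=
  J_injective (by rw [J_lap, J_gen₁, lap_genO, map_zero])

lemma der_gen₁ (hu : u ∈ 𝓛 U) (ht : t ∈ 𝓛 U) (h : L u = t) :
    der H U (gen₁ hu) = gen₀ ht :=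
  J_injective (by rw [J_der, J_gen₁, J_gen₀, der_genO, h])

lemma br_gen (hu : u ∈ 𝓛 U) (ht : t ∈ 𝓛 U) :
    br H U (gen₁ hu) (gen₀ ht) = I (fun p => u p.1 * t p.2) • one U :=
  J_injective (by rw [J_br, J_gen₁, J_gen₀, bra_genO_genE, map_smul, J_one])

lemma br_gen₁ (hu : u ∈ 𝓛 U) (ht : t ∈ 𝓛 U) :
    br H U (gen₁ hu) (gen₁ ht) = 0 :=
  J_injective (by rw [J_br, J_gen₁, J_gen₁, bra_genO_genO, map_zero])

end Tot

namespace QTot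

variable (H : IsFieldTheory d L I)

include H

lemma diff_const (x : 𝒮 U) :
    diff H U (const x) = const (Tot.der H U x) + hbar (const (Tot.lap H U x)) :=
  LCSum.coef_ext fun n => by
    rw [coef_diff, map_add, coef_hbar, coef_const, coef_const]
    rcases n with _ | _ | n <;> simp [hshift, coef_const]

lemma mFun_const {ι : Type} [Fintype ι] [LinearOrder ι] {U : ι → Opens M}
    (hV : ∀ i, U i ≤ V) (a : ∀ i, 𝒮 (U i)) :
    ((quantum H).mFun (U := U) hV (fun i => const (a i)) : 𝒬 V) =
      const (𝕜 := 𝕜) (V := 𝒱ₛ V) ((Tot.classical H).mFun (U := U) hV a) := by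
  have key : ∀ l : List ι, (l.map fun i => ext (hV i) (const (a i))).foldr
      (fun x y => mul V x y) (one V) =
      const ((l.map fun i => Tot.ext (hV i) (a i)).foldr (fun x y => Tot.mul V x y) (Tot.one V)) := by
    intro l
    induction l with
    | nil => rfl
    | cons i l ih => rw [List.map_cons, List.foldr_cons, ih, ext_const, mul, formalBil_const]; rfl
  exact key _

end QTot

namespace IsFieldTheory

variable (H : IsFieldTheory d L I)

include H

lemma isPolyvectorAlgebra : IsPolyvectorAlgebra (d := d) (F := F) (E := E) (Tot.classical H).toBD
    fun U k => degEquiv (𝕜 := 𝕜) (V := 𝒱ₛ U) k where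
  pos U j hj := deg_eq_bot hj
  one U := Tot.exists_mk_one
  mul U n k n' k' f f' := Tot.exists_mk_mul f f'
  ext U V hUV n k f := by
    obtain ⟨h, h1, h2⟩ := Tot.exists_mk_ext hUV f
    exact ⟨h, h1, ((Tot.classical H).ext_eq hUV _).trans h2⟩

lemma isBVLaplacian (U : Opens M) {A : Set (𝒮 U)}
    (hA : ∀ x ∈ A, ∃ u, ∃ hu : u ∈ 𝓛 U, x = Tot.gen₀ hu ∨ x = Tot.gen₁ hu) :
    IsBVLaplacian (Tot.classical H).toBD U A (Tot.lap H U) where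
  bdd := Tot.isBddLinear_lap H
  deg := Tot.lap_deg H
  mul i x hx y := Tot.lap_mul H hx y
  one := Tot.lap_one H
  linear x hx := by
    obtain ⟨u, hu, rfl | rfl⟩ := hA x hx
    exacts [Tot.lap_gen₀ H hu, Tot.lap_gen₁ H hu]

lemma isBVLaplacian_unique (U : Opens M) {A : Set (𝒮 U)}
    (hA : ∀ u (hu : u ∈ 𝓛 U), Tot.gen₀ hu ∈ Submodule.span 𝕜 A ∧
      Tot.gen₁ hu ∈ Submodule.span 𝕜 A) {Δ Δ' : 𝒮 U →ₗ[𝕜] 𝒮 U}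
    (h : IsBVLaplacian (Tot.classical H).toBD U A Δ)
    (h' : IsBVLaplacian (Tot.classical H).toBD U A Δ') : Δ' = Δ := by
  have hs : ∀ x ∈ Submodule.span 𝕜 A, (Δ' - Δ) x = 0 := fun x hx =>
    (Submodule.span_le (p := LinearMap.ker (Δ' - Δ))).2 (fun x hx => by
      change Δ' x - Δ x = 0
      exact (congrArg₂ (· - ·) (h'.linear x hx) (h.linear x hx)).trans (sub_zero _)) hx
  refine sub_eq_zero.1 (Tot.eq_zero_of_derivation (fun S hS => ?_) (fun i x hx y => ?_) ?_
    (fun u hu => hs _ (hA u hu).1) fun u hu => hs _ (hA u hu).2)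
  · have : IsTopologicalAddGroup (𝒮 U) :=
      (PolynormableSpace.withSeminorms 𝕜 (𝒮 U)).topologicalAddGroup
    have h1 : Bornology.IsVonNBounded 𝕜 (Δ '' S) := h.bdd S hS
    have h2 : Bornology.IsVonNBounded 𝕜 (Δ' '' S) := h'.bdd S hS
    refine (h2.sub h1).subset ?_
    rintro _ ⟨x, hx, rfl⟩
    exact Set.sub_mem_sub (mem_image_of_mem _ hx) (mem_image_of_mem _ hx)
  · have e : Δ' (Tot.mul U x y) = Tot.mul U (Δ' x) y + sgn i • Tot.mul U x (Δ' y) + Tot.br H U x y :=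
      h'.mul i x hx y
    have e' : Δ (Tot.mul U x y) = Tot.mul U (Δ x) y + sgn i • Tot.mul U x (Δ y) + Tot.br H U x y :=
      h.mul i x hx y
    rw [LinearMap.sub_apply, LinearMap.sub_apply, LinearMap.sub_apply, e, e', map_sub, map_sub,
      LinearMap.sub_apply, smul_sub]
    abel
  · exact (congrArg₂ (· - ·) h'.one h.one).trans (sub_zero _)

lemma isBDQuantization : IsBDQuantization (Tot.classical H).toBD (QTot.quantum H).toBD
    fun U => Tot.lap H U := by
  exact ⟨fun U => const, fun U j => formalEquiv j, fun U => formalEquiv_single,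
    fun U => hbar_formalEquiv, fun U => rfl, fun U => formalBil_const _ Tot.mul_deg,
    fun U => formalBil_const _ (Tot.br_deg H), fun U V hU hV a => QTot.mFun_const H hV a,
    fun U => QTot.diff_const H⟩

end IsFieldTheory

variable [∀ x, IsTopologicalAddGroup (E x)] [∀ x, ContinuousSMul ℝ (E x)]
  {b : ∀ x, E x →L[ℝ] E x →L[ℝ] ℝ} {p : M} {y : EuclideanSpace ℝ (Fin d)}
  {P : Cₛ^∞⟮𝓡 d; F, E⟯ →ₗ[ℝ] Cₛ^∞⟮𝓡 d; F, E⟯}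

/-! ## The fibre pairing in bundle charts -/

variable (F E) in
/-- The linear frame of `E` over the chart domain at `p`. -/
def frame (p x : M) : F →ₗ[ℝ] E x := (𝔱 p).symmₗ ℝ x

lemma bundleChart_symm (hy : y ∈ 𝔇 p) (ξ : F) : (𝔲 p).symm (y, ξ) =
    ⟨(𝔠 p).symm y, frame F E p ((𝔠 p).symm y) ξ⟩ := by
  rw [bundleChart, FiberBundle.extChartAt, frame, Trivialization.symmₗ_apply _ hy.2]
  exact ((𝔱 p).mk_symm hy.2 ξ).symm

lemma frame_apply {x : M} (hx : x ∈ (𝔱 p).baseSet) (v : E x) :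
    frame F E p x (𝔱 p ⟨x, v⟩).2 = v := by
  rw [frame, Trivialization.symmₗ_apply _ hx]
  exact (𝔱 p).symm_apply_apply_mk hx v

lemma triv_frame {x : M} (hx : x ∈ (𝔱 p).baseSet) (ξ : F) :
    (𝔱 p ⟨x, frame F E p x ξ⟩).2 = ξ := by
  rw [frame, Trivialization.symmₗ_apply _ hx, (𝔱 p).apply_mk_symm hx]

lemma frame_injective {x : M} (hx : x ∈ (𝔱 p).baseSet) :
    Function.Injective (frame F E p x) := fun ξ η h => by
  rw [← triv_frame hx ξ, h, triv_frame hx]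

lemma frame_localSection (s : ∀ x, E x) (hy : y ∈ 𝔇 p) :
    frame F E p _ (localSection F E p s y) = s ((𝔠 p).symm y) :=
  frame_apply hy.2 _

lemma mem_localDomain {x : M} (hx : x ∈ chartDom d F E p) :
    𝔠 p x ∈ 𝔇 p := by
  have h : x ∈ (𝔠 p).source := by rw [extChartAt_source]; exact hx.1
  refine ⟨(𝔠 p).map_source h, ?_⟩
  rw [mem_preimage, (𝔠 p).left_inv h]
  exact hx.2

lemma symm_mem_chartDom (hy : y ∈ 𝔇 p) :
    (𝔠 p).symm y ∈ chartDom d F E p := by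
  refine ⟨?_, hy.2⟩
  rw [← extChartAt_source (𝓡 d)]
  exact (𝔠 p).map_target hy.1

lemma contDiffOn_localSection (s : Cₛ^∞⟮𝓡 d; F, E⟯) (p : M) :
    ContDiffOn ℝ ∞ (localSection F E p s) (𝔇 p) := by
  rw [← contMDiffOn_iff_contDiffOn]
  have h1 : ContMDiffOn (𝓡 d) 𝓘(ℝ, F) ∞ (fun x => (𝔱 p ⟨x, s x⟩).2)
      (𝔱 p).baseSet := fun x hx =>
    ((𝔱 p).contMDiffWithinAt_section _ hx).1 (s.contMDiff x).contMDiffWithinAt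
  exact h1.comp ((contMDiffOn_extChartAt_symm p).mono inter_subset_left) fun y hy => hy.2

lemma contMDiff_of_localSection {s : ∀ x, E x}
    (h : ∀ p, ContDiffOn ℝ ∞ (localSection F E p s) (𝔇 p)) :
    ContMDiff (𝓡 d) ((𝓡 d).prod 𝓘(ℝ, F)) ∞ fun x => TotalSpace.mk' F x (s x) := by
  intro p
  rw [contMDiffAt_section]
  have h1 := ((contMDiffOn_iff_contDiffOn.2 (h p)).contMDiffAt ((isOpen_localDomain p).mem_nhds
    (mem_localDomain (mem_chartDom p)))).comp p (contMDiffAt_extChartAt (n := ∞))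
  refine h1.congr_of_eventuallyEq ?_
  filter_upwards [(isOpen_chartDom (d := d) (F := F) (E := E) p).mem_nhds (mem_chartDom p)] with x hx
  simp only [Function.comp_apply, localSection]
  rw [(𝔠 p).left_inv (by rw [extChartAt_source]; exact hx.1)]

variable (F b) in
/-- The expression of the fibre pairing in the bundle chart at `p`. -/
def pairCoord (p : M) (y : 𝔼) : F →L[ℝ] F →L[ℝ] ℝ :=
  LinearMap.toContinuousLinearMap <|
    (LinearMap.toContinuousLinearMap (𝕜 := ℝ) (E := F) (F' := ℝ)).toLinearMap ∘ₗ LinearMap.mk₂ ℝ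
      (fun η ξ => b ((𝔠 p).symm y) (frame F E p _ ξ) (frame F E p _ η))
      (fun η ζ ξ => by rw [map_add, map_add]) (fun c η ξ => by rw [map_smul, map_smul])
      (fun η ξ ζ => by rw [map_add, map_add]; rfl) (fun c η ξ => by rw [map_smul, map_smul]; rfl)

lemma pairCoord_apply (η ξ : F) : pairCoord F b p y η ξ =
    b ((𝔠 p).symm y) (frame F E p _ ξ) (frame F E p _ η) := rfl

lemma contDiffOn_pairCoord (hb : IsSmoothForm (d := d) F b) (p : M) :
    ContDiffOn ℝ ∞ (pairCoord (d := d) F b p) (𝔇 p) := by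
  refine contDiffOn_clm_apply.2 fun η => contDiffOn_clm_apply.2 fun ξ => ?_
  rw [← contMDiffOn_iff_contDiffOn]
  have h0 : ContMDiffOn 𝓘(ℝ, 𝔼) (𝓡 d) ∞ (𝔠 p).symm
      (𝔇 p) := (contMDiffOn_extChartAt_symm p).mono inter_subset_left
  have h1 : ∀ ζ : F, ContMDiffOn 𝓘(ℝ, 𝔼) ((𝓡 d).prod 𝓘(ℝ, F)) ∞
      (fun y => TotalSpace.mk' F ((𝔠 p).symm y)
        (frame F E p ((𝔠 p).symm y) ζ)) (𝔇 p) := by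
    intro ζ
    have h2 : ContMDiffOn 𝓘(ℝ, 𝔼 × F) ((𝓡 d).prod 𝓘(ℝ, F)) ∞
      (𝔲 p).symm (𝔲 p).target :=
      contMDiffOn_extChartAt_symm (I := (𝓡 d).prod 𝓘(ℝ, F)) (⟨p, 0⟩ : 𝕏)
    have h3 : ContMDiff 𝓘(ℝ, 𝔼) 𝓘(ℝ, 𝔼 × F) ∞
        fun y : 𝔼 => (y, ζ) :=
      contMDiff_iff_contDiff.2 (contDiff_id.prodMk contDiff_const)
    refine (h2.comp h3.contMDiffOn fun y hy => ?_).congr fun y hy => (bundleChart_symm hy ζ).symm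
    rw [mem_preimage, bundleChart_target]
    exact ⟨hy, mem_univ _⟩
  have h4 : ContMDiffOn 𝓘(ℝ, 𝔼) ((𝓡 d).prod 𝓘(ℝ, ℝ)) ∞
      (fun y => TotalSpace.mk' ℝ (E := Bundle.Trivial M ℝ) ((𝔠 p).symm y)
        (pairCoord F b p y η ξ)) (𝔇 p) := by
    refine ContMDiffOn.clm_bundle_apply₂ (F₁ := F) (F₂ := F) ?_ (h1 ξ) (h1 η)
    exact hb.comp_contMDiffOn h0
  intro y hy
  have := h4 y hy
  simp only [contMDiffWithinAt_totalSpace] at this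
  exact this.2

variable (F b) in
/-- The inverse of the fibre pairing in the bundle chart at `p`. -/
def raise (p : M) (y : 𝔼) : (F →L[ℝ] ℝ) →L[ℝ] F :=
  (pairCoord F b p y).inverse

lemma exists_equiv_pairCoord (hb' : ∀ x, ∀ v : E x, v ≠ 0 → ∃ w, b x v w ≠ 0)
    (hy : y ∈ 𝔇 p) : ∃ e : F ≃L[ℝ] (F →L[ℝ] ℝ), (e : F →L[ℝ] F →L[ℝ] ℝ) =
      pairCoord F b p y := by
  have hr : Module.finrank ℝ (F →L[ℝ] ℝ) = Module.finrank ℝ F :=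
    (LinearMap.toContinuousLinearMap (𝕜 := ℝ) (E := F) (F' := ℝ)).symm.finrank_eq.trans
      Subspace.dual_finrank_eq
  have h1 : Function.Injective (pairCoord F b p y).flip := by
    refine (injective_iff_map_eq_zero _).2 fun ξ hξ => ?_
    by_contra h
    obtain ⟨w, hw⟩ := hb' _ (frame F E p _ ξ) fun h0 => h (frame_injective hy.2
      (h0.trans (map_zero _).symm))
    refine hw ?_
    rw [← frame_apply hy.2 w]
    exact DFunLike.congr_fun hξ _
  have h2 : Function.Surjective (pairCoord F b p y).flip :=
    (LinearMap.injective_iff_surjective_of_finrank_eq_finrank hr.symm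
      (f := (pairCoord F b p y).flip.toLinearMap)).1 h1
  have h3 : Function.Injective (pairCoord F b p y) := by
    refine (injective_iff_map_eq_zero _).2 fun η hη => ?_
    refine (Module.forall_dual_apply_eq_zero_iff ℝ η).1 fun f => ?_
    obtain ⟨ξ, hξ⟩ := h2 (LinearMap.toContinuousLinearMap f)
    have := DFunLike.congr_fun hξ η
    rw [ContinuousLinearMap.flip_apply, hη] at this
    exact this.symm
  exact ⟨(LinearEquiv.ofInjectiveOfFinrankEq (pairCoord F b p y).toLinearMap h3
    hr.symm).toContinuousLinearEquiv, by ext; rfl⟩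

lemma pairCoord_raise (hb' : ∀ x, ∀ v : E x, v ≠ 0 → ∃ w, b x v w ≠ 0)
    (hy : y ∈ 𝔇 p) (l : F →L[ℝ] ℝ) : pairCoord F b p y (raise F b p y l) = l := by
  obtain ⟨e, he⟩ := exists_equiv_pairCoord hb' hy
  rw [raise, ← he, ContinuousLinearMap.inverse_equiv]
  exact e.apply_symm_apply l

lemma raise_pairCoord (hb' : ∀ x, ∀ v : E x, v ≠ 0 → ∃ w, b x v w ≠ 0)
    (hy : y ∈ 𝔇 p) (η : F) : raise F b p y (pairCoord F b p y η) = η := by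
  obtain ⟨e, he⟩ := exists_equiv_pairCoord hb' hy
  rw [raise, ← he, ContinuousLinearMap.inverse_equiv]
  exact e.symm_apply_apply η

lemma contDiffOn_raise (hb : IsSmoothForm (d := d) F b)
    (hb' : ∀ x, ∀ v : E x, v ≠ 0 → ∃ w, b x v w ≠ 0) (p : M) :
    ContDiffOn ℝ ∞ (raise (d := d) F b p) (𝔇 p) := by
  intro y hy
  obtain ⟨e, he⟩ := exists_equiv_pairCoord hb' hy
  have := (contDiffAt_map_inverse (n := ∞) e)
  rw [he] at this
  exact this.comp_contDiffWithinAt y (contDiffOn_pairCoord hb p y hy)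

/-! ## Test sections as linear functions, and the operator of the equation of motion -/

lemma LinFuns.mem_iff {u : 𝕏 → 𝕜} : u ∈ 𝓛 U ↔
    (∀ p, ContDiffOn ℝ ∞ (fun z : 𝔼 × F => u ((𝔲 p).symm z))
      (𝔇 p ×ˢ univ)) ∧
    (∀ (x : M) (v w : E x) (c : ℝ), u ⟨x, v + c • w⟩ = u ⟨x, v⟩ + c • u ⟨x, w⟩) ∧
    ∃ K : Set M, IsCompact K ∧ K ⊆ U ∧ ∀ v : 𝕏, v.proj ∉ K → u v = 0 := by
  constructor
  · rintro ⟨h1, h2, K, hK, hKU, h3⟩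
    refine ⟨fun p => ?_, fun x v w c => ?_, K, hK, hKU, fun v hv => h3 (fun _ => v) ⟨(), hv⟩⟩
    · rw [← bundleChart_target]
      refine (h1 fun _ => ⟨p, 0⟩).comp (contDiff_pi.2 fun _ => contDiff_id).contDiffOn
        fun z hz i _ => hz
    · have := h2 (fun _ => ⟨x, 0⟩) () x v w c
      simpa [LinearMap.funLeft_apply] using this
  · rintro ⟨h1, h2, K, hK, hKU, h3⟩
    refine ⟨fun c => ?_, fun v i x s t r => ?_, K, hK, hKU, fun v ⟨i, hi⟩ => h3 _ hi⟩
    · have := h1 (c ()).proj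
      rw [← bundleChart_target] at this
      refine (this.comp (contDiff_apply ℝ _ ()).contDiffOn fun z hz => ?_).congr fun z hz => ?_
      · have := hz () (mem_univ _)
        rw [← extChartAt_eq_bundleChart]
        exact this
      · simp only [localRep, LinearMap.funLeft_apply, Function.comp_apply]
        rw [extChartAt_eq_bundleChart]
    · simpa [LinearMap.funLeft_apply] using h2 x s t r

variable (𝕜 F b) in
/-- The linear function which the fibre pairing associates with a section. -/
def pairWith (s : ∀ x, E x) (v : 𝕏) : 𝕜 := ((b v.proj v.2 (s v.proj) : ℝ) : 𝕜)

lemma pairWith_symm (s : ∀ x, E x) (hy : y ∈ 𝔇 p) (ξ : F) :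
    pairWith 𝕜 F b s ((𝔲 p).symm (y, ξ)) =
      ((pairCoord F b p y (localSection F E p s y) ξ : ℝ) : 𝕜) := by
  rw [bundleChart_symm hy, pairCoord_apply, frame_localSection s hy]
  rfl

lemma pairWith_mem (hb : IsSmoothForm (d := d) F b) (s : TestSections d F E U) :
    pairWith 𝕜 F b s.1 ∈ 𝓛 U := by
  obtain ⟨K, hK, hKU, h⟩ := s.2
  refine LinFuns.mem_iff.2 ⟨fun p => ?_, fun x v w c => ?_, K, hK, hKU, fun v hv => ?_⟩
  · have h1 : ContDiffOn ℝ ∞ (fun z : 𝔼 × F =>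
        pairCoord F b p z.1 (localSection F E p s.1 z.1) z.2) (𝔇 p ×ˢ univ) :=
      (((contDiffOn_pairCoord hb p).comp contDiffOn_fst fun z hz => hz.1).clm_apply
        ((contDiffOn_localSection s.1 p).comp contDiffOn_fst fun z hz => hz.1)).clm_apply
        contDiffOn_snd
    exact ((RCLike.ofRealCLM (K := 𝕜)).contDiff.comp_contDiffOn h1).congr fun z hz =>
      pairWith_symm s.1 hz.1 z.2
  · simp only [pairWith, map_add, map_smul, _root_.add_apply,
      _root_.smul_apply, RCLike.ofReal_add, smul_eq_mul, RCLike.ofReal_mul]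
    rw [RCLike.real_smul_eq_coe_mul]
  · simp [pairWith, h _ hv]

variable (F E) in
/-- The restriction to the fibres of a linear function, in the bundle chart at `p`. -/
def covec (p : M) (y : 𝔼) (u : 𝕏 → ℝ) : F →L[ℝ] ℝ :=
  ∑ β, u ((𝔲 p).symm (y, Module.finBasis ℝ F β)) • fibreCoord F β

lemma exists_linearMap {u : 𝕏 → 𝕜}
    (hu : ∀ (x : M) (v w : E x) (c : ℝ), u ⟨x, v + c • w⟩ = u ⟨x, v⟩ + c • u ⟨x, w⟩) (x : M) :
    ∃ l : E x →ₗ[ℝ] 𝕜, ∀ v, l v = u ⟨x, v⟩ := by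
  have h0 : u ⟨x, 0⟩ = 0 := by simpa using hu x 0 0 1
  exact ⟨{ toFun := fun v => u ⟨x, v⟩
           map_add' := fun v w => by simpa using hu x v w 1
           map_smul' := fun c w => by simpa [h0] using hu x 0 w c }, fun _ => rfl⟩

lemma covec_apply {u : 𝕏 → ℝ}
    (hu : ∀ (x : M) (v w : E x) (c : ℝ), u ⟨x, v + c • w⟩ = u ⟨x, v⟩ + c • u ⟨x, w⟩)
    (hy : y ∈ 𝔇 p) (ξ : F) :
    covec F E p y u ξ = u ⟨(𝔠 p).symm y, frame F E p _ ξ⟩ := by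
  obtain ⟨l, hl⟩ := exists_linearMap hu ((𝔠 p).symm y)
  have h1 : u ⟨(𝔠 p).symm y, frame F E p _ ξ⟩ = l (frame F E p _ ξ) := (hl _).symm
  conv_rhs => rw [h1, ← (Module.finBasis ℝ F).sum_repr ξ]
  simp only [covec, _root_.sum_apply, map_sum, _root_.smul_apply,
    map_smul, smul_eq_mul]
  refine Finset.sum_congr rfl fun β _ => ?_
  rw [bundleChart_symm hy, mul_comm, hl]
  rfl

variable (d F E) in
lemma exists_localDomain (x : M) :
    ∃ y ∈ 𝔇 x, (𝔠 x).symm y = x := by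
  have e : (𝔠 x).symm (𝔠 x x) = x := extChartAt_to_inv x
  exact ⟨𝔠 x x, ⟨mem_extChartAt_target x, by
    rw [mem_preimage, e]; exact mem_baseSet_trivializationAt F E x⟩, e⟩

lemma eq_of_forall_pair (hb' : ∀ x, ∀ v : E x, v ≠ 0 → ∃ w, b x v w ≠ 0)
    (hy : y ∈ 𝔇 p) {s t : E ((𝔠 p).symm y)}
    (h : ∀ v, b _ v s = b _ v t) : s = t := by
  rw [← frame_apply (p := p) hy.2 s, ← frame_apply (p := p) hy.2 t]
  congr 1
  rw [← raise_pairCoord hb' hy (𝔱 p ⟨_, s⟩).2,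
    ← raise_pairCoord hb' hy (𝔱 p ⟨_, t⟩).2]
  congr 1
  refine ContinuousLinearMap.ext fun ξ => ?_
  rw [pairCoord_apply, pairCoord_apply, frame_apply hy.2, frame_apply hy.2, h]

lemma exists_section (hb : IsSmoothForm (d := d) F b)
    (hb' : ∀ x, ∀ v : E x, v ≠ 0 → ∃ w, b x v w ≠ 0) {u : 𝕏 → ℝ}
    (hu : u ∈ LinFuns d ℝ F E U) : ∃ s : TestSections d F E U, u = pairWith ℝ F b s.1 := by
  obtain ⟨h1, h2, K, hK, hKU, h3⟩ := LinFuns.mem_iff.1 hu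
  have h4 : ∀ x, ∃ s : E x, ∀ v, b x v s = u ⟨x, v⟩ := by
    intro x
    obtain ⟨y, hy, e⟩ := exists_localDomain d F E x
    have : ∃ s : E ((𝔠 x).symm y), ∀ v, b _ v s = u ⟨_, v⟩ := by
      refine ⟨frame F E x _ (raise F b x y (covec F E x y u)), fun v => ?_⟩
      rw [← frame_apply (p := x) hy.2 v, ← pairCoord_apply, pairCoord_raise hb' hy,
        covec_apply h2 hy]
    rwa [e] at this
  choose s hs using h4
  have h5 : ∀ p, ∀ y ∈ 𝔇 p,
      raise F b p y (covec F E p y u) = localSection F E p s y := by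
    intro p y hy
    rw [← raise_pairCoord hb' hy (localSection F E p s y)]
    congr 1
    refine ContinuousLinearMap.ext fun ξ => ?_
    rw [covec_apply h2 hy, pairCoord_apply, frame_localSection s hy, hs]
  have h6 := contMDiff_of_localSection (d := d) (F := F) (s := s) fun p => by
    refine ContDiffOn.congr ?_ fun y hy => (h5 p y hy).symm
    refine (contDiffOn_raise hb hb' p).clm_apply ?_
    refine ContDiffOn.sum fun β _ => ContDiffOn.smul (f := fun y => u ((𝔲 p).symm
      (y, Module.finBasis ℝ F β))) (g := fun _ => fibreCoord F β) ?_ contDiffOn_const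
    exact (h1 p).comp (contDiff_id.prodMk contDiff_const).contDiffOn fun y hy => ⟨hy, mem_univ _⟩
  refine ⟨⟨⟨s, h6⟩, K, hK, hKU, fun x hx => ?_⟩, funext fun v => (hs _ _).symm⟩
  obtain ⟨y, hy, e⟩ := exists_localDomain d F E x
  have h8 : (𝔠 x).symm y ∉ K := by rwa [e]
  have h7 := eq_of_forall_pair hb' hy (s := s _) (t := 0) fun v => (hs _ v).trans (by
    rw [h3 _ h8, map_zero])
  rwa [e] at h7

lemma localSection_eq (hb' : ∀ x, ∀ v : E x, v ≠ 0 → ∃ w, b x v w ≠ 0) (s : ∀ x, E x)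
    (hy : y ∈ 𝔇 p) :
    localSection F E p s y = raise F b p y (covec F E p y (pairWith ℝ F b s)) := by
  rw [← raise_pairCoord hb' hy (localSection F E p s y)]
  congr 1
  refine ContinuousLinearMap.ext fun ξ => ?_
  rw [covec_apply (fun x v w c => ?_) hy, pairCoord_apply, frame_localSection s hy]
  · rfl
  · simp [pairWith]

/-! ## The operator of the equation of motion -/

lemma IsTTFam.clm {𝕜' : Type*} [RCLike 𝕜'] {f : α → (ι → 𝕏) → 𝕜}
    (hf : IsTTFam d U f) (A : 𝕜 →L[ℝ] 𝕜') : IsTTFam d U fun a v => A (f a v) := by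
  obtain ⟨K, hK, hKU, h⟩ := hf.supp
  refine ⟨fun a v i x s t c => ?_, ⟨K, hK, hKU, fun a v hv => ?_⟩, fun c =>
    (hf.bdd c).clm (isOpen_repDomain c) A⟩
  · rw [hf.linear a v i x s t c, map_add, map_smul]
  · exact (congrArg A (h a v hv)).trans (map_zero A)

lemma IsDifferentialOperator.eq_zero (hP : IsDifferentialOperator F E P) {K : Set M}
    (hK : IsClosed K) {s : Cₛ^∞⟮𝓡 d; F, E⟯} (h : ∀ x ∉ K, s x = 0) : ∀ x ∉ K, P s x = 0 := by
  obtain ⟨r, hr⟩ := hP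
  intro x hx
  obtain ⟨y, hy, e⟩ := exists_localDomain d F E x
  obtain ⟨a, -, ha⟩ := hr x
  have h0 : localSection F E x s =ᶠ[𝓝 y] 0 := by
    have h1 : IsOpen ((𝔠 x).target ∩ (𝔠 x).symm ⁻¹' Kᶜ) :=
      (continuousOn_extChartAt_symm x).isOpen_inter_preimage (isOpen_extChartAt_target x)
        hK.isOpen_compl
    filter_upwards [h1.mem_nhds ⟨hy.1, by rw [mem_preimage, e]; exact hx⟩,
      (isOpen_localDomain x).mem_nhds hy] with z hz hz'
    refine frame_injective hz'.2 ?_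
    rw [frame_localSection s hz', h _ hz.2]
    exact (map_zero _).symm
  have h2 := frame_localSection (P s) hy
  rw [ha s y hy, Finset.sum_eq_zero fun j _ => ?_, map_zero, e] at h2
  · exact h2.symm
  · rw [(Filter.EventuallyEq.iteratedFDeriv ℝ h0 j).eq_of_nhds, show (0 : 𝔼 → F) = fun _ => 0 from rfl,
      iteratedFDeriv_fun_zero, Pi.zero_apply, map_zero]

variable (P) in
/-- The operator as an endomorphism of the test sections. -/
def onTestSections (hP : IsDifferentialOperator F E P) (s : TestSections d F E U) :
    TestSections d F E U :=
  ⟨P s.1, by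
    obtain ⟨K, hK, hKU, h⟩ := s.2
    exact ⟨K, hK, hKU, hP.eq_zero hK.isClosed h⟩⟩

lemma exists_real_operator (hb : IsSmoothForm (d := d) F b)
    (hb' : ∀ x, ∀ v : E x, v ≠ 0 → ∃ w, b x v w ≠ 0) (P : Cₛ^∞⟮𝓡 d; F, E⟯ →ₗ[ℝ] Cₛ^∞⟮𝓡 d; F, E⟯) :
    ∃ L : (𝕏 → ℝ) →ₗ[ℝ] (𝕏 → ℝ), ∀ s : TestSections d F E ⊤,
      L (pairWith ℝ F b s.1) = pairWith ℝ F b (P s.1) := by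
  have hinj : ∀ s t : TestSections d F E ⊤, pairWith ℝ F b s.1 = pairWith ℝ F b t.1 → s = t := by
    intro s t h
    refine Subtype.ext (ContMDiffSection.ext fun x => ?_)
    obtain ⟨y, hy, e⟩ := exists_localDomain d F E x
    have := eq_of_forall_pair hb' hy (s := s.1 _) (t := t.1 _) fun v => congrFun h ⟨_, v⟩
    rwa [e] at this
  let A : TestSections d F E ⊤ →ₗ[ℝ] LinFuns d ℝ F E ⊤ :=
    { toFun := fun s => ⟨pairWith ℝ F b s.1, pairWith_mem hb s⟩
      map_add' := fun s t => Subtype.ext (funext fun v => map_add (b v.proj v.2) _ _)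
      map_smul' := fun c s => Subtype.ext (funext fun v => map_smul (b v.proj v.2) _ _) }
  have hA : Function.Bijective A := ⟨fun s t h => hinj s t (congrArg Subtype.val h), fun u => by
    obtain ⟨s, hs⟩ := exists_section hb hb' u.2
    exact ⟨s, Subtype.ext hs.symm⟩⟩
  let B : TestSections d F E ⊤ →ₗ[ℝ] (𝕏 → ℝ) :=
    { toFun := fun s => pairWith ℝ F b (P s.1)
      map_add' := fun s t => funext fun v => by
        change b v.proj v.2 (P (s.1 + t.1) v.proj) = _
        rw [map_add]; exact map_add (b v.proj v.2) _ _
      map_smul' := fun c s => funext fun v => by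
        change b v.proj v.2 (P (c • s.1) v.proj) = _
        rw [map_smul]; exact map_smul (b v.proj v.2) _ _ }
  obtain ⟨L, hL⟩ := (B.comp (LinearEquiv.ofBijective A hA).symm.toLinearMap).exists_extend
  refine ⟨L, fun s => ?_⟩
  have := LinearMap.congr_fun hL (A s)
  refine this.trans (congrArg B ?_)
  exact (LinearEquiv.ofBijective A hA).symm_apply_apply s

lemma IsTTFam.real_operator (hb : IsSmoothForm (d := d) F b)
    (hb' : ∀ x, ∀ v : E x, v ≠ 0 → ∃ w, b x v w ≠ 0) (hP : IsDifferentialOperator F E P)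
    {L : (𝕏 → ℝ) →ₗ[ℝ] (𝕏 → ℝ)}
    (hL : ∀ s : TestSections d F E ⊤, L (pairWith ℝ F b s.1) = pairWith ℝ F b (P s.1))
    {f : α → (ι → 𝕏) → ℝ} (hf : IsTTFam d U f) (i : ι) :
    IsTTFam d U fun a v => L (fun y => f a (Function.update v i y)) (v i) := by
  have hS : ∀ a v, ∃ s : TestSections d F E U,
      (fun y => f a (Function.update v i y)) = pairWith ℝ F b s.1 := fun a v =>
    exists_section hb hb' ((hf.update v i).mem a)
  have hS' : ∀ s : TestSections d F E U, L (pairWith ℝ F b s.1) = pairWith ℝ F b (P s.1) :=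
    fun s => hL ⟨s.1, by obtain ⟨K, hK, -, h⟩ := s.2; exact ⟨K, hK, subset_univ _, h⟩⟩
  refine ⟨fun a v j x s t c => ?_, ?_, fun c => ?_⟩
  · by_cases hj : j = i
    · subst hj
      obtain ⟨σ, hσ⟩ := hS a v
      simp only [Function.update_self, Function.update_idem]
      rw [hσ, hS']
      simp [pairWith]
    · have e1 : ∀ w : E x, (fun y => f a (Function.update (Function.update v j ⟨x, w⟩) i y)) =
          fun y => f a (Function.update (Function.update v i y) j ⟨x, w⟩) := fun w =>
        funext fun y => by rw [Function.update_comm hj]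
      have e2 : (fun y => f a (Function.update (Function.update v i y) j ⟨x, s + c • t⟩)) =
          (fun y => f a (Function.update (Function.update v i y) j ⟨x, s⟩)) +
          c • fun y => f a (Function.update (Function.update v i y) j ⟨x, t⟩) :=
        funext fun y => hf.linear a _ j x s t c
      simp only [Function.update_of_ne (Ne.symm hj)]
      rw [e1, e1, e1, e2, map_add, map_smul]
      rfl
  · obtain ⟨K, hK, hKU, h⟩ := hf.supp
    refine ⟨K, hK, hKU, fun a v => ?_⟩
    rintro ⟨j, hj⟩
    beta_reduce
    by_cases hij : j = i
    · subst hij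
      obtain ⟨σ, hσ⟩ := hS a v
      rw [hσ, hS']
      have h0 : ∀ x ∉ K, σ.1 x = 0 := by
        intro x hx
        obtain ⟨y, hy, e⟩ := exists_localDomain d F E x
        have hx' : (𝔠 x).symm y ∉ K := by rwa [e]
        have := eq_of_forall_pair hb' hy (s := σ.1 _) (t := 0) fun w => by
          rw [map_zero]
          refine (congrFun hσ ⟨_, w⟩).symm.trans (h a _ ⟨j, ?_⟩)
          rw [Function.update_self]
          exact hx'
        rwa [e] at this
      have := hP.eq_zero hK.isClosed h0 _ hj
      simp [pairWith, this]
    · have : (fun y => f a (Function.update v i y)) = 0 := funext fun y => h a _ ⟨j, by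
        rwa [Function.update_of_ne hij]⟩
      rw [this, map_zero]; rfl
  · obtain ⟨r, hr⟩ := hP
    set p := (c i).proj with hp
    obtain ⟨A, hA, hAP⟩ := hr p
    have hO := isOpen_localDomain (d := d) (F := F) (E := E) p
    have hR := isOpen_repDomain (d := d) c
    have hW : IsOpen (𝔇 p ×ˢ repDomain d c) := hO.prod hR
    have hci : 𝔟 (c i) = 𝔲 p :=
      extChartAt_eq_bundleChart _
    have hzi : ∀ z ∈ repDomain d c, (z i).1 ∈ 𝔇 p := fun z hz => by
      have : z i ∈ (𝔟 (c i)).target := hz i (mem_univ _)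
      rw [hci, bundleChart_target] at this
      exact this.1
    have hfst : ContDiff ℝ ∞ fun z : ι → 𝔼 × F => (z i).1 :=
      contDiff_fst.comp (contDiff_apply ℝ _ i)
    have hsnd : ContDiff ℝ ∞ fun z : ι → 𝔼 × F => (z i).2 :=
      contDiff_snd.comp (contDiff_apply ℝ _ i)
    let H : α → 𝔼 × (ι → 𝔼 × F) → F := fun a q =>
      ∑ β, localRep d c (f a) (Function.update q.2 i (q.1, Module.finBasis ℝ F β)) •
        raise F b p q.1 (fibreCoord F β)
    have hH : SB (𝔇 p ×ˢ repDomain d c) H := by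
      refine SB.sum _ (fun β _ => SB.bilin ((hf.bdd c).comp_contDiffOn hR hW
        (h := fun q => Function.update q.2 i (q.1, Module.finBasis ℝ F β)) ?_ ?_)
        (SB.of_contDiffOn hW (h := fun q => raise F b p q.1 (fibreCoord F β)) ?_) hW
        (ContinuousLinearMap.lsmul ℝ ℝ)) hW
      · refine contDiffOn_pi.2 fun j => ?_
        by_cases hj : j = i
        · subst hj; simp only [Function.update_self]; fun_prop
        · simp only [Function.update_of_ne hj]; fun_prop
      · intro q hq j _
        by_cases hj : j = i
        · subst hj
          simp only [Function.update_self]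
          rw [hci, bundleChart_target]
          exact ⟨hq.1, mem_univ _⟩
        · simp only [Function.update_of_ne hj]
          exact hq.2 j (mem_univ _)
      · exact (((contDiffOn_raise hb hb' p).comp contDiffOn_fst fun q hq => hq.1).clm_apply
          contDiffOn_const)
    have hD : ∀ j, SB (repDomain d c) fun a z => iteratedFDeriv ℝ j (fun y => H a (y, z)) (z i).1 := by
      intro j
      refine (((hH.iteratedFDeriv hW j).comp_contDiffOn hW hR (h := fun z => ((z i).1, z))
        (hfst.prodMk contDiff_id).contDiffOn fun z hz => ⟨hzi z hz, hz⟩).clm hR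
        (ContinuousMultilinearMap.compContinuousLinearMapL fun _ =>
          ContinuousLinearMap.inl ℝ _ _)).congr hR fun a z hz => ?_
      exact iteratedFDeriv_prod_left hW (hH.smooth a) (y := z) ⟨hzi z hz, hz⟩ j
    have hT := SB.sum (Finset.range (r + 1)) (fun j _ => SB.bilin (SB.of_contDiffOn (α := α) hR
      ((hA j).comp hfst.contDiffOn hzi)) (hD j) hR (ContinuousLinearMap.id ℝ _)) hR
    refine (SB.bilin (SB.bilin (SB.of_contDiffOn (α := α) hR ((contDiffOn_pairCoord hb p).comp
      hfst.contDiffOn hzi)) hT hR (ContinuousLinearMap.id ℝ _)) (SB.of_contDiffOn hR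
      hsnd.contDiffOn) hR (ContinuousLinearMap.id ℝ _)).congr hR fun a z hz => ?_
    have hy := hzi z hz
    obtain ⟨σ, hσ⟩ := hS a fun j => (𝔟 (c j)).symm (z j)
    have e1 : localSection F E p σ.1 =ᶠ[𝓝 (z i).1] fun y => H a (y, z) := by
      filter_upwards [hO.mem_nhds hy] with y' hy'
      rw [localSection_eq hb' _ hy', ← hσ, covec, map_sum]
      refine Finset.sum_congr rfl fun β _ => ?_
      rw [map_smul, ← hci]
      congr 2
      funext j
      by_cases hj : j = i
      · subst hj; simp
      · simp [Function.update_of_ne hj]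
    have e2 : localRep d c (fun v => L (fun y => f a (Function.update v i y)) (v i)) z =
        pairCoord F b p (z i).1 (localSection F E p (P σ.1) (z i).1) (z i).2 := by
      rw [localRep, hσ, hS']
      beta_reduce
      rw [hci]
      exact pairWith_symm (𝕜 := ℝ) (P σ.1) hy (z i).2
    rw [e2, hAP _ _ hy]
    simp only [fun j => (Filter.EventuallyEq.iteratedFDeriv ℝ e1 j).eq_of_nhds]
    rfl

theorem exists_operator (hb : IsSmoothForm (d := d) F b)
    (hb' : ∀ x, ∀ v : E x, v ≠ 0 → ∃ w, b x v w ≠ 0) (hP : IsDifferentialOperator F E P) :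
    ∃ L : (𝕏 → 𝕜) →ₗ[𝕜] (𝕏 → 𝕜),
      IsSlotOperator.{uK, uM, uF, uE, v} d L ∧ ∀ s : TestSections d F E ⊤,
        L (pairWith 𝕜 F b s.1) = pairWith 𝕜 F b (P s.1) := by
  obtain ⟨A, hA⟩ := exists_real_operator hb hb' P
  let L : (𝕏 → 𝕜) →ₗ[𝕜] (𝕏 → 𝕜) :=
    { toFun := fun u v => (A (fun w => RCLike.re (u w)) v : 𝕜) +
        (A (fun w => RCLike.im (u w)) v : 𝕜) * RCLike.I
      map_add' := fun u u' => funext fun v => by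
        have e1 : (fun w => RCLike.re ((u + u') w)) = (fun w => RCLike.re (u w)) +
          fun w => RCLike.re (u' w) := funext fun w => map_add _ _ _
        have e2 : (fun w => RCLike.im ((u + u') w)) = (fun w => RCLike.im (u w)) +
          fun w => RCLike.im (u' w) := funext fun w => map_add _ _ _
        rw [e1, e2, map_add, map_add]
        simp only [Pi.add_apply, RCLike.ofReal_add]
        ring
      map_smul' := fun c u => funext fun v => by
        have e1 : (fun w => RCLike.re ((c • u) w)) = RCLike.re c • (fun w => RCLike.re (u w)) -
          RCLike.im c • fun w => RCLike.im (u w) := funext fun w => RCLike.mul_re _ _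
        have e2 : (fun w => RCLike.im ((c • u) w)) = RCLike.re c • (fun w => RCLike.im (u w)) +
          RCLike.im c • fun w => RCLike.re (u w) := funext fun w => RCLike.mul_im _ _
        rw [e1, e2, map_add, map_sub, map_smul, map_smul, map_smul, map_smul]
        simp only [Pi.add_apply, Pi.sub_apply, Pi.smul_apply, smul_eq_mul, RCLike.ofReal_add,
          RCLike.ofReal_sub, RCLike.ofReal_mul, RingHom.id_apply]
        nth_rw 5 [← RCLike.re_add_im c]
        rcases RCLike.I_mul_I_ax (K := 𝕜) with h | h
        · simp [h, RCLike.im_eq_zero h c]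
        · linear_combination (-(RCLike.im c : 𝕜) * (A (fun w => RCLike.im (u w)) v : 𝕜)) * h }
  refine ⟨L, fun {α ι} _ _ U f hf i => ?_, fun s => funext fun v => ?_⟩
  · have h1 := ((hf.clm RCLike.reCLM).real_operator hb hb' hP hA i).clm (RCLike.ofRealCLM (K := 𝕜))
    have h2 := ((hf.clm RCLike.imCLM).real_operator hb hb' hP hA i).clm (RCLike.ofRealCLM (K := 𝕜))
    refine (congrArg (IsTTFam d U) ?_).mp (h1.add (h2.const_smul RCLike.I))
    funext a v
    exact congrArg (_ + ·) (mul_comm _ _)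
  · have e1 : (fun w => RCLike.re (pairWith 𝕜 F b s.1 w)) = pairWith ℝ F b s.1 :=
      funext fun w => RCLike.ofReal_re _
    have e2 : (fun w => RCLike.im (pairWith 𝕜 F b s.1 w)) = 0 :=
      funext fun w => RCLike.ofReal_im _
    change (A _ v : 𝕜) + (A _ v : 𝕜) * RCLike.I = _
    rw [e1, e2, map_zero, hA]
    simp [pairWith]

lemma exists_sections (hb : IsSmoothForm (d := d) F b)
    (hb' : ∀ x, ∀ v : E x, v ≠ 0 → ∃ w, b x v w ≠ 0) {u : 𝕏 → 𝕜}
    (hu : u ∈ 𝓛 U) : ∃ s t : TestSections d F E U,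
      u = pairWith 𝕜 F b s.1 + (RCLike.I : 𝕜) • pairWith 𝕜 F b t.1 := by
  have h := IsTTFam.of_mem (α := Unit) hu
  obtain ⟨s, hs⟩ := exists_section (U := U) (u := fun v => RCLike.re (u v)) hb hb'
    ((h.clm RCLike.reCLM).mem ())
  obtain ⟨t, ht⟩ := exists_section (U := U) (u := fun v => RCLike.im (u v)) hb hb'
    ((h.clm RCLike.imCLM).mem ())
  refine ⟨s, t, funext fun v => ?_⟩
  have h1 : RCLike.re (u v) = b v.proj v.2 (s.1 v.proj) := congrFun hs v
  have h2 : RCLike.im (u v) = b v.proj v.2 (t.1 v.proj) := congrFun ht v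
  rw [← RCLike.re_add_im (u v), h1, h2, mul_comm]
  rfl

/-! ## Contraction with the fibre pairing -/

lemma IsTTFam.sumElim {f : α → (ι ⊕ κ → 𝕏) → 𝕜} (hf : IsTTFam d U f)
    (v : ι → 𝕏) [Nonempty κ] : IsTTFam d U fun a w => f a (Sum.elim v w) := by
  obtain ⟨K, hK, hKU, h⟩ := hf.supp
  refine ⟨fun a w j x s t r => ?_, ⟨K, hK, hKU, ?_⟩, fun c => ?_⟩
  · have := hf.linear a (Sum.elim v w) (.inr j) x s t r
    simpa only [Sum.update_elim_inr] using this
  · rintro a w ⟨j, hj⟩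
    exact h a _ ⟨.inr j, hj⟩
  · have h1 : ContDiff ℝ ∞ fun z : κ → 𝔼 × F =>
        Sum.elim (centre d F E v) z := by
      refine contDiff_pi.2 fun j => ?_
      rcases j with j | j
      · exact contDiff_const
      · exact contDiff_apply ℝ _ j
    have := (hf.bdd (Sum.elim v c)).comp_contDiffOn (isOpen_repDomain _) (isOpen_repDomain c)
      h1.contDiffOn (fun z hz j _ => ?_)
    · convert this using 3 with a z
      refine congrArg (f a) (funext fun j => ?_)
      rcases j with j | j
      · exact (extChartAt_to_inv (v j)).symm
      · rfl
    · rcases j with j | j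
      · exact centre_mem v j (mem_univ _)
      · exact hz j (mem_univ _)

lemma sum_dual_eq {V κ : Type*} [AddCommGroup V] [Module ℝ V] [Fintype κ] (B : V → V → ℝ)
    (h : V → V → 𝕜) (h1 : ∀ (c : κ → ℝ) (f : κ → V) w, h (∑ i, c i • f i) w = ∑ i, c i • h (f i) w)
    (h2 : ∀ (c : κ → ℝ) (f : κ → V) w, h w (∑ i, c i • f i) = ∑ i, c i • h w (f i))
    {f f' g g' : κ → V} (hf : ∀ v, v = ∑ i, B v (f' i) • f i)
    (hg : ∀ v, v = ∑ i, B (g i) v • g' i) : ∑ i, h (g i) (g' i) = ∑ i, h (f i) (f' i) := by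
  have e1 : ∀ i, h (g i) (g' i) = ∑ j, B (g i) (f' j) • h (f j) (g' i) := fun i => by
    conv_lhs => rw [hf (g i)]
    exact h1 _ _ _
  have e2 : ∀ j, h (f j) (f' j) = ∑ i, B (g i) (f' j) • h (f j) (g' i) := fun j => by
    conv_lhs => rw [hg (f' j)]
    exact h2 _ _ _
  rw [Finset.sum_congr rfl fun i _ => e1 i, Finset.sum_congr rfl fun i _ => e2 i, Finset.sum_comm]

variable (F b) in
/-- The contraction of a function of two points in a fibre, in the bundle chart at `p`. -/
def contrCoord (p : M) (y : 𝔼) (h : 𝕏 × 𝕏 → 𝕜) :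
    𝕜 :=
  ∑ β, h ((𝔲 p).symm (y, Module.finBasis ℝ F β),
    (𝔲 p).symm (y, raise F b p y (fibreCoord F β)))

variable (d F b) in
/-- The contraction of a function of two points in the fibre at `x`. -/
def contr (x : M) (h : 𝕏 × 𝕏 → 𝕜) : 𝕜 :=
  contrCoord F b x (𝔠 x x) h

lemma exists_frames (hb' : ∀ x, ∀ v : E x, v ≠ 0 → ∃ w, b x v w ≠ 0)
    (hy : y ∈ 𝔇 p) {x : M} (e : (𝔠 p).symm y = x) :
    ∃ f f' : Fin (Module.finrank ℝ F) → E x, (∀ v, v = ∑ i, b x v (f' i) • f i) ∧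
      (∀ v, v = ∑ i, b x (f i) v • f' i) ∧
      ∀ h : 𝕏 × 𝕏 → 𝕜,
        contrCoord F b p y h = ∑ i, h (⟨x, f i⟩, ⟨x, f' i⟩) := by
  subst e
  refine ⟨fun β => frame F E p _ (Module.finBasis ℝ F β),
    fun β => frame F E p _ (raise F b p y (fibreCoord F β)), fun v => ?_, fun v => ?_, fun h => ?_⟩
  · obtain ⟨ξ, rfl⟩ : ∃ ξ, frame F E p _ ξ = v := ⟨_, frame_apply hy.2 v⟩
    conv_lhs => rw [← (Module.finBasis ℝ F).sum_repr ξ, map_sum]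
    refine Finset.sum_congr rfl fun β _ => ?_
    rw [map_smul, ← pairCoord_apply, pairCoord_raise hb' hy]
    rfl
  · obtain ⟨ξ, rfl⟩ : ∃ ξ, frame F E p _ ξ = v := ⟨_, frame_apply hy.2 v⟩
    have h1 : pairCoord F b p y ξ = ∑ β, pairCoord F b p y ξ (Module.finBasis ℝ F β) •
        fibreCoord F β := by
      refine ContinuousLinearMap.ext fun η => ?_
      conv_lhs => rw [← (Module.finBasis ℝ F).sum_repr η, map_sum]
      rw [_root_.sum_apply]
      refine Finset.sum_congr rfl fun β _ => ?_
      rw [map_smul, _root_.smul_apply, smul_eq_mul, smul_eq_mul, mul_comm]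
      rfl
    conv_lhs => rw [← raise_pairCoord hb' hy ξ, h1, map_sum, map_sum]
    refine Finset.sum_congr rfl fun β _ => ?_
    rw [map_smul, map_smul, pairCoord_apply]
  · refine Finset.sum_congr rfl fun β _ => ?_
    rw [bundleChart_symm hy, bundleChart_symm hy]

/-- Functions which are linear along the fibres in both variables. -/
def IsFibreBilinear (h : 𝕏 × 𝕏 → 𝕜) : Prop :=
  (∀ w (x : M) (s t : E x) (c : ℝ), h (⟨x, s + c • t⟩, w) = h (⟨x, s⟩, w) + c • h (⟨x, t⟩, w)) ∧
  ∀ w (x : M) (s t : E x) (c : ℝ), h (w, ⟨x, s + c • t⟩) = h (w, ⟨x, s⟩) + c • h (w, ⟨x, t⟩)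

lemma contr_eq (hb' : ∀ x, ∀ v : E x, v ≠ 0 → ∃ w, b x v w ≠ 0)
    {h : 𝕏 × 𝕏 → 𝕜} (hh : IsFibreBilinear h) (hy : y ∈ 𝔇 p) :
    contr d F b ((𝔠 p).symm y) h = contrCoord F b p y h := by
  obtain ⟨f, f', h1, -, h3⟩ := exists_frames (𝕜 := 𝕜) hb' hy rfl
  obtain ⟨g, g', -, h2', h3'⟩ := exists_frames (𝕜 := 𝕜) hb'
    (mem_localDomain (mem_chartDom (d := d) (F := F) (E := E) ((𝔠 p).symm y)))
    (extChartAt_to_inv _)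
  rw [contr, h3', h3]
  refine sum_dual_eq (fun v w => b _ v w) (fun v w => h (⟨_, v⟩, ⟨_, w⟩)) (fun c f w => ?_)
    (fun c f w => ?_) h1 h2'
  · obtain ⟨l, hl⟩ := exists_linearMap (u := fun v => h (v, ⟨_, w⟩)) (hh.1 _)
      ((𝔠 p).symm y)
    simp only [← hl, map_sum, map_smul]
  · obtain ⟨l, hl⟩ := exists_linearMap (u := fun v => h (⟨_, w⟩, v)) (hh.2 _)
      ((𝔠 p).symm y)
    simp only [← hl, map_sum, map_smul]

lemma contr_pairWith (hb' : ∀ x, ∀ v : E x, v ≠ 0 → ∃ w, b x v w ≠ 0) (s t : ∀ x, E x) (x : M) :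
    contr d F b x (fun q => pairWith 𝕜 F b s q.1 * pairWith 𝕜 F b t q.2) =
      ((b x (s x) (t x) : ℝ) : 𝕜) := by
  obtain ⟨f, f', h1, h2, h3⟩ := exists_frames (𝕜 := 𝕜) hb'
    (mem_localDomain (mem_chartDom (d := d) (F := F) (E := E) x)) (extChartAt_to_inv _)
  rw [contr, h3]
  conv_rhs => rw [h2 (s x), map_sum, _root_.sum_apply, RCLike.ofReal_sum]
  refine Finset.sum_congr rfl fun i _ => ?_
  rw [map_smul, _root_.smul_apply, smul_eq_mul, RCLike.ofReal_mul]
  rfl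

lemma contr_eq_zero {x : M} {h : 𝕏 × 𝕏 → 𝕜}
    (hx : ∀ v w : 𝕏, v.proj = x → w.proj = x → h (v, w) = 0) : contr d F b x h = 0 := by
  have hy := mem_localDomain (mem_chartDom (d := d) (F := F) (E := E) x)
  rw [contr, contrCoord]
  refine Finset.sum_eq_zero fun β _ => hx _ _ ?_ ?_
  · rw [bundleChart_symm hy]; exact extChartAt_to_inv x
  · rw [bundleChart_symm hy]; exact extChartAt_to_inv x

lemma IsTTFam.sb_contrCoord {f : α → (ι ⊕ Fin 2 → 𝕏) → 𝕜} (hf : IsTTFam d U f)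
    (hb : IsSmoothForm (d := d) F b) (hb' : ∀ x, ∀ v : E x, v ≠ 0 → ∃ w, b x v w ≠ 0)
    (c : ι → 𝕏) (p : M) : SB (repDomain d c ×ˢ 𝔇 p)
      fun a (q : (ι → 𝔼 × F) × 𝔼) =>
      _root_.contrCoord F b p q.2 fun w => f a (Sum.elim
        (fun i => (𝔟 (c i)).symm (q.1 i)) ![w.1, w.2]) := by
  have hR := isOpen_repDomain (d := d) c
  have hO := isOpen_localDomain (d := d) (F := F) (E := E) p
  refine SB.sum _ (fun β _ => ?_) (hR.prod hO)
  refine ((hf.bdd (Sum.elim c fun _ => ⟨p, 0⟩)).comp_contDiffOn (isOpen_repDomain _) (hR.prod hO)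
    (h := fun q => Sum.elim q.1 ![(q.2, Module.finBasis ℝ F β),
      (q.2, raise F b p q.2 (fibreCoord F β))]) ?_ ?_).congr (hR.prod hO) fun a q hq => ?_
  · refine contDiffOn_pi.2 fun j => ?_
    rcases j with j | j
    · exact ((contDiff_apply ℝ _ j).comp contDiff_fst).contDiffOn
    · fin_cases j
      · exact (contDiff_snd.prodMk contDiff_const).contDiffOn
      · exact contDiffOn_snd.prodMk (((contDiffOn_raise hb hb' p).comp contDiffOn_snd
          fun q hq => hq.2).clm_apply contDiffOn_const)
  · intro q hq j _
    rcases j with j | j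
    · exact hq.1 j (mem_univ _)
    · have : ∀ ξ : F, (q.2, ξ) ∈ (𝔲 p).target := fun ξ => by
        rw [bundleChart_target]; exact ⟨hq.2, mem_univ _⟩
      fin_cases j
      · exact this _
      · exact this _
  · refine congrArg (f a) (funext fun j => ?_)
    rcases j with j | j
    · rfl
    · fin_cases j <;> rfl

variable [MeasurableSpace M] [BorelSpace M]

/-! ## The volume measure is finite on compact sets -/

namespace LorentzianMetric

variable (g : LorentzianMetric d M)

/-- The density of the volume measure in the chart at `p`. -/
def density (p : M) (y : 𝔼) : ℝ :=
  Real.sqrt |(Matrix.of fun a b =>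
    g.val ((𝔠 p).symm y) (coordVec p y a) (coordVec p y b)).det|

lemma chartVolume_apply (p : M) {A : Set M} (hA : MeasurableSet A) : g.chartVolume p A =
    ∫⁻ y in (𝔠 p).symm ⁻¹' A ∩ (𝔠 p).target,
      ENNReal.ofReal (g.density p y) := by
  have hT : MeasurableSet (𝔠 p).target := (isOpen_extChartAt_target p).measurableSet
  have h1 : AEMeasurable (𝔠 p).symm
      (volume.restrict (𝔠 p).target) :=
    (continuousOn_extChartAt_symm p).aemeasurable hT
  rw [chartVolume, Measure.map_apply_of_aemeasurable
    (h1.mono_ac (withDensity_absolutelyContinuous _ _)) hA, withDensity_apply',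
    Measure.restrict_restrict' hT]
  rfl

lemma continuousOn_density (p : M) : ContinuousOn (g.density p) (𝔠 p).target := by
  have : IsManifold (𝓡 d) (∞ + 1) M := ‹IsManifold (𝓡 d) ∞ M›
  have h0 : localDomain (d := d) 𝔼 (TangentSpace (𝓡 d) : M → Type _) p =
      (𝔠 p).target := by
    refine inter_eq_left.2 fun y hy => ?_
    have := (𝔠 p).map_target hy
    rw [extChartAt_source] at this
    exact this
  have h1 := contDiffOn_pairCoord (E := (TangentSpace (𝓡 d) : M → Type _)) g.smooth p
  rw [h0] at h1
  have h2 : ∀ y ∈ (𝔠 p).target, ∀ a b,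
      g.val ((𝔠 p).symm y) (coordVec p y a) (coordVec p y b) =
      pairCoord 𝔼 g.val p y (EuclideanSpace.single b 1)
        (EuclideanSpace.single a 1) := by
    intro y hy a b
    have h3 : ∀ a, coordVec p y a = frame 𝔼
        (TangentSpace (𝓡 d) : M → Type _) p _ (EuclideanSpace.single a 1) := by
      intro a
      have h4 := (𝔠 p).map_target hy
      rw [extChartAt_source] at h4
      have h5 := TangentBundle.symmL_trivializationAt (I := 𝓡 d) h4
      rw [(𝔠 p).right_inv hy] at h5
      have h6 := DFunLike.congr_fun h5 (EuclideanSpace.single a 1)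
      refine Eq.trans ?_ h6.symm
      simp only [ModelWithCorners.range_eq_univ, mfderivWithin_univ]
      rfl
    rw [pairCoord_apply, h3, h3]
  refine Real.continuous_sqrt.comp_continuousOn (continuous_abs.comp_continuousOn ?_)
  refine (continuous_id.matrix_det).comp_continuousOn (continuousOn_pi.2 fun a =>
    continuousOn_pi.2 fun b => ?_)
  refine ContinuousOn.congr ?_ fun y hy => h2 y hy a b
  exact (h1.continuousOn.clm_apply continuousOn_const).clm_apply continuousOn_const

lemma density_eq {p q : M} {y : 𝔼} (hy : y ∈ (𝔠 q).target)
    (hp : (𝔠 q).symm y ∈ (𝔠 p).source) : g.density q y =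
      |(fderiv ℝ (𝔠 p ∘ (𝔠 q).symm) y).det| *
        g.density p (𝔠 p ((𝔠 q).symm y)) := by
  set Ψ := 𝔠 p ∘ (𝔠 q).symm with hΨ
  have hΨy : MDifferentiableAt (𝓡 d) (𝓡 d) Ψ y := by
    refine MDifferentiableAt.comp y ?_
      ((contMDiffOn_extChartAt_symm (n := ∞) q).contMDiffAt
        ((isOpen_extChartAt_target q).mem_nhds hy) |>.mdifferentiableAt (by simp))
    exact (contMDiffAt_extChartAt' (n := ∞) (by rwa [extChartAt_source] at hp)).mdifferentiableAt
      (by simp)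
  have hq : MDifferentiableAt (𝓡 d) (𝓡 d) (𝔠 p).symm (Ψ y) :=
    (contMDiffOn_extChartAt_symm (I := 𝓡 d) (n := ∞) p).contMDiffAt
      ((isOpen_extChartAt_target (I := 𝓡 d) p).mem_nhds
      ((𝔠 p).map_source hp)) |>.mdifferentiableAt (by simp)
  have hΨp : (𝔠 p).symm (Ψ y) = (𝔠 q).symm y :=
    (𝔠 p).left_inv hp
  have h1 : (𝔠 q).symm =ᶠ[𝓝 y] (𝔠 p).symm ∘ Ψ := by
    have := (continuousOn_extChartAt_symm q).isOpen_inter_preimage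
      (isOpen_extChartAt_target (I := 𝓡 d) q)
      (isOpen_extChartAt_source (I := 𝓡 d) p)
    filter_upwards [this.mem_nhds ⟨hy, hp⟩] with z hz
    exact ((𝔠 p).left_inv hz.2).symm
  let D : 𝔼 →L[ℝ] 𝔼 :=
    mfderiv (𝓡 d) (𝓡 d) (𝔠 p).symm (Ψ y)
  let J : 𝔼 →L[ℝ] 𝔼 := fderiv ℝ Ψ y
  let G : M → 𝔼 →L[ℝ] 𝔼 →L[ℝ] ℝ := g.val
  have h2 : ∀ a, (coordVec q y a : 𝔼) =
      D (J (EuclideanSpace.single a 1)) := by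
    intro a
    have e1 : mfderiv (𝓡 d) (𝓡 d) (𝔠 q).symm y =
        mfderiv (𝓡 d) (𝓡 d) ((𝔠 p).symm ∘ Ψ) y := h1.mfderiv_eq
    have e2 := mfderiv_comp y hq hΨy
    have e3 : mfderiv (𝓡 d) (𝓡 d) Ψ y = fderiv ℝ Ψ y := mfderiv_eq_fderiv
    have e4 := DFunLike.congr_fun (e1.trans e2) (EuclideanSpace.single a 1)
    rw [e3] at e4
    exact e4
  let B : LinearMap.BilinForm ℝ 𝔼 := LinearMap.mk₂ ℝ
    (fun v w => G ((𝔠 q).symm y) (D v) (D w))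
    (fun _ _ _ => by simp only [map_add]; rfl) (fun _ _ _ => by simp only [map_smul]; rfl)
    (fun _ _ _ => by simp only [map_add]) (fun _ _ _ => by simp only [map_smul])
  let e := (EuclideanSpace.basisFun (Fin d) ℝ).toBasis
  have he : ∀ a, e a = EuclideanSpace.single a 1 := fun a => by simp [e]
  have hBq : (Matrix.of fun a b => g.val ((𝔠 q).symm y) (coordVec q y a)
      (coordVec q y b)) = LinearMap.BilinForm.toMatrix e (B.comp J.toLinearMap J.toLinearMap) := by
    ext a b
    rw [LinearMap.BilinForm.toMatrix_apply, he, he]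
    change G _ (coordVec q y a) (coordVec q y b) = G _ (D (J _)) (D (J _))
    rw [h2, h2]
  have hBp : (Matrix.of fun a b => g.val ((𝔠 p).symm (Ψ y)) (coordVec p (Ψ y) a)
      (coordVec p (Ψ y) b)) = LinearMap.BilinForm.toMatrix e B := by
    ext a b
    rw [LinearMap.BilinForm.toMatrix_apply, he, he]
    change G ((𝔠 p).symm (Ψ y)) (D _) (D _) = G _ (D _) (D _)
    rw [hΨp]
  change Real.sqrt |Matrix.det _| = |J.det| * Real.sqrt |Matrix.det (Matrix.of fun a b =>
    g.val ((𝔠 p).symm (Ψ y)) (coordVec p (Ψ y) a) (coordVec p (Ψ y) b))|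
  rw [hBq, hBp, LinearMap.BilinForm.toMatrix_comp e e, Matrix.det_mul, Matrix.det_mul,
    Matrix.det_transpose, LinearMap.det_toMatrix, abs_mul, abs_mul, mul_right_comm,
    Real.sqrt_mul (by positivity), Real.sqrt_mul_self (abs_nonneg _)]

lemma chartVolume_le (p q : M) {A : Set M} (hA : MeasurableSet A)
    (hAq : A ⊆ (𝔠 q).source) : g.chartVolume p A ≤ g.chartVolume q A := by
  set φ := 𝔠 p
  set ψ := 𝔠 q
  set S := ψ.target ∩ ψ.symm ⁻¹' (A ∩ φ.source) with hS
  have hSm : MeasurableSet S := by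
    have h1 : Continuous fun y : ψ.target => ψ.symm y :=
      continuousOn_iff_continuous_domRestrict.1 (continuousOn_extChartAt_symm q)
    have h2 := (isOpen_extChartAt_target (I := 𝓡 d) q).measurableSet.subtype_image
      (h1.measurable (hA.inter (isOpen_extChartAt_source (I := 𝓡 d) p).measurableSet))
    convert h2 using 1
    ext y
    exact ⟨fun h => ⟨⟨y, h.1⟩, h.2, rfl⟩, fun ⟨z, hz, e⟩ => e ▸ ⟨z.2, hz⟩⟩
  have hd : ∀ y ∈ S, HasFDerivWithinAt (φ ∘ ψ.symm) (fderiv ℝ (φ ∘ ψ.symm) y) S y := by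
    intro y hy
    refine (DifferentiableAt.hasFDerivAt ?_).hasFDerivWithinAt
    rw [← mdifferentiableAt_iff_differentiableAt]
    refine MDifferentiableAt.comp y ?_
      ((contMDiffOn_extChartAt_symm (n := ∞) q).contMDiffAt
        ((isOpen_extChartAt_target q).mem_nhds hy.1) |>.mdifferentiableAt (by simp))
    have := hy.2.2
    exact (contMDiffAt_extChartAt' (n := ∞) (by rwa [extChartAt_source] at this)).mdifferentiableAt
      (by simp)
  have hinj : InjOn (φ ∘ ψ.symm) S := fun y hy z hz h =>
    ψ.symm.injOn hy.1 hz.1 (φ.injOn hy.2.2 hz.2.2 h)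
  have himg : φ.symm ⁻¹' A ∩ φ.target = (φ ∘ ψ.symm) '' S := by
    ext z
    constructor
    · rintro ⟨h1, h2⟩
      refine ⟨ψ (φ.symm z), ⟨ψ.map_source (hAq h1), ?_⟩, ?_⟩
      · rw [mem_preimage, ψ.left_inv (hAq h1)]
        exact ⟨h1, φ.map_target h2⟩
      · rw [Function.comp_apply, ψ.left_inv (hAq h1), φ.right_inv h2]
    · rintro ⟨y, hy, rfl⟩
      refine ⟨?_, φ.map_source hy.2.2⟩
      rw [mem_preimage, Function.comp_apply, φ.left_inv hy.2.2]
      exact hy.2.1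
  rw [chartVolume_apply _ _ hA, chartVolume_apply _ _ hA, himg,
    lintegral_image_eq_lintegral_abs_det_fderiv_mul volume hSm hd hinj]
  calc _ = ∫⁻ y in S, ENNReal.ofReal (g.density q y) := by
        refine setLIntegral_congr_fun hSm fun y hy => ?_
        rw [g.density_eq hy.1 hy.2.2, ENNReal.ofReal_mul (abs_nonneg _)]
        rfl
    _ ≤ _ := lintegral_mono_set (show S ⊆ ψ.symm ⁻¹' A ∩ ψ.target from fun y hy => ⟨hy.2.1, hy.1⟩)

instance : IsLocallyFiniteMeasure g.dvol := by
  refine ⟨fun x => ?_⟩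
  have := Manifold.locallyCompact_of_finiteDimensional (M := M) (𝓡 d)
  set ψ := 𝔠 x
  obtain ⟨K, hKx, hKs, hK⟩ := local_compact_nhds (extChartAt_source_mem_nhds (I := 𝓡 d) x)
  refine ⟨K, hKx, ?_⟩
  have hs : MeasurableSet ψ.source := (isOpen_extChartAt_source (I := 𝓡 d) x).measurableSet
  have h1 : g.dvol ≤ (g.chartVolume x).restrict ψ.source + g.dvol.restrict ψ.sourceᶜ := by
    refine iSup_le fun p => Measure.le_iff.2 fun A hA => ?_
    rw [Measure.add_apply, Measure.restrict_apply hA, Measure.restrict_apply hA,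
      ← measure_inter_add_sdiff A hs, sdiff_eq]
    exact add_le_add (g.chartVolume_le p x (hA.inter hs) inter_subset_right)
      (le_iSup g.chartVolume p _)
  have h2 : ψ.symm ⁻¹' K ∩ ψ.target = ψ '' K := by
    rw [inter_comm, ← ψ.image_eq_target_inter_inv_preimage hKs]
  have hK' : IsCompact (ψ '' K) := hK.image_of_continuousOn ((continuousOn_extChartAt x).mono hKs)
  obtain ⟨R, hR⟩ := hK'.exists_bound_of_continuousOn ((g.continuousOn_density x).mono
    (by rw [← h2]; exact inter_subset_right))
  calc g.dvol K ≤ _ := h1 K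
    _ = g.chartVolume x K := by
      rw [Measure.add_apply, Measure.restrict_apply hK.measurableSet,
        Measure.restrict_apply hK.measurableSet, inter_eq_left.2 hKs,
        (disjoint_compl_right_iff_subset.2 hKs).inter_eq, measure_empty, add_zero]
    _ ≤ ∫⁻ _ in ψ '' K, ENNReal.ofReal R := by
      rw [chartVolume_apply _ _ hK.measurableSet, h2]
      exact setLIntegral_mono' hK'.measurableSet fun y hy =>
        ENNReal.ofReal_le_ofReal ((le_abs_self _).trans (hR y hy))
    _ < ⊤ := by
      rw [setLIntegral_const]
      exact ENNReal.mul_lt_top ENNReal.ofReal_lt_top hK'.measure_lt_top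

end LorentzianMetric

/-! ## The contraction functional -/

variable {μ : Measure M} [IsFiniteMeasureOnCompacts μ]

lemma IsTTFam.isFibreBilinear {f : α → (ι ⊕ Fin 2 → 𝕏) → 𝕜} (hf : IsTTFam d U f)
    (a : α) (v : ι → 𝕏) : IsFibreBilinear fun w => f a (Sum.elim v ![w.1, w.2]) := by
  have h := (hf.sumElim v).linear a
  refine ⟨fun w x s t c => ?_, fun w x s t c => ?_⟩
  · have e : ∀ r : E x, Function.update ![w, w] 0 (⟨x, r⟩ : 𝕏) = ![⟨x, r⟩, w] :=
      fun r => funext fun j => by fin_cases j <;> rfl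
    have := h ![w, w] 0 x s t c
    rw [e, e, e] at this
    exact this
  · have e : ∀ r : E x, Function.update ![w, w] 1 (⟨x, r⟩ : 𝕏) = ![w, ⟨x, r⟩] :=
      fun r => funext fun j => by fin_cases j <;> rfl
    have := h ![w, w] 1 x s t c
    rw [e, e, e] at this
    exact this

lemma IsTTFam.integral_contr (hb : IsSmoothForm (d := d) F b)
    (hb' : ∀ x, ∀ v : E x, v ≠ 0 → ∃ w, b x v w ≠ 0)
    {f : α → (ι ⊕ Fin 2 → 𝕏) → 𝕜} (hf : IsTTFam d U f) :
    (∀ a v, Continuous fun x => contr d F b x fun w => f a (Sum.elim v ![w.1, w.2])) ∧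
    ∀ c, SB (repDomain d c) fun a => localRep d c fun v =>
      ∫ x, contr d F b x (fun w => f a (Sum.elim v ![w.1, w.2])) ∂μ := by
  have key : ∀ (c : ι → 𝕏) (p x : M), x ∈ chartDom d F E p →
      ∀ a (z : ι → 𝔼 × F), contr d F b x (fun w => f a (Sum.elim
        (fun i => (𝔟 (c i)).symm (z i)) ![w.1, w.2])) =
      contrCoord F b p (𝔠 p x) fun w => f a (Sum.elim
        (fun i => (𝔟 (c i)).symm (z i)) ![w.1, w.2]) := by
    intro c p x hx a z
    rw [← contr_eq hb' (hf.isFibreBilinear a _) (mem_localDomain hx),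
      (𝔠 p).left_inv (by rw [extChartAt_source]; exact hx.1)]
  have hφ : ∀ p : M, ContinuousOn (𝔠 p) (chartDom d F E p) := fun p =>
    (continuousOn_extChartAt p).mono (by rw [extChartAt_source]; exact inter_subset_left)
  refine ⟨fun a v => continuous_iff_continuousAt.2 fun p => ?_, fun c => ?_⟩
  · have h1 := ((hf.sb_contrCoord hb hb' v p).smooth a).continuousOn
    have h2 : ContinuousOn (fun x => contrCoord F b p (𝔠 p x) fun w => f a (Sum.elim
        (fun i => (𝔟 (v i)).symm (centre d F E v i)) ![w.1, w.2]))
        (chartDom d F E p) :=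
      h1.comp (f := fun x => (centre d F E v, 𝔠 p x))
        (continuousOn_const.prodMk (hφ p)) fun x hx => ⟨centre_mem v, mem_localDomain hx⟩
    refine ((h2.congr fun x hx => ?_).continuousAt ((isOpen_chartDom p).mem_nhds (mem_chartDom p)))
    rw [← key v p x hx a]
    refine congrArg (contr d F b x) (funext fun w => congrArg (f a) (funext fun j => ?_))
    rcases j with j | j
    · exact (extChartAt_to_inv (v j)).symm
    · rfl
  · obtain ⟨K, hK, hKU, hfK⟩ := hf.supp
    have hR := isOpen_repDomain (d := d) c
    set g : α → (ι → 𝔼 × F) → M → 𝕜 := fun a z x =>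
      contr d F b x (fun w => f a (Sum.elim
        (fun i => (𝔟 (c i)).symm (z i)) ![w.1, w.2])) with hg
    have hD : ∀ a p, ∀ x ∈ chartDom d F E p, ∀ z ∈ repDomain d c, ∀ j,
        iteratedFDeriv ℝ j (g a · x) z = (iteratedFDeriv ℝ j (fun q : (ι → 𝔼
          × F) × 𝔼 => contrCoord F b p q.2 fun w => f a (Sum.elim
          (fun i => (𝔟 (c i)).symm (q.1 i)) ![w.1, w.2]))
          (z, 𝔠 p x)).compContinuousLinearMap
            fun _ => ContinuousLinearMap.inl ℝ _ _ := by
      intro a p x hx z hz j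
      rw [← iteratedFDeriv_prod_left (hR.prod (isOpen_localDomain p))
        ((hf.sb_contrCoord hb hb' c p).smooth a) ⟨hz, mem_localDomain hx⟩]
      exact congrArg (fun G => iteratedFDeriv ℝ j G z) (funext fun z => key c p x hx a z)
    have hS := fun p j =>
      ((hf.sb_contrCoord hb hb' c p).iteratedFDeriv (hR.prod (isOpen_localDomain p)) j).clm
        (hR.prod (isOpen_localDomain p)) (ContinuousMultilinearMap.compContinuousLinearMapL
          (fun _ : Fin j => ContinuousLinearMap.inl ℝ (ι → 𝔼 × F)
              𝔼) : _ →L[ℝ]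
            (ContinuousMultilinearMap ℝ (fun _ : Fin j => ι → 𝔼 × F) 𝕜))
    have := SB.integral (μ := μ) (f := g) hK hR (fun a x _ => ?_) (fun a j => ?_) fun C hC hC' j => ?_
    · refine this.congr hR fun a z _ => ?_
      refine (setIntegral_eq_integral_of_forall_compl_eq_zero fun x hx => ?_).symm
      exact contr_eq_zero fun v w hv _ => hfK a _ ⟨.inr 0, by simpa [hv] using hx⟩
    · have h1 := ((hf.sb_contrCoord hb hb' c x).smooth a).comp
        (f := fun z => (z, 𝔠 x x)) (contDiff_id.prodMk contDiff_const).contDiffOn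
        fun z hz => ⟨hz, mem_localDomain (mem_chartDom x)⟩
      exact h1.congr fun z hz => key c x x (mem_chartDom x) a z
    · intro q hq
      refine ContinuousAt.continuousWithinAt ?_
      have h1 : ContinuousOn _ (repDomain d c ×ˢ 𝔇 q.2) := ((hS q.2 j).smooth a).continuousOn
      have h2 := h1.comp (f := fun r : _ × M => (r.1, 𝔠 q.2 r.2))
        (s := repDomain d c ×ˢ chartDom d F E q.2) (continuousOn_fst.prodMk
          ((hφ q.2).comp continuousOn_snd fun r hr => hr.2)) fun r hr => ⟨hr.1, mem_localDomain hr.2⟩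
      refine (h2.congr fun r hr => ?_).continuousAt ((hR.prod (isOpen_chartDom q.2)).mem_nhds
        ⟨hq.1, mem_chartDom _⟩)
      exact hD a q.2 r.2 hr.2 r.1 hr.1 j
    · refine hK.induction_on (p := fun Q => ∃ R : ℝ, ∀ a, ∀ z ∈ C, ∀ y ∈ Q,
        ‖iteratedFDeriv ℝ j (g a · y) z‖ ≤ R) ⟨0, by simp⟩ ?_ ?_ fun x hx => ?_
      · rintro Q Q' hQ ⟨R, hR⟩
        exact ⟨R, fun a z hz y hy => hR a z hz y (hQ hy)⟩
      · rintro Q Q' ⟨R, hR⟩ ⟨R', hR'⟩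
        refine ⟨max R R', fun a z hz y hy => ?_⟩
        rcases hy with hy | hy
        · exact (hR a z hz y hy).trans (le_max_left _ _)
        · exact (hR' a z hz y hy).trans (le_max_right _ _)
      · obtain ⟨B, hB, hBO, hBc⟩ := exists_compact_nhds_subset
          (isOpen_localDomain (d := d) (F := F) (E := E) x)
          (mem_localDomain (mem_chartDom x))
        obtain ⟨R, hR⟩ := (hS x j).bdd (C ×ˢ B) (prod_mono hC hBO) (hC'.prod hBc) 0
        refine ⟨chartDom d F E x ∩ 𝔠 x ⁻¹' B, mem_nhdsWithin_of_mem_nhds ?_,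
          R, fun a z hz y hy => ?_⟩
        · exact Filter.inter_mem ((isOpen_chartDom x).mem_nhds (mem_chartDom x))
            ((continuousAt_extChartAt x).preimage_mem_nhds hB)
        · have := hR a (z, 𝔠 x y) ⟨hz, hy.2⟩
          rw [norm_iteratedFDeriv_zero] at this
          rw [hD a x y hy.1 z (hC hz) j]
          exact this

theorem exists_contraction (hb : IsSmoothForm (d := d) F b)
    (hb' : ∀ x, ∀ v : E x, v ≠ 0 → ∃ w, b x v w ≠ 0) (μ : Measure M) [IsFiniteMeasureOnCompacts μ] :
    ∃ I : (𝕏 × 𝕏 → 𝕜) →ₗ[𝕜] 𝕜,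
      IsContraction.{uK, uM, uF, uE, v} d I ∧
      (∀ s t : TestSections d F E ⊤, I (fun q => pairWith 𝕜 F b s.1 q.1 * pairWith 𝕜 F b t.1 q.2) =
        ((∫ x, b x (s.1 x) (t.1 x) ∂μ : ℝ) : 𝕜)) ∧
      ∀ {U V : Opens M}, Disjoint U V → ∀ u ∈ 𝓛 U, ∀ w ∈ 𝓛 V,
        I (fun q => u q.1 * w q.2) = 0 := by
  let S : Submodule 𝕜 (𝕏 × 𝕏 → 𝕜) := (𝒯 (Fin 2) ⊤).comap
    (LinearMap.funLeft 𝕜 𝕜 fun w : Fin 2 → 𝕏 => (w 0, w 1))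
  have hint : ∀ h ∈ S, Integrable (fun x => contr d F b x h) μ := by
    intro h hh
    have h1 := (IsTTFam.of_mem (α := Unit) hh).comp (Equiv.emptySum Empty (Fin 2)).symm
    have h2 := (h1.integral_contr (μ := μ) hb hb').1 () Empty.elim
    obtain ⟨K, hK, -, h3⟩ := hh.2.2
    refine Continuous.integrable_of_hasCompactSupport h2 (HasCompactSupport.intro hK fun x hx => ?_)
    exact contr_eq_zero fun v w hv _ => h3 ![v, w] ⟨0, by simpa [hv] using hx⟩
  let I₀ : S →ₗ[𝕜] 𝕜 :=
    { toFun := fun h => ∫ x, contr d F b x h.1 ∂μ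
      map_add' := fun h h' => by
        rw [← integral_add (hint _ h.2) (hint _ h'.2)]
        refine integral_congr_ae (.of_forall fun x => ?_)
        change contr d F b x (h.1 + h'.1) = _
        simp only [contr, contrCoord, Pi.add_apply, smul_add, Finset.sum_add_distrib]
      map_smul' := fun c h => by
        rw [RingHom.id_apply, ← integral_smul]
        refine integral_congr_ae (.of_forall fun x => ?_)
        change contr d F b x (c • h.1) = c • contr d F b x h.1
        simp only [contr, contrCoord, Pi.smul_apply, Finset.smul_sum, smul_comm c] }
  obtain ⟨I, hI⟩ := I₀.exists_extend
  have hI' : ∀ h ∈ S, I h = ∫ x, contr d F b x h ∂μ := fun h hh =>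
    LinearMap.congr_fun hI ⟨h, hh⟩
  have hprod : ∀ u ∈ 𝓛 ⊤, ∀ w ∈ 𝓛 ⊤, (fun q => u q.1 * w q.2) ∈ S := by
    intro u hu w hw
    have h1 := ((IsTTFam.of_mem (α := Unit) hu).mul (IsTTFam.of_mem (α := Unit) hw)).comp
      (Equiv.ofBijective (Sum.elim (fun _ => 0) fun _ => 1 : Unit ⊕ Unit → Fin 2) (by decide))
    exact h1.mem ()
  refine ⟨I, fun {α ι} _ _ U f hf => ?_, fun s t => ?_, fun {U V} hUV u hu w hw => ?_⟩
  · have hS : ∀ a v, (fun w => f a (Sum.elim v ![w.1, w.2])) ∈ S := fun a v => by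
      refine (congrArg (· ∈ 𝒯 (Fin 2) ⊤) (funext fun w => ?_)).mp
        (((hf.sumElim v).mono le_top).mem a)
      refine congrArg (fun w => f a (Sum.elim v w)) (funext fun j => ?_)
      fin_cases j <;> rfl
    obtain ⟨K, hK, hKU, hfK⟩ := hf.supp
    refine ⟨fun a v i x s t c => ?_, ⟨K, hK, hKU, fun a v ⟨i, hi⟩ => ?_⟩, fun c => ?_⟩
    · rw [← LinearMap.map_smul_of_tower I c, ← map_add]
      refine congrArg I (funext fun w => ?_)
      have := hf.linear a (Sum.elim v ![w.1, w.2]) (.inl i) x s t c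
      simpa only [Sum.update_elim_inl, Pi.add_apply, Pi.smul_apply] using this
    · refine (congrArg I (funext fun w => ?_)).trans (map_zero I)
      exact hfK a _ ⟨.inl i, hi⟩
    · refine ((hf.integral_contr (μ := μ) hb hb').2 c).congr (isOpen_repDomain c) fun a z _ => ?_
      exact hI' _ (hS a _)
  · rw [hI' _ (hprod _ (pairWith_mem hb s) _ (pairWith_mem hb t)), ← integral_ofReal]
    exact integral_congr_ae (.of_forall fun x => contr_pairWith hb' _ _ x)
  · rw [hI' _ (hprod u (LinFuns.mono le_top hu) w (LinFuns.mono le_top hw))]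
    obtain ⟨-, -, K, -, hKU, hK⟩ := LinFuns.mem_iff.1 hu
    obtain ⟨-, -, K', -, hKV, hK'⟩ := LinFuns.mem_iff.1 hw
    refine (integral_congr_ae (.of_forall fun x => ?_)).trans (integral_zero M 𝕜)
    refine contr_eq_zero fun v v' hv hv' => ?_
    by_cases hx : x ∈ K
    · have : x ∉ K' := fun h => (Set.disjoint_left.1 (Opens.coe_disjoint.2 hUV)) (hKU hx) (hKV h)
      change u v * w v' = 0
      rw [hK' v' (hv' ▸ this), mul_zero]
    · change u v * w v' = 0
      rw [hK v (hv ▸ hx), zero_mul]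

variable (𝕜) in
theorem exists_fieldTheory (hb : IsSmoothForm (d := d) F b)
    (hb' : ∀ x, ∀ v : E x, v ≠ 0 → ∃ w, b x v w ≠ 0) (hP : IsDifferentialOperator F E P)
    (μ : Measure M) [IsFiniteMeasureOnCompacts μ]
    (hvar : ∀ s t : TestSections d F E ⊤,
      ∫ x, b x (s.1 x) (P t.1 x) ∂μ = ∫ x, b x (t.1 x) (P s.1 x) ∂μ) :
    ∃ (L : (𝕏 → 𝕜) →ₗ[𝕜] (𝕏 → 𝕜))
      (I : (𝕏 × 𝕏 → 𝕜) →ₗ[𝕜] 𝕜), IsFieldTheory d L I ∧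
      (∀ s : TestSections d F E ⊤, L (pairWith 𝕜 F b s.1) = pairWith 𝕜 F b (P s.1)) ∧
      ∀ s t : TestSections d F E ⊤, I (fun q => pairWith 𝕜 F b s.1 q.1 * pairWith 𝕜 F b t.1 q.2) =
        ((∫ x, b x (s.1 x) (t.1 x) ∂μ : ℝ) : 𝕜) := by
  obtain ⟨L, hL, hLP⟩ := exists_operator (𝕜 := 𝕜) hb hb' hP
  obtain ⟨I, hI, hIb, hI0⟩ := exists_contraction (𝕜 := 𝕜) hb hb' μ
  refine ⟨L, I, ⟨hL, hI, fun u hu w hw => ?_, hI0⟩, hLP, hIb⟩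
  let B : (𝕏 → 𝕜) →ₗ[𝕜] (𝕏 → 𝕜) →ₗ[𝕜] 𝕜 := LinearMap.mk₂ 𝕜
    (fun u w => I fun q => u q.1 * w q.2)
    (fun u u' w => by rw [← map_add]; exact congrArg I (funext fun q => add_mul _ _ _))
    (fun c u w => by rw [← map_smul]; exact congrArg I (funext fun q => mul_assoc _ _ _))
    (fun u w w' => by rw [← map_add]; exact congrArg I (funext fun q => mul_add _ _ _))
    (fun c u w => by rw [← map_smul]; exact congrArg I (funext fun q => mul_left_comm _ _ _))
  have h1 : ∀ s t : TestSections d F E ⊤, B (pairWith 𝕜 F b s.1) (pairWith 𝕜 F b (P t.1)) =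
      B (pairWith 𝕜 F b t.1) (pairWith 𝕜 F b (P s.1)) := fun s t =>
    (hIb s (onTestSections P hP t)).trans ((congrArg _ (hvar s t)).trans
      (hIb t (onTestSections P hP s)).symm)
  obtain ⟨s, s', rfl⟩ := exists_sections hb hb' hu
  obtain ⟨t, t', rfl⟩ := exists_sections hb hb' hw
  change B _ (L _) = B _ (L _)
  simp only [map_add, map_smul, LinearMap.add_apply, LinearMap.smul_apply, hLP, h1 s t, h1 s t',
    h1 s' t, h1 s' t', smul_add]
  abel

variable (hb : IsSmoothForm (d := d) F b)
  (hb' : ∀ x, ∀ v : E x, v ≠ 0 → ∃ w, b x v w ≠ 0)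
  {P : Cₛ^∞⟮𝓡 d; F, E⟯ →ₗ[ℝ] Cₛ^∞⟮𝓡 d; F, E⟯}

include hb'

lemma Tot.exists_sections {u : 𝕏 → 𝕜} (hu : u ∈ 𝓛 U) :
    ∃ s t : TestSections d F E U,
      gen₀ hu = gen₀ (pairWith_mem hb s) + (RCLike.I : 𝕜) • gen₀ (pairWith_mem hb t) ∧
      gen₁ hu = gen₁ (pairWith_mem hb s) + (RCLike.I : 𝕜) • gen₁ (pairWith_mem hb t) := by
  obtain ⟨s, t, rfl⟩ := _root_.exists_sections hb hb' hu
  refine ⟨s, t, ?_, ?_⟩ <;>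
  · simp only [gen₀, gen₁]
    rw [← map_smul, ← map_add]
    rfl

lemma Tot.mem_span_gen {u : 𝕏 → 𝕜} (hu : u ∈ 𝓛 U) :
    gen₀ hu ∈ Submodule.span 𝕜 (range (fun s => gen₀ (𝕜 := 𝕜) (pairWith_mem hb s)) ∪
      range fun s => gen₁ (pairWith_mem hb s)) ∧
    gen₁ hu ∈ Submodule.span 𝕜 (range (fun s => gen₀ (𝕜 := 𝕜) (pairWith_mem hb s)) ∪
      range fun s => gen₁ (pairWith_mem hb s)) := by
  obtain ⟨s, t, h₀, h₁⟩ := Tot.exists_sections hb hb' hu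
  rw [h₀, h₁]
  exact ⟨add_mem (Submodule.subset_span (.inl ⟨s, rfl⟩)) (Submodule.smul_mem _ _
    (Submodule.subset_span (.inl ⟨t, rfl⟩))), add_mem (Submodule.subset_span (.inr ⟨s, rfl⟩))
    (Submodule.smul_mem _ _ (Submodule.subset_span (.inr ⟨t, rfl⟩)))⟩

lemma isFreeModel {g : LorentzianMetric d M}
    (H : IsFieldTheory d L I) (hP : IsDifferentialOperator F E P)
    (hL : ∀ s : TestSections d F E ⊤, L (pairWith 𝕜 F b s.1) = pairWith 𝕜 F b (P s.1))
    (hI : ∀ s t : TestSections d F E ⊤,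
      I (fun q => pairWith 𝕜 F b s.1 q.1 * pairWith 𝕜 F b t.1 q.2) =
        ((∫ x, b x (s.1 x) (t.1 x) ∂g.dvol : ℝ) : 𝕜)) :
    IsFreeModel g b P (Tot.classical H).toBD
      (fun U k => LCSum.degEquiv (𝕜 := 𝕜) (V := 𝒱ₛ U) k)
      (fun U s => Tot.gen₀ (pairWith_mem hb s)) fun U s => Tot.gen₁ (pairWith_mem hb s) := by
  have top : ∀ {U : Opens M} (s : TestSections d F E U), s.1 ∈ TestSections d F E ⊤ := fun s => by
    obtain ⟨K, hK, -, h⟩ := s.2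
    exact ⟨K, hK, subset_univ _, h⟩
  refine ⟨fun U s => ⟨⟨_, _⟩, rfl, rfl⟩, fun U s => ⟨⟨_, _⟩, rfl, rfl⟩, fun U s =>
    ⟨onTestSections _ hP s, rfl, Tot.der_gen₁ H _ _ (hL ⟨s.1, top s⟩)⟩, fun U s t => ?_,
    fun U s t => Tot.br_gen₁ H _ _, fun U A hA h1 hmul h₀ h₁ => Tot.eq_top hA h1 hmul
      (fun u hu => ?_) fun u hu => ?_⟩
  · refine (Tot.br_gen H _ _).trans (congrArg (· • Tot.one U) ?_)
    rw [hI ⟨s.1, top s⟩ ⟨t.1, top t⟩, setIntegral_eq_integral_of_forall_compl_eq_zero fun x hx => ?_]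
    obtain ⟨K, -, hKU, h⟩ := s.2
    rw [h x fun hxK => hx (hKU hxK), map_zero]
    rfl
  · obtain ⟨s, t, h, -⟩ := Tot.exists_sections hb hb' hu
    rw [h]
    exact add_mem (h₀ s) (A.smul_mem _ (h₀ t))
  · obtain ⟨s, t, -, h⟩ := Tot.exists_sections hb hb' hu
    rw [h]
    exact add_mem (h₁ s) (A.smul_mem _ (h₁ t))

end Manifold

end

theorem mainTheorem6 {𝕜 : Type uK} [RCLike 𝕜] {d : ℕ} {M : Type uM}
    [TopologicalSpace M] [T2Space M] [SecondCountableTopology M]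
    [ChartedSpace (EuclideanSpace ℝ (Fin d)) M] [IsManifold (𝓡 d) ∞ M]
    [MeasurableSpace M] [BorelSpace M]
    (g : LorentzianMetric d M) (_horient : IsOrientableManifold d M)
    (T : SmoothVectorField d M) (_hT : g.IsTimeOrientation T) (_hhyp : g.IsGloballyHyperbolic)
    {F : Type uF} [NormedAddCommGroup F] [NormedSpace ℝ F] [FiniteDimensional ℝ F]
    {E : M → Type uE} [TopologicalSpace (TotalSpace F E)] [∀ x, TopologicalSpace (E x)]
    [∀ x, AddCommGroup (E x)] [∀ x, Module ℝ (E x)] [∀ x, IsTopologicalAddGroup (E x)]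
    [∀ x, ContinuousSMul ℝ (E x)] [FiberBundle F E] [VectorBundle ℝ F E]
    [ContMDiffVectorBundle ∞ F E (𝓡 d)]
    (b : ∀ x, E x →L[ℝ] E x →L[ℝ] ℝ) (_hb : IsSmoothForm (d := d) F b)
    (_hb' : ∀ x, ∀ v : E x, v ≠ 0 → ∃ w, b x v w ≠ 0)
    (P : Cₛ^∞⟮𝓡 d; F, E⟯ →ₗ[ℝ] Cₛ^∞⟮𝓡 d; F, E⟯) (_hP : IsGreenHyperbolic g T P)
    (_hvar : ∀ s t : TestSections d F E ⊤,
      ∫ x, b x (s.1 x) (P t.1 x) ∂g.dvol = ∫ x, b x (t.1 x) (P s.1 x) ∂g.dvol) :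
    ∃ (Obs : ClassicalModel.{uM, max uK uM uE} 𝕜 M)
      (e : ∀ (U : Opens M) (k : ℕ), PV d 𝕜 F E k U ≃L[𝕜] (Obs.obj U).deg (-(k : ℤ)))
      (γ₀ γ₁ : ∀ U : Opens M, TestSections d F E U → Obs.obj U),
      IsPolyvectorAlgebra Obs e ∧ IsFreeModel g b P Obs e γ₀ γ₁ ∧
      ∃ Δ : ∀ U : Opens M, Obs.obj U →ₗ[𝕜] Obs.obj U,
        (∀ U, IsBVLaplacian Obs U (Set.range (γ₀ U) ∪ Set.range (γ₁ U)) (Δ U) ∧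
          ∀ Δ', IsBVLaplacian Obs U (Set.range (γ₀ U) ∪ Set.range (γ₁ U)) Δ' → Δ' = Δ U) ∧
        ∃ 𝒜 : QuantumModel.{uM, max uK uM uE} 𝕜 M, IsBDQuantization Obs 𝒜 Δ := by
  obtain ⟨L, I, H, hL, hI⟩ := exists_fieldTheory 𝕜 _hb _hb' _hP.1 g.dvol _hvar
  exact ⟨(Tot.classical H).toBD, fun U k => LCSum.degEquiv (V := fun k => PV d 𝕜 F E k U) k,
    fun U s => Tot.gen₀ (pairWith_mem _hb s), fun U s => Tot.gen₁ (pairWith_mem _hb s),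
    H.isPolyvectorAlgebra, isFreeModel _hb _hb' H _hP.1 hL hI, fun U => Tot.lap H U, fun U =>
      ⟨H.isBVLaplacian U (by
        rintro _ (⟨s, rfl⟩ | ⟨s, rfl⟩)
        exacts [⟨_, _, .inl rfl⟩, ⟨_, _, .inr rfl⟩]), fun Δ' h' => H.isBVLaplacian_unique U
        (fun u hu => Tot.mem_span_gen _hb _hb' hu) (H.isBVLaplacian U (by
        rintro _ (⟨s, rfl⟩ | ⟨s, rfl⟩)
        exacts [⟨_, _, .inl rfl⟩, ⟨_, _, .inr rfl⟩])) h'⟩, (QTot.quantum H).toBD, H.isBDQuantization⟩
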